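/- **Setting.** Let $\mathcal M=(X,\mathcal O)$ be a compact (Hausdorff) smooth supermanifold of dimension $m|n$, i.e. $\mathcal O$ is a sheaf of supercommutative real superalgebras on the compact Hausdorff space $X$ and $(X,\mathcal O)$ is locally isomorphic to $(V,C^\infty_V\otimes\Lambda[\theta_1,\dots,\theta_n])$ with $V\subset\mathbb R^m$ open. Let $\mathcal{TM}$ be the sheaf of superderivations of $\mathcal O$ and let $E=E_{\bar 0}\oplus E_{\bar 1}$ be the superalgebra of global sections of $\mathcal End(\mathcal{TM})$ (sheaf endomorphisms $A$ with $A(fD)=(-1)^{|A||f|}fA(D)$), with the $C^\infty$ topology (uniform convergence of all derivatives of all components on compact subsets of charts). Let $\mathsf{Gr}$ be the category of the real Grassmann algebras $\Lambda=\Lambda_k$, $k\ge 0$, and parity-preserving algebra homomorphisms; $\epsilon_\Lambda:\Lambda\to\mathbb R$ kills the odd generators. For a super vector space $V$ put $\overline V(\Lambda)=(\Lambda\otimes_{\mathbb R}V)_{\bar 0}$, $\overline V(\varphi)=\varphi\otimes\mathrm{id}$. The even sections over $\mathcal P(\Lambda)\times\mathcal M$ of the pullback of $\mathcal End(\mathcal{TM})$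 are $\hat\Gamma(\Lambda):=\hat\Gamma(\mathcal End(\mathcal{TM}))(\Lambda)=(\Lambda\otimes E)_{\bar 0}$, with product $(\lambda\otimes A)(\mu\otimes B)=(-1)^{|A||\mu|}\lambda\mu\otimes AB$, the topology of $\Lambda\otimes E\cong E^{\dim\Lambda}$ and $\hat\Gamma(\varphi)=\varphi\otimes\mathrm{id}$. Put $$\mathcal A(\mathcal M)(\Lambda)=\{J\in\hat\Gamma(\Lambda)\mid J^2=-1\}$$ with the subspace topology. For $J\in\mathcal A(\mathcal M)(\Lambda)$ let $T_J=\{H\in\hat\Gamma(\Lambda)\mid HJ+JH=0\}$, a complex vector space with $iH:=JH$, and on $U_J=\{H\in T_J\mid 1+H\text{ invertible}\}$ let $\psi_J(H)=(1+H)J(1+H)^{-1}$. For $J_0\in\mathcal A(\mathcal M)(\mathbb R)$, regarded also as a point of $\mathcal A(\mathcal M)(\Lambda)$ through $\mathbb R\subset\Lambda$, let $\hat T_{J_0}$ be the functor $\Lambda\mapsto T_{J_0}\subset\hat\Gamma(\Lambda)$, $\varphi\mapsto\hat\Gamma(\varphi)|$, with its $\mathbb C$- and $\Lambda_{\bar 0}$-module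 structures. A $\overline{\mathbb C}$-module in $\mathsf{Top}^{\mathsf{Gr}}$ is a functor whose $\Lambda$-points carry, naturally in $\Lambda$, commuting actions of $\mathbb C$ and $\Lambda_{\bar 0}$ that agree on $\mathbb R$; it is superrepresentable if it is isomorphic to $\overline V$ for a complex topological super vector space $V$, and Fréchet if moreover all its point sets are Fréchet spaces (on which the module actions are continuous). Smooth and holomorphic maps between open subsets of Fréchet spaces are those of class $C^\infty$ in the sense of iterated continuous directional derivatives over $\mathbb R$ and $\mathbb C$. A functor $\mathcal F:\mathsf{Gr}\to\mathsf{Top}$ is a complex Fréchet supermanifold if it has a complex superatlas: a family of natural maps $u_\alpha:\mathcal U_\alpha\to\mathcal F$ from open subfunctors $\mathcal U_\alpha$ of Fréchet $\overline{\mathbb C}$-modules such that, for each $\Lambda$, the $u_{\alpha,\Lambda}$ are open embeddings and cover $\mathcal F(\Lambda)$, and all transition maps are holomorphic for each $\Lambda$, with $\Lambda_{\bar 0}$-linear derivatives. **Theorem.** 1. $\mathcal A(\mathcal M)$ is a subfunctor of $\hat\Gamma(\mathcal End(\mathcal{TM}))$. 2. For each $\Lambda$, $\hat\Gamma(\Lambda)$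 is a Fréchet space and $\mathcal A(\mathcal M)(\Lambda)$ is a split submanifold of it. More precisely, for each $J_0\in\mathcal A(\mathcal M)(\Lambda)$ the subspace $T_{J_0}$ is topologically complemented and there is a diffeomorphism between open subsets $V\to W$ of $\hat\Gamma(\Lambda)$ that maps $V\cap\mathcal A(\mathcal M)(\Lambda)$ onto $W\cap T_{J_0}=U_{J_0}$ and whose inverse restricts to $\psi_{J_0}$ on $U_{J_0}$. 3. For each $\Lambda$, the maps $\psi_{J_0}$ on $U_{J_0}$, $J_0\in\mathcal A(\mathcal M)(\Lambda)$, form a holomorphic atlas of $\mathcal A(\mathcal M)(\Lambda)$, modelled on the complex Fréchet spaces $T_{J_0}$, with $\psi_{J_0}(0)=J_0$. For $H\in U_{J_0}$, the derivative $D\psi_{J_0}(H)$ is a $\mathbb C$-linear topological isomorphism $T_{J_0}\to T_{\psi_{J_0}(H)}$, i.e. $\psi_{J_0}$ pulls the almost complex structure $K\mapsto JK$ back to the constant one. 4. For each $J_0\in\mathcal A(\mathcal M)(\mathbb R)$, $\hat T_{J_0}$ is a superrepresentable (Fréchet) $\overline{\mathbb C}$-module; the domains and the images of the charts $\psi_{J_0}$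 on the $\Lambda$-points are the preimages under $\epsilon_\Lambda$ of the domain and the image of the chart on the $\mathbb R$-points; and the charts are natural: $\mathcal A(\mathcal M)(\varphi)(\psi_{J_0}(H))=\psi_{J_0}(\hat T_{J_0}(\varphi)(H))$ for all $\varphi:\Lambda\to\Lambda'$. 5. The charts $\psi_{J_0}$ from open subfunctors of $\hat T_{J_0}$ to $\mathcal A(\mathcal M)$, $J_0\in\mathcal A(\mathcal M)(\mathbb R)$, form a complex superatlas of $\mathcal A(\mathcal M)$. Hence $\mathcal A(\mathcal M)$ is a complex Fréchet supermanifold. -/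

import Mathlib

open CategoryTheory TopologicalSpace Topology Set Filter
open scoped TensorProduct Manifold ContDiff

universe u

set_option maxSynthPendingDepth 3

noncomputable section
namespace SuperACS

/-- The real Grassmann algebra `Λ_n` on `n` odd generators. -/
abbrev Grass (n : ℕ) : Type := ExteriorAlgebra ℝ (Fin n → ℝ)

/-- The even (`i = 0`) and odd (`i = 1`) part of `Λ_n`. -/
abbrev Grass.part (n : ℕ) : ZMod 2 → Submodule ℝ (Grass n) :=
  CliffordAlgebra.evenOdd (0 : QuadraticForm ℝ (Fin n → ℝ))

/-- The even subalgebra `(Λ_n)_0`. -/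
abbrev Grass.even (n : ℕ) : Subalgebra ℝ (Grass n) :=
  CliffordAlgebra.even (0 : QuadraticForm ℝ (Fin n → ℝ))

/-- Objects of the category `Gr` of finite-dimensional real Grassmann algebras; `⟨n⟩` stands for
`Λ_n`. -/
structure Gr where
  n : ℕ

/-- Morphisms of `Gr`: parity-preserving algebra homomorphisms. -/
@[ext]
structure GrHom (Λ Λ' : Gr) where
  toAlgHom : Grass Λ.n →ₐ[ℝ] Grass Λ'.n
  map_part : ∀ (i : ZMod 2) (x : Grass Λ.n),
    x ∈ Grass.part Λ.n i → toAlgHom x ∈ Grass.part Λ'.n i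

instance : Category Gr where
  Hom := GrHom
  id Λ := ⟨AlgHom.id ℝ _, fun _ _ h => h⟩
  comp f g := ⟨g.toAlgHom.comp f.toAlgHom, fun i _ h => g.map_part i _ (f.map_part i _ h)⟩

/-- The map `(Λ)_0 → (Λ')_0` induced by a morphism `φ : Λ ⟶ Λ'`. -/
def GrHom.onEven {Λ Λ' : Gr} (φ : Λ ⟶ Λ') (a : Grass.even Λ.n) : Grass.even Λ'.n :=
  ⟨GrHom.toAlgHom φ a, GrHom.map_part φ 0 a a.2⟩

theorem map_zero_mem (n n' : ℕ) (i : ZMod 2) (x : Grass n) (hx : x ∈ Grass.part n i) :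
    ExteriorAlgebra.map (0 : (Fin n → ℝ) →ₗ[ℝ] (Fin n' → ℝ)) x ∈ Grass.part n' i := by
  suffices h : (Grass.part n i).map
      (ExteriorAlgebra.map (0 : (Fin n → ℝ) →ₗ[ℝ] (Fin n' → ℝ))).toLinearMap ≤ Grass.part n' i from
    h (Submodule.mem_map_of_mem hx)
  rw [Grass.part, CliffordAlgebra.evenOdd, Submodule.map_iSup]
  refine iSup_mono fun j => ?_
  rw [Submodule.map_pow]
  refine pow_le_pow_left' ?_ _
  rintro _ ⟨_, ⟨v, rfl⟩, rfl⟩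
  exact ⟨0, by
    rw [map_zero]
    exact ((ExteriorAlgebra.map_apply_ι _ v).trans (by simp)).symm⟩

/-- The morphism `Λ ⟶ Λ'` that sends all odd generators to zero.  For `Λ' = ℝ` it is the terminal
morphism `ε_Λ`, for `Λ = ℝ` it is the initial morphism `ℝ ⟶ Λ'`. -/
def Gr.zeroHom (Λ Λ' : Gr) : Λ ⟶ Λ' :=
  ⟨ExteriorAlgebra.map (0 : (Fin Λ.n → ℝ) →ₗ[ℝ] (Fin Λ'.n → ℝ)), map_zero_mem _ _⟩

/-- The Grassmann algebra `ℝ = Λ_0`. -/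
def Gr.real : Gr := ⟨0⟩

/-- The Koszul sign `(-1)^{ij}`. -/
def sgn (i j : ZMod 2) : ℝ := ((if i = 1 ∧ j = 1 then -1 else 1 : ℤ) : ℝ)

theorem sgn_zero_left (j : ZMod 2) : sgn 0 j = 1 := by simp [sgn]

theorem sgn_add_left (i i' j : ZMod 2) : sgn (i + i') j = sgn i j * sgn i' j := by
  unfold sgn
  rw [← Int.cast_mul]
  congr 1
  revert i i' j
  decide

/-- `w` is the derivative over `𝕜` of `f` at `x` in the direction `v`. -/
def HasDirDeriv (𝕜 : Type*) {E F : Type*} [NontriviallyNormedField 𝕜] [AddCommGroup E] [Module 𝕜 E]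
    [AddCommGroup F] [Module 𝕜 F] [TopologicalSpace F] (f : E → F) (x v : E) (w : F) : Prop :=
  Tendsto (fun t : 𝕜 => t⁻¹ • (f (x + t • v) - f x)) (𝓝[≠] 0) (𝓝 w)

/-- Maps of class `C^k` (in the sense of Bastiani, Michal and Hamilton) on an open subset `s` of a
topological vector space: `f` is continuous, all directional derivatives exist, and
`(x, v) ↦ df(x) v` is of class `C^{k-1}` on `s × E`. -/
def IsClass (𝕜 : Type*) [NontriviallyNormedField 𝕜] : ∀ (_ : ℕ) {E F : Type u}
    [AddCommGroup E] [Module 𝕜 E] [TopologicalSpace E]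
    [AddCommGroup F] [Module 𝕜 F] [TopologicalSpace F], Set E → (E → F) → Prop
  | 0, _, _, _, _, _, _, _, _, s, f => ContinuousOn f s
  | k + 1, E, F, _, _, _, _, _, _, s, f => ContinuousOn f s ∧ ∃ df : E × E → F,
      (∀ x ∈ s, ∀ v, HasDirDeriv 𝕜 f x v (df (x, v))) ∧
        IsClass 𝕜 k (s ×ˢ (univ : Set E)) df

/-- Smooth maps on an open subset of a topological vector space over `𝕜`; for `𝕜 = ℂ` and Fréchet
spaces these are the holomorphic maps. -/
def IsSmoothOn (𝕜 : Type*) [NontriviallyNormedField 𝕜] {E F : Type u}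
    [AddCommGroup E] [Module 𝕜 E] [TopologicalSpace E]
    [AddCommGroup F] [Module 𝕜 F] [TopologicalSpace F] (s : Set E) (f : E → F) : Prop :=
  ∀ k, IsClass 𝕜 k s f

/-- Real Fréchet spaces: complete metrizable locally convex topological vector spaces. -/
structure IsFrechetSpace (E : Type*) [AddCommGroup E] [Module ℝ E] [TopologicalSpace E] : Prop where
  addGroup : IsTopologicalAddGroup E
  smul : ContinuousSMul ℝ E
  convex : LocallyConvexSpace ℝ E
  metrizable : MetrizableSpace E
  complete : @CompleteSpace E (IsTopologicalAddGroup.rightUniformSpace E)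

/-- `ψ` on `D ⊆ F` is a parametrization of an open part of `S ⊆ G` that comes from a flattening chart:
a diffeomorphism `φ : V → W` between open subsets of `G`, with inverse `χ`, that maps `V ∩ S` onto
`W ∩ F`, where `D = W ∩ F` and `ψ = χ` on `D`. -/
def IsSliceChart {G : Type u} [AddCommGroup G] [Module ℝ G] [TopologicalSpace G] (S : Set G)
    (F : Submodule ℝ G) (D : Set F) (ψ : F → G) : Prop :=
  ∃ (V W : Set G) (φ χ : G → G), IsOpen V ∧ IsOpen W ∧ MapsTo φ V W ∧ MapsTo χ W V ∧
    InvOn χ φ V W ∧ IsSmoothOn ℝ V φ ∧ IsSmoothOn ℝ W χ ∧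
    φ '' (V ∩ S) = W ∩ F ∧ D = {x : F | (x : G) ∈ W} ∧ ∀ x ∈ D, χ x = ψ x

/-- `S` is a (split) smooth submanifold of the topological vector space `G`: near each of its points
there is a flattening chart onto an open subset of a topologically complemented subspace. -/
def IsSplitSubmanifold {G : Type u} [AddCommGroup G] [Module ℝ G] [TopologicalSpace G]
    (S : Set G) : Prop :=
  ∀ s ∈ S, ∃ (F : Submodule ℝ G) (D : Set F) (ψ : F → G),
    F.ClosedComplemented ∧ IsSliceChart S F D ψ ∧ s ∈ ψ '' D

/-- Data of a local parametrization of `S`: a map from a subset of a complex topological vector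
space to `S`. -/
structure LocalParam (S : Type u) where
  model : Type u
  [addCommGroup : AddCommGroup model]
  [module : Module ℂ model]
  [topology : TopologicalSpace model]
  dom : Set model
  toFun : dom → S

attribute [instance] LocalParam.addCommGroup LocalParam.module LocalParam.topology

/-- The local parametrizations form a holomorphic atlas modelled on complex Fréchet spaces. -/
structure IsHolomorphicAtlas {S : Type u} [TopologicalSpace S] {I : Type u}
    (c : I → LocalParam S) : Prop where
  frechet : ∀ i, IsFrechetSpace (c i).model
  smul : ∀ i, ContinuousSMul ℂ (c i).model
  dom_open : ∀ i, IsOpen (c i).dom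
  openEmbedding : ∀ i, IsOpenEmbedding (c i).toFun
  cover : ∀ s, ∃ i, s ∈ range (c i).toFun
  transition : ∀ i j, ∃ τ : (c i).model → (c j).model,
    (∀ x : (c i).dom, (c i).toFun x ∈ range (c j).toFun →
      ∃ h : τ x ∈ (c j).dom, (c j).toFun ⟨τ x, h⟩ = (c i).toFun x) ∧
    IsSmoothOn ℂ (Subtype.val '' ((c i).toFun ⁻¹' range (c j).toFun)) τ

/-- The even part `(Λ ⊗ V)_0 = Λ_0 ⊗ V_0 + Λ_1 ⊗ V_1` for a real super vector space `V` with homogeneous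
parts `P`. -/
def evenTensor (n : ℕ) {V : Type*} [AddCommGroup V] [Module ℝ V] (P : ZMod 2 → Submodule ℝ V) :
    Submodule ℝ (Grass n ⊗[ℝ] V) :=
  Submodule.span ℝ {x | ∃ (i : ZMod 2) (a : Grass n) (v : V),
    a ∈ Grass.part n i ∧ v ∈ P i ∧ x = a ⊗ₜ[ℝ] v}

theorem map_mem_evenTensor {n n' : ℕ} {V V' : Type*} [AddCommGroup V] [Module ℝ V]
    [AddCommGroup V'] [Module ℝ V'] {P : ZMod 2 → Submodule ℝ V} {P' : ZMod 2 → Submodule ℝ V'}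
    {f : Grass n →ₗ[ℝ] Grass n'} {g : V →ₗ[ℝ] V'}
    (hf : ∀ i, ∀ a ∈ Grass.part n i, f a ∈ Grass.part n' i) (hg : ∀ i, ∀ v ∈ P i, g v ∈ P' i)
    {x : Grass n ⊗[ℝ] V} (hx : x ∈ evenTensor n P) :
    TensorProduct.map f g x ∈ evenTensor n' P' := by
  suffices h : evenTensor n P ≤ (evenTensor n' P').comap (TensorProduct.map f g) from h hx
  refine Submodule.span_le.2 ?_
  rintro _ ⟨i, a, v, ha, hv, rfl⟩
  exact Submodule.subset_span ⟨i, f a, g v, hf i a ha, hg i v hv, by simp⟩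

/-- The map `(Λ ⊗ V)_0 → (Λ' ⊗ V')_0` induced by even maps `f` and `g`. -/
def evenTensorMap {n n' : ℕ} {V V' : Type*} [AddCommGroup V] [Module ℝ V]
    [AddCommGroup V'] [Module ℝ V'] {P : ZMod 2 → Submodule ℝ V} {P' : ZMod 2 → Submodule ℝ V'}
    (f : Grass n →ₗ[ℝ] Grass n') (g : V →ₗ[ℝ] V')
    (hf : ∀ i, ∀ a ∈ Grass.part n i, f a ∈ Grass.part n' i) (hg : ∀ i, ∀ v ∈ P i, g v ∈ P' i) :
    evenTensor n P →ₗ[ℝ] evenTensor n' P' :=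
  (TensorProduct.map f g).restrict fun _ hx => map_mem_evenTensor hf hg hx

/-- The map `l ⊗ id : Λ ⊗ V → V` for a linear form `l` on `Λ`. -/
def tensorSlice {n : ℕ} (V : Type*) [AddCommGroup V] [Module ℝ V] (l : Module.Dual ℝ (Grass n)) :
    Grass n ⊗[ℝ] V →ₗ[ℝ] V :=
  (TensorProduct.lid ℝ V).toLinearMap ∘ₗ TensorProduct.map l LinearMap.id

/-- The topology of `Λ ⊗ V ≅ V^{dim Λ}`: the coarsest one for which all `l ⊗ id` are continuous. -/
@[reducible]
def tensorTopology (n : ℕ) (V : Type*) [AddCommGroup V] [Module ℝ V] [TopologicalSpace V] :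
    TopologicalSpace (Grass n ⊗[ℝ] V) :=
  ⨅ l : Module.Dual ℝ (Grass n), TopologicalSpace.induced (tensorSlice V l) inferInstance

theorem tensorMap_continuous {n n' : ℕ} (V : Type*) [AddCommGroup V] [Module ℝ V]
    [TopologicalSpace V] (f : Grass n →ₗ[ℝ] Grass n') :
    Continuous[tensorTopology n V, tensorTopology n' V] (TensorProduct.map f LinearMap.id) := by
  let _ := tensorTopology n V
  let _ := tensorTopology n' V
  refine continuous_iInf_rng.2 fun l => continuous_induced_rng.2 ?_
  have h : (tensorSlice V l) ∘ (TensorProduct.map f LinearMap.id) =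
      tensorSlice V (l ∘ₗ f) := by
    funext x
    simp only [tensorSlice, Function.comp_apply, LinearMap.comp_apply]
    rw [← LinearMap.comp_apply (TensorProduct.map l _), ← TensorProduct.map_comp,
      LinearMap.id_comp]
  rw [h]
  exact continuous_iInf_dom continuous_induced_dom

theorem mul_mem_part {n : ℕ} {a : Grass n} (ha : a ∈ Grass.even n) (i : ZMod 2) (b : Grass n)
    (hb : b ∈ Grass.part n i) : a * b ∈ Grass.part n i := by
  have h := SetLike.mul_mem_graded (A := Grass.part n) (i := 0) (j := i) ha hb
  rwa [zero_add] at h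

section Bar

variable {B : Type u} [Ring B] [Algebra ℝ B] (P : ZMod 2 → Submodule ℝ B) [GradedAlgebra P]

/-- The tensor product of superalgebras `Λ ⊗ B`, with
`(λ ⊗ a)(μ ⊗ b) = (-1)^{|a||μ|} λμ ⊗ ab`. -/
abbrev GTensor (Λ : Gr) : Type u := Grass.part Λ.n ᵍ⊗[ℝ] P

theorem tmul_mul_tmul (Λ : Gr) {i j : ZMod 2} {a a' : Grass Λ.n} {b b' : B}
    (ha' : a' ∈ Grass.part Λ.n j) (hb : b ∈ P i) :
    (GradedTensorProduct.of ℝ (Grass.part Λ.n) P (a ⊗ₜ b)) *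
      (GradedTensorProduct.of ℝ (Grass.part Λ.n) P (a' ⊗ₜ b')) =
    ((((-1 : ℤˣ) ^ (i * j) : ℤˣ) : ℤ) : ℝ) •
      GradedTensorProduct.of ℝ (Grass.part Λ.n) P ((a * a') ⊗ₜ (b * b')) := by
  have h := GradedTensorProduct.tmul_coe_mul_coe_tmul (R := ℝ) (Grass.part Λ.n) P a ⟨b, hb⟩
    ⟨a', ha'⟩ b'
  rw [Int.cast_smul_eq_zsmul ℝ, ← @Units.smul_def _ _ (_) (_)]
  exact h

theorem one_mem_even_part (n : ℕ) : (1 : Grass n) ∈ Grass.part n 0 :=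
  SetLike.GradedOne.one_mem

/-- The even part of `Λ ⊗ B`, as a subalgebra. -/
def barAlg (Λ : Gr) : Subalgebra ℝ (GTensor P Λ) where
  carrier := {x | (GradedTensorProduct.of ℝ (Grass.part Λ.n) P).symm x ∈ evenTensor Λ.n P}
  add_mem' {x y} hx hy := by
    simp only [mem_ofPred_eq, map_add] at *
    exact add_mem hx hy
  mul_mem' {x y} hx hy := by
    have key : ∀ u ∈ evenTensor Λ.n P, ∀ v ∈ evenTensor Λ.n P,
        (GradedTensorProduct.of ℝ (Grass.part Λ.n) P).symm
          (GradedTensorProduct.of ℝ (Grass.part Λ.n) P u *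
            GradedTensorProduct.of ℝ (Grass.part Λ.n) P v) ∈ evenTensor Λ.n P := by
      intro u hu v hv
      refine Submodule.span_induction₂ (p := fun u v _ _ =>
        (GradedTensorProduct.of ℝ (Grass.part Λ.n) P).symm
          (GradedTensorProduct.of ℝ (Grass.part Λ.n) P u *
            GradedTensorProduct.of ℝ (Grass.part Λ.n) P v) ∈ evenTensor Λ.n P)
        ?_ ?_ ?_ ?_ ?_ ?_ ?_ hu hv
      · rintro _ _ ⟨i, a, b, ha, hb, rfl⟩ ⟨j, a', b', ha', hb', rfl⟩
        rw [tmul_mul_tmul P Λ ha' hb, map_smul]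
        refine Submodule.smul_mem _ _ (Submodule.subset_span ⟨i + j, a * a', b * b', ?_, ?_, rfl⟩)
        · exact SetLike.mul_mem_graded ha ha'
        · exact SetLike.mul_mem_graded hb hb'
      · intro v _; simp
      · intro v _; simp
      · intro u v w _ _ _ h h'
        rw [map_add, add_mul, map_add]; exact add_mem h h'
      · intro u v w _ _ _ h h'
        rw [map_add, mul_add, map_add]; exact add_mem h h'
      · intro r u v _ _ h
        rw [map_smul, smul_mul_assoc, map_smul]; exact Submodule.smul_mem _ _ h
      · intro r u v _ _ h
        rw [map_smul, mul_smul_comm, map_smul]; exact Submodule.smul_mem _ _ h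
    exact key _ hx _ hy
  algebraMap_mem' r := by
    have h : algebraMap ℝ (Grass Λ.n) r ∈ Grass.part Λ.n 0 := SetLike.algebraMap_mem_graded _ _
    have h' : algebraMap ℝ (Grass Λ.n) r ⊗ₜ[ℝ] (1 : B) ∈ evenTensor Λ.n P :=
      Submodule.subset_span ⟨0, _, 1, h, SetLike.GradedOne.one_mem, rfl⟩
    exact h'

/-- The `Λ`-points `(Λ ⊗ B)_0` of the functor associated with the superalgebra `B`. -/
def Bar (Λ : Gr) : Type u := barAlg P Λ

instance (Λ : Gr) : Ring (Bar P Λ) := inferInstanceAs (Ring (barAlg P Λ))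

instance (Λ : Gr) : Algebra ℝ (Bar P Λ) := inferInstanceAs (Algebra ℝ (barAlg P Λ))

/-- An element of `(Λ ⊗ B)_0`, seen as a tensor. -/
def Bar.toTensor {Λ : Gr} (x : Bar P Λ) : Grass Λ.n ⊗[ℝ] B :=
  (GradedTensorProduct.of ℝ (Grass.part Λ.n) P).symm x.1

theorem Bar.toTensor_injective (Λ : Gr) : Function.Injective (Bar.toTensor P (Λ := Λ)) :=
  (LinearEquiv.injective _).comp Subtype.val_injective

/-- The algebra homomorphism `φ ⊗ id : Λ ⊗ B → Λ' ⊗ B`. -/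
def gMap {Λ Λ' : Gr} (φ : Λ ⟶ Λ') : GTensor P Λ →ₐ[ℝ] GTensor P Λ' :=
  GradedTensorProduct.lift _ _
    ((GradedTensorProduct.includeLeft (Grass.part Λ'.n) P).comp (GrHom.toAlgHom φ))
    (GradedTensorProduct.includeRight (Grass.part Λ'.n) P) (by
      intro i j a b
      have h1 : (1 : Grass Λ'.n) ∈ Grass.part Λ'.n 0 := one_mem_even_part _
      have h2 : (1 : B) ∈ P 0 := SetLike.GradedOne.one_mem
      have e1 := tmul_mul_tmul P Λ' (a := GrHom.toAlgHom φ a) (b' := (b : B)) h1 h2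
      have e2 := tmul_mul_tmul P Λ' (a := 1) (b' := 1) (GrHom.map_part φ i a a.2) b.2
      simp only [mul_one, one_mul, mul_zero, uzpow_zero, Units.val_one, Int.cast_one,
        one_smul] at e1 e2
      have e1' : (((GradedTensorProduct.includeLeft (Grass.part Λ'.n) P).comp
          (GrHom.toAlgHom φ)) a * (GradedTensorProduct.includeRight (Grass.part Λ'.n) P) b) =
          GradedTensorProduct.of ℝ (Grass.part Λ'.n) P ((GrHom.toAlgHom φ a) ⊗ₜ (b : B)) := e1
      rw [e1']
      have e2' : ((GradedTensorProduct.includeRight (Grass.part Λ'.n) P) b *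
        ((GradedTensorProduct.includeLeft (Grass.part Λ'.n) P).comp
          (GrHom.toAlgHom φ)) a) = _ := e2
      rw [e2', @Units.smul_def _ _ (_) (_), ← Int.cast_smul_eq_zsmul ℝ, smul_smul]
      rw [← Int.cast_mul, ← Units.val_mul, Int.units_mul_self, Units.val_one, Int.cast_one, one_smul])

theorem gMap_eq {Λ Λ' : Gr} (φ : Λ ⟶ Λ') (x : Grass Λ.n ⊗[ℝ] B) :
    gMap P φ (GradedTensorProduct.of ℝ (Grass.part Λ.n) P x) =
      GradedTensorProduct.of ℝ (Grass.part Λ'.n) P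
        (TensorProduct.map (GrHom.toAlgHom φ).toLinearMap LinearMap.id x) := by
  induction x with
  | zero => simp
  | add x y hx hy => rw [map_add, map_add, hx, hy, map_add, map_add]
  | tmul a b =>
    refine (GradedTensorProduct.lift_tmul _ _ _ _ _ a b).trans ?_
    have h := GradedTensorProduct.tmul_one_mul_one_tmul (R := ℝ) (Grass.part Λ'.n) P
      (GrHom.toAlgHom φ a) b
    exact h

/-- The algebra homomorphism `φ ⊗ id : (Λ ⊗ B)_0 → (Λ' ⊗ B)_0`. -/
def Bar.map {Λ Λ' : Gr} (φ : Λ ⟶ Λ') : Bar P Λ →ₐ[ℝ] Bar P Λ' :=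
  ((gMap P φ).comp (barAlg P Λ).val).codRestrict (barAlg P Λ') (by
    intro x
    change (GradedTensorProduct.of ℝ (Grass.part Λ'.n) P).symm (gMap P φ
      (GradedTensorProduct.of ℝ (Grass.part Λ.n) P (Bar.toTensor P x))) ∈ evenTensor Λ'.n P
    rw [gMap_eq, LinearEquiv.symm_apply_apply]
    exact map_mem_evenTensor (fun i a h => GrHom.map_part φ i a h) (fun i v h => h) x.2)

theorem Bar.toTensor_map {Λ Λ' : Gr} (φ : Λ ⟶ Λ') (x : Bar P Λ) :
    Bar.toTensor P (Bar.map P φ x) =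
      TensorProduct.map (GrHom.toAlgHom φ).toLinearMap LinearMap.id (Bar.toTensor P x) := by
  change (GradedTensorProduct.of ℝ (Grass.part Λ'.n) P).symm (gMap P φ
      (GradedTensorProduct.of ℝ (Grass.part Λ.n) P (Bar.toTensor P x))) = _
  rw [gMap_eq, LinearEquiv.symm_apply_apply]

theorem Bar.map_id (Λ : Gr) (x : Bar P Λ) : Bar.map P (𝟙 Λ) x = x := by
  apply Bar.toTensor_injective P
  rw [Bar.toTensor_map]
  exact DFunLike.congr_fun (TensorProduct.map_id (R := ℝ) (M := Grass Λ.n) (N := B)) _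

theorem Bar.map_comp {Λ Λ' Λ'' : Gr} (φ : Λ ⟶ Λ') (φ' : Λ' ⟶ Λ'') (x : Bar P Λ) :
    Bar.map P (φ ≫ φ') x = Bar.map P φ' (Bar.map P φ x) := by
  apply Bar.toTensor_injective P
  rw [Bar.toTensor_map, Bar.toTensor_map, Bar.toTensor_map, ← LinearMap.comp_apply,
    ← TensorProduct.map_comp]
  rfl

/-- The (central) inclusion `λ ↦ λ ⊗ 1` of `Λ_0` into `(Λ ⊗ B)_0`. -/
def Bar.ofEven (Λ : Gr) : Grass.even Λ.n →ₐ[ℝ] Bar P Λ :=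
  ((GradedTensorProduct.includeLeft (Grass.part Λ.n) P).comp (Grass.even Λ.n).val).codRestrict
    (barAlg P Λ) (fun a => by
      have h : (a : Grass Λ.n) ⊗ₜ[ℝ] (1 : B) ∈ evenTensor Λ.n P :=
        Submodule.subset_span ⟨0, a, 1, a.2, SetLike.GradedOne.one_mem, rfl⟩
      exact h)

theorem Bar.map_ofEven {Λ Λ' : Gr} (φ : Λ ⟶ Λ') (a : Grass.even Λ.n) :
    Bar.map P φ (Bar.ofEven P Λ a) = Bar.ofEven P Λ' (GrHom.onEven φ a) := by
  apply Bar.toTensor_injective P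
  rw [Bar.toTensor_map]
  exact TensorProduct.map_tmul _ _ _ _

theorem ι_mul_ι_commute {n : ℕ} (v w : Fin n → ℝ) (b : Grass n) :
    Commute (ExteriorAlgebra.ι ℝ v * ExteriorAlgebra.ι ℝ w) b := by
  induction b using ExteriorAlgebra.induction with
  | algebraMap r => exact Algebra.commute_algebraMap_right r _
  | ι z =>
    have h1 := eq_neg_of_add_eq_zero_left (ExteriorAlgebra.ι_add_mul_swap (R := ℝ) w z)
    have h2 := eq_neg_of_add_eq_zero_left (ExteriorAlgebra.ι_add_mul_swap (R := ℝ) v z)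
    change _ * _ * _ = _ * (_ * _)
    rw [mul_assoc, h1, mul_neg, ← mul_assoc, h2, neg_mul, neg_neg, mul_assoc]
  | mul x y hx hy => exact hx.mul_right hy
  | add x y hx hy => exact hx.add_right hy

theorem even_comm {n : ℕ} {a : Grass n} (ha : a ∈ Grass.even n) (b : Grass n) :
    a * b = b * a := by
  refine CliffordAlgebra.even_induction (0 : QuadraticForm ℝ (Fin n → ℝ))
    (motive := fun a _ => a * b = b * a) ?_ ?_ ?_ a ha
  · intro r
    exact Algebra.commutes r b
  · intro x y _ _ hx hy
    rw [add_mul, mul_add, hx, hy]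
  · intro v w x _ hx
    have hb' : ExteriorAlgebra.ι ℝ v * ExteriorAlgebra.ι ℝ w * b =
      b * (ExteriorAlgebra.ι ℝ v * ExteriorAlgebra.ι ℝ w) := ι_mul_ι_commute v w b
    change ExteriorAlgebra.ι ℝ v * ExteriorAlgebra.ι ℝ w * x * b =
      b * (ExteriorAlgebra.ι ℝ v * ExteriorAlgebra.ι ℝ w * x)
    rw [mul_assoc _ x b, hx, ← mul_assoc _ b x, hb', mul_assoc b]

theorem Bar.ofEven_comm {Λ : Gr} (a : Grass.even Λ.n) (x : Bar P Λ) :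
    Bar.ofEven P Λ a * x = x * Bar.ofEven P Λ a := by
  have key : ∀ u ∈ evenTensor Λ.n P,
      GradedTensorProduct.of ℝ (Grass.part Λ.n) P ((a : Grass Λ.n) ⊗ₜ 1) *
          GradedTensorProduct.of ℝ (Grass.part Λ.n) P u =
        GradedTensorProduct.of ℝ (Grass.part Λ.n) P u *
          GradedTensorProduct.of ℝ (Grass.part Λ.n) P ((a : Grass Λ.n) ⊗ₜ 1) := by
    intro u hu
    refine Submodule.span_induction (p := fun u _ =>
      GradedTensorProduct.of ℝ (Grass.part Λ.n) P ((a : Grass Λ.n) ⊗ₜ 1) *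
          GradedTensorProduct.of ℝ (Grass.part Λ.n) P u =
        GradedTensorProduct.of ℝ (Grass.part Λ.n) P u *
          GradedTensorProduct.of ℝ (Grass.part Λ.n) P ((a : Grass Λ.n) ⊗ₜ 1))
      ?_ ?_ ?_ ?_ hu
    · rintro _ ⟨i, b, v, hb, hv, rfl⟩
      rw [tmul_mul_tmul P Λ hb (SetLike.GradedOne.one_mem : (1 : B) ∈ P 0),
        tmul_mul_tmul P Λ a.2 hv, even_comm a.2, one_mul, mul_one, zero_mul, mul_zero]
    · simp
    · intro x y _ _ hx hy
      rw [map_add, mul_add, add_mul, hx, hy]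
    · intro r x _ hx
      rw [map_smul, mul_smul_comm, smul_mul_assoc, hx]
  exact Subtype.ext (key _ x.2)

variable [TopologicalSpace B]

instance (Λ : Gr) : TopologicalSpace (Bar P Λ) :=
  TopologicalSpace.induced (Bar.toTensor P) (tensorTopology Λ.n B)

theorem Bar.map_continuous {Λ Λ' : Gr} (φ : Λ ⟶ Λ') : Continuous (Bar.map P φ) := by
  let _ := tensorTopology Λ.n B
  let _ := tensorTopology Λ'.n B
  refine continuous_induced_rng.2 ?_
  have h : Bar.toTensor P ∘ Bar.map P φ =
      TensorProduct.map (GrHom.toAlgHom φ).toLinearMap LinearMap.id ∘ Bar.toTensor P :=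
    funext fun x => Bar.toTensor_map P φ x
  rw [h]
  exact (tensorMap_continuous B _).comp continuous_induced_dom

/-- The functor `Λ ↦ (Λ ⊗ B)_0`, `φ ↦ φ ⊗ id`. -/
def Bar.functor : Gr ⥤ TopCat.{u} where
  obj Λ := TopCat.of (Bar P Λ)
  map φ := TopCat.ofHom ⟨Bar.map P φ, Bar.map_continuous P φ⟩
  map_id Λ := by ext x; exact Bar.map_id P Λ x
  map_comp φ φ' := by ext x; exact Bar.map_comp P φ φ' x

end Bar

section Acs

variable {B : Type u} [Ring B] [Algebra ℝ B]

/-- The elements `J` of a ring with `J² = -1`. -/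
def Acs (B : Type u) [Ring B] : Type u := {J : B // J * J = -1}

instance [TopologicalSpace B] : TopologicalSpace (Acs B) :=
  inferInstanceAs (TopologicalSpace {J : B // J * J = -1})

/-- The image of an element with square `-1` under a ring homomorphism. -/
def Acs.map {B' : Type u} [Ring B'] (f : B →+* B') (J : Acs B) : Acs B' :=
  ⟨f J.1, by rw [← map_mul, J.2, map_neg, map_one]⟩

/-- The subspace of the elements that anticommute with `J`. -/
def antiSubmodule (J : Acs B) : Submodule ℝ B where
  carrier := {H | H * J.1 + J.1 * H = 0}
  zero_mem' := by simp
  add_mem' {H K} hH hK := by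
    simp only [mem_ofPred_eq] at *
    rw [add_mul, mul_add, add_add_add_comm, hH, hK, add_zero]
  smul_mem' c H hH := by
    simp only [mem_ofPred_eq] at *
    rw [smul_mul_assoc, mul_smul_comm, ← smul_add, hH, smul_zero]

theorem mul_mem_anti (J : Acs B) {H : B} (hH : H ∈ antiSubmodule J) :
    J.1 * H ∈ antiSubmodule J := by
  have h : H * J.1 + J.1 * H = 0 := hH
  change J.1 * H * J.1 + J.1 * (J.1 * H) = 0
  rw [mul_assoc, ← mul_add, h, mul_zero]

/-- The tangent space `T_J`: the elements that anticommute with `J`, a complex vector space in which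
multiplication by `i` is `H ↦ JH`. -/
@[ext]
structure Anti (J : Acs B) : Type u where
  val : B
  property : val ∈ antiSubmodule J

namespace Anti

variable (J : Acs B)

theorem val_injective : Function.Injective (val : Anti J → B) := fun _ _ h => Anti.ext h

instance : Zero (Anti J) := ⟨⟨0, zero_mem _⟩⟩
instance : Add (Anti J) := ⟨fun H K => ⟨H.1 + K.1, add_mem H.2 K.2⟩⟩
instance : Neg (Anti J) := ⟨fun H => ⟨-H.1, neg_mem H.2⟩⟩
instance : Sub (Anti J) := ⟨fun H K => ⟨H.1 - K.1, sub_mem H.2 K.2⟩⟩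
instance : SMul ℕ (Anti J) := ⟨fun k H => ⟨k • H.1, nsmul_mem H.2 k⟩⟩
instance : SMul ℤ (Anti J) := ⟨fun k H => ⟨k • H.1, zsmul_mem H.2 k⟩⟩

instance : AddCommGroup (Anti J) :=
  (val_injective J).addCommGroup _ rfl (fun _ _ => rfl) (fun _ => rfl) (fun _ _ => rfl)
    (fun _ _ => rfl) (fun _ _ => rfl)

instance : SMul ℂ (Anti J) :=
  ⟨fun c H => ⟨c.re • H.1 + c.im • (J.1 * H.1),
    add_mem (Submodule.smul_mem _ _ H.2) (Submodule.smul_mem _ _ (mul_mem_anti J H.2))⟩⟩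

instance : Module ℂ (Anti J) where
  one_smul H := by
    ext
    change (1 : ℂ).re • H.1 + (1 : ℂ).im • (J.1 * H.1) = H.1
    simp
  mul_smul c d H := by
    ext
    change (c * d).re • H.1 + (c * d).im • (J.1 * H.1) = c.re • (d.re • H.1 + d.im • (J.1 * H.1)) +
      c.im • (J.1 * (d.re • H.1 + d.im • (J.1 * H.1)))
    have h : J.1 * (J.1 * H.1) = -H.1 := by rw [← mul_assoc, J.2, neg_one_mul]
    rw [Complex.mul_re, Complex.mul_im, mul_add, mul_smul_comm, mul_smul_comm, h]
    module
  smul_zero c := by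
    ext
    change c.re • (0 : B) + c.im • (J.1 * 0) = 0
    simp
  zero_smul H := by
    ext
    change (0 : ℂ).re • H.1 + (0 : ℂ).im • (J.1 * H.1) = 0
    simp
  smul_add c H K := by
    ext
    change c.re • (H.1 + K.1) + c.im • (J.1 * (H.1 + K.1)) =
      (c.re • H.1 + c.im • (J.1 * H.1)) + (c.re • K.1 + c.im • (J.1 * K.1))
    rw [mul_add]
    module
  add_smul c d H := by
    ext
    change (c + d).re • H.1 + (c + d).im • (J.1 * H.1) =
      (c.re • H.1 + c.im • (J.1 * H.1)) + (d.re • H.1 + d.im • (J.1 * H.1))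
    rw [Complex.add_re, Complex.add_im]
    module

instance [TopologicalSpace B] : TopologicalSpace (Anti J) :=
  TopologicalSpace.induced val inferInstance

end Anti

/-- The endomorphism `(1 + H) J (1 + H)⁻¹`. -/
def afVal (J : Acs B) (H : B) : B := (1 + H) * J.1 * Ring.inverse (1 + H)

theorem afVal_sq (J : Acs B) (H : B) (h : IsUnit (1 + H)) : afVal J H * afVal J H = -1 := by
  have e := Ring.inverse_mul_cancel (1 + H) h
  have e' := Ring.mul_inverse_cancel (1 + H) h
  calc afVal J H * afVal J H
      = (1 + H) * J.1 * (Ring.inverse (1 + H) * (1 + H)) * J.1 * Ring.inverse (1 + H) := by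
        simp only [afVal, mul_assoc]
    _ = (1 + H) * (J.1 * J.1) * Ring.inverse (1 + H) := by rw [e]; simp only [mul_assoc, one_mul]
    _ = -1 := by rw [J.2, mul_neg_one, neg_mul, e']

/-- The `H` anticommuting with `J` for which `1 + H` is invertible. -/
def afDom (J : Acs B) : Set (Anti J) := {H | IsUnit (1 + H.val)}

/-- The Abresch-Fischer chart `ψ_J : H ↦ (1 + H) J (1 + H)⁻¹` around `J`. -/
def afChart (J : Acs B) (H : afDom J) : Acs B := ⟨afVal J H.1.val, afVal_sq J _ H.2⟩

/-- The Abresch-Fischer chart around `J` as a local parametrization of `{J | J² = -1}`. -/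
def afParam [TopologicalSpace B] (J : Acs B) : LocalParam (Acs B) where
  model := Anti J
  dom := afDom J
  toFun := afChart J

end Acs

/-- A `ℂ̄`-module in `Top^Gr`: a functor `Λ ↦ obj Λ` with values in topological spaces, such that
`obj Λ` is a module over `ℂ̄(Λ) = ℂ ⊗ Λ_0`, i.e. carries commuting actions of `ℂ` and `Λ_0` that agree on
the real numbers, naturally in `Λ`. -/
structure CBarModule where
  obj : Gr → Type u
  [addCommGroup : ∀ Λ, AddCommGroup (obj Λ)]
  [module : ∀ Λ, Module ℂ (obj Λ)]
  [evenModule : ∀ Λ : Gr, Module (Grass.even Λ.n) (obj Λ)]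
  [topology : ∀ Λ, TopologicalSpace (obj Λ)]
  smul_comm : ∀ (Λ : Gr) (a : Grass.even Λ.n) (c : ℂ) (x : obj Λ), a • c • x = c • a • x
  real_smul : ∀ (Λ : Gr) (r : ℝ) (x : obj Λ), algebraMap ℝ (Grass.even Λ.n) r • x = (r : ℂ) • x
  map : ∀ {Λ Λ' : Gr}, (Λ ⟶ Λ') → (obj Λ →ₗ[ℂ] obj Λ')
  map_id : ∀ (Λ : Gr) (x : obj Λ), map (𝟙 Λ) x = x
  map_comp : ∀ {Λ Λ' Λ'' : Gr} (φ : Λ ⟶ Λ') (φ' : Λ' ⟶ Λ'') (x : obj Λ),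
    map (φ ≫ φ') x = map φ' (map φ x)
  map_smul : ∀ {Λ Λ' : Gr} (φ : Λ ⟶ Λ') (a : Grass.even Λ.n) (x : obj Λ),
    map φ (a • x) = GrHom.onEven φ a • map φ x
  map_continuous : ∀ {Λ Λ' : Gr} (φ : Λ ⟶ Λ'), Continuous (map φ)

attribute [instance] CBarModule.addCommGroup CBarModule.module CBarModule.evenModule
  CBarModule.topology

instance (Λ : Gr) {V : Type u} [AddCommGroup V] [Module ℝ V] [TopologicalSpace V]
    (P : ZMod 2 → Submodule ℝ V) : TopologicalSpace (evenTensor Λ.n P) :=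
  TopologicalSpace.induced Subtype.val (tensorTopology Λ.n V)

/-- Complex topological super vector spaces: a complex topological vector space that is the
topological direct sum of an even and an odd subspace. -/
structure SuperSpace where
  space : Type u
  [addCommGroup : AddCommGroup space]
  [module : Module ℂ space]
  [topology : TopologicalSpace space]
  part : ZMod 2 → Submodule ℂ space
  addGroup : IsTopologicalAddGroup space
  smul : ContinuousSMul ℂ space
  isCompl : IsCompl (part 0) (part 1)
  proj : ∃ p : space →L[ℂ] space, (∀ v ∈ part 0, p v = v) ∧ ∀ v ∈ part 1, p v = 0

attribute [instance] SuperSpace.addCommGroup SuperSpace.module SuperSpace.topology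

/-- The points `V̄(Λ) = (Λ ⊗ V)_0`. -/
abbrev SuperSpace.points (V : SuperSpace.{u}) (Λ : Gr) :
    Submodule ℝ (Grass Λ.n ⊗[ℝ] V.space) :=
  evenTensor Λ.n fun i => (V.part i).restrictScalars ℝ

/-- `V̄(φ) = φ ⊗ id`. -/
def SuperSpace.pointsMap (V : SuperSpace.{u}) {Λ Λ' : Gr} (φ : Λ ⟶ Λ') :
    V.points Λ →ₗ[ℝ] V.points Λ' :=
  evenTensorMap (GrHom.toAlgHom φ).toLinearMap LinearMap.id (fun i a h => GrHom.map_part φ i a h)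
    (fun _ _ h => h)

/-- The action of `Λ_0` on `V̄(Λ)`. -/
def SuperSpace.evenMul (V : SuperSpace.{u}) {Λ : Gr} (a : Grass.even Λ.n) :
    V.points Λ →ₗ[ℝ] V.points Λ :=
  evenTensorMap (LinearMap.mulLeft ℝ (a : Grass Λ.n)) LinearMap.id
    (fun i b h => mul_mem_part a.2 i b h) (fun _ _ h => h)

/-- The action of `ℂ` on `V̄(Λ)`. -/
def SuperSpace.complexMul (V : SuperSpace.{u}) {Λ : Gr} (c : ℂ) :
    V.points Λ →ₗ[ℝ] V.points Λ :=
  evenTensorMap LinearMap.id (LinearMap.lsmul ℂ V.space c |>.restrictScalars ℝ) (fun _ _ h => h)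
    (fun i _ h => (V.part i).smul_mem c h)

/-- A `ℂ̄`-module is superrepresentable if it is isomorphic to `V̄` for a complex super vector
space `V`. -/
def CBarModule.IsSuperrepresentable (T : CBarModule.{u}) : Prop :=
  ∃ (V : SuperSpace.{u}) (e : ∀ Λ, V.points Λ ≃ₗ[ℝ] T.obj Λ),
    (∀ Λ, IsHomeomorph (e Λ)) ∧
    (∀ (Λ : Gr) (c : ℂ) x, e Λ (V.complexMul c x) = c • e Λ x) ∧
    (∀ (Λ : Gr) (a : Grass.even Λ.n) x, e Λ (V.evenMul a x) = a • e Λ x) ∧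
    ∀ {Λ Λ' : Gr} (φ : Λ ⟶ Λ') x, e Λ' (V.pointsMap φ x) = T.map φ (e Λ x)

/-- Fréchet `ℂ̄`-modules: superrepresentable, and all point sets are complex Fréchet spaces. -/
structure CBarModule.IsFrechet (T : CBarModule.{u}) : Prop where
  superrepresentable : T.IsSuperrepresentable
  frechet : ∀ Λ, IsFrechetSpace (T.obj Λ)
  smul : ∀ Λ, ContinuousSMul ℂ (T.obj Λ)
  even_smul : ∀ (Λ : Gr) (a : Grass.even Λ.n), Continuous fun x : T.obj Λ => a • x

/-- Data of a superchart of a functor `F`: for each `Λ` a map from a subset of the `Λ`-points of a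
`ℂ̄`-module to `F(Λ)`. -/
structure SuperParam (F : Gr ⥤ TopCat.{u}) where
  model : CBarModule.{u}
  dom : ∀ Λ, Set (model.obj Λ)
  toFun : ∀ Λ, dom Λ → F.obj Λ

/-- The supercharts form a complex atlas on `F`: the models are Fréchet `ℂ̄`-modules, the domains are
open subfunctors of the models, the charts are natural in `Λ`, are open embeddings at each `Λ`, cover
`F(Λ)` for each `Λ`, and their transition maps are supersmooth over `ℂ`: holomorphic at each `Λ`, with
`Λ_0`-linear derivatives. -/
structure IsComplexSuperAtlas (F : Gr ⥤ TopCat.{u}) {I : Type u} (c : I → SuperParam F) :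
    Prop where
  frechet : ∀ i, (c i).model.IsFrechet
  dom_open : ∀ i Λ, IsOpen ((c i).dom Λ)
  natural : ∀ (i : I) {Λ Λ' : Gr} (φ : Λ ⟶ Λ') (x : (c i).dom Λ),
    ∃ h : (c i).model.map φ x ∈ (c i).dom Λ',
      (c i).toFun Λ' ⟨(c i).model.map φ x, h⟩ = F.map φ ((c i).toFun Λ x)
  openEmbedding : ∀ i Λ, IsOpenEmbedding ((c i).toFun Λ)
  cover : ∀ (Λ : Gr) (s : F.obj Λ), ∃ i, s ∈ range ((c i).toFun Λ)
  transition : ∀ (i j : I) (Λ : Gr), ∃ τ : (c i).model.obj Λ → (c j).model.obj Λ,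
    (∀ x : (c i).dom Λ, (c i).toFun Λ x ∈ range ((c j).toFun Λ) →
      ∃ h : τ x ∈ (c j).dom Λ, (c j).toFun Λ ⟨τ x, h⟩ = (c i).toFun Λ x) ∧
    IsSmoothOn ℂ (Subtype.val '' ((c i).toFun Λ ⁻¹' range ((c j).toFun Λ))) τ ∧
    ∀ x : (c i).dom Λ, (c i).toFun Λ x ∈ range ((c j).toFun Λ) →
      ∃ D : (c i).model.obj Λ →ₗ[ℂ] (c j).model.obj Λ,
        (∀ (a : Grass.even Λ.n) v, D (a • v) = a • D v) ∧
        ∀ v, HasDirDeriv ℂ τ x v (D v)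

/-- `F` is a complex Fréchet supermanifold. -/
def IsComplexFrechetSupermanifold (F : Gr ⥤ TopCat.{u}) : Prop :=
  ∃ (I : Type u) (c : I → SuperParam F), IsComplexSuperAtlas F c

section Tangent

variable {B : Type u} [Ring B] [Algebra ℝ B] (P : ZMod 2 → Submodule ℝ B) [GradedAlgebra P]

instance (Λ : Gr) (J : Acs (Bar P Λ)) : SMul (Grass.even Λ.n) (Anti J) :=
  ⟨fun a H => ⟨Bar.ofEven P Λ a * H.val, by
    have h : H.val * J.1 + J.1 * H.val = 0 := H.property
    change Bar.ofEven P Λ a * H.val * J.1 + J.1 * (Bar.ofEven P Λ a * H.val) = 0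
    rw [← mul_assoc J.1, ← Bar.ofEven_comm, mul_assoc, mul_assoc, ← mul_add, h, mul_zero]⟩⟩

instance (Λ : Gr) (J : Acs (Bar P Λ)) : Module (Grass.even Λ.n) (Anti J) where
  one_smul H := by
    apply Anti.ext
    change Bar.ofEven P Λ 1 * H.val = H.val
    rw [map_one, one_mul]
  mul_smul a b H := by
    apply Anti.ext
    change Bar.ofEven P Λ (a * b) * H.val = Bar.ofEven P Λ a * (Bar.ofEven P Λ b * H.val)
    rw [map_mul, mul_assoc]
  smul_zero a := Anti.ext (mul_zero _)
  zero_smul H := by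
    apply Anti.ext
    change Bar.ofEven P Λ 0 * H.val = 0
    rw [map_zero, zero_mul]
  smul_add a H K := Anti.ext (mul_add _ _ _)
  add_smul a b H := by
    apply Anti.ext
    change Bar.ofEven P Λ (a + b) * H.val = Bar.ofEven P Λ a * H.val + Bar.ofEven P Λ b * H.val
    rw [map_add, add_mul]

/-- The map induced by `φ` on the elements of square `-1` in `(Λ ⊗ B)_0`. -/
def acsMap {Λ Λ' : Gr} (φ : Λ ⟶ Λ') (J : Acs (Bar P Λ)) : Acs (Bar P Λ') :=
  Acs.map (Bar.map P φ).toRingHom J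

theorem real_comp {Λ Λ' : Gr} (φ : Λ ⟶ Λ') :
    Gr.zeroHom Gr.real Λ ≫ φ = Gr.zeroHom Gr.real Λ' := by
  apply GrHom.ext
  apply ExteriorAlgebra.hom_ext
  apply LinearMap.ext
  intro v
  have h : v = 0 := funext fun k => k.elim0
  subst h
  rw [map_zero, map_zero]

/-- A real point `J`, seen as a `Λ`-point. -/
def constLift (J : Acs (Bar P Gr.real)) (Λ : Gr) : Acs (Bar P Λ) := acsMap P (Gr.zeroHom Gr.real Λ) J

theorem acsMap_constLift (J : Acs (Bar P Gr.real)) {Λ Λ' : Gr} (φ : Λ ⟶ Λ') :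
    acsMap P φ (constLift P J Λ) = constLift P J Λ' := by
  apply Subtype.ext
  refine (Bar.map_comp P (Gr.zeroHom Gr.real Λ) φ J.1).symm.trans ?_
  rw [real_comp]
  rfl

/-- The restriction of `φ ⊗ id` to the elements anticommuting with `J`. -/
def tanMap (J : Acs (Bar P Gr.real)) {Λ Λ' : Gr} (φ : Λ ⟶ Λ') :
    Anti (constLift P J Λ) →ₗ[ℂ] Anti (constLift P J Λ') where
  toFun H := ⟨Bar.map P φ H.val, by
    have h : H.val * (constLift P J Λ).1 + (constLift P J Λ).1 * H.val = 0 := H.property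
    change _ * _ + _ * _ = (0 : Bar P Λ')
    have e : (constLift P J Λ').1 = Bar.map P φ (constLift P J Λ).1 :=
      congrArg Subtype.val (acsMap_constLift P J φ).symm
    rw [e, ← map_mul, ← map_mul, ← map_add, h, map_zero]⟩
  map_add' H K := Anti.ext (map_add _ _ _)
  map_smul' c H := by
    apply Anti.ext
    have e : (constLift P J Λ').1 = Bar.map P φ (constLift P J Λ).1 :=
      congrArg Subtype.val (acsMap_constLift P J φ).symm
    change Bar.map P φ (c.re • H.val + c.im • ((constLift P J Λ).1 * H.val)) =
      c.re • Bar.map P φ H.val + c.im • ((constLift P J Λ').1 * Bar.map P φ H.val)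
    rw [e, map_add, map_smul, map_smul, map_mul]

variable [TopologicalSpace B]

/-- The functor `Λ ↦ {J ∈ (Λ ⊗ B)_0 | J² = -1}`. -/
def acsFunctor : Gr ⥤ TopCat.{u} where
  obj Λ := TopCat.of (Acs (Bar P Λ))
  map φ := TopCat.ofHom ⟨acsMap P φ,
    ((Bar.map_continuous P φ).comp continuous_subtype_val).subtype_mk _⟩
  map_id Λ := by ext J; exact Subtype.ext (Bar.map_id P Λ J.1)
  map_comp φ φ' := by ext J; exact Subtype.ext (Bar.map_comp P φ φ' J.1)

/-- The functor `T̂_J`: its `Λ`-points are the elements of `(Λ ⊗ B)_0` that anticommute with `J`, with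
the complex structure `H ↦ JH`. -/
def tanModule (J : Acs (Bar P Gr.real)) : CBarModule.{u} where
  obj Λ := Anti (constLift P J Λ)
  smul_comm Λ a c H := by
    apply Anti.ext
    change Bar.ofEven P Λ a * (c.re • H.val + c.im • ((constLift P J Λ).1 * H.val)) =
      c.re • (Bar.ofEven P Λ a * H.val) + c.im • ((constLift P J Λ).1 * (Bar.ofEven P Λ a * H.val))
    rw [mul_add, mul_smul_comm, mul_smul_comm, ← mul_assoc _ (constLift P J Λ).1,
      Bar.ofEven_comm P a (constLift P J Λ).1, mul_assoc]
  real_smul Λ r H := by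
    apply Anti.ext
    change Bar.ofEven P Λ (algebraMap ℝ _ r) * H.val =
      (r : ℂ).re • H.val + (r : ℂ).im • ((constLift P J Λ).1 * H.val)
    rw [AlgHom.commutes, Complex.ofReal_re, Complex.ofReal_im, zero_smul, add_zero,
      Algebra.smul_def]
  map φ := tanMap P J φ
  map_id Λ H := Anti.ext (Bar.map_id P Λ H.val)
  map_comp φ φ' H := Anti.ext (Bar.map_comp P φ φ' H.val)
  map_smul φ a H := by
    apply Anti.ext
    change Bar.map P φ (Bar.ofEven P _ a * H.val) =
      Bar.ofEven P _ (GrHom.onEven φ a) * Bar.map P φ H.val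
    rw [map_mul, Bar.map_ofEven]
  map_continuous φ := continuous_induced_rng.2
    ((Bar.map_continuous P φ).comp continuous_induced_dom)

/-- The Abresch-Fischer charts around a real point `J`, for all `Λ` at once. -/
def afSuperParam (J : Acs (Bar P Gr.real)) : SuperParam (acsFunctor P) where
  model := tanModule P J
  dom Λ := afDom (constLift P J Λ)
  toFun Λ := afChart (constLift P J Λ)

end Tangent

abbrev Euc (m : ℕ) : Type := EuclideanSpace ℝ (Fin m)
/-- Smooth real functions on an open subset of Euclidean space. -/
abbrev SmoothFn {m : ℕ} (V : Opens (Euc m)) : Type := C^∞⟮𝓘(ℝ, Euc m), V; 𝓘(ℝ, ℝ), ℝ⟯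

/-- Restriction of smooth functions. -/
def SmoothFn.res {m : ℕ} {V W : Opens (Euc m)} (h : W ≤ V) : SmoothFn V →ₐ[ℝ] SmoothFn W :=
  { ContMDiffMap.restrictRingHom 𝓘(ℝ, Euc m) 𝓘(ℝ, ℝ) ℝ h with
    commutes' := fun _ => rfl }

/-- Superfunctions `C^∞(V) ⊗ Λ[θ_1, …, θ_n]` on a superdomain of dimension `m|n`. -/
abbrev LinFn {m : ℕ} (n : ℕ) (V : Opens (Euc m)) : Type := SmoothFn V ⊗[ℝ] Grass n
/-- Restriction of superfunctions. -/
def LinFn.res {m : ℕ} (n : ℕ) {V W : Opens (Euc m)} (h : W ≤ V) : LinFn n V →ₐ[ℝ] LinFn n W :=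
  Algebra.TensorProduct.map (SmoothFn.res h) (AlgHom.id ℝ (Grass n))
/-- The homogeneous parts of the superfunctions. -/
def LinFn.part {m : ℕ} (n : ℕ) (V : Opens (Euc m)) (i : ZMod 2) : Submodule ℝ (LinFn n V) :=
  LinearMap.range (LinearMap.lTensor (SmoothFn V) (Grass.part n i).subtype)

/-- The preimage of an open set under a chart, as an open set of the manifold. -/
def chartPreimage {X : Type u} [TopologicalSpace X] {m : ℕ} (φ : OpenPartialHomeomorph X (Euc m)) (V : Opens (Euc m)) : Opens X :=
  ⟨φ.source ∩ φ ⁻¹' V, φ.isOpen_inter_preimage V.2⟩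

theorem chartPreimage_mono {X : Type u} [TopologicalSpace X] {m : ℕ}
    (φ : OpenPartialHomeomorph X (Euc m)) {V W : Opens (Euc m)} (h : W ≤ V) :
    chartPreimage φ W ≤ chartPreimage φ V :=
  fun _ hx => ⟨hx.1, h hx.2⟩

/-- A smooth supermanifold of dimension `m|n` with underlying space `X`: a sheaf `O` of supercommutative
real superalgebras on `X` such that `(X, O)` is locally isomorphic to
`(V, C^∞_V ⊗ Λ[θ_1, …, θ_n])`, `V` open in `ℝ^m`. -/
structure Supermanifold (m n : ℕ) (X : Type u) [TopologicalSpace X] where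
  O : Opens X → Type u
  [ring : ∀ U, Ring (O U)]
  [algebra : ∀ U, Algebra ℝ (O U)]
  part : ∀ U, ZMod 2 → Submodule ℝ (O U)
  [graded : ∀ U, GradedAlgebra (part U)]
  supercomm : ∀ (U : Opens X) (i j : ZMod 2) (a b : O U), a ∈ part U i → b ∈ part U j →
    a * b = sgn i j • (b * a)
  res : ∀ {U V : Opens X}, V ≤ U → (O U →ₐ[ℝ] O V)
  res_part : ∀ {U V : Opens X} (h : V ≤ U) (i : ZMod 2) (a : O U), a ∈ part U i → res h a ∈ part V i
  res_id : ∀ (U : Opens X) (a : O U), res (le_refl U) a = a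
  res_res : ∀ {U V W : Opens X} (h : V ≤ U) (h' : W ≤ V) (a : O U),
    res h' (res h a) = res (h'.trans h) a
  glue : ∀ {ι : Type u} (U : ι → Opens X) (s : ∀ i, O (U i)),
    (∀ i j, res (inf_le_left : U i ⊓ U j ≤ U i) (s i) = res inf_le_right (s j)) →
    ∃! t : O (⨆ i, U i), ∀ i, res (le_iSup U i) t = s i
  locallyLinear : ∀ p : X, ∃ φ : OpenPartialHomeomorph X (Euc m), p ∈ φ.source ∧
    ∃ e : ∀ V : Opens (Euc m), (V : Set (Euc m)) ⊆ φ.target →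
        (O (chartPreimage φ V) ≃ₐ[ℝ] LinFn n V),
      (∀ V hV i a, a ∈ part (chartPreimage φ V) i → e V hV a ∈ LinFn.part n V i) ∧
      ∀ (V W : Opens (Euc m)) (hV : (V : Set (Euc m)) ⊆ φ.target) (h : W ≤ V) a,
        e W (Subset.trans h hV) (res (chartPreimage_mono φ h) a) = LinFn.res n h (e V hV a)

attribute [instance] Supermanifold.ring Supermanifold.algebra Supermanifold.graded

namespace Supermanifold
variable {m n : ℕ} {X : Type u} [TopologicalSpace X] (M : Supermanifold m n X)

/-- Families of linear maps `O(W) → O(W)`, `W ⊆ U`. -/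
abbrev PreVect (U : Opens X) : Type u := ∀ W : Set.Iic U, Module.End ℝ (M.O W.1)

/-- The homogeneous super vector fields of parity `i` on `U`: the superderivations of the sheaf `O`
restricted to `U`. -/
def vectPart (U : Opens X) (i : ZMod 2) : Submodule ℝ (M.PreVect U) where
  carrier := {D |
    (∀ (W W' : Set.Iic U) (h : W'.1 ≤ W.1) (f : M.O W.1), M.res h (D W f) = D W' (M.res h f)) ∧
    (∀ (W : Set.Iic U) (j : ZMod 2) (f : M.O W.1), f ∈ M.part W.1 j → D W f ∈ M.part W.1 (i + j)) ∧
    ∀ (W : Set.Iic U) (j : ZMod 2) (f g : M.O W.1), f ∈ M.part W.1 j →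
      D W (f * g) = D W f * g + sgn i j • (f * D W g)}
  zero_mem' := by
    refine ⟨?_, ?_, ?_⟩ <;> intros <;> simp
  add_mem' := by
    rintro D D' ⟨h1, h2, h3⟩ ⟨h1', h2', h3'⟩
    refine ⟨?_, ?_, ?_⟩
    · intro W W' h f; simp [h1 W W' h, h1' W W' h]
    · intro W j f hf; exact add_mem (h2 W j f hf) (h2' W j f hf)
    · intro W j f g hf
      simp only [Pi.add_apply, LinearMap.add_apply, h3 W j f g hf, h3' W j f g hf, add_mul, mul_add,
        smul_add]
      abel
  smul_mem' := by
    rintro c D ⟨h1, h2, h3⟩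
    refine ⟨?_, ?_, ?_⟩
    · intro W W' h f; simp [h1 W W' h]
    · intro W j f hf; exact Submodule.smul_mem _ _ (h2 W j f hf)
    · intro W j f g hf
      simp only [Pi.smul_apply, LinearMap.smul_apply, h3 W j f g hf, smul_add, smul_mul_assoc,
        mul_smul_comm]
      rw [smul_comm]

/-- The super vector fields on `U`, i.e. the sections over `U` of the tangent sheaf. -/
def Vect (U : Opens X) : Submodule ℝ (M.PreVect U) := ⨆ i, M.vectPart U i

/-- Restriction of families of linear maps. -/
def preVectRes {U V : Opens X} (h : V ≤ U) : M.PreVect U →ₗ[ℝ] M.PreVect V where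
  toFun D := fun W => D ⟨W.1, le_trans W.2 h⟩
  map_add' _ _ := rfl
  map_smul' _ _ := rfl

theorem preVectRes_part {U V : Opens X} (h : V ≤ U) (i : ZMod 2) (D : M.PreVect U)
    (hD : D ∈ M.vectPart U i) : M.preVectRes h D ∈ M.vectPart V i :=
  ⟨fun W W' => hD.1 ⟨W.1, le_trans W.2 h⟩ ⟨W'.1, le_trans W'.2 h⟩,
    fun W => hD.2.1 ⟨W.1, le_trans W.2 h⟩, fun W => hD.2.2 ⟨W.1, le_trans W.2 h⟩⟩

/-- Restriction of vector fields. -/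
def vectRes {U V : Opens X} (h : V ≤ U) : M.Vect U →ₗ[ℝ] M.Vect V :=
  (M.preVectRes h).restrict (by
    suffices h' : M.Vect U ≤ (M.Vect V).comap (M.preVectRes h) from fun _ hD => h' hD
    exact iSup_le fun i D hD => Submodule.mem_iSup_of_mem i (M.preVectRes_part h i D hD))

/-- Multiplication of a family of linear maps by a superfunction. -/
def preMulVect {U : Opens X} (f : M.O U) : M.PreVect U →ₗ[ℝ] M.PreVect U where
  toFun D := fun W => LinearMap.mulLeft ℝ (M.res W.2 f) ∘ₗ D W
  map_add' D D' := by ext W g; simp [mul_add]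
  map_smul' c D := by ext W g; simp

theorem preMulVect_sum {U : Opens X} {α : Type*} (s : Finset α) (f : α → M.O U)
    (D : M.PreVect U) : M.preMulVect (∑ k ∈ s, f k) D = ∑ k ∈ s, M.preMulVect (f k) D := by
  ext W g
  simp [preMulVect, Finset.sum_mul, map_sum, Finset.sum_apply, LinearMap.sum_apply]

theorem preMulVect_part {U : Opens X} (k i : ZMod 2) (f : M.O U) (hf : f ∈ M.part U k)
    (D : M.PreVect U) (hD : D ∈ M.vectPart U i) : M.preMulVect f D ∈ M.vectPart U (k + i) := by
  have hfW := fun W : Set.Iic U => M.res_part W.2 k f hf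
  refine ⟨?_, ?_, ?_⟩
  · intro W W' h g
    simp only [preMulVect, LinearMap.coe_mk, AddHom.coe_mk, LinearMap.comp_apply,
      LinearMap.mulLeft_apply, map_mul, hD.1 W W' h]
    rw [M.res_res W.2 h]
  · intro W j g hg
    rw [add_assoc]
    exact SetLike.mul_mem_graded (hfW W) (hD.2.1 W j g hg)
  · intro W j g g' hg
    simp only [preMulVect, LinearMap.coe_mk, AddHom.coe_mk, LinearMap.comp_apply,
      LinearMap.mulLeft_apply, hD.2.2 W j g g' hg, mul_add, mul_assoc, mul_smul_comm]
    congr 1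
    rw [← mul_assoc, M.supercomm W.1 k j _ _ (hfW W) hg, smul_mul_assoc, smul_smul,
      mul_assoc, sgn_add_left, mul_comm]

/-- Multiplication of a vector field by a superfunction. -/
def mulVect {U : Opens X} (f : M.O U) : M.Vect U →ₗ[ℝ] M.Vect U :=
  (M.preMulVect f).restrict (by
    suffices h' : M.Vect U ≤ (M.Vect U).comap (M.preMulVect f) from fun _ hD => h' hD
    classical
    refine iSup_le fun i D hD => ?_
    change M.preMulVect f D ∈ M.Vect U
    rw [← DirectSum.sum_support_decompose (M.part U) f, M.preMulVect_sum]
    exact Submodule.sum_mem _ fun k _ =>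
      Submodule.mem_iSup_of_mem _ (M.preMulVect_part k i _ (SetLike.coe_mem _) D hD))

/-- Families of linear maps of the spaces of vector fields. -/
abbrev PreEnd : Type u := ∀ U : Opens X, Module.End ℝ (M.Vect U)

/-- The global sections of parity `j` of the endomorphism bundle of the tangent bundle: morphisms of
sheaves that shift parity by `j` and satisfy `A(fD) = (-1)^{|A||f|} f A(D)`. -/
def endPart (j : ZMod 2) : Submodule ℝ M.PreEnd where
  carrier := {A |
    (∀ (U V : Opens X) (h : V ≤ U) (D : M.Vect U), M.vectRes h (A U D) = A V (M.vectRes h D)) ∧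
    (∀ (U : Opens X) (i : ZMod 2) (D : M.Vect U),
      D.1 ∈ M.vectPart U i → (A U D).1 ∈ M.vectPart U (j + i)) ∧
    ∀ (U : Opens X) (k : ZMod 2) (f : M.O U) (D : M.Vect U), f ∈ M.part U k →
      A U (M.mulVect f D) = sgn j k • M.mulVect f (A U D)}
  zero_mem' := by
    refine ⟨?_, ?_, ?_⟩ <;> intros <;> simp
  add_mem' := by
    rintro A A' ⟨h1, h2, h3⟩ ⟨h1', h2', h3'⟩
    refine ⟨?_, ?_, ?_⟩
    · intro U V h D; simp [h1 U V h, h1' U V h]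
    · intro U i D hD; exact add_mem (h2 U i D hD) (h2' U i D hD)
    · intro U k f D hf
      simp only [Pi.add_apply, LinearMap.add_apply, h3 U k f D hf, h3' U k f D hf, map_add,
        smul_add]
  smul_mem' := by
    rintro c A ⟨h1, h2, h3⟩
    refine ⟨?_, ?_, ?_⟩
    · intro U V h D; simp [h1 U V h]
    · intro U i D hD; exact Submodule.smul_mem _ _ (h2 U i D hD)
    · intro U k f D hf
      simp only [Pi.smul_apply, LinearMap.smul_apply, h3 U k f D hf, map_smul]
      rw [smul_comm]

theorem one_mem_endPart : (1 : M.PreEnd) ∈ M.endPart 0 := by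
  refine ⟨fun _ _ _ _ => rfl, ?_, ?_⟩
  · intro U i D hD
    simpa using hD
  · intro U k f D hf
    simp [sgn_zero_left]

theorem mul_mem_endPart {j k : ZMod 2} {A B : M.PreEnd} (hA : A ∈ M.endPart j)
    (hB : B ∈ M.endPart k) : A * B ∈ M.endPart (j + k) := by
  refine ⟨?_, ?_, ?_⟩
  · intro U V h D
    simp only [Pi.mul_apply, Module.End.mul_apply, hA.1 U V h, hB.1 U V h]
  · intro U i D hD
    rw [add_assoc]
    exact hA.2.1 U _ _ (hB.2.1 U i D hD)
  · intro U l f D hf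
    simp only [Pi.mul_apply, Module.End.mul_apply, hB.2.2 U l f D hf]
    rw [map_smul, hA.2.2 U l f _ hf, smul_smul, sgn_add_left, mul_comm]

/-- The superalgebra of global sections of the endomorphism bundle of the tangent bundle. -/
def endAlg : Subalgebra ℝ M.PreEnd where
  carrier := (⨆ j, M.endPart j : Submodule ℝ M.PreEnd)
  add_mem' := Submodule.add_mem _
  mul_mem' {A B} hA hB := by
    have h : (⨆ j, M.endPart j) * (⨆ j, M.endPart j) ≤ ⨆ j, M.endPart j := by
      rw [Submodule.iSup_mul]
      refine iSup_le fun j => ?_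
      rw [Submodule.mul_iSup]
      refine iSup_le fun k => Submodule.mul_le.2 fun A hA B hB => ?_
      exact Submodule.mem_iSup_of_mem _ (M.mul_mem_endPart hA hB)
    exact h (Submodule.mul_mem_mul hA hB)
  algebraMap_mem' r := by
    rw [Algebra.algebraMap_eq_smul_one]
    exact Submodule.smul_mem _ _ (Submodule.mem_iSup_of_mem 0 M.one_mem_endPart)

/-- The superalgebra of global sections of the endomorphism bundle of the tangent bundle. -/
def EndT : Type u := M.endAlg

instance : Ring M.EndT := inferInstanceAs (Ring M.endAlg)

instance : Algebra ℝ M.EndT := inferInstanceAs (Algebra ℝ M.endAlg)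

/-- The family of linear maps underlying a section of the endomorphism bundle. -/
def EndT.val : M.EndT →ₐ[ℝ] M.PreEnd := M.endAlg.val

theorem EndT.ext {A B : M.EndT} (h : EndT.val M A = EndT.val M B) : A = B := Subtype.ext h

/-- The parity decomposition of the sections of the endomorphism bundle. -/
def EndT.part (j : ZMod 2) : Submodule ℝ M.EndT :=
  (M.endPart j).comap (EndT.val M).toLinearMap

instance : SetLike.GradedMonoid (EndT.part M) where
  one_mem := M.one_mem_endPart
  mul_mem _ _ _ _ hA hB := M.mul_mem_endPart hA hB

theorem vectPart_disjoint (U : Opens X) : Disjoint (M.vectPart U 0) (M.vectPart U 1) := by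
  classical
  rw [Submodule.disjoint_def]
  intro D h0 h1
  funext W
  ext f
  have hd : ∀ j, Disjoint (M.part W.1 j) (M.part W.1 (1 + j)) := fun j =>
    (DirectSum.Decomposition.isInternal (M.part W.1)).submodule_iSupIndep.pairwiseDisjoint
      (by revert j; decide)
  rw [← DirectSum.sum_support_decompose (M.part W.1) f, map_sum]
  refine (Finset.sum_eq_zero fun j _ => ?_).trans rfl
  have a := h0.2.1 W j _ (SetLike.coe_mem (DirectSum.decompose (M.part W.1) f j))
  have b := h1.2.1 W j _ (SetLike.coe_mem (DirectSum.decompose (M.part W.1) f j))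
  rw [zero_add] at a
  exact Submodule.disjoint_def.1 (hd j) _ a b

theorem endPart_disjoint : Disjoint (M.endPart 0) (M.endPart 1) := by
  rw [Submodule.disjoint_def]
  intro A h0 h1
  funext U
  have key : M.Vect U ≤ (LinearMap.ker (A U)).map (M.Vect U).subtype := by
    refine iSup_le fun i D hD => ?_
    have hD' : D ∈ M.Vect U := Submodule.mem_iSup_of_mem i hD
    refine ⟨⟨D, hD'⟩, ?_, rfl⟩
    have a := h0.2.1 U i ⟨D, hD'⟩ hD
    have b := h1.2.1 U i ⟨D, hD'⟩ hD
    have hd : Disjoint (M.vectPart U (0 + i)) (M.vectPart U (1 + i)) := by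
      have := M.vectPart_disjoint U
      fin_cases i
      · exact this
      · exact this.symm
    exact Subtype.ext (Submodule.disjoint_def.1 hd _ a b)
  ext1 D
  obtain ⟨D', h, e⟩ := key D.2
  have : D' = D := Subtype.ext e
  subst this
  exact h

theorem EndT.isCompl : IsCompl (EndT.part M 0) (EndT.part M 1) := by
  refine ⟨?_, ?_⟩
  · rw [Submodule.disjoint_def]
    intro A h0 h1
    exact EndT.ext M (Submodule.disjoint_def.1 M.endPart_disjoint _ h0 h1)
  · rw [codisjoint_iff, eq_top_iff]
    rintro ⟨A, hA⟩ -
    have hle : (⨆ j, M.endPart j) ≤ M.endPart 0 ⊔ M.endPart 1 := by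
      refine iSup_le fun j => ?_
      fin_cases j
      · exact le_sup_left
      · exact le_sup_right
    obtain ⟨a, ha, b, hb, rfl⟩ := Submodule.mem_sup.1 (hle hA)
    exact Submodule.mem_sup.2 ⟨⟨a, Submodule.mem_iSup_of_mem 0 ha⟩, ha,
      ⟨b, Submodule.mem_iSup_of_mem 1 hb⟩, hb, rfl⟩

theorem EndT.isInternal : DirectSum.IsInternal (EndT.part M) := by
  have h01 : (0 : ZMod 2) ≠ 1 := by decide
  have hu : (Set.univ : Set (ZMod 2)) = {0, 1} := by
    have h2 : ∀ i : ZMod 2, i = 0 ∨ i = 1 := by decide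
    ext i
    simpa using h2 i
  exact (DirectSum.isInternal_submodule_iff_isCompl (EndT.part M) h01 hu).2 (EndT.isCompl M)

instance : GradedAlgebra (EndT.part M) where
  toDecomposition := (EndT.isInternal M).chooseDecomposition _

/-- `c` is the value at `p` of a superfunction `f`: `f - c` is not invertible on any neighbourhood
of `p`.  For `p ∈ U` there is exactly one such `c`. -/
def HasValue {U : Opens X} (f : M.O U) (p : X) (c : ℝ) : Prop :=
  ∀ (W : Opens X) (h : W ≤ U), p ∈ W → ¬ IsUnit (M.res h f - algebraMap ℝ (M.O W) c)

/-- The value of a superfunction at a point. -/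
def value {U : Opens X} (f : M.O U) (p : X) : ℝ := Classical.epsilon (M.HasValue f p)

/-- The superfunction `D f`. -/
def applyVect {U : Opens X} (D : M.Vect U) (f : M.O U) : M.O U := D.1 ⟨U, le_refl U⟩ f

/-- The `C^∞` topology: the coarsest one for which `A ↦ Y_1 ⋯ Y_k (A(D) f)`, evaluated at the points
of `U`, is continuous for uniform convergence on compact subsets of `U`, for all open `U`, all vector
fields `D, Y_1, …, Y_k` and superfunctions `f` on `U`.  In charts this is uniform convergence on compact
sets of all derivatives of all components of `A`. -/
instance : TopologicalSpace M.EndT :=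
  ⨅ (U : Opens X) (D : M.Vect U) (f : M.O U) (L : List (M.Vect U)),
    TopologicalSpace.induced
      (fun A : M.EndT => UniformOnFun.ofFun {K : Set U | IsCompact K}
        (fun p : U => M.value (L.foldr M.applyVect (M.applyVect (EndT.val M A U D) f)) p))
      inferInstance

/-- The sections over `P(Λ) × M` of the pullback `Λ ⊗ End(TM)` of the endomorphism bundle along the
projection to `M` (even ones, as always). -/
abbrev Sections (Λ : Gr) : Type u := Bar (EndT.part M) Λ

/-- The functor of sections of the endomorphism bundle. -/
abbrev sectionsFunctor : Gr ⥤ TopCat.{u} := Bar.functor (EndT.part M)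

/-- The almost complex structures on `P(Λ) × M` over `P(Λ)`. -/
abbrev ACS (Λ : Gr) : Type u := Acs (M.Sections Λ)

/-- The functor of almost complex structures. -/
abbrev acs : Gr ⥤ TopCat.{u} := acsFunctor (EndT.part M)

/-- The functor `T̂_{J}` for an almost complex structure `J` on `M`. -/
abbrev tangent (J : M.ACS Gr.real) : CBarModule.{u} := tanModule (EndT.part M) J

/-- The Abresch-Fischer charts around an almost complex structure `J` on `M`. -/
abbrev superchart (J : M.ACS Gr.real) : SuperParam M.acs := afSuperParam (EndT.part M) J

end Supermanifold

end SuperACS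
end

open SuperACS

noncomputable section
namespace SuperACS

/-! ### Slope calculus -/

/-! Everything rests on one property of the algebra R of even sections over P(Λ) × M: it is a
Fréchet algebra in which all elements close to 1 are invertible (`IsUnitOpenAlgebra`). Algebra and
analysis derive the charts from this property, nilpotency reduces it from Λ to real points, and
compactness of X yields it there.

Algebra. If J² = J'² = -1, then J'(J + J') = (J + J')J, so an invertible J + J' conjugates J to J'.
The Cayley transform y ↦ (J + y)⁻¹(J - y) is a bijection from {J + y invertible} to {1 + x
invertible}, with inverse x ↦ J(1 - x)(1 + x)⁻¹. It takes the solutions of y² = -1 to the elements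
that anticommute with J, and on those its inverse is ψ_J, because (1 + x)J = J(1 - x). So it
flattens the set of almost complex structures. For two charts, split g = 1 + H into P₊ + P₋ with
P₊J₁ = J₂P₊ and P₋J₁ = -J₂P₋. Then g = (1 + P₋P₊⁻¹)P₊, and the transition map is τ(H) = P₋P₊⁻¹,
defined exactly on the overlap. Its derivative v ↦ (P₋v - τ P₊v)P₊⁻¹ is complex linear: P₋ is linear
on the tangent space, P₊ is antilinear, and τ anticommutes with J₂.

Analysis. These maps are built from products and inverses. Inversion is continuous on the units, by
an argument with infinite products (`continuousOn_inverse_of_mem_nhds_one`). Since y⁻¹ - x⁻¹ =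
-x⁻¹(y - x)y⁻¹, difference quotients are again products and inverses, and the slope calculus
(`SlopeClass`) turns continuity into smoothness. A real slope map whose derivative commutes with i
is holomorphic, because the symmetry of second derivatives passes complex linearity on to all higher
derivatives (`isClass_complex`).

Nilpotents. An element of (Λ ⊗ E)_0 is invertible if and only if its body is (`Bar.isUnit_iff`).
Hence domains and images of the charts are preimages of those on real points, and the charts around
real points cover every A(M)(Λ). Since J₀ is even, anticommuting with 1 ⊗ J₀ is a condition on the
factor E only; so T̂ is represented by the space of all elements of E, even or odd, that anticommute
with J₀.

Geometry. It remains that E is a Fréchet superalgebra with continuous product and parity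
projections, in which even elements close to 1 have even inverses (`Supermanifold.isSuperUnitOpen`).
Hadamard's lemma shows that superderivations are determined by their values on coordinates, so a
section of the endomorphism bundle is a matrix of superfunctions in each chart. For a finite atlas
these components induce the given topology of E (`isInducing_kappa`), and completeness follows from
pointwise limits. A matrix of superfunctions is invertible when the determinant of its body has no
zeros. Near A = 1 this holds on finitely many compact sets that cover M, and the local inverses
glue. -/

/-- Maps of class `C^k` in the sense of difference quotients: `f y - f x = Φ (x, y, y - x)` with `Φ`
linear in the last argument and of class `C^{k-1}`. -/
def SlopeClass : ∀ (_ : ℕ) {E F : Type u}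
    [AddCommGroup E] [Module ℝ E] [TopologicalSpace E]
    [AddCommGroup F] [Module ℝ F] [TopologicalSpace F], Set E → (E → F) → Prop
  | 0, _, _, _, _, _, _, _, _, s, f => ContinuousOn f s
  | k + 1, E, F, _, _, _, _, _, _, s, f => ContinuousOn f s ∧ ∃ Φ : E × E × E → F,
      (∀ x ∈ s, ∀ y ∈ s, f y - f x = Φ (x, y, y - x)) ∧
      (∀ x ∈ s, ∀ y ∈ s, IsLinearMap ℝ fun v => Φ (x, y, v)) ∧
        SlopeClass k (s ×ˢ s ×ˢ (univ : Set E)) Φ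

namespace SlopeClass

section

variable {E E' F F' : Type u} [AddCommGroup E] [Module ℝ E] [TopologicalSpace E]
  [AddCommGroup E'] [Module ℝ E'] [TopologicalSpace E']
  [AddCommGroup F] [Module ℝ F] [TopologicalSpace F]
  [AddCommGroup F'] [Module ℝ F'] [TopologicalSpace F']

theorem continuousOn {k : ℕ} {s : Set E} {f : E → F} (h : SlopeClass k s f) :
    ContinuousOn f s := by
  cases k with
  | zero => exact h
  | succ k => exact h.1

theorem pred {k : ℕ} : ∀ {E F : Type u}
    [AddCommGroup E] [Module ℝ E] [TopologicalSpace E]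
    [AddCommGroup F] [Module ℝ F] [TopologicalSpace F] {s : Set E} {f : E → F},
    SlopeClass (k + 1) s f → SlopeClass k s f := by
  induction k with
  | zero => intro E F _ _ _ _ _ _ s f h; exact h.1
  | succ k ih =>
    rintro E F _ _ _ _ _ _ s f ⟨hc, Φ, h1, h2, h3⟩
    exact ⟨hc, Φ, h1, h2, ih h3⟩

theorem congr {k : ℕ} {s : Set E} {f g : E → F} (h : SlopeClass k s f) (hfg : EqOn g f s) :
    SlopeClass k s g := by
  cases k with
  | zero => exact ContinuousOn.congr h hfg
  | succ k =>
    obtain ⟨hc, Φ, h1, h2, h3⟩ := h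
    exact ⟨hc.congr hfg, Φ, fun x hx y hy => by rw [hfg hx, hfg hy, h1 x hx y hy], h2, h3⟩

theorem comp_clm {k : ℕ} : ∀ {E E' F : Type u}
    [AddCommGroup E] [Module ℝ E] [TopologicalSpace E]
    [AddCommGroup E'] [Module ℝ E'] [TopologicalSpace E']
    [AddCommGroup F] [Module ℝ F] [TopologicalSpace F] {s : Set E} {f : E → F}
    (_ : SlopeClass k s f) (l : E' →L[ℝ] E) {s' : Set E'} (_ : MapsTo l s' s),
    SlopeClass k s' (fun x => f (l x)) := by
  induction k with
  | zero =>
    intro E E' F _ _ _ _ _ _ _ _ _ s f h l s' hl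
    exact ContinuousOn.comp h l.continuous.continuousOn hl
  | succ k ih =>
    rintro E E' F _ _ _ _ _ _ _ _ _ s f ⟨hc, Φ, h1, h2, h3⟩ l s' hl
    refine ⟨hc.comp l.continuous.continuousOn hl, fun p => Φ (l p.1, l p.2.1, l p.2.2), ?_, ?_, ?_⟩
    · intro x hx y hy
      simp only [map_sub]
      exact h1 _ (hl hx) _ (hl hy)
    · intro x hx y hy
      have h := h2 _ (hl hx) _ (hl hy)
      exact ⟨fun v w => by simp only [map_add]; exact h.map_add _ _,
        fun c v => by simp only [map_smul]; exact h.map_smul _ _⟩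
    · exact ih h3 (l.prodMap (l.prodMap l)) fun p hp => ⟨hl hp.1, hl hp.2.1, mem_univ _⟩

theorem clm_comp {k : ℕ} : ∀ {E F F' : Type u}
    [AddCommGroup E] [Module ℝ E] [TopologicalSpace E]
    [AddCommGroup F] [Module ℝ F] [TopologicalSpace F]
    [AddCommGroup F'] [Module ℝ F'] [TopologicalSpace F'] {s : Set E} {f : E → F}
    (_ : SlopeClass k s f) (l : F →L[ℝ] F'), SlopeClass k s (fun x => l (f x)) := by
  induction k with
  | zero =>
    intro E F F' _ _ _ _ _ _ _ _ _ s f h l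
    exact l.continuous.comp_continuousOn h
  | succ k ih =>
    rintro E F F' _ _ _ _ _ _ _ _ _ s f ⟨hc, Φ, h1, h2, h3⟩ l
    refine ⟨l.continuous.comp_continuousOn hc, fun p => l (Φ p), ?_, ?_, ih h3 l⟩
    · intro x hx y hy
      rw [← map_sub, h1 x hx y hy]
    · intro x hx y hy
      have h := h2 x hx y hy
      exact ⟨fun v w => by rw [← map_add]; exact congrArg l (h.map_add _ _),
        fun c v => by rw [← map_smul]; exact congrArg l (h.map_smul _ _)⟩

theorem clm (k : ℕ) : ∀ {E F : Type u}
    [AddCommGroup E] [Module ℝ E] [TopologicalSpace E]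
    [AddCommGroup F] [Module ℝ F] [TopologicalSpace F] (s : Set E) (l : E →L[ℝ] F),
    SlopeClass k s l := by
  induction k with
  | zero => intro E F _ _ _ _ _ _ s l; exact l.continuous.continuousOn
  | succ k ih =>
    intro E F _ _ _ _ _ _ s l
    refine ⟨l.continuous.continuousOn, fun p => l p.2.2, fun x _ y _ => (map_sub l y x).symm,
      fun x _ y _ => ⟨map_add l, map_smul l⟩, ?_⟩
    exact ih _ (l.comp ((ContinuousLinearMap.snd ℝ E E).comp (ContinuousLinearMap.snd ℝ E (E × E))))

theorem const (k : ℕ) : ∀ {E F : Type u}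
    [AddCommGroup E] [Module ℝ E] [TopologicalSpace E]
    [AddCommGroup F] [Module ℝ F] [TopologicalSpace F] (s : Set E) (c : F),
    SlopeClass k s fun _ => c := by
  induction k with
  | zero => intro E F _ _ _ _ _ _ s c; exact continuousOn_const
  | succ k ih =>
    intro E F _ _ _ _ _ _ s c
    exact ⟨continuousOn_const, fun _ => 0, fun x _ y _ => sub_self c,
      fun x _ y _ => ⟨fun _ _ => (add_zero 0).symm, fun r _ => (smul_zero r).symm⟩, ih _ _⟩

theorem add {k : ℕ} : ∀ {E F : Type u}
    [AddCommGroup E] [Module ℝ E] [TopologicalSpace E]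
    [AddCommGroup F] [Module ℝ F] [TopologicalSpace F] [ContinuousAdd F] {s : Set E} {f g : E → F}
    (_ : SlopeClass k s f) (_ : SlopeClass k s g), SlopeClass k s (fun x => f x + g x) := by
  induction k with
  | zero =>
    intro E F _ _ _ _ _ _ _ s f g hf hg
    exact ContinuousOn.add hf hg
  | succ k ih =>
    rintro E F _ _ _ _ _ _ _ s f g ⟨hc, Φ, h1, h2, h3⟩ ⟨hc', Φ', h1', h2', h3'⟩
    refine ⟨hc.add hc', fun p => Φ p + Φ' p, ?_, ?_, ih h3 h3'⟩
    · intro x hx y hy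
      simp only
      rw [← h1 x hx y hy, ← h1' x hx y hy]
      abel
    · intro x hx y hy
      have h := h2 x hx y hy
      have h' := h2' x hx y hy
      refine ⟨fun v w => ?_, fun c v => ?_⟩
      · have e := h.map_add v w
        have e' := h'.map_add v w
        simp only at e e' ⊢
        rw [e, e']; abel
      · have e := h.map_smul c v
        have e' := h'.map_smul c v
        simp only at e e' ⊢
        rw [e, e', smul_add]

end

section Ring

variable {R : Type u} [Ring R] [Algebra ℝ R] [TopologicalSpace R] [ContinuousAdd R]
  [ContinuousMul R]

/-- The differences satisfy f(y)g(y) - f(x)g(x) = f(y)(g(y) - g(x)) + (f(y) - f(x))g(x), so the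
slope is a sum of products of slopes and of the functions themselves, all of class one lower. -/
theorem mul {k : ℕ} : ∀ {E : Type u} [AddCommGroup E] [Module ℝ E] [TopologicalSpace E]
    {s : Set E} {f g : E → R} (_ : SlopeClass k s f) (_ : SlopeClass k s g),
    SlopeClass k s (fun x => f x * g x) := by
  induction k with
  | zero =>
    intro E _ _ _ s f g hf hg
    exact ContinuousOn.mul hf hg
  | succ k ih =>
    intro E _ _ _ s f g hf hg
    have hf0 := hf.pred.comp_clm ((ContinuousLinearMap.fst ℝ E E).comp
      (ContinuousLinearMap.snd ℝ E (E × E))) (s' := s ×ˢ s ×ˢ univ) fun p hp => hp.2.1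
    have hg0 := hg.pred.comp_clm (ContinuousLinearMap.fst ℝ E (E × E)) (s' := s ×ˢ s ×ˢ univ)
      fun p hp => hp.1
    obtain ⟨hc, Φ, h1, h2, h3⟩ := hf
    obtain ⟨hc', Φ', h1', h2', h3'⟩ := hg
    refine ⟨hc.mul hc', fun p => f p.2.1 * Φ' p + Φ p * g p.1, ?_, ?_,
      (ih hf0 h3').add (ih h3 hg0)⟩
    · intro x hx y hy
      simp only
      rw [← h1 x hx y hy, ← h1' x hx y hy]
      noncomm_ring
    · intro x hx y hy
      have h := h2 x hx y hy
      have h' := h2' x hx y hy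
      refine ⟨fun v w => ?_, fun c v => ?_⟩
      · have e := h.map_add v w
        have e' := h'.map_add v w
        simp only at e e' ⊢
        rw [e, e']; noncomm_ring
      · have e := h.map_smul c v
        have e' := h'.map_smul c v
        simp only at e e' ⊢
        rw [e, e', smul_add, mul_smul_comm, smul_mul_assoc]

/-- By y⁻¹ - x⁻¹ = -x⁻¹(y - x)y⁻¹ the slope is a product of inverses and the slope of `f`.
Continuity of inversion is therefore the only analytic input, at every order. -/
theorem inverse (hinv : ContinuousOn (Ring.inverse : R → R) {x | IsUnit x}) {k : ℕ} :
    ∀ {E : Type u} [AddCommGroup E] [Module ℝ E] [TopologicalSpace E]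
    {s : Set E} {f : E → R} (_ : SlopeClass k s f) (_ : ∀ x ∈ s, IsUnit (f x)),
    SlopeClass k s (fun x => Ring.inverse (f x)) := by
  induction k with
  | zero =>
    intro E _ _ _ s f hf hu
    exact hinv.comp hf hu
  | succ k ih =>
    intro E _ _ _ s f hf hu
    have h0 := ih hf.pred hu
    have hy := h0.comp_clm ((ContinuousLinearMap.fst ℝ E E).comp
      (ContinuousLinearMap.snd ℝ E (E × E))) (s' := s ×ˢ s ×ˢ univ) fun p hp => hp.2.1
    have hx := h0.comp_clm (ContinuousLinearMap.fst ℝ E (E × E)) (s' := s ×ˢ s ×ˢ univ)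
      fun p hp => hp.1
    obtain ⟨hc, Φ, h1, h2, h3⟩ := hf
    refine ⟨h0.continuousOn, fun p => (-1) * Ring.inverse (f p.1) * Φ p * Ring.inverse (f p.2.1),
      ?_, ?_, (((const k _ (-1 : R)).mul hx).mul h3).mul hy⟩
    · intro x hx y hy
      simp only
      rw [← h1 x hx y hy, neg_one_mul, neg_mul, neg_mul, mul_sub, Ring.inverse_mul_cancel _ (hu x hx),
        sub_mul, mul_assoc, Ring.mul_inverse_cancel _ (hu y hy), one_mul, mul_one, neg_sub]
    · intro x hx y hy
      have h := h2 x hx y hy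
      refine ⟨fun v w => ?_, fun c v => ?_⟩
      · have e := h.map_add v w
        simp only at e ⊢
        rw [e]; noncomm_ring
      · have e := h.map_smul c v
        simp only at e ⊢
        rw [e, mul_smul_comm, smul_mul_assoc]

end Ring

section Derivative

variable {E F : Type u} [AddCommGroup E] [Module ℝ E] [TopologicalSpace E]
  [IsTopologicalAddGroup E] [ContinuousSMul ℝ E]
  [AddCommGroup F] [Module ℝ F] [TopologicalSpace F]

theorem eventually_mem {𝕜 : Type*} [NontriviallyNormedField 𝕜] {E : Type*} [AddCommGroup E]
    [Module 𝕜 E] [TopologicalSpace E] [ContinuousAdd E] [ContinuousSMul 𝕜 E] {s : Set E}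
    (hs : IsOpen s) {x : E} (hx : x ∈ s) (v : E) :
    Tendsto (fun t : 𝕜 => x + t • v) (𝓝[≠] 0) (𝓝[s] x) := by
  have hc : Continuous fun t : 𝕜 => x + t • v := by fun_prop
  have ht : Tendsto (fun t : 𝕜 => x + t • v) (𝓝 0) (𝓝 x) := by
    have := hc.tendsto 0
    simpa using this
  rw [hs.nhdsWithin_eq hx]
  exact ht.mono_left nhdsWithin_le_nhds

/-- The slope `Φ` gives the directional derivatives. -/
theorem hasDirDeriv_of_slope {s : Set E} (hs : IsOpen s) {f : E → F} {Φ : E × E × E → F}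
    (h1 : ∀ x ∈ s, ∀ y ∈ s, f y - f x = Φ (x, y, y - x))
    (h2 : ∀ x ∈ s, ∀ y ∈ s, IsLinearMap ℝ fun v => Φ (x, y, v))
    (h3 : ContinuousOn Φ (s ×ˢ s ×ˢ univ)) {x : E} (hx : x ∈ s) (v : E) :
    HasDirDeriv ℝ f x v (Φ (x, x, v)) := by
  have hm := eventually_mem (𝕜 := ℝ) hs hx v
  -- By linearity in the last argument the difference quotient equals Φ(x, x + tv, v), so only
  -- continuity of Φ is needed.
  have hlim : Tendsto (fun t : ℝ => Φ (x, x + t • v, v)) (𝓝[≠] 0) (𝓝 (Φ (x, x, v))) := by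
    have hcont : ContinuousOn (fun y => Φ (x, y, v)) s :=
      h3.comp (by fun_prop) fun y hy => ⟨hx, hy, mem_univ _⟩
    exact (hcont x hx).tendsto.comp hm
  refine hlim.congr' ?_
  have hin : ∀ᶠ t : ℝ in 𝓝[≠] 0, x + t • v ∈ s := hm.eventually self_mem_nhdsWithin
  filter_upwards [hin, self_mem_nhdsWithin] with t ht ht0
  have ht0' : t ≠ 0 := ht0
  have e := (h2 x hx _ ht).map_smul t v
  rw [h1 x hx _ ht, add_sub_cancel_left, e, smul_smul, inv_mul_cancel₀ ht0', one_smul]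

end Derivative

/-- The derivative is the slope on the diagonal, (x, v) ↦ Φ(x, x, v): a composition with a
continuous linear map, hence again of slope class. -/
theorem isClass {k : ℕ} : ∀ {E F : Type u} [AddCommGroup E] [Module ℝ E] [TopologicalSpace E]
    [IsTopologicalAddGroup E] [ContinuousSMul ℝ E]
    [AddCommGroup F] [Module ℝ F] [TopologicalSpace F] {s : Set E} {f : E → F} (_ : IsOpen s)
    (_ : SlopeClass k s f), IsClass ℝ k s f := by
  induction k with
  | zero => intro E F _ _ _ _ _ _ _ _ s f _ h; exact h
  | succ k ih =>
    rintro E F _ _ _ _ _ _ _ _ s f hs ⟨hc, Φ, h1, h2, h3⟩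
    refine ⟨hc, fun p => Φ (p.1, p.1, p.2), fun x hx v =>
      hasDirDeriv_of_slope hs h1 h2 h3.continuousOn hx v, ih (hs.prod isOpen_univ) ?_⟩
    exact h3.comp_clm ((ContinuousLinearMap.fst ℝ E E).prod
      ((ContinuousLinearMap.fst ℝ E E).prod (ContinuousLinearMap.snd ℝ E E)))
      fun p hp => ⟨hp.1, hp.1, mem_univ _⟩

theorem isSmoothOn {E F : Type u} [AddCommGroup E] [Module ℝ E] [TopologicalSpace E]
    [IsTopologicalAddGroup E] [ContinuousSMul ℝ E]
    [AddCommGroup F] [Module ℝ F] [TopologicalSpace F] {s : Set E} {f : E → F} (hs : IsOpen s)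
    (h : ∀ k, SlopeClass k s f) : IsSmoothOn ℝ s f :=
  fun k => isClass hs (h k)

/-! ### Holomorphy from real slopes -/

section Complex

theorem continuousSMul_real (E : Type*) [AddCommGroup E] [Module ℂ E] [TopologicalSpace E]
    [ContinuousSMul ℂ E] : ContinuousSMul ℝ E :=
  ⟨by
    have h : Continuous fun p : ℝ × E => (p.1 : ℂ) • p.2 := by fun_prop
    exact h⟩

/-- A directional derivative along `ℂ` exists where the slope has a complex-linear limit. -/
theorem hasDirDeriv_complex_of_slope {E F : Type u} [AddCommGroup E] [Module ℂ E]
    [TopologicalSpace E] [IsTopologicalAddGroup E] [ContinuousSMul ℂ E]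
    [AddCommGroup F] [Module ℂ F] [TopologicalSpace F] [IsTopologicalAddGroup F]
    [ContinuousSMul ℂ F] {s : Set E} (hs : IsOpen s) {f : E → F} {Φ : E × E × E → F}
    (h1 : ∀ x ∈ s, ∀ y ∈ s, f y - f x = Φ (x, y, y - x))
    (h2 : ∀ x ∈ s, ∀ y ∈ s, IsLinearMap ℝ fun v => Φ (x, y, v))
    (h3 : ContinuousOn Φ (s ×ˢ s ×ˢ univ)) {x : E} (hx : x ∈ s) (v : E)
    (hI : Φ (x, x, Complex.I • v) = Complex.I • Φ (x, x, v)) :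
    HasDirDeriv ℂ f x v (Φ (x, x, v)) := by
  have hm := eventually_mem (𝕜 := ℂ) hs hx v
  have hlim : ∀ w, Tendsto (fun t : ℂ => Φ (x, x + t • v, w) - Φ (x, x, w)) (𝓝[≠] 0) (𝓝 0) := by
    intro w
    have hcont : ContinuousOn (fun y => Φ (x, y, w)) s :=
      h3.comp (by fun_prop) fun y hy => ⟨hx, hy, mem_univ _⟩
    have := ((hcont x hx).tendsto.comp hm).sub_const (Φ (x, x, w))
    simpa using this
  -- The coefficients Re t / t and Im t / t stay in the closed unit disc. Compactness of the disc
  -- replaces a norm on `F` in showing that bounded multiples of a null family tend to 0.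
  have hsm : ∀ (r : ℂ → ℝ) (_ : ∀ t, |r t| ≤ ‖t‖) (w : E), Tendsto (fun t : ℂ => (t⁻¹ * (r t : ℂ)) •
      (Φ (x, x + t • v, w) - Φ (x, x, w))) (𝓝[≠] 0) (𝓝 0) := by
    intro r hr w
    have hb : ∀ t : ℂ, t⁻¹ * (r t : ℂ) ∈ Metric.closedBall (0 : ℂ) 1 := by
      intro t
      rw [mem_closedBall_zero_iff, norm_mul, norm_inv, Complex.norm_real, Real.norm_eq_abs]
      rcases eq_or_ne t 0 with rfl | ht
      · simp
      · rw [inv_mul_le_iff₀ (norm_pos_iff.2 ht), mul_one]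
        exact hr t
    have hK : IsCompact (Metric.closedBall (0 : ℂ) 1) := isCompact_closedBall 0 1
    rw [tendsto_def]
    intro N hN
    have hN' : ∀ᶠ y in 𝓝 (0 : F), ∀ c ∈ Metric.closedBall (0 : ℂ) 1, c • y ∈ N := by
      refine hK.eventually_forall_of_forall_eventually fun c _ => ?_
      have hcs : Continuous fun z : F × ℂ => z.2 • z.1 := by fun_prop
      have := hcs.tendsto (0, c)
      simp only [smul_zero] at this
      exact this hN
    filter_upwards [(hlim w).eventually hN'] with t ht
    exact ht _ (hb t)
  have hfin := ((hsm Complex.re Complex.abs_re_le_norm v).add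
    (hsm Complex.im Complex.abs_im_le_norm (Complex.I • v))).add_const (Φ (x, x, v))
  rw [add_zero, zero_add] at hfin
  refine hfin.congr' ?_
  have hin : ∀ᶠ t : ℂ in 𝓝[≠] 0, x + t • v ∈ s := hm.eventually self_mem_nhdsWithin
  filter_upwards [hin, self_mem_nhdsWithin] with t ht ht0
  have ht0' : t ≠ 0 := ht0
  have e := (h2 x hx _ ht).map_smul
  have e' := (h2 x hx _ ht).map_add
  -- Off the diagonal the slope is only real linear, so t is split into its real and imaginary part.
  have et : t • v = (t.re : ℝ) • v + (t.im : ℝ) • (Complex.I • v) := by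
    rw [← Complex.coe_smul, ← Complex.coe_smul, smul_smul, ← add_smul, Complex.re_add_im]
  have key : t⁻¹ • f (x + t • v) - t⁻¹ • f x = t⁻¹ • ((t.re : ℂ) • Φ (x, x + t • v, v) +
      (t.im : ℂ) • Φ (x, x + t • v, Complex.I • v)) := by
    rw [← smul_sub, h1 x hx _ ht, add_sub_cancel_left]
    congr 1
    conv_lhs => rw [show Φ (x, x + t • v, t • v) =
      Φ (x, x + t • v, (t.re : ℝ) • v + (t.im : ℝ) • (Complex.I • v)) from by rw [← et]]
    rw [e', e, e, Complex.coe_smul, Complex.coe_smul]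
  rw [smul_sub t⁻¹, key, hI]
  -- On the diagonal, complex linearity recombines the two coefficients: Re t / t + i · Im t / t =
  -- 1.
  have h1' : t⁻¹ * (t.re : ℂ) + t⁻¹ * (t.im : ℂ) * Complex.I = 1 := by
    rw [mul_assoc, ← mul_add, Complex.re_add_im, inv_mul_cancel₀ ht0']
  have h2' : Φ (x, x, v) = (t⁻¹ * (t.re : ℂ)) • Φ (x, x, v) +
      (t⁻¹ * (t.im : ℂ)) • Complex.I • Φ (x, x, v) := by
    rw [smul_smul, ← add_smul, h1', one_smul]
  calc _ = (t⁻¹ * (t.re : ℂ)) • Φ (x, x + t • v, v) + (t⁻¹ * (t.im : ℂ)) • Φ (x, x + t • v,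
        Complex.I • v) - ((t⁻¹ * (t.re : ℂ)) • Φ (x, x, v) +
        (t⁻¹ * (t.im : ℂ)) • Complex.I • Φ (x, x, v)) + Φ (x, x, v) := by
        rw [smul_sub, smul_sub]; abel
    _ = _ := by rw [← h2', sub_add_cancel, smul_add, smul_smul, smul_smul]

/-- The slopes of a slope are symmetric on the diagonal. -/
theorem slope_symm {E F : Type u} [AddCommGroup E] [Module ℝ E]
    [TopologicalSpace E] [IsTopologicalAddGroup E] [ContinuousSMul ℝ E]
    [AddCommGroup F] [Module ℝ F] [TopologicalSpace F] [T2Space F]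
    {s : Set E} (hs : IsOpen s) {f : E → F} {Φ : E × E × E → F}
    (h1 : ∀ x ∈ s, ∀ y ∈ s, f y - f x = Φ (x, y, y - x))
    (h2 : ∀ x ∈ s, ∀ y ∈ s, IsLinearMap ℝ fun v => Φ (x, y, v))
    {Ψ : (E × E × E) × (E × E × E) × (E × E × E) → F}
    (h1' : ∀ p ∈ s ×ˢ s ×ˢ (univ : Set E), ∀ q ∈ s ×ˢ s ×ˢ (univ : Set E),
      Φ q - Φ p = Ψ (p, q, q - p))
    (h2' : ∀ p ∈ s ×ˢ s ×ˢ (univ : Set E), ∀ q ∈ s ×ˢ s ×ˢ (univ : Set E),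
      IsLinearMap ℝ fun v => Ψ (p, q, v))
    (h3' : ContinuousOn Ψ ((s ×ˢ s ×ˢ univ) ×ˢ (s ×ˢ s ×ˢ univ) ×ˢ univ))
    {x : E} (hx : x ∈ s) (u v : E) :
    Ψ ((x, x, v), (x, x, v), (u, u, 0)) = Ψ ((x, x, u), (x, x, u), (v, v, 0)) := by
  -- The second difference over the parallelogram spanned by tu and tv is t² times a second slope:
  -- one factor t comes from linearity of Φ, the other from linearity of Ψ.
  have main : ∀ u v : E, ∀ t : ℝ, x + t • u ∈ s → x + t • v ∈ s → x + t • u + t • v ∈ s → 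
      (f (x + t • u + t • v) - f (x + t • u)) - (f (x + t • v) - f x) =
      (t * t) • Ψ ((x, x + t • v, v), (x + t • u, x + t • u + t • v, v), (u, u, 0)) := by
    intro u v t ha hb hc
    rw [h1 _ ha _ hc, h1 _ hx _ hb, add_sub_cancel_left, add_sub_cancel_left]
    have e1 := (h2 _ ha _ hc).map_smul t v
    have e2 := (h2 _ hx _ hb).map_smul t v
    rw [e1, e2, ← smul_sub, h1' (x, x + t • v, v) ⟨hx, hb, mem_univ _⟩
      (x + t • u, x + t • u + t • v, v) ⟨ha, hc, mem_univ _⟩, mul_smul]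
    have e3 := (h2' (x, x + t • v, v) ⟨hx, hb, mem_univ _⟩
      (x + t • u, x + t • u + t • v, v) ⟨ha, hc, mem_univ _⟩).map_smul t (u, u, 0)
    rw [← e3]
    congr 3
    simp only [Prod.mk_sub_mk, Prod.smul_mk, smul_zero, sub_self, add_sub_cancel_left]
    rw [add_right_comm, add_sub_cancel_left]
  have hev : ∀ u v : E, ∀ᶠ t : ℝ in 𝓝[≠] 0, x + t • u + t • v ∈ s := by
    intro u v
    have hc : Continuous fun t : ℝ => x + t • u + t • v := by fun_prop
    have := hc.tendsto 0
    simp only [zero_smul, add_zero] at this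
    exact (this.mono_left nhdsWithin_le_nhds).eventually (hs.mem_nhds hx)
  have hl : ∀ u v : E, Tendsto (fun t : ℝ =>
      Ψ ((x, x + t • v, v), (x + t • u, x + t • u + t • v, v), (u, u, 0))) (𝓝[≠] 0)
      (𝓝 (Ψ ((x, x, v), (x, x, v), (u, u, 0)))) := by
    intro u v
    have hc : Continuous fun t : ℝ => (((x, x + t • v, v), (x + t • u, x + t • u + t • v, v),
      (u, u, 0)) : (E × E × E) × (E × E × E) × (E × E × E)) := by fun_prop
    have h0 := (hc.tendsto 0).mono_left (nhdsWithin_le_nhds (s := {0}ᶜ))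
    simp only [zero_smul, add_zero] at h0
    refine (h3' ((x, x, v), (x, x, v), (u, u, 0))
      ⟨⟨hx, hx, mem_univ _⟩, ⟨hx, hx, mem_univ _⟩, mem_univ _⟩).tendsto.comp ?_
    refine tendsto_nhdsWithin_iff.2 ⟨h0, ?_⟩
    have hu := hev u 0
    have hv := hev 0 v
    simp only [smul_zero, add_zero] at hu hv
    filter_upwards [hu, hv, hev u v] with t a b c
    exact ⟨⟨hx, b, mem_univ _⟩, ⟨a, c, mem_univ _⟩, mem_univ _⟩
  refine tendsto_nhds_unique (hl u v) ((hl v u).congr' ?_)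
  have hu := hev u 0
  have hv := hev 0 v
  simp only [smul_zero, add_zero] at hu hv
  filter_upwards [hu, hv, hev u v, hev v u, self_mem_nhdsWithin] with t a b c d ht0
  have ht : t * t ≠ 0 := mul_ne_zero ht0 ht0
  have e1 := main u v t a b c
  have e2 := main v u t b a d
  -- The second difference does not depend on the order of u and v; cancelling t² and letting t tend
  -- to 0 gives the symmetry.
  have e3 : (f (x + t • u + t • v) - f (x + t • u)) - (f (x + t • v) - f x) =
      (f (x + t • v + t • u) - f (x + t • v)) - (f (x + t • u) - f x) := by
    rw [show x + t • u + t • v = x + t • v + t • u by abel]; abel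
  rw [e1, e2] at e3
  exact ((smul_right_injective F ht) e3).symm

/-- The derivative of Φ(x, x, v) along (u, w) is a second derivative in (u, v) plus Φ(x, x, w). The
latter is complex linear in w. The former is complex linear in v, and by symmetry also in u, so the
hypothesis passes to the derivative. This uses a second slope, hence the surplus order. -/
theorem isClass_complex {k : ℕ} : ∀ {E F : Type u} [AddCommGroup E] [Module ℂ E]
    [TopologicalSpace E] [IsTopologicalAddGroup E] [ContinuousSMul ℂ E]
    [AddCommGroup F] [Module ℂ F] [TopologicalSpace F] [IsTopologicalAddGroup F]
    [ContinuousSMul ℂ F] [T2Space F] {s : Set E} {f : E → F} (_ : IsOpen s)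
    (_ : SlopeClass (k + 1) s f)
    (_ : ∀ x ∈ s, ∀ v w, HasDirDeriv ℝ f x v w → HasDirDeriv ℝ f x (Complex.I • v) (Complex.I • w)),
    IsClass ℂ k s f := by
  induction k with
  | zero => intro E F _ _ _ _ _ _ _ _ _ _ _ s f _ h _; exact h.1
  | succ k ih =>
    rintro E F _ _ _ _ _ _ _ _ _ _ _ s f hs ⟨hc, Φ, h1, h2, h3⟩ hI
    have := continuousSMul_real E
    have hΦ : ∀ x ∈ s, ∀ v, Φ (x, x, Complex.I • v) = Complex.I • Φ (x, x, v) := fun x hx v =>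
      tendsto_nhds_unique (hasDirDeriv_of_slope hs h1 h2 h3.continuousOn hx (Complex.I • v))
        (hI x hx v _ (hasDirDeriv_of_slope hs h1 h2 h3.continuousOn hx v))
    have hdf := h3.comp_clm ((ContinuousLinearMap.fst ℝ E E).prod
      ((ContinuousLinearMap.fst ℝ E E).prod (ContinuousLinearMap.snd ℝ E E)))
      (s' := s ×ˢ univ) fun p hp => ⟨hp.1, hp.1, mem_univ _⟩
    refine ⟨hc, fun p => Φ (p.1, p.1, p.2), fun x hx v =>
      hasDirDeriv_complex_of_slope hs h1 h2 h3.continuousOn hx v (hΦ x hx v),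
      ih (hs.prod isOpen_univ) hdf ?_⟩
    rintro ⟨x, v⟩ hxv ⟨u, w⟩ z hz
    have hx : x ∈ s := hxv.1
    obtain ⟨hcΦ, Ψ, k1, k2, k3⟩ := h3
    have hso : IsOpen (s ×ˢ s ×ˢ (univ : Set E)) := hs.prod (hs.prod isOpen_univ)
    have hp : ∀ v, ((x, x, v) : E × E × E) ∈ s ×ˢ s ×ˢ (univ : Set E) := fun v =>
      ⟨hx, hx, mem_univ _⟩
    have hder : ∀ v u w : E, HasDirDeriv ℝ (fun p : E × E => Φ (p.1, p.1, p.2)) (x, v) (u, w)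
        (Ψ ((x, x, v), (x, x, v), (u, u, w))) := fun v u w =>
      hasDirDeriv_of_slope hso k1 k2 k3.continuousOn (hp v) (u, u, w)
    have hz' : z = Ψ ((x, x, v), (x, x, v), (u, u, w)) :=
      tendsto_nhds_unique hz (hder v u w)
    have hsplit : ∀ v u w : E, Ψ ((x, x, v), (x, x, v), (u, u, w)) =
        Ψ ((x, x, v), (x, x, v), (u, u, 0)) + Ψ ((x, x, v), (x, x, v), (0, 0, w)) := by
      intro v u w
      have := (k2 _ (hp v) _ (hp v)).map_add (u, u, 0) (0, 0, w)
      simpa using this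
    -- Φ is linear in its last argument, so its difference quotients in that direction are constant.
    have hlin : ∀ v w : E, Ψ ((x, x, v), (x, x, v), (0, 0, w)) = Φ (x, x, w) := by
      intro v w
      refine tendsto_nhds_unique (hder v 0 w) (tendsto_const_nhds.congr' ?_)
      filter_upwards [self_mem_nhdsWithin] with t ht
      have e := (h2 x hx x hx).map_smul t w
      have e' := (h2 x hx x hx).map_add v (t • w)
      simp only [Prod.mk_add_mk, Prod.smul_mk, smul_zero, add_zero] at e e' ⊢
      rw [e', e, add_sub_cancel_left, smul_smul, inv_mul_cancel₀ ht, one_smul]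
    have hsymm := fun u v => slope_symm hs h1 h2 k1 k2 k3.continuousOn hx u v
    -- This differentiates Φ(y, y, iv) = iΦ(y, y, v) in the base point y along u.
    have hIv : ∀ v u : E, Ψ ((x, x, Complex.I • v), (x, x, Complex.I • v), (u, u, 0)) =
        Complex.I • Ψ ((x, x, v), (x, x, v), (u, u, 0)) := by
      intro v u
      refine tendsto_nhds_unique (hder (Complex.I • v) u 0)
        (((hder v u 0).const_smul Complex.I).congr' ?_)
      have hin : ∀ᶠ t : ℝ in 𝓝[≠] 0, x + t • u ∈ s :=
        (eventually_mem hs hx u).eventually self_mem_nhdsWithin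
      filter_upwards [hin] with t ht
      simp only [Prod.mk_add_mk, Prod.smul_mk, smul_zero, add_zero]
      rw [hΦ _ ht, hΦ _ hx, smul_comm, smul_sub]
    have hgoal : Complex.I • z = Ψ ((x, x, v), (x, x, v),
        (Complex.I • u, Complex.I • u, Complex.I • w)) := by
      rw [hz', hsplit, hsplit v (Complex.I • u), hlin, hlin, hΦ x hx, smul_add,
        hsymm (Complex.I • u) v, hIv, hsymm u v]
    rw [hgoal]
    exact hder v (Complex.I • u) (Complex.I • w)

theorem isSmoothOn_complex {E F : Type u} [AddCommGroup E] [Module ℂ E]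
    [TopologicalSpace E] [IsTopologicalAddGroup E] [ContinuousSMul ℂ E]
    [AddCommGroup F] [Module ℂ F] [TopologicalSpace F] [IsTopologicalAddGroup F]
    [ContinuousSMul ℂ F] [T2Space F] {s : Set E} {f : E → F} (hs : IsOpen s)
    (h : ∀ k, SlopeClass k s f)
    (hI : ∀ x ∈ s, ∀ v w, HasDirDeriv ℝ f x v w →
      HasDirDeriv ℝ f x (Complex.I • v) (Complex.I • w)) :
    IsSmoothOn ℂ s f :=
  fun k => isClass_complex hs (h (k + 1)) hI

end Complex

end SlopeClass

/-! ### Fréchet spaces -/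

/-- Cauchy filters of a topological abelian group. -/
def AddCauchy {E : Type*} [AddCommGroup E] [TopologicalSpace E] (F : Filter E) : Prop :=
  F.NeBot ∧ Tendsto (fun p : E × E => p.2 - p.1) (F ×ˢ F) (𝓝 0)

/-- Completeness of a topological abelian group, without reference to a uniform structure. -/
def AddComplete (E : Type*) [AddCommGroup E] [TopologicalSpace E] : Prop :=
  ∀ F : Filter E, AddCauchy F → ∃ x, F ≤ 𝓝 x

theorem AddCauchy.map {E E' : Type*} [AddCommGroup E] [TopologicalSpace E] [AddCommGroup E']
    [TopologicalSpace E'] {F : Filter E} (hF : AddCauchy F) (f : E →+ E') (hf : Continuous f) :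
    AddCauchy (F.map f) := by
  have := hF.1
  refine ⟨inferInstance, ?_⟩
  rw [Filter.prod_map_map_eq, tendsto_map'_iff]
  have h0 : Tendsto f (𝓝 0) (𝓝 0) := by simpa using hf.tendsto 0
  exact (h0.comp hF.2).congr fun p => by simp

theorem addCauchy_iff_cauchy {E : Type*} [AddCommGroup E] [UniformSpace E] [IsUniformAddGroup E]
    {F : Filter E} : AddCauchy F ↔ Cauchy F := by
  rw [AddCauchy, Cauchy, uniformity_eq_comap_nhds_zero, ← tendsto_iff_comap]

theorem addComplete_of_completeSpace (E : Type*) [AddCommGroup E] [UniformSpace E]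
    [IsUniformAddGroup E] [CompleteSpace E] : AddComplete E := fun _ hF =>
  CompleteSpace.complete (addCauchy_iff_cauchy.1 hF)

theorem addComplete_iff (E : Type*) [AddCommGroup E] [TopologicalSpace E]
    [IsTopologicalAddGroup E] :
    AddComplete E ↔ @CompleteSpace E (IsTopologicalAddGroup.rightUniformSpace E) := by
  let _ := IsTopologicalAddGroup.rightUniformSpace E
  have := isUniformAddGroup_of_addCommGroup (G := E)
  exact ⟨fun h => ⟨fun hF => h _ (addCauchy_iff_cauchy.2 hF)⟩,
    fun _ => addComplete_of_completeSpace E⟩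

theorem AddComplete.pi {ι : Type*} {E : ι → Type*} [∀ i, AddCommGroup (E i)]
    [∀ i, TopologicalSpace (E i)] (h : ∀ i, AddComplete (E i)) : AddComplete (∀ i, E i) := by
  intro F hF
  choose x hx using fun i => h i _ (hF.map (Pi.evalAddMonoidHom E i) (continuous_apply i))
  exact ⟨x, tendsto_pi_nhds.2 hx⟩

/-- The limit is found in `F` and carried back by `r`, which need not be additive. -/
theorem AddComplete.retract {E F : Type*} [AddCommGroup E] [TopologicalSpace E] [AddCommGroup F]
    [TopologicalSpace F] (hF : AddComplete F) (f : E →+ F) (r : F → E) (hf : Continuous f)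
    (hr : Continuous r) (h : ∀ x, r (f x) = x) : AddComplete E := by
  intro G hG
  obtain ⟨y, hy⟩ := hF _ (hG.map f hf)
  refine ⟨r y, ?_⟩
  have := (hr.tendsto y).comp (show Tendsto f G (𝓝 y) from hy)
  exact (this.congr h : Tendsto id G _)

theorem IsFrechetSpace.addComplete {E : Type*} [AddCommGroup E] [Module ℝ E] [TopologicalSpace E]
    (h : IsFrechetSpace E) : AddComplete E :=
  have := h.addGroup
  (addComplete_iff E).2 h.complete

theorem IsFrechetSpace.t2 {E : Type*} [AddCommGroup E] [Module ℝ E] [TopologicalSpace E]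
    (h : IsFrechetSpace E) : T2Space E :=
  have := h.metrizable
  inferInstance

theorem IsFrechetSpace.of_addComplete {E : Type*} [AddCommGroup E] [Module ℝ E]
    [TopologicalSpace E] (h1 : IsTopologicalAddGroup E) (h2 : ContinuousSMul ℝ E)
    (h3 : LocallyConvexSpace ℝ E) (h4 : MetrizableSpace E) (h5 : AddComplete E) :
    IsFrechetSpace E :=
  ⟨h1, h2, h3, h4, (addComplete_iff E).1 h5⟩

/-- A continuous left inverse makes `f` an embedding, and every defining property is inherited.
Tensors (from finite powers), even tensors (from tensors) and tangent spaces (from the algebra)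
become Fréchet spaces in this way. -/
theorem IsFrechetSpace.retract {E F : Type*} [AddCommGroup E] [Module ℝ E] [TopologicalSpace E]
    [AddCommGroup F] [Module ℝ F] [TopologicalSpace F] (hF : IsFrechetSpace F) (f : E →ₗ[ℝ] F)
    (r : F → E) (hf : Continuous f) (hr : Continuous r) (h : ∀ x, r (f x) = x) :
    IsFrechetSpace E := by
  have he : IsEmbedding f := Function.LeftInverse.isEmbedding h hr hf
  have := hF.addGroup
  have := hF.smul
  have := hF.convex
  have := hF.metrizable
  have h1 : IsTopologicalAddGroup E := by
    rw [he.eq_induced]; exact topologicalAddGroup_induced f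
  refine .of_addComplete h1 ?_ ?_ he.metrizableSpace
    (hF.addComplete.retract f.toAddMonoidHom r hf hr h)
  · rw [he.eq_induced]; exact continuousSMul_induced f
  · rw [he.eq_induced]; exact .induced f

theorem IsFrechetSpace.pi {ι : Type*} [Finite ι] {E : ι → Type*} [∀ i, AddCommGroup (E i)]
    [∀ i, Module ℝ (E i)] [∀ i, TopologicalSpace (E i)] (h : ∀ i, IsFrechetSpace (E i)) :
    IsFrechetSpace (∀ i, E i) := by
  have := Fintype.ofFinite ι
  have := fun i => (h i).addGroup
  have := fun i => (h i).smul
  have := fun i => (h i).convex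
  have := fun i => (h i).metrizable
  exact .of_addComplete inferInstance inferInstance inferInstance inferInstance
    (.pi fun i => (h i).addComplete)

/-! ### Continuity of inversion -/

section Inverse

variable {R : Type*} [Ring R]

theorem isUnit_of_mul_left {x y : R} (hx : IsUnit x) (h : IsUnit (x * y)) : IsUnit y := by
  obtain ⟨u, rfl⟩ := hx
  simpa using h

theorem inverse_eq_of_mul {x y : R} (hx : IsUnit x) (h : x * y = 1) : Ring.inverse x = y := by
  rw [← mul_one (Ring.inverse x), ← h, ← mul_assoc, Ring.inverse_mul_cancel _ hx, one_mul]

theorem isOpen_units_of_mem_nhds_one [TopologicalSpace R] [ContinuousMul R]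
    (h : {x : R | IsUnit x} ∈ 𝓝 1) : IsOpen {x : R | IsUnit x} := by
  rw [isOpen_iff_mem_nhds]
  rintro _ ⟨u, rfl⟩
  have hc : Continuous fun x : R => ((u⁻¹ : Rˣ) : R) * x := by fun_prop
  have ht := hc.tendsto (u : R)
  rw [Units.inv_mul] at ht
  filter_upwards [ht h] with x hx
  exact isUnit_of_mul_left (u⁻¹).isUnit hx

/-- A sequence of units of a complete metrizable ring with limit `1` has a subsequence whose inverses
converge to `1`, if all elements close to `1` are units. -/
theorem exists_subseq_inverse_tendsto [PseudoMetricSpace R] [CompleteSpace R] [T2Space R]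
    [ContinuousMul R] (h : {x : R | IsUnit x} ∈ 𝓝 1) {x : ℕ → R}
    (hx : Tendsto x atTop (𝓝 1)) (hu : ∀ k, IsUnit (x k)) :
    ∃ c : ℕ → ℕ, Tendsto (fun k => Ring.inverse (x (c k))) atTop (𝓝 1) := by
  classical
  obtain ⟨δ, hδ, hball⟩ := Metric.mem_nhds_iff.1 h
  -- Right multiplication by a late x_j moves finitely many given p as little as desired. Finite
  -- sets are used because the metric need not give an estimate uniform in p.
  have hex : ∀ (S : Finset R) (k : ℕ), ∃ j, ∀ p ∈ S, dist p (p * x j) ≤ δ / 2 / 2 / 2 ^ k := by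
    intro S k
    have hev : ∀ᶠ j in atTop, ∀ p ∈ S, dist p (p * x j) < δ / 2 / 2 / 2 ^ k := by
      rw [Finset.eventually_all]
      intro p _
      have ht : Tendsto (fun j => dist p (p * x j)) atTop (𝓝 0) := by
        have := (hx.const_mul p).dist (tendsto_const_nhds (x := p))
        simpa [dist_comm] using this
      exact ht.eventually (gt_mem_nhds (by positivity))
    obtain ⟨j, hj⟩ := hev.exists
    exact ⟨j, fun p hp => (hj p hp).le⟩
  choose c hc using hex
  -- With y_k the element chosen at stage k, S k consists of 1 and all products y_i ⋯ y_{k-1} with i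
  -- < k; the next factor has to be harmless for all of them.
  let S : ℕ → Finset R := fun k => k.rec {1} fun k S => insert 1 (S.image fun p => p * x (c S k))
  have hS1 : ∀ k, (1 : R) ∈ S k := by
    intro k
    cases k with
    | zero => simp [S]
    | succ k => simp [S]
  let y : ℕ → R := fun k => x (c (S k) k)
  have hSs : ∀ k, S (k + 1) = insert 1 ((S k).image fun p => p * y k) := fun k => rfl
  -- The partial product y_i ⋯ y_{i+j-1}.
  let Q : ℕ → ℕ → R := fun i j => j.rec 1 fun j q => q * y (i + j)
  have hQ0 : ∀ i, Q i 0 = 1 := fun i => rfl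
  have hQs : ∀ i j, Q i (j + 1) = Q i j * y (i + j) := fun i j => rfl
  have hQS : ∀ i j, Q i j ∈ S (i + j) := by
    intro i j
    induction j with
    | zero => rw [hQ0]; exact hS1 _
    | succ j ih =>
      rw [hQs, ← add_assoc, hSs]
      exact Finset.mem_insert_of_mem (Finset.mem_image_of_mem _ ih)
  -- The bound is arranged as a geometric series in j with sum δ / 2 / 2 ^ i, which then bounds the
  -- distance from 1 to the infinite product z i.
  have hd : ∀ i j, dist (Q i j) (Q i (j + 1)) ≤ δ / 2 / 2 ^ i / 2 / 2 ^ j := by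
    intro i j
    rw [hQs]
    refine (hc (S (i + j)) (i + j) _ (hQS i j)).trans (le_of_eq ?_)
    rw [pow_add]
    field_simp
  have hlim : ∀ i, ∃ z, Tendsto (Q i) atTop (𝓝 z) := fun i =>
    cauchySeq_tendsto_of_complete (cauchySeq_of_le_geometric_two (hd i))
  choose z hz using hlim
  have hz1 : ∀ i, dist 1 (z i) ≤ δ / 2 / 2 ^ i := fun i =>
    dist_le_of_le_geometric_two_of_tendsto₀ (hd i) (hz i)
  -- The infinite product starting at 0 lies within δ / 2 of 1, inside the ball of units.
  have hzu : IsUnit (z 0) := by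
    refine hball ?_
    rw [Metric.mem_ball, dist_comm]
    refine (hz1 0).trans_lt ?_
    simp [hδ]
  have hzt : Tendsto z atTop (𝓝 1) := by
    rw [tendsto_iff_dist_tendsto_zero]
    refine squeeze_zero (fun _ => dist_nonneg) (fun i => (dist_comm _ _).trans_le (hz1 i)) ?_
    simp_rw [div_eq_mul_inv _ ((2 : ℝ) ^ _), ← inv_pow]
    simpa using (tendsto_pow_atTop_nhds_zero_of_lt_one (r := (2 : ℝ)⁻¹) (by norm_num)
      (by norm_num)).const_mul (δ / 2)
  have hQmul : ∀ k j, Q 0 (k + j) = Q 0 k * Q k j := by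
    intro k j
    induction j with
    | zero => rw [hQ0, mul_one, add_zero]
    | succ j ih => rw [hQs, ← mul_assoc, ← ih, ← add_assoc, hQs, zero_add]
  -- Splitting off the first k factors of the infinite product. As z 0 is a unit, Q 0 k has the
  -- inverse z k · z 0⁻¹, whose limit is known.
  have hzk : ∀ k, z 0 = Q 0 k * z k := by
    intro k
    refine tendsto_nhds_unique ((hz 0).comp (tendsto_add_atTop_nat k)) ?_
    refine ((hz k).const_mul (Q 0 k)).congr fun j => ?_
    rw [← hQmul, Function.comp_apply, add_comm]
  have hQu : ∀ k, IsUnit (Q 0 k) := by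
    intro k
    induction k with
    | zero => rw [hQ0]; exact isUnit_one
    | succ k ih => rw [hQs]; exact ih.mul (hu _)
  have hQinv : ∀ k, Ring.inverse (Q 0 k) = z k * Ring.inverse (z 0) := fun k =>
    inverse_eq_of_mul (hQu k) (by rw [← mul_assoc, ← hzk, Ring.mul_inverse_cancel _ hzu])
  refine ⟨fun k => c (S k) k, ?_⟩
  -- A single factor is a quotient of consecutive partial products, so its inverse tends to z 0⁻¹ ·
  -- z 0 = 1.
  have hy : ∀ k, Ring.inverse (y k) = Ring.inverse (Q 0 (k + 1)) * Q 0 k := by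
    intro k
    refine inverse_eq_of_mul (hu _) ?_
    obtain ⟨u, hu'⟩ := hQu k
    refine (Units.mul_right_inj u).1 ?_
    rw [hu', ← mul_assoc, ← mul_assoc]
    have e := hQs 0 k
    rw [zero_add] at e
    rw [← e, Ring.mul_inverse_cancel (Q 0 (k + 1)) (hQu (k + 1)), one_mul, mul_one]
  have hfin : Tendsto (fun k => z (k + 1) * Ring.inverse (z 0) * Q 0 k) atTop
      (𝓝 (1 * Ring.inverse (z 0) * z 0)) :=
    (((hzt.comp (tendsto_add_atTop_nat 1)).mul_const _).mul (hz 0))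
  rw [one_mul, Ring.inverse_mul_cancel _ hzu] at hfin
  refine hfin.congr fun k => ?_
  change _ = Ring.inverse (y k)
  rw [hy]
  exact congrArg (· * Q 0 k) (hQinv (k + 1)).symm

/-- At 1 it suffices that from every sequence of units with limit 1 one can select terms whose
inverses tend to 1. Every other unit u is reduced to this by x⁻¹ = (u⁻¹x)⁻¹u⁻¹. -/
theorem continuousOn_inverse_of_mem_nhds_one [TopologicalSpace R] [IsTopologicalAddGroup R]
    [ContinuousMul R] [MetrizableSpace R] (hcomp : AddComplete R)
    (h : {x : R | IsUnit x} ∈ 𝓝 1) : ContinuousOn (Ring.inverse : R → R) {x | IsUnit x} := by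
  have hone : Tendsto (Ring.inverse : R → R) (𝓝[{x | IsUnit x}] 1) (𝓝 1) := by
    refine tendsto_of_subseq_tendsto fun x hx => ?_
    rw [tendsto_nhdsWithin_iff] at hx
    obtain ⟨N, hN⟩ := eventually_atTop.1 hx.2
    have hcs := (addComplete_iff R).1 hcomp
    let _ := IsTopologicalAddGroup.rightUniformSpace R
    have := isUniformAddGroup_of_addCommGroup (G := R)
    have := IsUniformAddGroup.uniformity_countably_generated (α := R)
    let _ := UniformSpace.pseudoMetricSpace R
    obtain ⟨c, hc⟩ := exists_subseq_inverse_tendsto h (hx.1.comp (tendsto_add_atTop_nat N))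
      fun k => hN (k + N) (Nat.le_add_left N k)
    exact ⟨fun k => c k + N, hc⟩
  rintro _ ⟨u, rfl⟩
  have hc : Continuous fun x : R => ((u⁻¹ : Rˣ) : R) * x := by fun_prop
  have ht : Tendsto (fun x : R => ((u⁻¹ : Rˣ) : R) * x) (𝓝[{x | IsUnit x}] u)
      (𝓝[{x | IsUnit x}] 1) := by
    refine tendsto_nhdsWithin_iff.2 ⟨?_, ?_⟩
    · have := hc.tendsto (u : R)
      rw [Units.inv_mul] at this
      exact this.mono_left nhdsWithin_le_nhds
    · filter_upwards [self_mem_nhdsWithin] with x hx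
      exact (u⁻¹).isUnit.mul hx
  rw [ContinuousWithinAt, Ring.inverse_unit]
  have h2 := (hone.comp ht).mul_const ((u⁻¹ : Rˣ) : R)
  rw [one_mul] at h2
  refine h2.congr' ?_
  filter_upwards [self_mem_nhdsWithin] with x hx
  obtain ⟨v, rfl⟩ := hx
  rw [Function.comp_apply, ← Units.val_mul, Ring.inverse_unit, Ring.inverse_unit,
    ← Units.val_mul]
  congr 1
  group

end Inverse

set_option linter.unusedSectionVars false

/-! ### The Cayley transform and the charts of the space of almost complex structures -/

section AcsAlgebra

variable {R : Type u} [Ring R]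

theorem Acs.isUnit (J : Acs R) : IsUnit J.1 :=
  ⟨⟨J.1, -J.1, by rw [mul_neg, J.2, neg_neg], by rw [neg_mul, J.2, neg_neg]⟩, rfl⟩

/-- Both sides equal J'J - 1. This identity makes J + J' an intertwiner of J and J', and it is
behind every property of the Cayley transform on almost complex structures. -/
theorem Acs.mul_add_self (J J' : Acs R) : J'.1 * (J.1 + J'.1) = (J.1 + J'.1) * J.1 := by
  rw [mul_add, add_mul, J.2, J'.2, add_comm]

theorem Acs.mul_mul_self (J : Acs R) (x : R) : J.1 * (J.1 * x) = -x := by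
  rw [← mul_assoc, J.2, neg_one_mul]

theorem Acs.mul_self_mul (J : Acs R) (x : R) : x * J.1 * J.1 = -x := by
  rw [mul_assoc, J.2, mul_neg_one]

variable [Algebra ℝ R]

theorem Acs.isUnit_two_smul (J : Acs R) : IsUnit ((2 : ℝ) • J.1) := by
  have h : IsUnit (algebraMap ℝ R 2) := (IsUnit.mk0 (2 : ℝ) two_ne_zero).map (algebraMap ℝ R)
  rw [Algebra.smul_def]
  exact h.mul J.isUnit

/-- The Cayley transform `y ↦ (J + y)⁻¹ (J - y)`. -/
def cayley (J : Acs R) (y : R) : R := Ring.inverse (J.1 + y) * (J.1 - y)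

/-- The inverse Cayley transform `x ↦ J (1 - x) (1 + x)⁻¹`. -/
def cayleyInv (J : Acs R) (x : R) : R := J.1 * (1 - x) * Ring.inverse (1 + x)

theorem add_mul_cayley (J : Acs R) {y : R} (h : IsUnit (J.1 + y)) :
    (J.1 + y) * cayley J y = J.1 - y := by
  rw [cayley, ← mul_assoc, Ring.mul_inverse_cancel _ h, one_mul]

/-- 1 + (J + y)⁻¹(J - y) = (J + y)⁻¹ · 2J. -/
theorem isUnit_one_add_cayley (J : Acs R) {y : R} (h : IsUnit (J.1 + y)) :
    IsUnit (1 + cayley J y) := by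
  have e : 1 + cayley J y = Ring.inverse (J.1 + y) * ((2 : ℝ) • J.1) := by
    rw [cayley]
    nth_rewrite 1 [← Ring.inverse_mul_cancel _ h]
    rw [← mul_add, two_smul]
    congr 1
    abel
  rw [e]
  exact h.ringInverse.mul J.isUnit_two_smul

theorem cayleyInv_cayley (J : Acs R) {y : R} (h : IsUnit (J.1 + y)) :
    cayleyInv J (cayley J y) = y := by
  have e : J.1 * (1 - cayley J y) = y * (1 + cayley J y) := by
    have := add_mul_cayley J h
    rw [add_mul] at this
    rw [mul_sub, mul_add, mul_one, mul_one, sub_eq_iff_eq_add, add_right_comm, add_assoc,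
      this]
    abel
  rw [cayleyInv, e, mul_assoc, Ring.mul_inverse_cancel _ (isUnit_one_add_cayley J h), mul_one]

theorem add_cayleyInv (J : Acs R) {x : R} (h : IsUnit (1 + x)) :
    J.1 + cayleyInv J x = (2 : ℝ) • J.1 * Ring.inverse (1 + x) := by
  have e : J.1 = J.1 * (1 + x) * Ring.inverse (1 + x) := by
    rw [mul_assoc, Ring.mul_inverse_cancel _ h, mul_one]
  have e' : J.1 * (1 + x) + J.1 * (1 - x) = (2 : ℝ) • J.1 := by
    rw [two_smul, ← mul_add, add_add_sub_cancel, mul_add, mul_one]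
  calc J.1 + cayleyInv J x
      = J.1 * (1 + x) * Ring.inverse (1 + x) + J.1 * (1 - x) * Ring.inverse (1 + x) := by
        rw [← e, cayleyInv]
    _ = _ := by rw [← add_mul, e']

theorem isUnit_add_cayleyInv (J : Acs R) {x : R} (h : IsUnit (1 + x)) :
    IsUnit (J.1 + cayleyInv J x) := by
  rw [add_cayleyInv J h]
  exact J.isUnit_two_smul.mul h.ringInverse

theorem cayley_cayleyInv (J : Acs R) {x : R} (h : IsUnit (1 + x)) :
    cayley J (cayleyInv J x) = x := by
  have e : cayleyInv J x * (1 + x) = J.1 * (1 - x) := by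
    rw [cayleyInv, mul_assoc, Ring.inverse_mul_cancel _ h, mul_one]
  have e' : (J.1 + cayleyInv J x) * x = J.1 - cayleyInv J x := by
    rw [mul_add, mul_one, mul_sub, mul_one] at e
    rw [add_mul, eq_sub_iff_add_eq, add_assoc, add_comm (cayleyInv J x * x), e]
    abel
  rw [cayley, ← e', ← mul_assoc, Ring.inverse_mul_cancel _ (isUnit_add_cayleyInv J h), one_mul]

theorem anti_mul (J : Acs R) {x : R} (h : x ∈ antiSubmodule J) : x * J.1 = -(J.1 * x) :=
  eq_neg_of_add_eq_zero_left h

/-- Moving J through 1 + x changes it to 1 - x when x anticommutes with J. -/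
theorem afVal_eq_cayleyInv (J : Acs R) {x : R} (h : x ∈ antiSubmodule J) :
    afVal J x = cayleyInv J x := by
  rw [afVal, cayleyInv, add_mul, anti_mul J h, mul_sub, one_mul, mul_one, sub_eq_add_neg]

/-- J passes through (J + J')⁻¹ and becomes J'; then (J - J')J = -1 - J'J and J'(J - J') = J'J + 1
cancel. -/
theorem cayley_mem_anti (J J' : Acs R) (h : IsUnit (J.1 + J'.1)) :
    cayley J J'.1 ∈ antiSubmodule J := by
  have e : J.1 * Ring.inverse (J.1 + J'.1) = Ring.inverse (J.1 + J'.1) * J'.1 := by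
    obtain ⟨u, hu⟩ := h
    have := J.mul_add_self J'
    rw [← hu] at this ⊢
    rw [Ring.inverse_unit, Units.mul_inv_eq_iff_eq_mul, mul_assoc, this, ← mul_assoc,
      Units.inv_mul, one_mul]
  change _ * _ + _ * _ = 0
  rw [cayley, ← mul_assoc, e, mul_assoc, mul_assoc, ← mul_add, mul_sub, sub_mul, J.2, J'.2]
  rw [show -1 - J'.1 * J.1 + (J'.1 * J.1 - -1) = 0 by abel, mul_zero]

/-- The Cayley transform recovers the parameter H from J'. This describes the image of a chart by an
open condition that ring homomorphisms preserve. -/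
theorem mem_range_afChart_iff (J J' : Acs R) :
    J' ∈ range (afChart J) ↔ IsUnit (J.1 + J'.1) := by
  constructor
  · rintro ⟨H, rfl⟩
    change IsUnit (J.1 + afVal J H.1.val)
    rw [afVal_eq_cayleyInv J H.1.property]
    exact isUnit_add_cayleyInv J H.2
  · intro h
    have hm := cayley_mem_anti J J' h
    refine ⟨⟨⟨cayley J J'.1, hm⟩, isUnit_one_add_cayley J h⟩, Subtype.ext ?_⟩
    change afVal J (cayley J J'.1) = J'.1
    rw [afVal_eq_cayleyInv J hm, cayleyInv_cayley J h]

theorem cayley_afChart (J : Acs R) (H : afDom J) : cayley J (afChart J H).1 = H.1.val := by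
  change cayley J (afVal J H.1.val) = _
  rw [afVal_eq_cayleyInv J H.1.property, cayley_cayleyInv J H.2]

/-! ### Linear and antilinear parts for a pair of complex structures -/

/-- The linear part of `x` with respect to the complex structures `J₁` (on the right) and `J₂`
(on the left). -/
def linPart (J₁ J₂ : Acs R) : R →ₗ[ℝ] R :=
  (1 / 2 : ℝ) • (LinearMap.id - LinearMap.mulLeft ℝ J₂.1 ∘ₗ LinearMap.mulRight ℝ J₁.1)

/-- The antilinear part of `x` with respect to the complex structures `J₁` (on the right) and `J₂`
(on the left). -/
def antiPart (J₁ J₂ : Acs R) : R →ₗ[ℝ] R :=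
  (1 / 2 : ℝ) • (LinearMap.id + LinearMap.mulLeft ℝ J₂.1 ∘ₗ LinearMap.mulRight ℝ J₁.1)

theorem linPart_apply (J₁ J₂ : Acs R) (x : R) :
    linPart J₁ J₂ x = (1 / 2 : ℝ) • (x - J₂.1 * (x * J₁.1)) := rfl

theorem antiPart_apply (J₁ J₂ : Acs R) (x : R) :
    antiPart J₁ J₂ x = (1 / 2 : ℝ) • (x + J₂.1 * (x * J₁.1)) := rfl

theorem linPart_add_antiPart (J₁ J₂ : Acs R) (x : R) :
    linPart J₁ J₂ x + antiPart J₁ J₂ x = x := by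
  rw [linPart_apply, antiPart_apply, ← smul_add, sub_add_add_cancel, ← two_smul ℝ x, smul_smul]
  norm_num

theorem linPart_mul (J₁ J₂ : Acs R) (x : R) :
    linPart J₁ J₂ x * J₁.1 = J₂.1 * linPart J₁ J₂ x := by
  rw [linPart_apply, smul_mul_assoc, mul_smul_comm, sub_mul, mul_sub, J₂.mul_mul_self, mul_assoc J₂.1,
    J₁.mul_self_mul, mul_neg]
  congr 1
  abel

theorem antiPart_mul (J₁ J₂ : Acs R) (x : R) :
    antiPart J₁ J₂ x * J₁.1 = -(J₂.1 * antiPart J₁ J₂ x) := by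
  rw [antiPart_apply, smul_mul_assoc, mul_smul_comm, add_mul, mul_add, J₂.mul_mul_self,
    mul_assoc J₂.1, J₁.mul_self_mul, mul_neg, ← smul_neg]
  congr 1
  abel

theorem antiPart_mem (J : Acs R) (x : R) : antiPart J J x ∈ antiSubmodule J := by
  change _ * _ + _ = 0
  rw [antiPart_mul, neg_add_cancel]

theorem antiPart_eq_self (J : Acs R) {x : R} (h : x ∈ antiSubmodule J) : antiPart J J x = x := by
  rw [antiPart_apply, anti_mul J h, mul_neg, J.mul_mul_self, neg_neg, ← two_smul ℝ x, smul_smul]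
  norm_num

/-- Since v anticommutes with J₁, multiplication by J₁ on its left is minus multiplication on its
right. Hence the linear part depends antilinearly on a tangent vector; for the antilinear part, the
signs combine to a linear dependence. -/
theorem linPart_mul_of_anti (J₁ J₂ : Acs R) {v : R} (hv : v ∈ antiSubmodule J₁) :
    linPart J₁ J₂ (J₁.1 * v) = -(J₂.1 * linPart J₁ J₂ v) := by
  rw [linPart_apply, linPart_apply, mul_smul_comm, ← smul_neg, mul_assoc, anti_mul J₁ hv]
  congr 1
  simp only [mul_neg, mul_sub, J₁.mul_mul_self, J₂.mul_mul_self]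
  abel

theorem antiPart_mul_of_anti (J₁ J₂ : Acs R) {v : R} (hv : v ∈ antiSubmodule J₁) :
    antiPart J₁ J₂ (J₁.1 * v) = J₂.1 * antiPart J₁ J₂ v := by
  rw [antiPart_apply, antiPart_apply, mul_smul_comm, mul_assoc, anti_mul J₁ hv]
  congr 1
  simp only [mul_neg, mul_add, J₁.mul_mul_self, J₂.mul_mul_self]
  abel

theorem Anti.val_smul (J : Acs R) (c : ℂ) (H : Anti J) :
    (c • H).val = c.re • H.val + c.im • (J.1 * H.val) := rfl

theorem Anti.val_I_smul (J : Acs R) (H : Anti J) : (Complex.I • H).val = J.1 * H.val := by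
  rw [Anti.val_smul]; simp

/-- The inclusion of the tangent space, as a real linear map. -/
def Anti.valₗ (J : Acs R) : Anti J →ₗ[ℝ] R where
  toFun := Anti.val
  map_add' _ _ := rfl
  map_smul' r H := by
    change ((r : ℂ) • H).val = r • H.val
    rw [Anti.val_smul]; simp

/-- The projection onto the tangent space, as a real linear map. -/
def Anti.projₗ (J : Acs R) : R →ₗ[ℝ] Anti J where
  toFun x := ⟨antiPart J J x, antiPart_mem J x⟩
  map_add' x y := Anti.ext (map_add _ x y)
  map_smul' r x := Anti.ext ((map_smul _ r x).trans (map_smul (Anti.valₗ J) r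
    ⟨antiPart J J x, antiPart_mem J x⟩).symm)

theorem Anti.proj_val (J : Acs R) (H : Anti J) : Anti.projₗ J H.val = H :=
  Anti.ext (antiPart_eq_self J H.property)

theorem Anti.val_proj (J : Acs R) {x : R} (hx : x ∈ antiSubmodule J) :
    (Anti.projₗ J x).val = x :=
  antiPart_eq_self J hx

theorem smul_eq_re_add_im {E : Type*} [AddCommGroup E] [Module ℂ E] (c : ℂ) (v : E) :
    c • v = (c.re : ℝ) • v + (c.im : ℝ) • (Complex.I • v) := by
  rw [← Complex.coe_smul, ← Complex.coe_smul, smul_smul, ← add_smul, Complex.re_add_im]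

/-- A real linear map between complex vector spaces that commutes with `i` is complex linear. -/
def complexLinear {E F : Type*} [AddCommGroup E] [Module ℂ E] [AddCommGroup F] [Module ℂ F]
    (f : E → F) (hf : IsLinearMap ℝ f) (hI : ∀ v, f (Complex.I • v) = Complex.I • f v) :
    E →ₗ[ℂ] F where
  toFun := f
  map_add' := hf.map_add
  map_smul' c v := by
    rw [RingHom.id_apply, smul_eq_re_add_im, hf.map_add, hf.map_smul, hf.map_smul, hI,
      smul_eq_re_add_im c (f v)]

end AcsAlgebra

/-! ### The charts over a Fréchet algebra in which elements near 1 are units -/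

/-- Fréchet algebras with a neighbourhood of `1` consisting of units. -/
structure IsUnitOpenAlgebra (R : Type*) [Ring R] [Algebra ℝ R] [TopologicalSpace R] : Prop where
  frechet : IsFrechetSpace R
  mul : ContinuousMul R
  units : {x : R | IsUnit x} ∈ 𝓝 1

namespace IsUnitOpenAlgebra

section

variable {R : Type u} [Ring R] [Algebra ℝ R] [TopologicalSpace R] (hR : IsUnitOpenAlgebra R)
include hR

theorem isOpen_units : IsOpen {x : R | IsUnit x} :=
  have := hR.mul
  isOpen_units_of_mem_nhds_one hR.units

theorem continuousOn_inverse : ContinuousOn (Ring.inverse : R → R) {x | IsUnit x} :=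
  have := hR.mul
  have := hR.frechet.addGroup
  have := hR.frechet.metrizable
  continuousOn_inverse_of_mem_nhds_one hR.frechet.addComplete hR.units

theorem continuous_linPart (J₁ J₂ : Acs R) : Continuous (linPart J₁ J₂) := by
  have := hR.mul
  have := hR.frechet.addGroup
  have := hR.frechet.smul
  have : Continuous fun x : R => (1 / 2 : ℝ) • (x - J₂.1 * (x * J₁.1)) := by fun_prop
  exact this

theorem continuous_antiPart (J₁ J₂ : Acs R) : Continuous (antiPart J₁ J₂) := by
  have := hR.mul
  have := hR.frechet.addGroup
  have := hR.frechet.smul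
  have : Continuous fun x : R => (1 / 2 : ℝ) • (x + J₂.1 * (x * J₁.1)) := by fun_prop
  exact this

theorem continuous_proj (J : Acs R) : Continuous (Anti.projₗ J) :=
  continuous_induced_rng.2 (hR.continuous_antiPart J J)

omit hR in
theorem continuous_val (J : Acs R) : Continuous (Anti.val : Anti J → R) := continuous_induced_dom

theorem anti_frechet (J : Acs R) : IsFrechetSpace (Anti J) :=
  hR.frechet.retract (Anti.valₗ J) (Anti.projₗ J) (continuous_val J) (hR.continuous_proj J)
    (Anti.proj_val J)

theorem anti_continuousSMul (J : Acs R) : ContinuousSMul ℂ (Anti J) := by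
  have := hR.mul
  have := hR.frechet.addGroup
  have := hR.frechet.smul
  have hv := continuous_val J
  refine ⟨continuous_induced_rng.2 ?_⟩
  have : Continuous fun p : ℂ × Anti J => p.1.re • p.2.val + p.1.im • (J.1 * p.2.val) := by
    fun_prop
  exact this

/-- x ↦ (x + JxJ)/2 is a continuous projection onto the tangent space. -/
theorem closedComplemented (J : Acs R) : (antiSubmodule J).ClosedComplemented :=
  ⟨⟨(antiPart J J).codRestrict _ (antiPart_mem J),
    (hR.continuous_antiPart J J).subtype_mk _⟩, fun x => Subtype.ext (antiPart_eq_self J x.2)⟩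

theorem isOpen_isUnit_comp {E : Type*} [TopologicalSpace E] {f : E → R} (hf : Continuous f) :
    IsOpen {x | IsUnit (f x)} :=
  hR.isOpen_units.preimage hf

/-- The Cayley transform is the flattening chart. It and its inverse are products of affine maps and
inverses, so the slope calculus makes both smooth. -/
theorem isSliceChart (J : Acs R) : IsSliceChart {S : R | S * S = -1} (antiSubmodule J)
    {H | IsUnit (1 + (H : R))} (fun H => afVal J H) := by
  have := hR.mul
  have := hR.frechet.addGroup
  have := hR.frechet.smul
  have hid : ∀ k s, SlopeClass k s fun x : R => x := fun k s =>
    SlopeClass.clm k s (ContinuousLinearMap.id ℝ R)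
  have hV : IsOpen {y : R | IsUnit (J.1 + y)} := hR.isOpen_isUnit_comp (by fun_prop)
  have hW : IsOpen {x : R | IsUnit (1 + x)} := hR.isOpen_isUnit_comp (by fun_prop)
  refine ⟨{y | IsUnit (J.1 + y)}, {x | IsUnit (1 + x)}, cayley J, cayleyInv J, hV, hW,
    fun y hy => isUnit_one_add_cayley J hy, fun x hx => isUnit_add_cayleyInv J hx,
    ⟨fun y hy => cayleyInv_cayley J hy, fun x hx => cayley_cayleyInv J hx⟩,
    SlopeClass.isSmoothOn hV fun k => ?_, SlopeClass.isSmoothOn hW fun k => ?_, ?_, rfl, ?_⟩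
  · have h1 := ((SlopeClass.const k {y : R | IsUnit (J.1 + y)} J.1).add (hid k _)).inverse
      hR.continuousOn_inverse fun x hx => hx
    have h2 := (SlopeClass.const k {y : R | IsUnit (J.1 + y)} J.1).add
      ((SlopeClass.const k _ (-1)).mul (hid k _))
    exact (h1.mul h2).congr fun x _ => by simp only [cayley, neg_one_mul, sub_eq_add_neg]
  · have h1 := ((SlopeClass.const k {x : R | IsUnit (1 + x)} 1).add (hid k _)).inverse
      hR.continuousOn_inverse fun x hx => hx
    have h2 := (SlopeClass.const k {x : R | IsUnit (1 + x)} 1).add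
      ((SlopeClass.const k _ (-1)).mul (hid k _))
    exact (((SlopeClass.const k _ J.1).mul h2).mul h1).congr fun x _ => by
      simp only [cayleyInv, neg_one_mul, sub_eq_add_neg]
  · ext x
    constructor
    · rintro ⟨y, ⟨hy, hy2⟩, rfl⟩
      exact ⟨isUnit_one_add_cayley J hy, cayley_mem_anti J ⟨y, hy2⟩ hy⟩
    · rintro ⟨hx, hx2⟩
      refine ⟨cayleyInv J x, ⟨isUnit_add_cayleyInv J hx, ?_⟩, cayley_cayleyInv J hx⟩
      rw [← afVal_eq_cayleyInv J hx2]
      exact afVal_sq J x hx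
  · intro x _
    exact (afVal_eq_cayleyInv J x.2).symm

theorem isSplitSubmanifold : IsSplitSubmanifold {S : R | S * S = -1} := by
  intro S hS
  let J : Acs R := ⟨S, hS⟩
  refine ⟨antiSubmodule J, _, _, hR.closedComplemented J, hR.isSliceChart J, 0, ?_, ?_⟩
  · simp
  · simp [afVal, J]

theorem isOpen_afDom (J : Acs R) : IsOpen (afDom J) := by
  have := hR.frechet.addGroup
  have := continuous_val J
  exact hR.isOpen_isUnit_comp (f := fun H : Anti J => 1 + H.val) (by fun_prop)

/-- The inverse on the open set of all J' with J + J' invertible is the Cayley transform; continuity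
in both directions comes from that of inversion. -/
theorem isOpenEmbedding_afChart (J : Acs R) : IsOpenEmbedding (afChart J) := by
  have := hR.mul
  have := hR.frechet.addGroup
  have hv := continuous_val J
  have hsub : Continuous (Subtype.val : Acs R → R) := continuous_subtype_val
  have hopen : IsOpen {J' : Acs R | IsUnit (J.1 + J'.1)} :=
    hR.isOpen_isUnit_comp (by fun_prop)
  have hinv := hR.continuousOn_inverse
  have hcont : Continuous (afChart J) := by
    refine Continuous.subtype_mk ?_ _
    have h1 : Continuous fun H : afDom J => 1 + H.1.val := by fun_prop
    exact (h1.mul continuous_const).mul (hinv.comp_continuous h1 fun H => H.2)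
  let e : afDom J ≃ₜ {J' : Acs R | IsUnit (J.1 + J'.1)} :=
    { toFun := fun H => ⟨afChart J H, (mem_range_afChart_iff J _).1 ⟨H, rfl⟩⟩
      invFun := fun J' => ⟨⟨cayley J J'.1.1, cayley_mem_anti J J'.1 J'.2⟩,
        isUnit_one_add_cayley J J'.2⟩
      left_inv := fun H => Subtype.ext (Anti.ext (cayley_afChart J H))
      right_inv := fun J' => Subtype.ext (Subtype.ext
        ((afVal_eq_cayleyInv J (cayley_mem_anti J J'.1 J'.2)).trans (cayleyInv_cayley J J'.2)))
      continuous_toFun := hcont.subtype_mk _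
      continuous_invFun := by
        refine Continuous.subtype_mk (continuous_induced_rng.2 ?_) _
        have h1 : Continuous fun J' : {J' : Acs R | IsUnit (J.1 + J'.1)} => J.1 + J'.1.1 := by
          fun_prop
        have h2 : Continuous fun J' : {J' : Acs R | IsUnit (J.1 + J'.1)} => J.1 - J'.1.1 := by
          fun_prop
        exact (hinv.comp_continuous h1 fun J' => J'.2).mul h2 }
  exact hopen.isOpenEmbedding_subtypeVal.comp e.isOpenEmbedding

end

/-! ### Transition maps and their holomorphy -/

section Transition

variable {R : Type u} [Ring R] [Algebra ℝ R] (J₁ J₂ : Acs R)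

/-- The transition map between two charts, `H ↦ P₋(1 + H) P₊(1 + H)⁻¹` with the antilinear and
linear parts `P₋` and `P₊`. -/
def transVal (H : R) : R :=
  antiPart J₁ J₂ (1 + H) * Ring.inverse (linPart J₁ J₂ (1 + H))

/-- The domain of the transition map. -/
def transDom : Set (Anti J₁) := {H | IsUnit (1 + H.val) ∧ IsUnit (linPart J₁ J₂ (1 + H.val))}

variable {J₁ J₂}

theorem inverse_linPart_mul {x : R} (h : IsUnit (linPart J₁ J₂ x)) :
    J₁.1 * Ring.inverse (linPart J₁ J₂ x) = Ring.inverse (linPart J₁ J₂ x) * J₂.1 := by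
  have e := linPart_mul J₁ J₂ x
  obtain ⟨u, hu⟩ := h
  rw [← hu] at e ⊢
  rw [Ring.inverse_unit, Units.mul_inv_eq_iff_eq_mul, mul_assoc, ← e, ← mul_assoc,
    Units.inv_mul, one_mul]

theorem mul_inverse_linPart_mem {a x : R} (ha : a * J₁.1 = -(J₂.1 * a))
    (h : IsUnit (linPart J₁ J₂ x)) : a * Ring.inverse (linPart J₁ J₂ x) ∈ antiSubmodule J₂ := by
  change _ * _ + _ * _ = 0
  rw [mul_assoc, ← inverse_linPart_mul h, ← mul_assoc, ha, neg_mul, mul_assoc, neg_add_cancel]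

theorem transVal_mem {H : R} (h : IsUnit (linPart J₁ J₂ (1 + H))) :
    transVal J₁ J₂ H ∈ antiSubmodule J₂ :=
  mul_inverse_linPart_mem (antiPart_mul J₁ J₂ _) h

/-- 1 + H = P₊ + P₋ = (1 + P₋P₊⁻¹)P₊. -/
theorem one_add_transVal {H : R} (h : IsUnit (linPart J₁ J₂ (1 + H))) :
    1 + transVal J₁ J₂ H = (1 + H) * Ring.inverse (linPart J₁ J₂ (1 + H)) := by
  rw [transVal]
  nth_rewrite 1 [← Ring.mul_inverse_cancel _ h]
  rw [← add_mul, linPart_add_antiPart]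

theorem isUnit_one_add_transVal {H : R} (h : IsUnit (linPart J₁ J₂ (1 + H)))
    (h' : IsUnit (1 + H)) : IsUnit (1 + transVal J₁ J₂ H) := by
  rw [one_add_transVal h]
  exact h'.mul h.ringInverse

/-- Since P₊J₁ = J₂P₊, conjugating J₁ by (1 + τ)P₊ is the same as conjugating J₂ by 1 + τ. -/
theorem afVal_transVal {H : R} (h : IsUnit (linPart J₁ J₂ (1 + H))) (h' : IsUnit (1 + H)) :
    afVal J₂ (transVal J₁ J₂ H) = afVal J₁ H := by
  have h3 := inverse_linPart_mul h
  rw [afVal, afVal, one_add_transVal h]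
  have e : Ring.inverse ((1 + H) * Ring.inverse (linPart J₁ J₂ (1 + H))) =
      linPart J₁ J₂ (1 + H) * Ring.inverse (1 + H) := by
    refine inverse_eq_of_mul (h'.mul h.ringInverse) ?_
    rw [mul_assoc, ← mul_assoc (Ring.inverse _), Ring.inverse_mul_cancel _ h, one_mul,
      Ring.mul_inverse_cancel _ h']
  rw [e, mul_assoc (1 + H), ← h3, ← mul_assoc, ← mul_assoc (1 + H) J₁.1, mul_assoc ((1 + H) * J₁.1),
    Ring.inverse_mul_cancel _ h, mul_one]

/-- P₊(1 + H) = -½ J₂(J₂ + ψ(H))(1 + H), where ψ is the chart around J₁. So the formula for the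
transition map makes sense exactly on the overlap of the charts. -/
theorem isUnit_linPart_iff {H : R} (h : IsUnit (1 + H)) :
    IsUnit (linPart J₁ J₂ (1 + H)) ↔ IsUnit (J₂.1 + afVal J₁ H) := by
  have e : linPart J₁ J₂ (1 + H) =
      ((-1 / 2 : ℝ) • J₂.1) * (J₂.1 + afVal J₁ H) * (1 + H) := by
    rw [mul_assoc, add_mul, afVal, mul_assoc _ (Ring.inverse _), Ring.inverse_mul_cancel _ h, mul_one,
      smul_mul_assoc, mul_add, J₂.mul_mul_self, linPart_apply, ← neg_sub, smul_neg,
      ← neg_smul, sub_eq_neg_add]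
    congr 1
    norm_num
  have hu : IsUnit ((-1 / 2 : ℝ) • J₂.1) := by
    rw [Algebra.smul_def]
    exact ((IsUnit.mk0 (-1 / 2 : ℝ) (by norm_num)).map (algebraMap ℝ R)).mul J₂.isUnit
  rw [e]
  constructor
  · intro h1
    obtain ⟨u, hu'⟩ := h
    rw [← hu', Units.isUnit_mul_units] at h1
    exact isUnit_of_mul_left hu h1
  · intro h1
    exact (hu.mul h1).mul h

theorem val_image_preimage_range : Subtype.val '' (afChart J₁ ⁻¹' range (afChart J₂)) =
    transDom J₁ J₂ := by
  ext H
  constructor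
  · rintro ⟨H, hH, rfl⟩
    exact ⟨H.2, (isUnit_linPart_iff H.2).2 ((mem_range_afChart_iff J₂ _).1 hH)⟩
  · rintro ⟨h1, h2⟩
    exact ⟨⟨H, h1⟩, (mem_range_afChart_iff J₂ _).2 ((isUnit_linPart_iff h1).1 h2), rfl⟩

/-- The slope of the transition map. -/
def transSlope (x y v : R) : R :=
  (antiPart J₁ J₂ v - transVal J₁ J₂ x * linPart J₁ J₂ v) *
    Ring.inverse (linPart J₁ J₂ (1 + y))

/-- τ(y) - τ(x) has the numerator P₋(1 + y) - τ(x)P₊(1 + y). As τ(x)P₊(1 + x) = P₋(1 + x), replacing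
1 + y by y - x in it changes nothing. -/
theorem transVal_sub {x y : R} (hx : IsUnit (linPart J₁ J₂ (1 + x)))
    (hy : IsUnit (linPart J₁ J₂ (1 + y))) :
    transVal J₁ J₂ y - transVal J₁ J₂ x = transSlope (J₁ := J₁) (J₂ := J₂) x y (y - x) := by
  have e1 : transVal J₁ J₂ x * linPart J₁ J₂ (1 + x) = antiPart J₁ J₂ (1 + x) := by
    rw [transVal, mul_assoc, Ring.inverse_mul_cancel _ hx, mul_one]
  have e2 : y - x = (1 + y) - (1 + x) := by abel
  rw [transSlope, e2, map_sub, map_sub, mul_sub, e1, sub_sub_sub_cancel_right, sub_mul, mul_assoc,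
    Ring.mul_inverse_cancel _ hy, mul_one, transVal]

theorem transSlope_mem {x y : R} (hx : IsUnit (linPart J₁ J₂ (1 + x)))
    (hy : IsUnit (linPart J₁ J₂ (1 + y))) (v : R) :
    transSlope (J₁ := J₁) (J₂ := J₂) x y v ∈ antiSubmodule J₂ := by
  refine mul_inverse_linPart_mem ?_ hy
  rw [sub_mul, antiPart_mul, mul_assoc, linPart_mul, ← mul_assoc, anti_mul J₂ (transVal_mem hx),
    mul_sub, neg_mul, mul_assoc]
  abel

/-- P₋ is complex linear and P₊ antilinear, but τ(x) anticommutes with J₂, so the second term also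
is linear. -/
theorem transSlope_I {x y : R} (hx : IsUnit (linPart J₁ J₂ (1 + x))) {v : R}
    (hv : v ∈ antiSubmodule J₁) : transSlope (J₁ := J₁) (J₂ := J₂) x y (J₁.1 * v) =
      J₂.1 * transSlope (J₁ := J₁) (J₂ := J₂) x y v := by
  rw [transSlope, transSlope, antiPart_mul_of_anti J₁ J₂ hv, linPart_mul_of_anti J₁ J₂ hv, mul_neg,
    ← mul_assoc (transVal J₁ J₂ x), anti_mul J₂ (transVal_mem hx), neg_mul, neg_neg,
    ← mul_assoc J₂.1, mul_sub, mul_assoc]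

/-- Even elements of Λ are central in the algebra of Λ-points; applied to them, this gives the
Λ_0-linearity of the derivatives required of a superatlas. -/
theorem transSlope_central {x y : R} {a : R} (ha : ∀ b, a * b = b * a) (v : R) :
    transSlope (J₁ := J₁) (J₂ := J₂) x y (a * v) =
      a * transSlope (J₁ := J₁) (J₂ := J₂) x y v := by
  have h1 : antiPart J₁ J₂ (a * v) = a * antiPart J₁ J₂ v := by
    rw [antiPart_apply, antiPart_apply, mul_smul_comm, mul_add, mul_assoc a v, ← mul_assoc J₂.1 a,
      ← ha J₂.1, mul_assoc a]
  have h2 : linPart J₁ J₂ (a * v) = a * linPart J₁ J₂ v := by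
    rw [linPart_apply, linPart_apply, mul_smul_comm, mul_sub, mul_assoc a v, ← mul_assoc J₂.1 a,
      ← ha J₂.1, mul_assoc a]
  rw [transSlope, transSlope, h1, h2, ← mul_assoc (transVal J₁ J₂ x), ← ha, mul_assoc a (transVal _ _ _),
    ← mul_sub, mul_assoc]

theorem transSlope_isLinearMap (x y : R) :
    IsLinearMap ℝ fun v => transSlope (J₁ := J₁) (J₂ := J₂) x y v := by
  refine ⟨fun v w => ?_, fun c v => ?_⟩
  · simp only [transSlope, map_add]
    noncomm_ring
  · simp only [transSlope, map_smul, mul_smul_comm, ← smul_sub, smul_mul_assoc]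

variable [TopologicalSpace R] (hR : IsUnitOpenAlgebra R)
include hR

/-- The transition maps are holomorphic, with derivatives that are linear over the centre. -/
theorem exists_transition (J₁ J₂ : Acs R) : ∃ τ : Anti J₁ → Anti J₂,
    (∀ x : afDom J₁, afChart J₁ x ∈ range (afChart J₂) →
      ∃ h : τ x ∈ afDom J₂, afChart J₂ ⟨τ x, h⟩ = afChart J₁ x) ∧
    IsSmoothOn ℂ (Subtype.val '' (afChart J₁ ⁻¹' range (afChart J₂))) τ ∧
    ∀ x : afDom J₁, afChart J₁ x ∈ range (afChart J₂) →
      ∃ D : Anti J₁ →ₗ[ℂ] Anti J₂,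
        (∀ a : R, (∀ b, a * b = b * a) → ∀ v w : Anti J₁, w.val = a * v.val →
          (D w).val = a * (D v).val) ∧
        ∀ v, HasDirDeriv ℂ τ x v (D v) := by
  have := hR.mul
  have := hR.frechet.addGroup
  have := hR.frechet.smul
  have := (hR.anti_frechet J₁).addGroup
  have := (hR.anti_frechet J₂).addGroup
  have := hR.anti_continuousSMul J₁
  have := hR.anti_continuousSMul J₂
  have := (hR.anti_frechet J₁).smul
  have := (hR.anti_frechet J₂).smul
  have := (hR.anti_frechet J₂).t2
  have hv₁ := continuous_val J₁
  have hlin := hR.continuous_linPart J₁ J₂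
  have hanti := hR.continuous_antiPart J₁ J₂
  have hopen : IsOpen (transDom J₁ J₂) :=
    (hR.isOpen_isUnit_comp (f := fun H : Anti J₁ => 1 + H.val) (by fun_prop)).inter
      (hR.isOpen_isUnit_comp (f := fun H : Anti J₁ => linPart J₁ J₂ (1 + H.val)) (by fun_prop))
  -- The projection makes τ a total map into the tangent space; on the overlap it changes nothing.
  let τ : Anti J₁ → Anti J₂ := fun H => Anti.projₗ J₂ (transVal J₁ J₂ H.val)
  let Φ : Anti J₁ × Anti J₁ × Anti J₁ → Anti J₂ := fun p =>
    Anti.projₗ J₂ (transSlope (J₁ := J₁) (J₂ := J₂) p.1.val p.2.1.val p.2.2.val)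
  have hτ : ∀ H ∈ transDom J₁ J₂, (τ H).val = transVal J₁ J₂ H.val := fun H hH =>
    Anti.val_proj J₂ (transVal_mem hH.2)
  have hmem : ∀ x : afDom J₁, afChart J₁ x ∈ range (afChart J₂) → x.1 ∈ transDom J₁ J₂ := by
    intro x hx
    rw [← val_image_preimage_range]
    exact ⟨x, hx, rfl⟩
  have h1 : ∀ x ∈ transDom J₁ J₂, ∀ y ∈ transDom J₁ J₂, τ y - τ x = Φ (x, y, y - x) := by
    intro x hx y hy
    simp only [τ, Φ]
    rw [← map_sub, transVal_sub hx.2 hy.2]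
    rfl
  have h2 : ∀ x ∈ transDom J₁ J₂, ∀ y ∈ transDom J₁ J₂, IsLinearMap ℝ fun v => Φ (x, y, v) := by
    intro x _ y _
    have hl := transSlope_isLinearMap (J₁ := J₁) (J₂ := J₂) x.val y.val
    refine ⟨fun v w => ?_, fun c v => ?_⟩
    · simp only [Φ]
      rw [← map_add, ← hl.map_add]
      rfl
    · simp only [Φ]
      have e : (c • v).val = c • v.val := map_smul (Anti.valₗ J₁) c v
      rw [← map_smul, ← hl.map_smul, e]
  have hS : ∀ k, SlopeClass k (transDom J₁ J₂) fun H : Anti J₁ => 1 + H.val := fun k =>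
    (SlopeClass.const k _ 1).add (SlopeClass.clm k _ ⟨Anti.valₗ J₁, hv₁⟩)
  have hSτ : ∀ k, SlopeClass k (transDom J₁ J₂) fun H : Anti J₁ => transVal J₁ J₂ H.val := fun k =>
    ((hS k).clm_comp ⟨antiPart J₁ J₂, hanti⟩).mul
      (((hS k).clm_comp ⟨linPart J₁ J₂, hlin⟩).inverse hR.continuousOn_inverse fun x hx => hx.2)
  have h3 : ContinuousOn Φ (transDom J₁ J₂ ×ˢ transDom J₁ J₂ ×ˢ univ) := by
    refine (hR.continuous_proj J₂).comp_continuousOn (ContinuousOn.mul (ContinuousOn.sub ?_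
      (ContinuousOn.mul ?_ ?_)) ?_)
    · exact Continuous.continuousOn (by fun_prop)
    · exact (hSτ 0).continuousOn.comp continuous_fst.continuousOn fun p hp => hp.1
    · exact Continuous.continuousOn (by fun_prop)
    · exact hR.continuousOn_inverse.comp (Continuous.continuousOn (by fun_prop))
        fun p hp => hp.2.1.2
  have hI : ∀ x ∈ transDom J₁ J₂, ∀ v, Φ (x, x, Complex.I • v) = Complex.I • Φ (x, x, v) := by
    intro x hx v
    apply Anti.ext
    rw [Anti.val_I_smul]
    simp only [Φ]
    rw [Anti.val_proj J₂ (transSlope_mem hx.2 hx.2 _), Anti.val_proj J₂ (transSlope_mem hx.2 hx.2 _),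
      Anti.val_I_smul, transSlope_I hx.2 v.property]
  refine ⟨τ, ?_, ?_, ?_⟩
  · intro x hx
    have hx' := hmem x hx
    refine ⟨?_, Subtype.ext ?_⟩
    · change IsUnit (1 + (τ x).val)
      rw [hτ _ hx']
      exact isUnit_one_add_transVal hx'.2 hx'.1
    · change afVal J₂ (τ x).val = afVal J₁ x.1.val
      rw [hτ _ hx', afVal_transVal hx'.2 hx'.1]
  · rw [val_image_preimage_range]
    refine SlopeClass.isSmoothOn_complex hopen
      (fun k => (hSτ k).clm_comp ⟨Anti.projₗ J₂, hR.continuous_proj J₂⟩) ?_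
    intro x hx v w hw
    have hd := fun v => SlopeClass.hasDirDeriv_of_slope hopen h1 h2 h3 hx v
    rw [tendsto_nhds_unique hw (hd v), ← hI x hx]
    exact hd _
  · intro x hx
    have hx' := hmem x hx
    refine ⟨complexLinear (fun v => Φ (x, x, v)) (h2 x hx' x hx') (hI x hx'), ?_, fun v =>
      SlopeClass.hasDirDeriv_complex_of_slope hopen h1 h2 h3 hx' v (hI x hx' v)⟩
    intro a ha v w hw
    change (Φ (x, x, w)).val = a * (Φ (x, x, v)).val
    simp only [Φ]
    rw [Anti.val_proj J₂ (transSlope_mem hx'.2 hx'.2 _),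
      Anti.val_proj J₂ (transSlope_mem hx'.2 hx'.2 _), hw, transSlope_central ha]

end Transition

/-! ### The atlas and the derivatives of its charts -/

section Atlas

variable {R : Type u} [Ring R] [Algebra ℝ R] [TopologicalSpace R] (hR : IsUnitOpenAlgebra R)
include hR

omit [TopologicalSpace R] hR in
theorem zero_mem_afDom (J : Acs R) : (0 : Anti J) ∈ afDom J := by
  change IsUnit (1 + (0 : R))
  simp

omit [TopologicalSpace R] hR in
theorem afChart_zero (J : Acs R) : afChart J ⟨0, zero_mem_afDom J⟩ = J := by
  apply Subtype.ext
  change (1 + (0 : R)) * J.1 * Ring.inverse (1 + (0 : R)) = J.1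
  simp

theorem isHolomorphicAtlas : IsHolomorphicAtlas fun J : Acs R => afParam J where
  frechet := hR.anti_frechet
  smul := hR.anti_continuousSMul
  dom_open := hR.isOpen_afDom
  openEmbedding := hR.isOpenEmbedding_afChart
  cover J := ⟨J, ⟨0, zero_mem_afDom J⟩, afChart_zero J⟩
  transition J₁ J₂ := by
    obtain ⟨τ, h1, h2, -⟩ := hR.exists_transition J₁ J₂
    exact ⟨τ, h1, h2⟩

/-- The derivatives of the charts. -/
theorem exists_derivative (J : Acs R) (H : afDom J) : ∃ D : Anti J ≃L[ℂ] Anti (afChart J H),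
    ∀ K : Anti J, HasDirDeriv ℝ (fun K' : Anti J => afVal J K'.val) H.1 K (D K).val := by
  have := hR.mul
  have := hR.frechet.addGroup
  have := hR.frechet.smul
  have := (hR.anti_frechet J).addGroup
  have := (hR.anti_frechet J).smul
  have hv := continuous_val J
  set J' := afChart J H with hJ'
  have hJ'v : J'.1 = afVal J H.1.val := rfl
  -- Both g = 1 + H and w = J + J' conjugate J to J' = ψ(H). The derivative will be K ↦ -wKg⁻¹, with
  -- inverse L ↦ -w⁻¹Lg, and both intertwine the complex structures.
  obtain ⟨g, hg⟩ : IsUnit (1 + H.1.val) := H.2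
  obtain ⟨w, hw⟩ : IsUnit (J.1 + J'.1) := (mem_range_afChart_iff J J').1 ⟨H, rfl⟩
  have hcomm : J'.1 * (w : R) = w * J.1 := by rw [hw]; exact J.mul_add_self J'
  have hcomm' : J.1 * ((w⁻¹ : Rˣ) : R) = ((w⁻¹ : Rˣ) : R) * J'.1 := by
    rw [Units.mul_inv_eq_iff_eq_mul, mul_assoc, hcomm, ← mul_assoc, Units.inv_mul, one_mul]
  have hg1 : J'.1 = g * J.1 * ((g⁻¹ : Rˣ) : R) := by
    rw [hJ'v, afVal, ← hg, Ring.inverse_unit]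
  have hg2 : J'.1 * (g : R) = g * J.1 := by rw [hg1, mul_assoc, Units.inv_mul, mul_one]
  have hg3 : ((g⁻¹ : Rˣ) : R) * J'.1 = J.1 * ((g⁻¹ : Rˣ) : R) := by
    rw [hg1, ← mul_assoc, ← mul_assoc, Units.inv_mul, one_mul]
  have hfwd : ∀ K ∈ antiSubmodule J, -((w : R) * K * ((g⁻¹ : Rˣ) : R)) ∈ antiSubmodule J' := by
    intro K hK
    change -(_ * _ * _) * _ + _ * -(_ * _ * _) = 0
    have e1 : (w : R) * K * ((g⁻¹ : Rˣ) : R) * J'.1 = -(w * (J.1 * K) * ((g⁻¹ : Rˣ) : R)) := by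
      rw [mul_assoc, hg3, ← mul_assoc, mul_assoc _ K, anti_mul J hK, mul_neg, neg_mul]
    have e2 : J'.1 * ((w : R) * K * ((g⁻¹ : Rˣ) : R)) = w * (J.1 * K) * ((g⁻¹ : Rˣ) : R) := by
      rw [← mul_assoc, ← mul_assoc, hcomm, mul_assoc _ J.1]
    rw [neg_mul, mul_neg, e1, e2, neg_neg, add_neg_cancel]
  have hbwd : ∀ L ∈ antiSubmodule J', -(((w⁻¹ : Rˣ) : R) * L * (g : R)) ∈ antiSubmodule J := by
    intro L hL
    change -(_ * _ * _) * _ + _ * -(_ * _ * _) = 0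
    have e1 : ((w⁻¹ : Rˣ) : R) * L * (g : R) * J.1 = -(((w⁻¹ : Rˣ) : R) * (J'.1 * L) * g) := by
      rw [mul_assoc, ← hg2, ← mul_assoc, mul_assoc _ L, anti_mul J' hL, mul_neg, neg_mul]
    have e2 : J.1 * (((w⁻¹ : Rˣ) : R) * L * (g : R)) = ((w⁻¹ : Rˣ) : R) * (J'.1 * L) * g := by
      rw [← mul_assoc, ← mul_assoc, hcomm', mul_assoc _ J'.1]
    rw [neg_mul, mul_neg, e1, e2, neg_neg, add_neg_cancel]
  let D : Anti J ≃L[ℂ] Anti J' :=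
    { toFun := fun K => ⟨-((w : R) * K.val * ((g⁻¹ : Rˣ) : R)), hfwd _ K.property⟩
      invFun := fun L => ⟨-(((w⁻¹ : Rˣ) : R) * L.val * (g : R)), hbwd _ L.property⟩
      map_add' := fun K L => Anti.ext (by
        change -((w : R) * (K.val + L.val) * ((g⁻¹ : Rˣ) : R)) =
          -((w : R) * K.val * ((g⁻¹ : Rˣ) : R)) + -((w : R) * L.val * ((g⁻¹ : Rˣ) : R))
        noncomm_ring)
      map_smul' := fun c K => Anti.ext (by
        change -((w : R) * (c.re • K.val + c.im • (J.1 * K.val)) * ((g⁻¹ : Rˣ) : R)) =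
          c.re • -((w : R) * K.val * ((g⁻¹ : Rˣ) : R)) +
            c.im • (J'.1 * -((w : R) * K.val * ((g⁻¹ : Rˣ) : R)))
        rw [mul_neg, ← mul_assoc J'.1, ← mul_assoc J'.1, hcomm, mul_add, mul_smul_comm,
          mul_smul_comm, add_mul, smul_mul_assoc, smul_mul_assoc, neg_add, smul_neg, smul_neg,
          ← mul_assoc (w : R)])
      left_inv := fun K => Anti.ext (by
        change -(((w⁻¹ : Rˣ) : R) * -((w : R) * K.val * ((g⁻¹ : Rˣ) : R)) * (g : R)) = K.val
        rw [mul_neg, neg_mul, neg_neg, ← mul_assoc, ← mul_assoc, Units.inv_mul, one_mul, mul_assoc,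
          Units.inv_mul, mul_one])
      right_inv := fun L => Anti.ext (by
        change -((w : R) * -(((w⁻¹ : Rˣ) : R) * L.val * (g : R)) * ((g⁻¹ : Rˣ) : R)) = L.val
        rw [mul_neg, neg_mul, neg_neg, ← mul_assoc, ← mul_assoc, Units.mul_inv, one_mul, mul_assoc,
          Units.mul_inv, mul_one])
      continuous_toFun := continuous_induced_rng.2 (by
        change Continuous fun K : Anti J => -((w : R) * K.val * ((g⁻¹ : Rˣ) : R))
        fun_prop)
      continuous_invFun := continuous_induced_rng.2 (by
        have := continuous_val J'
        change Continuous fun L : Anti J' => -(((w⁻¹ : Rˣ) : R) * L.val * (g : R))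
        fun_prop) }
  refine ⟨D, fun K => ?_⟩
  have hcaf : ContinuousOn (fun x : Anti J => afVal J x.val) (afDom J) := by
    refine ContinuousOn.mul (Continuous.continuousOn (by fun_prop)) ?_
    exact hR.continuousOn_inverse.comp (Continuous.continuousOn (by fun_prop)) fun x hx => hx
  -- From ψ(x)(1 + x) = (1 + x)J follows ψ(y) - ψ(x) = ((y - x)J - ψ(x)(y - x))(1 + y)⁻¹. On the
  -- diagonal, KJ = -JK turns the numerator into -(J + J')K.
  have key := SlopeClass.hasDirDeriv_of_slope (hR.isOpen_afDom J)
    (f := fun K' : Anti J => afVal J K'.val)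
    (Φ := fun p => (p.2.2.val * J.1 - afVal J p.1.val * p.2.2.val) *
      Ring.inverse (1 + p.2.1.val)) ?_ ?_ ?_ H.2 K
  · convert key using 1
    change -((w : R) * K.val * ((g⁻¹ : Rˣ) : R)) = _
    rw [← hg, Ring.inverse_unit, ← hJ'v, hw, anti_mul J K.property, ← neg_mul, add_mul, neg_add,
      sub_eq_add_neg]
  · intro x hx y hy
    have e1 : afVal J x.val * (1 + x.val) = (1 + x.val) * J.1 := by
      rw [afVal, mul_assoc, Ring.inverse_mul_cancel _ hx, mul_one]
    have e2 : (y - x).val = (1 + y.val) - (1 + x.val) := by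
      change y.val - x.val = _
      abel
    simp only
    rw [e2, mul_sub, e1, sub_mul _ _ J.1, sub_sub_sub_cancel_right, sub_mul,
      mul_assoc (afVal J x.val), Ring.mul_inverse_cancel _ hy, mul_one, afVal]
  · intro x _ y _
    refine ⟨fun v w => ?_, fun c v => ?_⟩
    · change ((v.val + w.val) * _ - _ * (v.val + w.val)) * _ = _
      noncomm_ring
    · have : (c • v).val = c • v.val := map_smul (Anti.valₗ J) c v
      simp only [this, mul_smul_comm, smul_mul_assoc, ← smul_sub]
  · refine ContinuousOn.mul (ContinuousOn.sub (Continuous.continuousOn (by fun_prop))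
      (ContinuousOn.mul ?_ (Continuous.continuousOn (by fun_prop)))) ?_
    · exact hcaf.comp continuous_fst.continuousOn fun p hp => hp.1
    · exact hR.continuousOn_inverse.comp (Continuous.continuousOn (by fun_prop))
        fun p hp => hp.2.1

end Atlas

end IsUnitOpenAlgebra

/-! ### Grassmann algebras -/

theorem eq_zero_of_eq_neg {V : Type*} [AddCommGroup V] [Module ℝ V] {x : V} (h : x = -x) : x = 0 := by
  have h2 : (2 : ℝ) • x = 0 := by rw [two_smul]; nth_rewrite 2 [h]; exact add_neg_cancel x
  exact (smul_eq_zero.1 h2).resolve_left two_ne_zero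

namespace Grass

variable (n : ℕ)

/-- The basis of monomials. -/
def basis : Module.Basis (Finset (Fin n)) ℝ (Grass n) := (Pi.basisFun ℝ (Fin n)).ExteriorAlgebra

instance : Module.Finite ℝ (Grass n) := Module.Finite.of_basis (basis n)

/-- The augmentation `ε : Λ_n → ℝ`. -/
def aug : Grass n →ₐ[ℝ] ℝ := ExteriorAlgebra.algebraMapInv

variable {n}

@[simp]
theorem aug_ι (v : Fin n → ℝ) : aug n (ExteriorAlgebra.ι ℝ v) = 0 := by
  simp [aug, ExteriorAlgebra.algebraMapInv]

/-- The span of the generators. -/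
abbrev gens (n : ℕ) : Submodule ℝ (Grass n) :=
  LinearMap.range (ExteriorAlgebra.ι ℝ : (Fin n → ℝ) →ₗ[ℝ] Grass n)

/-- The elements that are sums of products of at least `k` generators. -/
def fil (n k : ℕ) : Submodule ℝ (Grass n) := ⨆ (j : ℕ) (_ : k ≤ j), gens n ^ j

theorem gens_pow_le_fil {k j : ℕ} (h : k ≤ j) : gens n ^ j ≤ fil n k :=
  le_iSup₂_of_le (f := fun j (_ : k ≤ j) => gens n ^ j) j h le_rfl

theorem fil_le_iff {k : ℕ} {S : Submodule ℝ (Grass n)} :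
    fil n k ≤ S ↔ ∀ j, k ≤ j → gens n ^ j ≤ S := iSup₂_le_iff

theorem fil_mul_fil (k l : ℕ) : fil n k * fil n l ≤ fil n (k + l) := by
  rw [fil, fil, Submodule.iSup_mul]
  refine iSup_le fun i => ?_
  rw [Submodule.iSup_mul]
  refine iSup_le fun hi => ?_
  rw [Submodule.mul_iSup]
  refine iSup_le fun j => ?_
  rw [Submodule.mul_iSup]
  refine iSup_le fun hj => ?_
  rw [← pow_add]
  exact gens_pow_le_fil (add_le_add hi hj)

theorem mul_mem_fil {k l : ℕ} {x y : Grass n} (hx : x ∈ fil n k) (hy : y ∈ fil n l) :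
    x * y ∈ fil n (k + l) :=
  fil_mul_fil k l (Submodule.mul_mem_mul hx hy)

/-- This is the j-th exterior power of ℝⁿ, of dimension n choose j. -/
theorem gens_pow_eq_bot {j : ℕ} (h : n < j) : gens n ^ j = ⊥ := by
  have hr : Module.finrank ℝ (⋀[ℝ]^j (Fin n → ℝ)) = 0 := by
    rw [exteriorPower.finrank_eq, Module.finrank_fin_fun, Nat.choose_eq_zero_of_lt h]
  exact Submodule.finrank_eq_zero.1 hr

theorem fil_eq_bot : fil n (n + 1) = ⊥ :=
  le_bot_iff.1 (fil_le_iff.2 fun _ hj => (gens_pow_eq_bot hj).le)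

theorem fil_zero : fil n 0 = ⊤ := by
  rw [eq_top_iff, ← CliffordAlgebra.iSup_ι_range_eq_top]
  exact iSup_le fun j => gens_pow_le_fil (Nat.zero_le j)

theorem aug_of_mem_fil_one {x : Grass n} (hx : x ∈ fil n 1) : aug n x = 0 := by
  suffices h : fil n 1 ≤ LinearMap.ker (aug n).toLinearMap from h hx
  refine fil_le_iff.2 fun j hj => ?_
  obtain ⟨j, rfl⟩ := Nat.exists_eq_add_of_le' hj
  rw [pow_succ, Submodule.mul_le]
  rintro x - _ ⟨v, rfl⟩
  simp

theorem sub_aug_mem_fil_one (x : Grass n) : x - algebraMap ℝ _ (aug n x) ∈ fil n 1 := by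
  have hx : x ∈ fil n 0 := by rw [fil_zero]; trivial
  suffices h : fil n 0 ≤ (fil n 1).comap (LinearMap.id -
      (Algebra.linearMap ℝ (Grass n)) ∘ₗ (aug n).toLinearMap) from h hx
  refine fil_le_iff.2 fun j _ => ?_
  rcases Nat.eq_zero_or_pos j with rfl | hj
  · rw [pow_zero]
    rintro _ ⟨r, rfl⟩
    simp
  · intro x hx
    have h1 : x ∈ fil n 1 := gens_pow_le_fil hj hx
    simpa [aug_of_mem_fil_one h1] using h1

theorem mem_fil_one_iff {x : Grass n} : x ∈ fil n 1 ↔ aug n x = 0 := by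
  refine ⟨aug_of_mem_fil_one, fun h => ?_⟩
  simpa [h] using sub_aug_mem_fil_one x

/-- The parity involution. -/
abbrev inv (n : ℕ) : Grass n →ₐ[ℝ] Grass n := CliffordAlgebra.involute

theorem inv_mem_fil {k : ℕ} {x : Grass n} (hx : x ∈ fil n k) : inv n x ∈ fil n k := by
  suffices h : fil n k ≤ (fil n k).comap (inv n).toLinearMap from h hx
  refine fil_le_iff.2 fun j hj => ?_
  rw [← Submodule.map_le_iff_le_comap, Submodule.map_pow]
  refine (pow_le_pow_left' ?_ j).trans (gens_pow_le_fil hj)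
  rintro _ ⟨_, ⟨v, rfl⟩, rfl⟩
  exact ⟨-v, by
    rw [map_neg]
    exact (CliffordAlgebra.involute_ι (Q := (0 : QuadraticForm ℝ (Fin n → ℝ))) v).symm⟩

theorem exists_part_add (x : Grass n) :
    ∃ a ∈ part n 0, ∃ b ∈ part n 1, a + b = x := by
  have h := (CliffordAlgebra.evenOdd_isCompl (0 : QuadraticForm ℝ (Fin n → ℝ))).sup_eq_top
  exact Submodule.mem_sup.1 (h ▸ Submodule.mem_top : x ∈ part n 0 ⊔ part n 1)

theorem inv_of_mem_zero {x : Grass n} (hx : x ∈ part n 0) : inv n x = x :=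
  CliffordAlgebra.involute_eq_of_mem_even hx

theorem inv_of_mem_one {x : Grass n} (hx : x ∈ part n 1) : inv n x = -x :=
  CliffordAlgebra.involute_eq_of_mem_odd hx

/-- The derivative with respect to the `j`-th generator. -/
def deriv (j : Fin n) : Grass n →ₗ[ℝ] Grass n :=
  CliffordAlgebra.contractLeft (Q := (0 : QuadraticForm ℝ (Fin n → ℝ))) (LinearMap.proj j)

theorem deriv_ι_mul (j : Fin n) (v : Fin n → ℝ) (x : Grass n) :
    deriv j (ExteriorAlgebra.ι ℝ v * x) = v j • x - ExteriorAlgebra.ι ℝ v * deriv j x :=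
  CliffordAlgebra.contractLeft_ι_mul ..

theorem deriv_ι (j : Fin n) (v : Fin n → ℝ) :
    deriv j (ExteriorAlgebra.ι ℝ v) = algebraMap ℝ _ (v j) :=
  CliffordAlgebra.contractLeft_ι ..

theorem deriv_algebraMap (j : Fin n) (r : ℝ) : deriv j (algebraMap ℝ _ r) = 0 :=
  CliffordAlgebra.contractLeft_algebraMap ..

@[elab_as_elim]
theorem left_induction {C : Grass n → Prop} (x : Grass n) (h0 : ∀ r, C (algebraMap ℝ _ r))
    (h1 : ∀ x y, C x → C y → C (x + y))
    (h2 : ∀ v x, C x → C (ExteriorAlgebra.ι ℝ v * x)) : C x :=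
  CliffordAlgebra.left_induction (Q := (0 : QuadraticForm ℝ (Fin n → ℝ))) h0 h1
    (fun x v h => h2 v x h) x

theorem inv_ι (v : Fin n → ℝ) : inv n (ExteriorAlgebra.ι ℝ v) = -ExteriorAlgebra.ι ℝ v :=
  CliffordAlgebra.involute_ι (Q := (0 : QuadraticForm ℝ (Fin n → ℝ))) v

theorem deriv_mul (j : Fin n) (x y : Grass n) :
    deriv j (x * y) = deriv j x * y + inv n x * deriv j y := by
  induction x using left_induction with
  | h0 r => rw [deriv_algebraMap, zero_mul, zero_add, AlgHom.commutes, ← Algebra.smul_def, map_smul,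
      ← Algebra.smul_def]
  | h1 a b ha hb => rw [add_mul, map_add, ha, hb, map_add, map_add, add_mul, add_mul]; abel
  | h2 v a ha =>
    rw [mul_assoc, deriv_ι_mul, ha, deriv_ι_mul, map_mul, inv_ι, sub_mul, smul_mul_assoc]
    noncomm_ring

theorem deriv_inv (j : Fin n) (x : Grass n) : deriv j (inv n x) = -inv n (deriv j x) := by
  induction x using left_induction with
  | h0 r => rw [AlgHom.commutes, deriv_algebraMap, map_zero, neg_zero]
  | h1 a b ha hb => rw [map_add, map_add, ha, hb, map_add, map_add, neg_add]
  | h2 v a ha =>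
    rw [map_mul, inv_ι, neg_mul, map_neg, deriv_ι_mul, ha, deriv_ι_mul, map_sub, map_smul, map_mul,
      inv_ι]
    noncomm_ring

/-! The linear forms `x ↦ ε (∂_{j₁} ⋯ ∂_{j_k} x)` span the dual space. -/

theorem deriv_mem_gens_pow (j : Fin n) {k : ℕ} {x : Grass n} (hx : x ∈ gens n ^ (k + 1)) :
    deriv j x ∈ gens n ^ k := by
  induction k generalizing x with
  | zero =>
    rw [zero_add, pow_one] at hx
    obtain ⟨v, rfl⟩ := hx
    rw [deriv_ι, pow_zero]
    exact Submodule.algebraMap_mem _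
  | succ k ih =>
    rw [pow_succ'] at hx
    refine Submodule.mul_induction_on hx ?_ fun a b ha hb => by rw [map_add]; exact add_mem ha hb
    rintro _ ⟨v, rfl⟩ y hy
    rw [deriv_ι_mul]
    refine sub_mem (Submodule.smul_mem _ _ hy) ?_
    rw [pow_succ']
    exact Submodule.mul_mem_mul ⟨v, rfl⟩ (ih hy)

theorem deriv_mem_fil (j : Fin n) {k : ℕ} {x : Grass n} (hx : x ∈ fil n (k + 1)) :
    deriv j x ∈ fil n k := by
  suffices h : fil n (k + 1) ≤ (fil n k).comap (deriv j) from h hx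
  refine fil_le_iff.2 fun i hi y hy => ?_
  obtain ⟨i, rfl⟩ := Nat.exists_eq_add_of_le' (le_trans (Nat.le_add_left 1 k) hi)
  exact gens_pow_le_fil (Nat.le_of_succ_le_succ hi) (deriv_mem_gens_pow j hy)

/-- The number operator `∑ θ_j ∂_j`. -/
def number (n : ℕ) : Grass n →ₗ[ℝ] Grass n :=
  ∑ j, LinearMap.mulLeft ℝ (ExteriorAlgebra.ι ℝ (Pi.single j 1)) ∘ₗ deriv j

theorem number_apply (x : Grass n) :
    number n x = ∑ j, ExteriorAlgebra.ι ℝ (Pi.single j (1 : ℝ)) * deriv j x := by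
  simp [number, LinearMap.sum_apply]

theorem sum_smul_ι (v : Fin n → ℝ) :
    ∑ j, v j • (ExteriorAlgebra.ι ℝ (Pi.single j (1 : ℝ)) : Grass n) = ExteriorAlgebra.ι ℝ v := by
  simp_rw [← map_smul]
  rw [← map_sum]
  congr 1
  ext i
  simp [Finset.sum_apply, Pi.single_apply]

theorem number_ι_mul (v : Fin n → ℝ) (x : Grass n) :
    number n (ExteriorAlgebra.ι ℝ v * x) =
      ExteriorAlgebra.ι ℝ v * x + ExteriorAlgebra.ι ℝ v * number n x := by
  rw [number_apply, number_apply, Finset.mul_sum]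
  nth_rewrite 2 [← sum_smul_ι v]
  rw [Finset.sum_mul, ← Finset.sum_add_distrib]
  refine Finset.sum_congr rfl fun j _ => ?_
  have h := eq_neg_of_add_eq_zero_left
    (ExteriorAlgebra.ι_add_mul_swap (R := ℝ) (Pi.single j (1 : ℝ)) v)
  rw [deriv_ι_mul, mul_sub, mul_smul_comm, smul_mul_assoc, ← mul_assoc, h, neg_mul, sub_neg_eq_add,
    mul_assoc]

theorem number_of_mem {k : ℕ} {x : Grass n} (hx : x ∈ gens n ^ k) : number n x = (k : ℝ) • x := by
  induction k generalizing x with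
  | zero =>
    rw [pow_zero] at hx
    obtain ⟨r, rfl⟩ := hx
    rw [number_apply, Nat.cast_zero, zero_smul]
    refine Finset.sum_eq_zero fun j _ => ?_
    rw [LinearMap.toSpanSingleton_apply, ← Algebra.algebraMap_eq_smul_one, deriv_algebraMap, mul_zero]
  | succ k ih =>
    rw [pow_succ'] at hx
    refine Submodule.mul_induction_on hx ?_ fun a b ha hb => by rw [map_add, ha, hb, smul_add]
    rintro _ ⟨v, rfl⟩ y hy
    rw [number_ι_mul, ih hy, mul_smul_comm, Nat.cast_succ, add_smul, one_smul, add_comm]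

/-- The number operator multiplies products of exactly k generators by k, and longer products lie in
the next step of the filtration anyway. -/
theorem number_sub_mem {k : ℕ} {x : Grass n} (hx : x ∈ fil n k) :
    number n x - (k : ℝ) • x ∈ fil n (k + 1) := by
  suffices h : fil n k ≤ (fil n (k + 1)).comap (number n - (k : ℝ) • LinearMap.id) by
    simpa using h hx
  refine fil_le_iff.2 fun i hi y hy => ?_
  simp only [Submodule.mem_comap, LinearMap.sub_apply, LinearMap.smul_apply, LinearMap.id_apply,
    number_of_mem hy]
  rcases eq_or_lt_of_le hi with rfl | hi
  · simp
  · exact sub_mem (Submodule.smul_mem _ _ (gens_pow_le_fil hi hy))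
      (Submodule.smul_mem _ _ (gens_pow_le_fil hi hy))

theorem number_mem_fil {k : ℕ} {x : Grass n} (hx : ∀ j, deriv j x ∈ fil n k) :
    number n x ∈ fil n (k + 1) := by
  rw [number_apply]
  refine Submodule.sum_mem _ fun j _ => ?_
  rw [add_comm]
  refine mul_mem_fil (gens_pow_le_fil le_rfl ?_) (hx j)
  rw [pow_one]
  exact ⟨_, rfl⟩

/-- Iterated derivatives. -/
def derivs (L : List (Fin n)) : Grass n →ₗ[ℝ] Grass n :=
  L.foldr (fun j T => deriv j ∘ₗ T) LinearMap.id

theorem derivs_cons (j : Fin n) (L : List (Fin n)) : derivs (j :: L) = deriv j ∘ₗ derivs L := rfl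

theorem derivs_concat (L : List (Fin n)) (j : Fin n) (x : Grass n) :
    derivs (L ++ [j]) x = derivs L (deriv j x) := by
  induction L with
  | nil => rfl
  | cons i L ih => rw [List.cons_append, derivs_cons, derivs_cons, LinearMap.comp_apply, ih]; rfl

/-- Let x lie in step k > 0 of the filtration. By induction its derivatives satisfy the same
hypothesis and lie in step k, so the number operator Σ θ_j ∂_j takes x to step k + 1. Modulo that
step it is multiplication by k, so x itself lies there. Thus x climbs until the filtration is 0. -/
theorem eq_zero_of_aug_derivs {x : Grass n} (h : ∀ L, aug n (derivs L x) = 0) : x = 0 := by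
  have key : ∀ k (x : Grass n), (∀ L, aug n (derivs L x) = 0) → x ∈ fil n k → x ∈ fil n (k + 1) := by
    intro k
    induction k with
    | zero => intro x hx _; exact mem_fil_one_iff.2 (hx [])
    | succ k ih =>
      intro x hx hxk
      have h1 := number_mem_fil fun j => ih (deriv j x)
        (fun L => by rw [← derivs_concat]; exact hx _) (deriv_mem_fil j hxk)
      have h2 := sub_mem h1 (number_sub_mem hxk)
      rw [sub_sub_cancel] at h2
      exact (Submodule.smul_mem_iff _ (Nat.cast_ne_zero.2 k.succ_ne_zero)).1 h2
  have all : ∀ k, x ∈ fil n k := by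
    intro k
    induction k with
    | zero => rw [fil_zero]; trivial
    | succ k ih => exact key k x h ih
  have := all (n + 1)
  rwa [fil_eq_bot, Submodule.mem_bot] at this

/-- Dual to `eq_zero_of_aug_derivs`, by finite dimension. Because of it, the bodies of odd
derivatives of a superfunction determine all its components. -/
theorem span_aug_derivs : Submodule.span ℝ
    (range fun L : List (Fin n) => (aug n).toLinearMap ∘ₗ derivs L) = ⊤ := by
  set W := Submodule.span ℝ (range fun L : List (Fin n) => (aug n).toLinearMap ∘ₗ derivs L)
  have h : W.dualCoannihilator = ⊥ := by
    rw [eq_bot_iff]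
    intro x hx
    rw [Submodule.mem_dualCoannihilator] at hx
    exact eq_zero_of_aug_derivs fun L => hx _ (Submodule.subset_span ⟨L, rfl⟩)
  have h2 := Subspace.dualCoannihilator_dualAnnihilator_eq (W := W)
  rw [← h2, h, Submodule.dualAnnihilator_bot]

end Grass

/-! ### The topology of `Λ ⊗ V` -/

section TensorTopology

instance (n : ℕ) (V : Type*) [AddCommGroup V] [Module ℝ V] [TopologicalSpace V] :
    TopologicalSpace (Grass n ⊗[ℝ] V) := tensorTopology n V

variable {n : ℕ} {V W : Type*} [AddCommGroup V] [Module ℝ V]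

@[simp]
theorem tensorSlice_tmul (l : Module.Dual ℝ (Grass n)) (a : Grass n) (v : V) :
    tensorSlice V l (a ⊗ₜ v) = l a • v := by
  simp [tensorSlice]

theorem sum_basis_tmul_slice (x : Grass n ⊗[ℝ] V) :
    ∑ i, Grass.basis n i ⊗ₜ[ℝ] tensorSlice V ((Grass.basis n).coord i) x = x := by
  induction x with
  | zero => simp
  | add x y hx hy =>
    simp only [map_add, TensorProduct.tmul_add, Finset.sum_add_distrib]
    rw [hx, hy]
  | tmul a v =>
    simp only [tensorSlice_tmul, TensorProduct.tmul_smul, TensorProduct.smul_tmul']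
    rw [← TensorProduct.sum_tmul]
    congr 1
    exact (Grass.basis n).sum_repr a

theorem slice_map {n' : ℕ} {V' : Type*} [AddCommGroup V'] [Module ℝ V']
    (f : Grass n →ₗ[ℝ] Grass n') (g : V →ₗ[ℝ] V') (l : Module.Dual ℝ (Grass n'))
    (x : Grass n ⊗[ℝ] V) :
    tensorSlice V' l (TensorProduct.map f g x) = g (tensorSlice V (l ∘ₗ f) x) := by
  induction x with
  | zero => simp
  | add x y hx hy => simp only [map_add, hx, hy]
  | tmul a v => simp

variable [TopologicalSpace V]

theorem continuous_slice (l : Module.Dual ℝ (Grass n)) : Continuous (tensorSlice V l) :=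
  continuous_iInf_dom continuous_induced_dom

theorem continuous_tensor_iff {Z : Type*} [TopologicalSpace Z] {f : Z → Grass n ⊗[ℝ] V} :
    Continuous f ↔ ∀ l : Module.Dual ℝ (Grass n), Continuous fun z => tensorSlice V l (f z) := by
  simp only [continuous_iInf_rng, continuous_induced_rng]
  rfl

theorem continuous_tmul [ContinuousConstSMul ℝ V] (a : Grass n) :
    Continuous fun v : V => a ⊗ₜ[ℝ] v :=
  continuous_tensor_iff.2 fun l => by
    simp only [tensorSlice_tmul]
    fun_prop

/-- The monomial basis exhibits Λ ⊗ V as a retract of a finite power of V. -/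
theorem IsFrechetSpace.tensor (hV : IsFrechetSpace V) : IsFrechetSpace (Grass n ⊗[ℝ] V) := by
  have := hV.addGroup
  have := hV.smul
  have hg : IsTopologicalAddGroup (Grass n ⊗[ℝ] V) :=
    topologicalAddGroup_iInf fun l => topologicalAddGroup_induced (tensorSlice V l)
  refine (IsFrechetSpace.pi fun _ : Finset (Fin n) => hV).retract
    (LinearMap.pi fun i => tensorSlice V ((Grass.basis n).coord i))
    (fun v => ∑ i, Grass.basis n i ⊗ₜ[ℝ] v i)
    (continuous_pi fun i => continuous_slice _) ?_ sum_basis_tmul_slice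
  exact continuous_finsetSum _ fun i _ => (continuous_tmul _).comp (continuous_apply i)

variable [AddCommGroup W] [Module ℝ W] [TopologicalSpace W] [IsTopologicalAddGroup W]

/-- Expansion in the finite monomial basis writes `f` as a finite sum of maps v ↦ f(a ⊗ v) applied
to continuous components. The bilinear version rests on the same expansion in both arguments. -/
theorem continuous_of_continuous_tmul {f : Grass n ⊗[ℝ] V →ₗ[ℝ] W}
    (hf : ∀ a, Continuous fun v => f (a ⊗ₜ v)) : Continuous f := by
  have h : (f : Grass n ⊗[ℝ] V → W) =
      fun x => ∑ i, f (Grass.basis n i ⊗ₜ[ℝ] tensorSlice V ((Grass.basis n).coord i) x) := by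
    funext x
    rw [← map_sum, sum_basis_tmul_slice]
  rw [h]
  exact continuous_finsetSum _ fun i _ => (hf _).comp (continuous_slice _)

theorem continuous₂_of_continuous_tmul {n' : ℕ} {V' : Type*} [AddCommGroup V'] [Module ℝ V']
    [TopologicalSpace V'] {f : Grass n ⊗[ℝ] V →ₗ[ℝ] Grass n' ⊗[ℝ] V' →ₗ[ℝ] W}
    (hf : ∀ a a', Continuous fun p : V × V' => f (a ⊗ₜ p.1) (a' ⊗ₜ p.2)) :
    Continuous fun p : (Grass n ⊗[ℝ] V) × (Grass n' ⊗[ℝ] V') => f p.1 p.2 := by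
  have h : (fun p : (Grass n ⊗[ℝ] V) × (Grass n' ⊗[ℝ] V') => f p.1 p.2) =
      fun p => ∑ i, ∑ j, f (Grass.basis n i ⊗ₜ[ℝ] tensorSlice V ((Grass.basis n).coord i) p.1)
        (Grass.basis n' j ⊗ₜ[ℝ] tensorSlice V' ((Grass.basis n').coord j) p.2) := by
    funext p
    simp only [← map_sum, sum_basis_tmul_slice]
    rw [← LinearMap.sum_apply, ← map_sum, sum_basis_tmul_slice]
  rw [h]
  refine continuous_finsetSum _ fun i _ => continuous_finsetSum _ fun j _ => ?_
  exact (hf _ _).comp (((continuous_slice _).comp continuous_fst).prodMk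
    ((continuous_slice _).comp continuous_snd))

end TensorTopology

/-! ### The superalgebra `(Λ ⊗ B)_0` -/

/-- Fréchet superalgebras with continuous parity projections, in which the even elements close to `1`
are invertible. -/
structure IsSuperUnitOpen {B : Type*} [Ring B] [Algebra ℝ B] [TopologicalSpace B]
    (P : ZMod 2 → Submodule ℝ B) [GradedAlgebra P] : Prop where
  frechet : IsFrechetSpace B
  mul : ContinuousMul B
  proj : ∀ i, Continuous fun b => (DirectSum.decompose P b i : B)
  units : ∀ᶠ A in 𝓝 (1 : B), A ∈ P 0 → ∃ C ∈ P 0, A * C = 1 ∧ C * A = 1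

theorem zmod_two_cases (i : ZMod 2) : i = 0 ∨ i = 1 := by revert i; decide

section Parity

variable {B : Type*} [AddCommGroup B] [Module ℝ B] (P : ZMod 2 → Submodule ℝ B)
  [DirectSum.Decomposition P]

/-- The parity projections. -/
def parityProj (i : ZMod 2) : B →ₗ[ℝ] B :=
  (P i).subtype ∘ₗ DirectSum.component ℝ (ZMod 2) (fun i => P i) i ∘ₗ
    (DirectSum.decomposeLinearEquiv P).toLinearMap

theorem parityProj_mem (i : ZMod 2) (b : B) : parityProj P i b ∈ P i := SetLike.coe_mem _

theorem parityProj_of_mem {i : ZMod 2} {b : B} (h : b ∈ P i) : parityProj P i b = b :=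
  DirectSum.decompose_of_mem_same P h

theorem parityProj_of_mem_ne {i j : ZMod 2} (hij : i ≠ j) {b : B} (h : b ∈ P i) :
    parityProj P j b = 0 :=
  DirectSum.decompose_of_mem_ne P h hij

theorem parityProj_add (b : B) : parityProj P 0 b + parityProj P 1 b = b := by
  induction b using DirectSum.Decomposition.inductionOn P with
  | zero => simp
  | @homogeneous i b =>
    rcases zmod_two_cases i with rfl | rfl
    · rw [parityProj_of_mem P b.2, parityProj_of_mem_ne P zero_ne_one b.2, add_zero]
    · rw [parityProj_of_mem P b.2, parityProj_of_mem_ne P one_ne_zero b.2, zero_add]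
  | add x y hx hy =>
    rw [map_add, map_add, add_add_add_comm, hx, hy]

end Parity

section BarTopology

variable {B : Type u} [Ring B] [Algebra ℝ B] (P : ZMod 2 → Submodule ℝ B) [GradedAlgebra P]
variable {Λ : Gr}

/-- `Bar.toTensor` as a linear map. -/
def Bar.toTensorₗ (Λ : Gr) : Bar P Λ →ₗ[ℝ] Grass Λ.n ⊗[ℝ] B :=
  (GradedTensorProduct.of ℝ (Grass.part Λ.n) P).symm.toLinearMap ∘ₗ (barAlg P Λ).val.toLinearMap

theorem Bar.toTensorₗ_apply (x : Bar P Λ) : Bar.toTensorₗ P Λ x = Bar.toTensor P x := rfl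

/-- An even tensor, as an element of `(Λ ⊗ B)_0`. -/
def Bar.mk (t : Grass Λ.n ⊗[ℝ] B) (ht : t ∈ evenTensor Λ.n P) : Bar P Λ :=
  ⟨GradedTensorProduct.of ℝ (Grass.part Λ.n) P t, ht⟩

theorem Bar.toTensor_mem (x : Bar P Λ) : Bar.toTensor P x ∈ evenTensor Λ.n P := x.2

/-- The product of `Λ ⊗ B` as a bilinear map. -/
def gMul (Λ : Gr) : Grass Λ.n ⊗[ℝ] B →ₗ[ℝ] Grass Λ.n ⊗[ℝ] B →ₗ[ℝ] Grass Λ.n ⊗[ℝ] B :=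
  ((LinearMap.mul ℝ (GTensor P Λ)).compl₁₂
    (GradedTensorProduct.of ℝ (Grass.part Λ.n) P).toLinearMap
    (GradedTensorProduct.of ℝ (Grass.part Λ.n) P).toLinearMap).compr₂
      (GradedTensorProduct.of ℝ (Grass.part Λ.n) P).symm.toLinearMap

theorem Bar.toTensor_mul (x y : Bar P Λ) :
    Bar.toTensor P (x * y) = gMul P Λ (Bar.toTensor P x) (Bar.toTensor P y) := rfl

theorem Bar.toTensor_one : Bar.toTensor P (1 : Bar P Λ) = 1 ⊗ₜ 1 := rfl

theorem gMul_tmul {i j : ZMod 2} {a a' : Grass Λ.n} {b b' : B}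
    (ha' : a' ∈ Grass.part Λ.n j) (hb : b ∈ P i) :
    gMul P Λ (a ⊗ₜ b) (a' ⊗ₜ b') =
      ((((-1 : ℤˣ) ^ (i * j) : ℤˣ) : ℤ) : ℝ) • ((a * a') ⊗ₜ (b * b')) := by
  exact congrArg (GradedTensorProduct.of ℝ (Grass.part Λ.n) P).symm (tmul_mul_tmul P Λ ha' hb)

/-- An even c produces no Koszul sign. For multiplication from the right no assumption on c is
needed, since there the sign involves only the even element 1. -/
theorem gMul_one_tmul_left {c : B} (hc : c ∈ P 0) (x : Grass Λ.n ⊗[ℝ] B) :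
    gMul P Λ (1 ⊗ₜ c) x = TensorProduct.map LinearMap.id (LinearMap.mulLeft ℝ c) x := by
  induction x with
  | zero => simp
  | add x y hx hy => rw [map_add, map_add, hx, hy]
  | tmul a b =>
    obtain ⟨a₀, h₀, a₁, h₁, rfl⟩ := Grass.exists_part_add a
    rw [TensorProduct.add_tmul, map_add, gMul_tmul P h₀ hc, gMul_tmul P h₁ hc]
    simp

theorem gMul_one_tmul_right (c : B) (x : Grass Λ.n ⊗[ℝ] B) :
    gMul P Λ x (1 ⊗ₜ c) = TensorProduct.map LinearMap.id (LinearMap.mulRight ℝ c) x := by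
  induction x with
  | zero => simp
  | add x y hx hy => rw [map_add, map_add, LinearMap.add_apply, hx, hy]
  | tmul a b =>
    rw [← parityProj_add P b, TensorProduct.tmul_add, map_add, LinearMap.add_apply,
      gMul_tmul P (one_mem_even_part _) (parityProj_mem P 0 b),
      gMul_tmul P (one_mem_even_part _) (parityProj_mem P 1 b)]
    simp

/-- The projection onto the even part. -/
def evenProj (Λ : Gr) : Grass Λ.n ⊗[ℝ] B →ₗ[ℝ] Grass Λ.n ⊗[ℝ] B :=
  ∑ i, TensorProduct.map (parityProj (Grass.part Λ.n) i) (parityProj P i)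

theorem evenProj_mem (x : Grass Λ.n ⊗[ℝ] B) : evenProj P Λ x ∈ evenTensor Λ.n P := by
  induction x with
  | zero => simp
  | add x y hx hy => rw [map_add]; exact add_mem hx hy
  | tmul a b =>
    rw [evenProj, LinearMap.sum_apply]
    exact Submodule.sum_mem _ fun i _ => Submodule.subset_span
      ⟨i, _, _, parityProj_mem _ i a, parityProj_mem P i b, rfl⟩

theorem evenProj_of_mem {x : Grass Λ.n ⊗[ℝ] B} (hx : x ∈ evenTensor Λ.n P) :
    evenProj P Λ x = x := by
  induction hx using Submodule.span_induction with
  | mem x h =>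
    obtain ⟨i, a, b, ha, hb, rfl⟩ := h
    rw [evenProj, LinearMap.sum_apply, Finset.sum_eq_single i]
    · rw [TensorProduct.map_tmul, parityProj_of_mem _ ha, parityProj_of_mem _ hb]
    · intro j _ hj
      rw [TensorProduct.map_tmul, parityProj_of_mem_ne _ hj.symm ha, TensorProduct.zero_tmul]
    · simp
  | zero => simp
  | add x y _ _ hx hy => rw [map_add, hx, hy]
  | smul r x _ hx => rw [map_smul, hx]

/-! ### Nilpotent elements and bodies -/

/-- The tensors whose first factors are products of at least `k` generators. -/
def tensorFil (n k : ℕ) (B : Type*) [AddCommGroup B] [Module ℝ B] : Submodule ℝ (Grass n ⊗[ℝ] B) :=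
  Submodule.span ℝ {x | ∃ (a : Grass n) (b : B), a ∈ Grass.fil n k ∧ x = a ⊗ₜ[ℝ] b}

theorem tensorFil_eq_bot (n : ℕ) : tensorFil n (n + 1) B = ⊥ := by
  refine eq_bot_iff.2 (Submodule.span_le.2 ?_)
  rintro _ ⟨a, b, ha, rfl⟩
  rw [Grass.fil_eq_bot, Submodule.mem_bot] at ha
  simp [ha]

theorem gMul_mem_tensorFil {k l : ℕ} {x y : Grass Λ.n ⊗[ℝ] B} (hx : x ∈ tensorFil Λ.n k B)
    (hy : y ∈ tensorFil Λ.n l B) : gMul P Λ x y ∈ tensorFil Λ.n (k + l) B := by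
  refine Submodule.span_induction₂ (p := fun x y _ _ => gMul P Λ x y ∈ tensorFil Λ.n (k + l) B)
    ?_ ?_ ?_ ?_ ?_ ?_ ?_ hx hy
  · rintro _ _ ⟨a, b, ha, rfl⟩ ⟨a', b', ha', rfl⟩
    -- The product formula holds for homogeneous factors only. The parity components (a' ± inv a')/2
    -- stay in the filtration because the involution preserves it.
    have hp : ∀ i, parityProj (Grass.part Λ.n) i a' ∈ Grass.fil Λ.n l := by
      have e := parityProj_add (Grass.part Λ.n) a'
      have h0 := Grass.inv_of_mem_zero (parityProj_mem (Grass.part Λ.n) 0 a')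
      have h1 := Grass.inv_of_mem_one (parityProj_mem (Grass.part Λ.n) 1 a')
      have hi := Grass.inv_mem_fil ha'
      rw [← e, map_add, h0, h1] at hi
      rw [← e] at ha'
      intro i
      rcases zmod_two_cases i with rfl | rfl
      · have := (Grass.fil Λ.n l).smul_mem (1 / 2 : ℝ) (add_mem ha' hi)
        convert this using 1
        module
      · have := (Grass.fil Λ.n l).smul_mem (1 / 2 : ℝ) (sub_mem ha' hi)
        convert this using 1
        module
    rw [← parityProj_add (Grass.part Λ.n) a', ← parityProj_add P b]
    simp only [TensorProduct.tmul_add, TensorProduct.add_tmul, map_add, LinearMap.add_apply]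
    have hm : ∀ i j, gMul P Λ (a ⊗ₜ parityProj P i b) (parityProj (Grass.part Λ.n) j a' ⊗ₜ b') ∈
        tensorFil Λ.n (k + l) B := fun i j => by
      rw [gMul_tmul P (parityProj_mem _ j a') (parityProj_mem P i b)]
      exact Submodule.smul_mem _ _ (Submodule.subset_span
        ⟨_, _, Grass.mul_mem_fil ha (hp j), rfl⟩)
    exact add_mem (add_mem (hm _ _) (hm _ _)) (add_mem (hm _ _) (hm _ _))
  · intro v _; simp
  · intro v _; simp
  · intro u v w _ _ _ h h'
    rw [map_add, LinearMap.add_apply]; exact add_mem h h'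
  · intro u v w _ _ _ h h'
    rw [map_add]; exact add_mem h h'
  · intro r u v _ _ h
    rw [map_smul, LinearMap.smul_apply]; exact Submodule.smul_mem _ _ h
  · intro r u v _ _ h
    rw [map_smul]; exact Submodule.smul_mem _ _ h

/-- Powers climb the filtration, and a product of more than n odd generators vanishes. -/
theorem Bar.isNilpotent {x : Bar P Λ} (hx : Bar.toTensor P x ∈ tensorFil Λ.n 1 B) :
    IsNilpotent x := by
  have h : ∀ k : ℕ, Bar.toTensor P (x ^ (k + 1)) ∈ tensorFil Λ.n (k + 1) B := by
    intro k
    induction k with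
    | zero => simpa using hx
    | succ k ih =>
      rw [pow_succ, Bar.toTensor_mul]
      exact gMul_mem_tensorFil P ih hx
  refine ⟨Λ.n + 1, Bar.toTensor_injective P Λ ?_⟩
  have := h Λ.n
  rw [tensorFil_eq_bot, Submodule.mem_bot] at this
  exact this.trans (map_zero (Bar.toTensorₗ P Λ)).symm

theorem zeroHom_apply (Λ Λ' : Gr) (a : Grass Λ.n) :
    GrHom.toAlgHom (Gr.zeroHom Λ Λ') a = algebraMap ℝ _ (Grass.aug Λ.n a) := by
  change ExteriorAlgebra.map 0 a = _
  induction a using Grass.left_induction with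
  | h0 r => simp
  | h1 x y hx hy => rw [map_add, hx, hy, map_add, map_add]
  | h2 v x hx => rw [map_mul, ExteriorAlgebra.map_apply_ι, map_mul, Grass.aug_ι]; simp

theorem zeroHom_comp (Λ Λ' Λ'' : Gr) :
    Gr.zeroHom Λ Λ' ≫ Gr.zeroHom Λ' Λ'' = Gr.zeroHom Λ Λ'' := by
  apply GrHom.ext
  apply AlgHom.ext
  intro v
  change GrHom.toAlgHom (Gr.zeroHom Λ' Λ'') (GrHom.toAlgHom (Gr.zeroHom Λ Λ') _) =
    GrHom.toAlgHom (Gr.zeroHom Λ Λ'') _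
  rw [zeroHom_apply, zeroHom_apply, zeroHom_apply, AlgHom.commutes]
  rfl

theorem sub_map_zeroHom_mem (x : Bar P Λ) :
    Bar.toTensor P (x - Bar.map P (Gr.zeroHom Λ Λ) x) ∈ tensorFil Λ.n 1 B := by
  rw [← Bar.toTensorₗ_apply, map_sub, Bar.toTensorₗ_apply, Bar.toTensorₗ_apply, Bar.toTensor_map]
  generalize Bar.toTensor P x = t
  induction t with
  | zero => simp
  | add x y hx hy => rw [map_add, add_sub_add_comm]; exact add_mem hx hy
  | tmul a b =>
    refine Submodule.subset_span ⟨_, b, Grass.sub_aug_mem_fil_one a, ?_⟩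
    rw [TensorProduct.map_tmul, TensorProduct.sub_tmul]
    congr 2
    exact zeroHom_apply Λ Λ a

theorem eq_algebraMap_aug (a : Grass Gr.real.n) : a = algebraMap ℝ _ (Grass.aug Gr.real.n a) := by
  have h := Grass.sub_aug_mem_fil_one a
  have h0 : Grass.fil Gr.real.n 1 = ⊥ := Grass.fil_eq_bot (n := 0)
  rwa [h0, Submodule.mem_bot, sub_eq_zero] at h

/-- The units xz and zx provide a right and a left inverse of x. -/
theorem isUnit_of_mul_mul {R : Type*} [Ring R] {x z : R} (h : IsUnit (x * z)) (h' : IsUnit (z * x)) :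
    IsUnit x := by
  obtain ⟨u, hu⟩ := h
  obtain ⟨v, hv⟩ := h'
  have h1 : x * (z * ((u⁻¹ : Rˣ) : R)) = 1 := by rw [← mul_assoc, ← hu, Units.mul_inv]
  have h2 : ((v⁻¹ : Rˣ) : R) * z * x = 1 := by rw [mul_assoc, ← hv, Units.inv_mul]
  exact ⟨⟨x, z * ((u⁻¹ : Rˣ) : R), h1, by rw [← left_inv_eq_right_inv h2 h1, h2]⟩, rfl⟩

/-- An element with body 1 is 1 plus a nilpotent, hence a unit. If z is the constant lift of the
inverse of the body of x, then xz and zx both have body 1. -/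
theorem Bar.isUnit_iff (x : Bar P Λ) :
    IsUnit x ↔ IsUnit (Bar.map P (Gr.zeroHom Λ Gr.real) x) := by
  refine ⟨fun h => h.map _, ?_⟩
  rintro ⟨u, hu⟩
  set z := Bar.map P (Gr.zeroHom Gr.real Λ) ((u⁻¹ : (Bar P Gr.real)ˣ) : Bar P Gr.real) with hz
  have hε : ∀ y : Bar P Λ, Bar.map P (Gr.zeroHom Λ Λ) y =
      Bar.map P (Gr.zeroHom Gr.real Λ) (Bar.map P (Gr.zeroHom Λ Gr.real) y) := fun y => by
    rw [← Bar.map_comp, zeroHom_comp]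
  have hzz : Bar.map P (Gr.zeroHom Λ Gr.real) z = ((u⁻¹ : (Bar P Gr.real)ˣ) : Bar P Gr.real) := by
    rw [hz, ← Bar.map_comp, real_comp]
    have : Gr.zeroHom Gr.real Gr.real = 𝟙 Gr.real := by
      apply GrHom.ext
      apply AlgHom.ext
      intro a
      rw [zeroHom_apply]
      exact (eq_algebraMap_aug a).symm
    rw [this, Bar.map_id]
  have key : ∀ y : Bar P Λ, Bar.map P (Gr.zeroHom Λ Gr.real) y = 1 → IsUnit y := by
    intro y hy
    have hn := Bar.isNilpotent P (sub_map_zeroHom_mem P y)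
    rw [hε y, hy, map_one] at hn
    simpa using hn.isUnit_one_add
  refine isUnit_of_mul_mul (z := z) (key _ ?_) (key _ ?_)
  · rw [map_mul, hzz, ← hu, Units.mul_inv]
  · rw [map_mul, hzz, ← hu, Units.inv_mul]

theorem tmul_eq_one_tmul (t : Grass Gr.real.n ⊗[ℝ] B) :
    t = 1 ⊗ₜ tensorSlice B (Grass.aug Gr.real.n).toLinearMap t := by
  induction t with
  | zero => simp
  | add x y hx hy => rw [map_add, TensorProduct.tmul_add, ← hx, ← hy]
  | tmul a b =>
    have h := eq_algebraMap_aug a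
    rw [tensorSlice_tmul, TensorProduct.tmul_smul, TensorProduct.smul_tmul',
      ← Algebra.algebraMap_eq_smul_one]
    nth_rewrite 1 [h]
    rfl

/-- The even element of `B` underlying a real point. -/
def realVal (x : Bar P Gr.real) : B :=
  tensorSlice B (Grass.aug Gr.real.n).toLinearMap (Bar.toTensor P x)

theorem toTensor_eq_one_tmul (x : Bar P Gr.real) : Bar.toTensor P x = 1 ⊗ₜ realVal P x :=
  tmul_eq_one_tmul _

/-- The Grassmann algebra without generators has no odd part, so only the tensors of an even scalar
with an even element contribute. -/
theorem realVal_mem (x : Bar P Gr.real) : realVal P x ∈ P 0 := by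
  have h : evenTensor Gr.real.n P ≤
      (P 0).comap (tensorSlice B (Grass.aug Gr.real.n).toLinearMap) := by
    refine Submodule.span_le.2 ?_
    rintro _ ⟨i, a, b, ha, hb, rfl⟩
    rcases zmod_two_cases i with rfl | rfl
    · simpa using (P 0).smul_mem _ hb
    · have h1 : a ∈ Grass.fil Gr.real.n 1 := by
        have h := eq_algebraMap_aug a
        have h2 := Grass.inv_of_mem_one ha
        rw [h, AlgHom.commutes, ← h] at h2
        rw [eq_zero_of_eq_neg h2]
        exact zero_mem _
      simp [Grass.aug_of_mem_fil_one h1]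
  exact h (Bar.toTensor_mem P x)

/-- An even element of `B`, as a real point. -/
def ofReal (c : B) (hc : c ∈ P 0) : Bar P Gr.real :=
  Bar.mk P (1 ⊗ₜ c) (Submodule.subset_span ⟨0, 1, c, one_mem_even_part _, hc, rfl⟩)

theorem realVal_ofReal (c : B) (hc : c ∈ P 0) : realVal P (ofReal P c hc) = c := by
  change tensorSlice B _ (1 ⊗ₜ c) = c
  rw [tensorSlice_tmul]
  simp

theorem realVal_injective : Function.Injective (realVal P) := fun x y h =>
  Bar.toTensor_injective P _ (by rw [toTensor_eq_one_tmul, toTensor_eq_one_tmul, h])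

theorem realVal_mul (x y : Bar P Gr.real) : realVal P (x * y) = realVal P x * realVal P y := by
  rw [realVal, Bar.toTensor_mul, toTensor_eq_one_tmul, toTensor_eq_one_tmul,
    gMul_one_tmul_left P (realVal_mem P x)]
  simp

theorem realVal_one : realVal P 1 = 1 := by
  rw [realVal, Bar.toTensor_one]; simp

theorem realVal_neg (x : Bar P Gr.real) : realVal P (-x) = -realVal P x := by
  rw [realVal, ← Bar.toTensorₗ_apply, map_neg, map_neg]; rfl

variable [TopologicalSpace B]

theorem Bar.continuous_toTensor : Continuous (Bar.toTensor P (Λ := Λ)) := continuous_induced_dom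

variable {P} (h : IsSuperUnitOpen P)
include h

/-- The projection onto the even part is a retraction of Λ ⊗ B, continuous because the parity
projections of B are. -/
theorem IsSuperUnitOpen.bar_frechet (Λ : Gr) : IsFrechetSpace (Bar P Λ) := by
  have := h.frechet.addGroup
  have := h.frechet.smul
  have := (h.frechet.tensor (n := Λ.n)).addGroup
  refine (h.frechet.tensor (n := Λ.n)).retract (Bar.toTensorₗ P Λ)
    (fun t => Bar.mk P _ (evenProj_mem P t)) (Bar.continuous_toTensor P) ?_
    fun x => Bar.toTensor_injective P Λ (evenProj_of_mem P x.2)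
  refine continuous_induced_rng.2 (continuous_of_continuous_tmul (f := evenProj P Λ) fun a => ?_)
  have : (fun v : B => evenProj P Λ (a ⊗ₜ v)) =
      fun v => ∑ i, parityProj (Grass.part Λ.n) i a ⊗ₜ[ℝ] parityProj P i v := by
    funext v
    rw [evenProj, LinearMap.sum_apply]
    rfl
  rw [this]
  exact continuous_finsetSum _ fun i _ => (continuous_tmul _).comp (h.proj i)

/-- After splitting into homogeneous components, the product of a ⊗ b and a' ⊗ b' is a finite sum of
signed tensors, continuous in (b, b'). -/
theorem IsSuperUnitOpen.bar_mul (Λ : Gr) : ContinuousMul (Bar P Λ) := by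
  have := h.frechet.addGroup
  have := h.frechet.smul
  have := h.mul
  have := (h.frechet.tensor (n := Λ.n)).addGroup
  have := (h.frechet.tensor (n := Λ.n)).smul
  refine ⟨continuous_induced_rng.2 ?_⟩
  have key : Continuous fun p : (Grass Λ.n ⊗[ℝ] B) × (Grass Λ.n ⊗[ℝ] B) => gMul P Λ p.1 p.2 := by
    refine continuous₂_of_continuous_tmul fun a a' => ?_
    have e : (fun p : B × B => gMul P Λ (a ⊗ₜ p.1) (a' ⊗ₜ p.2)) = fun p => ∑ i, ∑ j,
        ((((-1 : ℤˣ) ^ (i * j) : ℤˣ) : ℤ) : ℝ) •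
          ((a * parityProj (Grass.part Λ.n) j a') ⊗ₜ[ℝ] (parityProj P i p.1 * p.2)) := by
      funext p
      have e1 : ∑ j, parityProj (Grass.part Λ.n) j a' = a' :=
        (Fin.sum_univ_two (fun j : Fin 2 => parityProj (Grass.part Λ.n) j a')).trans
          (parityProj_add _ a')
      have e2 : ∑ j, parityProj P j p.1 = p.1 :=
        (Fin.sum_univ_two (fun j : Fin 2 => parityProj P j p.1)).trans (parityProj_add _ p.1)
      conv_lhs => rw [← e1, ← e2]
      simp only [TensorProduct.tmul_sum, TensorProduct.sum_tmul, map_sum, LinearMap.sum_apply]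
      rw [Finset.sum_comm]
      exact Finset.sum_congr rfl fun i _ => Finset.sum_congr rfl fun j _ =>
        gMul_tmul P (parityProj_mem (Grass.part Λ.n) _ a') (parityProj_mem P _ p.1)
    rw [e]
    refine continuous_finsetSum _ fun i _ => continuous_finsetSum _ fun j _ => ?_
    have hm : Continuous fun p : B × B => parityProj P i p.1 * p.2 :=
      ((h.proj i).comp continuous_fst).mul continuous_snd
    exact (continuous_const_smul (T := Grass Λ.n ⊗[ℝ] B) _).comp
      ((continuous_tmul (a * parityProj (Grass.part Λ.n) j a')).comp hm)
  have e : (Bar.toTensor P ∘ fun p : Bar P Λ × Bar P Λ => p.1 * p.2) =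
      (fun p : (Grass Λ.n ⊗[ℝ] B) × (Grass Λ.n ⊗[ℝ] B) => gMul P Λ p.1 p.2) ∘
        fun p => (Bar.toTensor P p.1, Bar.toTensor P p.2) :=
    funext fun p => Bar.toTensor_mul P p.1 p.2
  rw [e]
  exact key.comp (((Bar.continuous_toTensor P).comp continuous_fst).prodMk
    ((Bar.continuous_toTensor P).comp continuous_snd))

/-- Invertibility depends on the body alone. The body is an even element of B and depends
continuously on the point, so near 1 the assumption on B supplies its inverse. -/
theorem IsSuperUnitOpen.isUnitOpenAlgebra (Λ : Gr) : IsUnitOpenAlgebra (Bar P Λ) := by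
  refine ⟨h.bar_frechet Λ, h.bar_mul Λ, ?_⟩
  have hc : Continuous fun x : Bar P Λ => realVal P (Bar.map P (Gr.zeroHom Λ Gr.real) x) :=
    (continuous_slice _).comp ((Bar.continuous_toTensor P).comp (Bar.map_continuous P _))
  have ht := hc.tendsto 1
  rw [map_one, realVal_one] at ht
  filter_upwards [ht.eventually h.units] with x hx
  obtain ⟨C, hC, h1, h2⟩ := hx (realVal_mem P _)
  rw [Bar.isUnit_iff]
  refine ⟨⟨_, ofReal P C hC, realVal_injective P ?_, realVal_injective P ?_⟩, rfl⟩
  · rw [realVal_mul, realVal_ofReal, h1, realVal_one]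
  · rw [realVal_mul, realVal_ofReal, h2, realVal_one]

end BarTopology

/-! ### Supercharts -/

section SuperCharts

variable {B : Type u} [Ring B] [Algebra ℝ B] (P : ZMod 2 → Submodule ℝ B) [GradedAlgebra P]

/-- The element of square `-1` of `B` underlying a real point. -/
def realAcs (J : Acs (Bar P Gr.real)) : Acs B :=
  ⟨realVal P J.1, by rw [← realVal_mul, J.2, realVal_neg, realVal_one]⟩

theorem toTensor_constLift (J : Acs (Bar P Gr.real)) (Λ : Gr) :
    Bar.toTensor P (constLift P J Λ).1 = 1 ⊗ₜ (realAcs P J).1 := by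
  refine (Bar.toTensor_map P (Gr.zeroHom Gr.real Λ) J.1).trans ?_
  rw [toTensor_eq_one_tmul, TensorProduct.map_tmul]
  exact congrArg (fun a : Grass Λ.n => a ⊗ₜ[ℝ] realVal P J.1)
    (map_one (GrHom.toAlgHom (Gr.zeroHom Gr.real Λ)))

theorem realAcs_mem (J : Acs (Bar P Gr.real)) : (realAcs P J).1 ∈ P 0 := realVal_mem P J.1

theorem toTensor_constLift_mul (J : Acs (Bar P Gr.real)) {Λ : Gr} (x : Bar P Λ) :
    Bar.toTensor P ((constLift P J Λ).1 * x) = TensorProduct.map (LinearMap.id (R := ℝ)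
      (M := Grass Λ.n)) (LinearMap.mulLeft ℝ (realAcs P J).1) (Bar.toTensor P x) := by
  rw [Bar.toTensor_mul, toTensor_constLift]
  exact gMul_one_tmul_left P (realAcs_mem P J) _

theorem toTensor_mul_constLift (J : Acs (Bar P Gr.real)) {Λ : Gr} (x : Bar P Λ) :
    Bar.toTensor P (x * (constLift P J Λ).1) = TensorProduct.map (LinearMap.id (R := ℝ)
      (M := Grass Λ.n)) (LinearMap.mulRight ℝ (realAcs P J).1) (Bar.toTensor P x) := by
  rw [Bar.toTensor_mul, toTensor_constLift]
  exact gMul_one_tmul_right P _ _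

/-- A constant point is 1 ⊗ J with even J, so multiplying by it on either side acts on the factor B
without signs. Anticommuting elements are thus the fixed points of id ⊗ P₋. -/
theorem mem_anti_constLift_iff (J : Acs (Bar P Gr.real)) {Λ : Gr} (x : Bar P Λ) :
    x ∈ antiSubmodule (constLift P J Λ) ↔
      TensorProduct.map LinearMap.id (antiPart (realAcs P J) (realAcs P J)) (Bar.toTensor P x) =
        Bar.toTensor P x := by
  have e : TensorProduct.map LinearMap.id (antiPart (realAcs P J) (realAcs P J))
      (Bar.toTensor P x) = Bar.toTensor P (antiPart (constLift P J Λ) (constLift P J Λ) x) := by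
    rw [antiPart_apply, ← Bar.toTensorₗ_apply P (_ • _), map_smul, map_add, Bar.toTensorₗ_apply,
      Bar.toTensorₗ_apply, toTensor_constLift_mul, toTensor_mul_constLift]
    generalize Bar.toTensor P x = t
    induction t with
    | zero => simp
    | add x y hx hy => simp only [map_add, hx, hy, smul_add]; abel
    | tmul a b =>
      simp [antiPart_apply, TensorProduct.tmul_add]
  rw [e]
  refine ⟨fun h => by rw [antiPart_eq_self _ h], fun h => ?_⟩
  rw [← Bar.toTensor_injective P Λ h]
  exact antiPart_mem _ _

theorem map_antiPart_map_val (J₀ : Acs B) {n : ℕ} (t : Grass n ⊗[ℝ] Anti J₀) :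
    TensorProduct.map LinearMap.id (antiPart J₀ J₀)
      (TensorProduct.map LinearMap.id (Anti.valₗ J₀) t) =
        TensorProduct.map LinearMap.id (Anti.valₗ J₀) t := by
  have hc : (antiPart J₀ J₀) ∘ₗ (Anti.valₗ J₀) = Anti.valₗ J₀ :=
    LinearMap.ext fun H => antiPart_eq_self _ H.property
  rw [← LinearMap.comp_apply, ← TensorProduct.map_comp, LinearMap.id_comp, hc]

theorem map_proj_map_val (J₀ : Acs B) {n : ℕ} (t : Grass n ⊗[ℝ] Anti J₀) :
    TensorProduct.map LinearMap.id (Anti.projₗ J₀)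
      (TensorProduct.map LinearMap.id (Anti.valₗ J₀) t) = t := by
  have hc : (Anti.projₗ J₀) ∘ₗ (Anti.valₗ J₀) = LinearMap.id :=
    LinearMap.ext fun H => Anti.proj_val J₀ H
  rw [← LinearMap.comp_apply, ← TensorProduct.map_comp, LinearMap.id_comp, hc,
    TensorProduct.map_id, LinearMap.id_apply]

theorem map_val_map_proj (J₀ : Acs B) {n : ℕ} (t : Grass n ⊗[ℝ] B) :
    TensorProduct.map LinearMap.id (Anti.valₗ J₀)
      (TensorProduct.map LinearMap.id (Anti.projₗ J₀) t) =
        TensorProduct.map LinearMap.id (antiPart J₀ J₀) t := by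
  have hc : (Anti.valₗ J₀) ∘ₗ (Anti.projₗ J₀) = antiPart J₀ J₀ := rfl
  rw [← LinearMap.comp_apply, ← TensorProduct.map_comp, LinearMap.id_comp, hc]

theorem map_val_map_smul (J₀ : Acs B) {n : ℕ} (c : ℂ) (t : Grass n ⊗[ℝ] Anti J₀) :
    TensorProduct.map LinearMap.id (Anti.valₗ J₀) (TensorProduct.map LinearMap.id
        (LinearMap.lsmul ℂ (Anti J₀) c |>.restrictScalars ℝ) t) =
      c.re • TensorProduct.map LinearMap.id (Anti.valₗ J₀) t +
        c.im • TensorProduct.map LinearMap.id (LinearMap.mulLeft ℝ J₀.1)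
          (TensorProduct.map LinearMap.id (Anti.valₗ J₀) t) := by
  induction t with
  | zero => simp
  | add x y hx hy => simp only [map_add, hx, hy, smul_add]; abel
  | tmul a b =>
    simp only [TensorProduct.map_tmul, LinearMap.id_apply]
    rw [← TensorProduct.tmul_smul, ← TensorProduct.tmul_smul, ← TensorProduct.tmul_add]
    rfl

theorem map_val_map_mulLeft (J₀ : Acs B) {Λ : Gr} (a : Grass.even Λ.n)
    (t : Grass Λ.n ⊗[ℝ] Anti J₀) :
    TensorProduct.map LinearMap.id (Anti.valₗ J₀) (TensorProduct.map
        (LinearMap.mulLeft ℝ (a : Grass Λ.n)) LinearMap.id t) =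
      gMul P Λ ((a : Grass Λ.n) ⊗ₜ 1) (TensorProduct.map LinearMap.id (Anti.valₗ J₀) t) := by
  induction t with
  | zero => simp
  | add x y hx hy => simp only [map_add, hx, hy]
  | tmul b v =>
    simp only [TensorProduct.map_tmul, LinearMap.id_apply, LinearMap.mulLeft_apply]
    obtain ⟨b₀, h₀, b₁, h₁, rfl⟩ := Grass.exists_part_add b
    rw [TensorProduct.add_tmul, map_add, gMul_tmul P h₀ SetLike.GradedOne.one_mem,
      gMul_tmul P h₁ SetLike.GradedOne.one_mem]
    simp [mul_add, TensorProduct.add_tmul]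

theorem map_val_comm (J₀ : Acs B) {n n' : ℕ} (f : Grass n →ₗ[ℝ] Grass n')
    (t : Grass n ⊗[ℝ] Anti J₀) :
    TensorProduct.map LinearMap.id (Anti.valₗ J₀) (TensorProduct.map f LinearMap.id t) =
      TensorProduct.map f LinearMap.id (TensorProduct.map LinearMap.id (Anti.valₗ J₀) t) := by
  rw [← LinearMap.comp_apply, ← LinearMap.comp_apply, ← TensorProduct.map_comp,
    ← TensorProduct.map_comp]
  rfl

/-- The homogeneous parts of the tangent space at a real point. -/
def antiPartition (J : Acs (Bar P Gr.real)) (i : ZMod 2) : Submodule ℂ (Anti (realAcs P J)) where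
  carrier := {H | H.val ∈ P i}
  zero_mem' := (P i).zero_mem
  add_mem' hx hy := (P i).add_mem hx hy
  smul_mem' c H hH := by
    have h : (realAcs P J).1 * H.val ∈ P i := by
      have := SetLike.mul_mem_graded (A := P) (realAcs_mem P J) (show H.val ∈ P i from hH)
      rwa [zero_add] at this
    exact (P i).add_mem ((P i).smul_mem _ hH) ((P i).smul_mem _ h)

theorem parityProj_mul_of_even {c : B} (hc : c ∈ P 0) (i : ZMod 2) (b : B) :
    parityProj P i (c * b) = c * parityProj P i b := by
  have h : ∀ k, c * parityProj P k b ∈ P k := fun k => by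
    have := SetLike.mul_mem_graded (A := P) hc (parityProj_mem P k b)
    rwa [zero_add] at this
  conv_lhs => rw [← parityProj_add P b, mul_add, map_add]
  rcases zmod_two_cases i with rfl | rfl
  · rw [parityProj_of_mem P (h 0), parityProj_of_mem_ne P one_ne_zero (h 1), add_zero]
  · rw [parityProj_of_mem P (h 1), parityProj_of_mem_ne P zero_ne_one (h 0), zero_add]

theorem parityProj_mul_even {c : B} (hc : c ∈ P 0) (i : ZMod 2) (b : B) :
    parityProj P i (b * c) = parityProj P i b * c := by
  have h : ∀ k, parityProj P k b * c ∈ P k := fun k => by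
    have := SetLike.mul_mem_graded (A := P) (parityProj_mem P k b) hc
    rwa [add_zero] at this
  conv_lhs => rw [← parityProj_add P b, add_mul, map_add]
  rcases zmod_two_cases i with rfl | rfl
  · rw [parityProj_of_mem P (h 0), parityProj_of_mem_ne P one_ne_zero (h 1), add_zero]
  · rw [parityProj_of_mem P (h 1), parityProj_of_mem_ne P zero_ne_one (h 0), zero_add]

/-- The parity projections of the tangent space at a real point. -/
def antiParity (J : Acs (Bar P Gr.real)) (i : ZMod 2) :
    Anti (realAcs P J) →ₗ[ℂ] Anti (realAcs P J) where
  toFun H := ⟨parityProj P i H.val, by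
    have h : H.val * (realAcs P J).1 + (realAcs P J).1 * H.val = 0 := H.property
    change _ * _ + _ * _ = (0 : B)
    rw [← parityProj_mul_of_even P (realAcs_mem P J), ← parityProj_mul_even P (realAcs_mem P J),
      ← map_add, h, map_zero]⟩
  map_add' H K := Anti.ext (map_add _ _ _)
  map_smul' c H := by
    apply Anti.ext
    change parityProj P i (_ • _ + _ • (_ * _)) = _ • _ + _ • (_ * _)
    rw [map_add, map_smul, map_smul]
    exact congrArg (fun z => c.re • parityProj P i H.val + c.im • z)
      (parityProj_mul_of_even P (realAcs_mem P J) i H.val)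

theorem antiParity_mem (J : Acs (Bar P Gr.real)) (i : ZMod 2) (H : Anti (realAcs P J)) :
    antiParity P J i H ∈ antiPartition P J i := parityProj_mem P i H.val

theorem antiParity_add (J : Acs (Bar P Gr.real)) (H : Anti (realAcs P J)) :
    antiParity P J 0 H + antiParity P J 1 H = H := Anti.ext (parityProj_add P H.val)

variable [TopologicalSpace B]

variable {P} (h : IsSuperUnitOpen P)
include h

theorem IsSuperUnitOpen.continuous_antiPart (J₁ J₂ : Acs B) : Continuous (antiPart J₁ J₂) := by
  have := h.mul
  have := h.frechet.addGroup
  have := h.frechet.smul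
  have : Continuous fun x : B => (1 / 2 : ℝ) • (x + J₂.1 * (x * J₁.1)) := by fun_prop
  exact this

/-- The tangent space at a real point as a complex super vector space. -/
def IsSuperUnitOpen.superSpace (J : Acs (Bar P Gr.real)) : SuperSpace.{u} where
  space := Anti (realAcs P J)
  part := antiPartition P J
  addGroup :=
    have := h.frechet.addGroup
    topologicalAddGroup_induced (Anti.valₗ (realAcs P J))
  smul := by
    have := h.mul
    have := h.frechet.addGroup
    have := h.frechet.smul
    have hv : Continuous (Anti.val : Anti (realAcs P J) → B) := continuous_induced_dom
    refine ⟨continuous_induced_rng.2 ?_⟩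
    have : Continuous fun p : ℂ × Anti (realAcs P J) =>
        p.1.re • p.2.val + p.1.im • ((realAcs P J).1 * p.2.val) := by fun_prop
    exact this
  isCompl := by
    refine ⟨Submodule.disjoint_def.2 fun H h0 h1 => Anti.ext ?_, ?_⟩
    · have := parityProj_of_mem P (show H.val ∈ P 0 from h0)
      rw [parityProj_of_mem_ne P one_ne_zero (show H.val ∈ P 1 from h1)] at this
      exact this.symm
    · rw [codisjoint_iff, eq_top_iff]
      intro H _
      exact Submodule.mem_sup.2 ⟨_, antiParity_mem P J 0 H, _, antiParity_mem P J 1 H,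
        antiParity_add P J H⟩
  proj := ⟨⟨antiParity P J 0, continuous_induced_rng.2 ((h.proj 0).comp continuous_induced_dom)⟩,
    fun H hH => Anti.ext (parityProj_of_mem P hH),
    fun H hH => Anti.ext (parityProj_of_mem_ne P one_ne_zero hH)⟩

/-- The representing space consists of all elements of B, even and odd, that anticommute with J.
Inclusion and projection of this space, tensored with the identity of Λ, give mutually inverse
isomorphisms; they preserve parity because J is even. -/
theorem IsSuperUnitOpen.superrepresentable (J : Acs (Bar P Gr.real)) :
    (tanModule P J).IsSuperrepresentable := by
  have := h.frechet.addGroup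
  have := h.frechet.smul
  set J₀ := realAcs P J with hJ₀
  set V := h.superSpace J with hV
  have hval : ∀ i, ∀ v ∈ ((V.part i).restrictScalars ℝ), Anti.valₗ J₀ v ∈ P i := fun i v hv => hv
  have hmem : ∀ Λ (x : V.points Λ), TensorProduct.map LinearMap.id (Anti.valₗ J₀) x.1 ∈
      evenTensor Λ.n P := fun Λ x => map_mem_evenTensor (fun _ _ h => h) hval x.2
  have hanti : ∀ Λ (x : V.points Λ), Bar.mk P _ (hmem Λ x) ∈ antiSubmodule (constLift P J Λ) := by
    intro Λ x
    exact (mem_anti_constLift_iff P J _).2 (map_antiPart_map_val J₀ x.1)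
  have hproj : ∀ i, ∀ b ∈ P i, Anti.projₗ J₀ b ∈ ((V.part i).restrictScalars ℝ) := by
    intro i b hb
    change antiPart J₀ J₀ b ∈ P i
    have h1 := SetLike.mul_mem_graded (A := P) (realAcs_mem P J)
      (SetLike.mul_mem_graded (A := P) hb (realAcs_mem P J))
    rw [add_zero, zero_add] at h1
    rw [antiPart_apply]
    exact (P i).smul_mem _ ((P i).add_mem hb h1)
  have hinv : ∀ Λ (H : Anti (constLift P J Λ)),
      TensorProduct.map LinearMap.id (Anti.projₗ J₀) (Bar.toTensor P H.val) ∈ V.points Λ :=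
    fun Λ H => map_mem_evenTensor (fun _ _ h => h) hproj (Bar.toTensor_mem P H.val)
  let e : ∀ Λ, V.points Λ ≃ₗ[ℝ] (tanModule P J).obj Λ := fun Λ =>
    { toFun := fun x => ⟨Bar.mk P _ (hmem Λ x), hanti Λ x⟩
      map_add' := fun x y => Anti.ext (Bar.toTensor_injective P Λ (map_add
        (TensorProduct.map LinearMap.id (Anti.valₗ J₀)) x.1 y.1))
      map_smul' := fun r x => by
        have h1 := map_smul (TensorProduct.map LinearMap.id (Anti.valₗ J₀)) r x.1
        have h2 := map_smul (Anti.valₗ (constLift P J Λ)) r ⟨Bar.mk P _ (hmem Λ x), hanti Λ x⟩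
        exact Anti.ext (Bar.toTensor_injective P Λ (h1.trans (congrArg (Bar.toTensor P) h2).symm))
      invFun := fun H => ⟨_, hinv Λ H⟩
      left_inv := fun x => Subtype.ext (map_proj_map_val J₀ x.1)
      right_inv := fun H => Anti.ext (Bar.toTensor_injective P Λ
        ((map_val_map_proj J₀ (Bar.toTensor P H.val)).trans
          ((mem_anti_constLift_iff P J H.val).1 H.property))) }
  have hcv : Continuous (Anti.valₗ J₀) := continuous_induced_dom
  have hcp : Continuous (Anti.projₗ J₀) := continuous_induced_rng.2 (h.continuous_antiPart J₀ J₀)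
  refine ⟨V, e, fun Λ => ?_, ?_, ?_, ?_⟩
  · have c1 : Continuous (e Λ) := by
      refine continuous_induced_rng.2 (continuous_induced_rng.2 (continuous_tensor_iff.2 fun l => ?_))
      have : (fun x : V.points Λ => tensorSlice B l
          (TensorProduct.map LinearMap.id (Anti.valₗ J₀) x.1)) =
            fun x => Anti.valₗ J₀ (tensorSlice V.space l x.1) :=
        funext fun x => slice_map LinearMap.id (Anti.valₗ J₀) l x.1
      change Continuous fun x : V.points Λ => tensorSlice B l
          (TensorProduct.map LinearMap.id (Anti.valₗ J₀) x.1)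
      rw [this]
      exact hcv.comp ((continuous_slice (V := V.space) l).comp continuous_induced_dom)
    have c2 : Continuous (e Λ).symm := by
      refine continuous_induced_rng.2 (continuous_tensor_iff.2 fun l => ?_)
      have : (fun H : Anti (constLift P J Λ) => tensorSlice V.space l
          (TensorProduct.map LinearMap.id (Anti.projₗ J₀) (Bar.toTensor P H.val))) =
            fun H => Anti.projₗ J₀ (tensorSlice B l (Bar.toTensor P H.val)) :=
        funext fun H => slice_map LinearMap.id (Anti.projₗ J₀) l _
      change Continuous fun H : Anti (constLift P J Λ) => tensorSlice V.space l
          (TensorProduct.map LinearMap.id (Anti.projₗ J₀) (Bar.toTensor P H.val))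
      rw [this]
      exact hcp.comp ((continuous_slice l).comp
        ((Bar.continuous_toTensor P).comp continuous_induced_dom))
    exact (Homeomorph.mk (e Λ).toEquiv c1 c2).isHomeomorph
  · intro Λ c x
    apply Anti.ext
    apply Bar.toTensor_injective P Λ
    refine (map_val_map_smul J₀ c x.1).trans ?_
    refine Eq.symm ((map_add (Bar.toTensorₗ P Λ) _ _).trans ?_)
    rw [map_smul, map_smul, Bar.toTensorₗ_apply, Bar.toTensorₗ_apply]
    exact congrArg₂ (fun y z => c.re • y + c.im • z) rfl (toTensor_constLift_mul P J _)
  · intro Λ a x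
    apply Anti.ext
    apply Bar.toTensor_injective P Λ
    exact map_val_map_mulLeft P J₀ a x.1
  · intro Λ Λ' φ x
    apply Anti.ext
    apply Bar.toTensor_injective P Λ'
    refine Eq.trans ?_ (Bar.toTensor_map P φ _).symm
    exact map_val_comm J₀ (GrHom.toAlgHom φ).toLinearMap x.1

theorem IsSuperUnitOpen.isFrechet (J : Acs (Bar P Gr.real)) : (tanModule P J).IsFrechet where
  superrepresentable := h.superrepresentable J
  frechet Λ := (h.isUnitOpenAlgebra Λ).anti_frechet (constLift P J Λ)
  smul Λ := (h.isUnitOpenAlgebra Λ).anti_continuousSMul (constLift P J Λ)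
  even_smul Λ a := by
    have := h.bar_mul Λ
    refine continuous_induced_rng.2 ?_
    exact (continuous_const_mul (Bar.ofEven P Λ a)).comp
      (continuous_induced_dom (f := (Anti.val : Anti (constLift P J Λ) → Bar P Λ)))

-- Algebra homomorphisms preserve units and inverses, and they carry constant lifts to constant
-- lifts.
omit h in
omit [TopologicalSpace B] in
theorem natural_afChart (J : Acs (Bar P Gr.real)) {Λ Λ' : Gr} (φ : Λ ⟶ Λ')
    (H : afDom (constLift P J Λ)) :
    ∃ h : tanMap P J φ H.1 ∈ afDom (constLift P J Λ'),
      afChart (constLift P J Λ') ⟨tanMap P J φ H.1, h⟩ = acsMap P φ (afChart (constLift P J Λ) H) := by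
  obtain ⟨u, hu⟩ : IsUnit (1 + H.1.val) := H.2
  have e : 1 + Bar.map P φ H.1.val = Units.map (Bar.map P φ).toRingHom.toMonoidHom u := by
    change _ = Bar.map P φ (u : Bar P Λ)
    rw [hu, map_add, map_one]
  refine ⟨⟨_, e.symm⟩, Subtype.ext ?_⟩
  change (1 + Bar.map P φ H.1.val) * (constLift P J Λ').1 * Ring.inverse (1 + Bar.map P φ H.1.val) =
    Bar.map P φ ((1 + H.1.val) * (constLift P J Λ).1 * Ring.inverse (1 + H.1.val))
  have e' : (constLift P J Λ').1 = Bar.map P φ (constLift P J Λ).1 :=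
    congrArg Subtype.val (acsMap_constLift P J φ).symm
  rw [e, Ring.inverse_unit, ← hu, Ring.inverse_unit, map_mul, map_mul, e']
  rfl

omit h in
omit [TopologicalSpace B] in
theorem mem_afDom_constLift_iff (J : Acs (Bar P Gr.real)) {Λ : Gr} (H : Anti (constLift P J Λ)) :
    H ∈ afDom (constLift P J Λ) ↔
      tanMap P J (Gr.zeroHom Λ Gr.real) H ∈ afDom (constLift P J Gr.real) := by
  change IsUnit (1 + H.val) ↔ IsUnit (1 + Bar.map P (Gr.zeroHom Λ Gr.real) H.val)
  rw [Bar.isUnit_iff, map_add, map_one]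

-- The image is given by invertibility of J + J', which by `Bar.isUnit_iff` can be tested on bodies.
omit h in
omit [TopologicalSpace B] in
theorem mem_range_constLift_iff (J : Acs (Bar P Gr.real)) {Λ : Gr} (J' : Acs (Bar P Λ)) :
    J' ∈ range (afChart (constLift P J Λ)) ↔
      acsMap P (Gr.zeroHom Λ Gr.real) J' ∈ range (afChart (constLift P J Gr.real)) := by
  rw [mem_range_afChart_iff, mem_range_afChart_iff, Bar.isUnit_iff, map_add]
  have e' : (constLift P J Gr.real).1 = Bar.map P (Gr.zeroHom Λ Gr.real) (constLift P J Λ).1 :=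
    congrArg Subtype.val (acsMap_constLift P J _).symm
  rw [e']
  rfl

theorem IsSuperUnitOpen.isComplexSuperAtlas :
    IsComplexSuperAtlas (acsFunctor P) fun J : Acs (Bar P Gr.real) => afSuperParam P J where
  frechet J := h.isFrechet J
  dom_open J Λ := (h.isUnitOpenAlgebra Λ).isOpen_afDom (constLift P J Λ)
  natural J _ _ φ H := natural_afChart J φ H
  openEmbedding J Λ := (h.isUnitOpenAlgebra Λ).isOpenEmbedding_afChart (constLift P J Λ)
  -- J' lies in the chart around its own body J₀: on real points the criterion asks for J₀ + J₀ =
  -- 2J₀ to be invertible.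
  cover Λ J' := by
    refine ⟨acsMap P (Gr.zeroHom Λ Gr.real) J', (mem_range_constLift_iff _ J').2 ?_⟩
    rw [mem_range_afChart_iff]
    have e : constLift P (acsMap P (Gr.zeroHom Λ Gr.real) J') Gr.real =
        acsMap P (Gr.zeroHom Λ Gr.real) J' := by
      apply Subtype.ext
      change Bar.map P _ (Bar.map P _ J'.1) = Bar.map P _ J'.1
      rw [← Bar.map_comp, zeroHom_comp]
    rw [e, ← two_smul ℝ]
    exact Acs.isUnit_two_smul _
  transition J₁ J₂ Λ := by
    obtain ⟨τ, h1, h2, h3⟩ :=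
      (h.isUnitOpenAlgebra Λ).exists_transition (constLift P J₁ Λ) (constLift P J₂ Λ)
    refine ⟨τ, h1, h2, fun x hx => ?_⟩
    obtain ⟨D, hD, hD'⟩ := h3 x hx
    exact ⟨D, fun a v => Anti.ext (hD (Bar.ofEven P Λ a) (Bar.ofEven_comm P a) v (a • v) rfl), hD'⟩

end SuperCharts

/-! ### Smooth functions -/

section Hadamard

variable {m : ℕ}

theorem euc_eq_sum (v : Euc m) : v = ∑ i, v i • (EuclideanSpace.single i (1 : ℝ) : Euc m) := by
  ext j
  simp [Finset.sum_apply, Pi.single_apply]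

theorem clm_euc_apply (f : Euc m →L[ℝ] ℝ) (v : Euc m) :
    f v = ∑ i, v i * f (EuclideanSpace.single i 1) := by
  conv_lhs => rw [euc_eq_sum v, map_sum]
  simp

/-- Integrals of smooth functions along segments depend smoothly on the end point. -/
theorem contDiff_integral_segment {h : Euc m → ℝ} (hh : ContDiff ℝ ∞ h) (q : Euc m) :
    ContDiff ℝ ∞ fun x => ∫ t in (0 : ℝ)..1, h (q + t • (x - q)) := by
  -- The integral is the convolution, evaluated at 0, of the indicator of (0, 1] with s ↦ χ(s)h(q -
  -- s(x - q)). The bump is 1 on [-1, 1], where it must not interfere, and vanishes outside [-2, 2],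
  -- which gives the required compact support.
  let χ : ContDiffBump (0 : ℝ) := ⟨1, 2, by norm_num, by norm_num⟩
  let g : Euc m → ℝ → ℝ := fun x s => χ s * h (q - s • (x - q))
  let f : ℝ → ℝ := (Ioc (0 : ℝ) 1).indicator fun _ => 1
  have hf : MeasureTheory.LocallyIntegrable f MeasureTheory.volume := by
    refine MeasureTheory.Integrable.locallyIntegrable ?_
    exact (MeasureTheory.integrable_indicator_iff measurableSet_Ioc).2
      (MeasureTheory.integrableOn_const (by simp) (by simp))
  have hg : ContDiffOn ℝ ((⊤ : ℕ∞) : ℕ∞ω) (↿g) (univ ×ˢ univ) := by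
    refine ContDiff.contDiffOn ?_
    change ContDiff ℝ ∞ fun p : Euc m × ℝ => χ p.2 * h (q - p.2 • (p.1 - q))
    exact (χ.contDiff.comp contDiff_snd).mul (hh.comp (contDiff_const.sub
      (contDiff_snd.smul (contDiff_fst.sub contDiff_const))))
  have key := MeasureTheory.contDiffOn_convolution_right_with_param (μ := MeasureTheory.volume)
    (ContinuousLinearMap.mul ℝ ℝ) isOpen_univ (isCompact_closedBall (0 : ℝ) 2)
    (g := g) (fun x s _ hs => by
      have : χ s = 0 := χ.zero_of_le_dist (by
        rw [Metric.mem_closedBall, not_le] at hs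
        exact hs.le)
      simp [g, this]) hf hg
  rw [univ_prod_univ, contDiffOn_univ] at key
  have h2 : ContDiff ℝ ∞ fun x : Euc m => (x, (0 : ℝ)) := contDiff_id.prodMk contDiff_const
  suffices e : (fun x => ∫ t in (0 : ℝ)..1, h (q + t • (x - q))) =
      (fun p : Euc m × ℝ => MeasureTheory.convolution f (g p.1) (ContinuousLinearMap.mul ℝ ℝ)
        MeasureTheory.volume p.2) ∘ fun x : Euc m => (x, (0 : ℝ)) by
    rw [e]; exact key.comp h2
  funext x
  symm
  rw [intervalIntegral.integral_of_le zero_le_one, ← MeasureTheory.integral_indicator measurableSet_Ioc]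
  change ∫ t, f t * g x (0 - t) = _
  congr 1
  funext t
  by_cases ht : t ∈ Ioc (0 : ℝ) 1
  · have h1 : χ (-t) = 1 := χ.one_of_mem_closedBall (by
      rw [Metric.mem_closedBall, dist_zero_right, norm_neg, Real.norm_eq_abs, abs_of_pos ht.1]
      exact ht.2)
    simp [f, g, ht, h1]
  · simp [f, ht]

/-- Hadamard's lemma. -/
theorem exists_hadamard {g : Euc m → ℝ} (hg : ContDiff ℝ ∞ g) (q : Euc m) :
    ∃ G : Fin m → Euc m → ℝ, (∀ i, ContDiff ℝ ∞ (G i)) ∧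
      ∀ x, g x = g q + ∑ i, (x i - q i) * G i x := by
  have hd : ∀ i : Fin m, ContDiff ℝ ∞ fun y => fderiv ℝ g y (EuclideanSpace.single i 1) := fun i =>
    (hg.fderiv_right (m := ∞) (by simp)).clm_apply contDiff_const
  refine ⟨fun i x => ∫ t in (0 : ℝ)..1,
    fderiv ℝ g (q + t • (x - q)) (EuclideanSpace.single i 1),
    fun i => contDiff_integral_segment (hd i) q, fun x => ?_⟩
  have hline : ∀ t : ℝ, HasDerivAt (fun t : ℝ => g (q + t • (x - q)))
      (fderiv ℝ g (q + t • (x - q)) (x - q)) t := by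
    intro t
    have h1 : HasDerivAt (fun t : ℝ => q + t • (x - q)) (x - q) t := by
      simpa using ((hasDerivAt_id t).smul_const (x - q)).const_add q
    exact ((hg.differentiable (by simp)) _).hasFDerivAt.comp_hasDerivAt t h1
  have hc : ∀ i : Fin m, Continuous fun t : ℝ =>
      fderiv ℝ g (q + t • (x - q)) (EuclideanSpace.single i 1) := fun i =>
    (hd i).continuous.comp (by fun_prop)
  have hsum : ∀ t : ℝ, fderiv ℝ g (q + t • (x - q)) (x - q) =
      ∑ i, (x i - q i) * fderiv ℝ g (q + t • (x - q)) (EuclideanSpace.single i 1) := fun t => by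
    rw [clm_euc_apply]; rfl
  have hFTC := intervalIntegral.integral_eq_sub_of_hasDerivAt (a := (0 : ℝ)) (b := 1)
    (fun t _ => hline t) (by
      simp only [hsum]
      refine Continuous.intervalIntegrable ?_ _ _
      exact continuous_finsetSum _ fun i _ => continuous_const.mul (hc i))
  simp only [hsum] at hFTC
  have hI : ∀ i : Fin m, IntervalIntegrable (fun t : ℝ => (x i - q i) *
      fderiv ℝ g (q + t • (x - q)) (EuclideanSpace.single i 1)) MeasureTheory.volume 0 1 := fun i =>
    (continuous_const.mul (hc i)).intervalIntegrable _ _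
  rw [intervalIntegral.integral_finsetSum fun i _ => hI i] at hFTC
  simp only [intervalIntegral.integral_const_mul] at hFTC
  rw [hFTC]
  simp

end Hadamard

namespace SmoothFn

variable {m : ℕ} {V W : Opens (Euc m)}

theorem contMDiff_iff_contDiffOn {f : Euc m → ℝ} :
    ContMDiff 𝓘(ℝ, Euc m) 𝓘(ℝ, ℝ) ∞ (fun x : V => f x) ↔ ContDiffOn ℝ ∞ f V := by
  refine ⟨fun h x hx => ?_, fun h x => ?_⟩
  · exact (contMDiffAt_subtype_iff.1 (h ⟨x, hx⟩)).contDiffAt.contDiffWithinAt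
  · exact contMDiffAt_subtype_iff.2 ((h x x.2).contDiffAt (V.2.mem_nhds x.2)).contMDiffAt

/-- Extension by zero. -/
def extend (g : SmoothFn V) (x : Euc m) : ℝ :=
  open Classical in if h : x ∈ V then g ⟨x, h⟩ else 0

theorem extend_apply (g : SmoothFn V) (x : V) : extend g x = g x := by
  simp [extend]

theorem contDiffOn_extend (g : SmoothFn V) : ContDiffOn ℝ ∞ (extend g) V := by
  rw [← contMDiff_iff_contDiffOn]
  simp only [extend_apply]
  exact g.contMDiff

/-- The smooth function on `V` given by a function that is smooth on `V`. -/
def ofFun (f : Euc m → ℝ) (hf : ContDiffOn ℝ ∞ f V) : SmoothFn V :=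
  ⟨fun x => f x, contMDiff_iff_contDiffOn.2 hf⟩

theorem res_apply (h : W ≤ V) (g : SmoothFn V) (x : W) : res h g x = g ⟨x, h x.2⟩ := rfl

/-- The underlying continuous function. -/
def toC (V : Opens (Euc m)) : SmoothFn V →ₐ[ℝ] C(V, ℝ) where
  toFun g := ⟨g, g.contMDiff.continuous⟩
  map_one' := rfl
  map_mul' _ _ := rfl
  map_zero' := rfl
  map_add' _ _ := rfl
  commutes' _ := rfl

@[simp]
theorem toC_apply (g : SmoothFn V) (x : V) : toC V g x = g x := rfl

theorem toC_injective : Function.Injective (toC V) := fun g h e => by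
  ext x
  exact DFunLike.congr_fun e x

theorem eventuallyEq_extend {g : SmoothFn V} {f : Euc m → ℝ} (h : ∀ x : V, g x = f x) (x : V) :
    extend g =ᶠ[𝓝 (x : Euc m)] f := by
  filter_upwards [V.2.mem_nhds x.2] with y hy
  rw [← h ⟨y, hy⟩]
  exact extend_apply g ⟨y, hy⟩

theorem contDiffOn_fderiv (g : SmoothFn V) (v : Euc m) :
    ContDiffOn ℝ ∞ (fun x => fderiv ℝ (extend g) x v) V :=
  ((contDiffOn_infty_iff_fderiv_of_isOpen V.2).1 (contDiffOn_extend g)).2.clm_apply contDiffOn_const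

theorem differentiableAt_extend (g : SmoothFn V) (x : V) :
    DifferentiableAt ℝ (extend g) x :=
  (((contDiffOn_extend g) x x.2).contDiffAt (V.2.mem_nhds x.2)).differentiableAt (by simp)

theorem fderiv_extend {g : SmoothFn V} {f : Euc m → ℝ} (h : ∀ x : V, g x = f x) (x : V) :
    fderiv ℝ (extend g) x = fderiv ℝ f x :=
  (eventuallyEq_extend h x).fderiv_eq

/-- Partial derivatives. -/
def pd (i : Fin m) : SmoothFn V →ₗ[ℝ] SmoothFn V where
  toFun g := ofFun (fun x => fderiv ℝ (extend g) x (EuclideanSpace.single i 1))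
    (contDiffOn_fderiv g _)
  map_add' g h := by
    ext x
    change fderiv ℝ (extend (g + h)) x _ = fderiv ℝ (extend g) x _ + fderiv ℝ (extend h) x _
    rw [fderiv_extend (f := extend g + extend h) (fun x => by
      simp [extend_apply]), fderiv_add (differentiableAt_extend g x) (differentiableAt_extend h x)]
    rfl
  map_smul' c g := by
    ext x
    change fderiv ℝ (extend (c • g)) x _ = c * fderiv ℝ (extend g) x _
    rw [fderiv_extend (f := c • extend g) (fun x => by simp [extend_apply]),
      fderiv_const_smul (differentiableAt_extend g x)]
    rfl

theorem pd_apply (i : Fin m) (g : SmoothFn V) (x : V) :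
    pd i g x = fderiv ℝ (extend g) x (EuclideanSpace.single i 1) := rfl

theorem pd_mul (i : Fin m) (g h : SmoothFn V) : pd i (g * h) = pd i g * h + g * pd i h := by
  ext x
  change pd i (g * h) x = pd i g x * h x + g x * pd i h x
  rw [pd_apply, fderiv_extend (f := extend g * extend h) (fun x => by simp [extend_apply]),
    fderiv_mul (differentiableAt_extend g x) (differentiableAt_extend h x)]
  simp only [add_apply, smul_apply, extend_apply,
    smul_eq_mul, pd_apply]
  ring

theorem pd_res (i : Fin m) (h : W ≤ V) (g : SmoothFn V) : pd i (res h g) = res h (pd i g) := by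
  ext x
  rw [pd_apply, res_apply, pd_apply]
  rw [fderiv_extend (f := extend g) fun x => (extend_apply g ⟨x, h x.2⟩).symm]

/-- The coordinate functions. -/
def coord (V : Opens (Euc m)) (i : Fin m) : SmoothFn V :=
  ofFun (fun x => x i) (by fun_prop)

theorem pd_coord (i j : Fin m) : pd i (coord V j) = if i = j then 1 else 0 := by
  ext x
  have hf : fderiv ℝ (fun x : Euc m => x j) (x : Euc m) =
      (EuclideanSpace.proj j : Euc m →L[ℝ] ℝ) :=
    (EuclideanSpace.proj j : Euc m →L[ℝ] ℝ).fderiv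
  rw [pd_apply, fderiv_extend (f := fun x => x j) (fun x => rfl), hf]
  split_ifs with h
  · subst h; simp
  · simp [Ne.symm h]

/-- Iterated partial derivatives. -/
def pds (L : List (Fin m)) : SmoothFn V →ₗ[ℝ] SmoothFn V :=
  L.foldr (fun i T => pd i ∘ₗ T) LinearMap.id

theorem pds_cons (i : Fin m) (L : List (Fin m)) (g : SmoothFn V) :
    pds (i :: L) g = pd i (pds L g) := rfl

/-- Limits of smooth functions whose derivatives converge locally uniformly are smooth. -/
theorem exists_limit {F : Filter (SmoothFn V)} [F.NeBot] {c : List (Fin m) → C(V, ℝ)}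
    (hc : ∀ L, Tendsto (fun g => toC V (pds L g)) F (𝓝 (c L))) :
    ∃ g : SmoothFn V, ∀ L, toC V (pds L g) = c L := by
  classical
  have hlc : LocallyCompactSpace V := V.2.locallyCompactSpace
  let C : List (Fin m) → Euc m → ℝ := fun L x => if h : x ∈ V then c L ⟨x, h⟩ else 0
  have hC : ∀ L (x : V), C L x = c L x := fun L x => by simp [C]
  -- Locally uniform convergence of the first derivatives lets differentiation pass to the limit.
  have hderiv : ∀ L, ∀ x ∈ V, HasFDerivAt (C L)
      (∑ i, C (i :: L) x • (EuclideanSpace.proj i : Euc m →L[ℝ] ℝ)) x := by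
    intro L x hx
    refine hasFDerivAt_of_tendstoLocallyUniformlyOn (l := F) (s := (V : Set (Euc m)))
      (f := fun g => extend (pds L g))
      (f' := fun g x => ∑ i, extend (pds (i :: L) g) x • (EuclideanSpace.proj i : Euc m →L[ℝ] ℝ))
      (g' := fun x => ∑ i, C (i :: L) x • (EuclideanSpace.proj i : Euc m →L[ℝ] ℝ))
      V.2 ?_ ?_ ?_ hx
    · rw [tendstoLocallyUniformlyOn_iff_tendstoLocallyUniformly_comp_coe]
      let S : Fin m → C(ℝ, Euc m →L[ℝ] ℝ) := fun i =>
        ⟨fun r => r • (EuclideanSpace.proj i : Euc m →L[ℝ] ℝ), by fun_prop⟩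
      have ht : Tendsto (fun g => ∑ i, (S i).comp (toC V (pds (i :: L) g))) F
          (𝓝 (∑ i, (S i).comp (c (i :: L)))) :=
        tendsto_finsetSum _ fun i _ =>
          ((ContinuousMap.continuous_postcomp (S i)).tendsto _).comp (hc (i :: L))
      rw [ContinuousMap.tendsto_iff_tendstoLocallyUniformly] at ht
      have e1 : (fun g (x : V) => ∑ i, extend (pds (i :: L) g) x •
          (EuclideanSpace.proj i : Euc m →L[ℝ] ℝ)) =
          fun g x => (∑ i, (S i).comp (toC V (pds (i :: L) g))) x := by
        funext g x
        rw [ContinuousMap.sum_apply]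
        exact Finset.sum_congr rfl fun i _ => by rw [extend_apply]; rfl
      have e2 : (fun x => ∑ i, C (i :: L) x • (EuclideanSpace.proj i : Euc m →L[ℝ] ℝ)) ∘
          (Subtype.val : V → Euc m) = ⇑(∑ i, (S i).comp (c (i :: L))) := by
        funext x
        rw [ContinuousMap.sum_apply]
        exact Finset.sum_congr rfl fun i _ => by rw [hC]; rfl
      exact (congrArg₂ (fun a b => TendstoLocallyUniformly a b F) e1 e2).mpr ht
    · intro g y hy
      suffices e : ∑ i, extend (pds (i :: L) g) y • (EuclideanSpace.proj i : Euc m →L[ℝ] ℝ) =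
          fderiv ℝ (extend (pds L g)) y by
        rw [e]; exact (differentiableAt_extend (pds L g) ⟨y, hy⟩).hasFDerivAt
      refine ContinuousLinearMap.ext (fun v : Euc m => ?_)
      refine Eq.trans ?_ (clm_euc_apply (fderiv ℝ (extend (pds L g)) y) v).symm
      rw [sum_apply]
      refine Finset.sum_congr rfl fun i _ => ?_
      rw [pds_cons, extend_apply _ ⟨y, hy⟩, pd_apply]
      exact mul_comm _ _
    · intro y hy
      have h1 := ((ContinuousEvalConst.continuous_eval_const (F := C(V, ℝ)) (⟨y, hy⟩ : V)).tendsto (c L)).comp (hc L)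
      rw [hC L ⟨y, hy⟩]
      refine h1.congr fun g => ?_
      exact (extend_apply (pds L g) ⟨y, hy⟩).symm
  -- All multi-indices are treated at once, since the derivative of C L is expressed by the
  -- functions C (i :: L).
  have hsmooth : ∀ (k : ℕ) L, ContDiffOn ℝ k (C L) V := by
    intro k
    induction k with
    | zero =>
      intro L
      rw [Nat.cast_zero, contDiffOn_zero]
      exact fun x hx => (hderiv L x hx).continuousAt.continuousWithinAt
    | succ k ih =>
      intro L
      rw [Nat.cast_succ, contDiffOn_succ_iff_fderiv_of_isOpen V.isOpen]
      refine ⟨fun x hx => (hderiv L x hx).differentiableAt.differentiableWithinAt,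
        fun h => absurd h (by simp), ?_⟩
      have : ContDiffOn ℝ k
          (fun x => ∑ i, C (i :: L) x • (EuclideanSpace.proj i : Euc m →L[ℝ] ℝ)) V :=
        ContDiffOn.sum fun i _ => (ih _).smul contDiffOn_const
      exact this.congr fun x hx => (hderiv L x hx).fderiv
  refine ⟨ofFun (C []) (contDiffOn_infty.2 fun k => hsmooth k []), fun L => ?_⟩
  induction L with
  | nil => ext x; exact hC [] x
  | cons i L ih =>
    ext x
    rw [toC_apply, pds_cons, pd_apply, fderiv_extend (f := C L) (fun x => by
      rw [hC, ← ih, toC_apply]), (hderiv L x x.2).fderiv]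
    simp [hC]

theorem isUnit_iff {g : SmoothFn V} : IsUnit g ↔ ∀ x, g x ≠ 0 := by
  refine ⟨fun h x => ?_, fun h => ?_⟩
  · have := (h.map (toC V)).map (ContinuousMap.evalAlgHom ℝ ℝ x : C(V, ℝ) →ₐ[ℝ] ℝ)
    exact this.ne_zero
  · have hs : ContDiffOn ℝ ∞ (fun x => (extend g x)⁻¹) V :=
      (contDiffOn_extend g).inv fun x hx => by
        rw [extend_apply g ⟨x, hx⟩]; exact h _
    refine IsUnit.of_mul_eq_one (ofFun _ hs) ?_
    ext x
    change g x * (extend g x)⁻¹ = 1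
    rw [extend_apply, mul_inv_cancel₀ (h x)]

end SmoothFn

/-! ### Superfunctions on superdomains -/

instance {α : Type*} [TopologicalSpace α] : IsUniformAddGroup C(α, ℝ) :=
  IsUniformInducing.isUniformAddGroup
    (⟨⟨ContinuousMap.toUniformOnFunIsCompact, rfl⟩, fun _ _ => rfl⟩ :
      C(α, ℝ) →+ UniformOnFun α ℝ {K | IsCompact K})
    ContinuousMap.isUniformEmbedding_toUniformOnFunIsCompact.isUniformInducing

namespace LinFn

variable {m n : ℕ} {V W : Opens (Euc m)}

/-- The component of a superfunction with respect to a linear form on the Grassmann algebra. -/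
def slice (l : Module.Dual ℝ (Grass n)) : LinFn n V →ₗ[ℝ] SmoothFn V :=
  (TensorProduct.rid ℝ (SmoothFn V)).toLinearMap ∘ₗ TensorProduct.map LinearMap.id l

@[simp]
theorem slice_tmul (l : Module.Dual ℝ (Grass n)) (g : SmoothFn V) (a : Grass n) :
    slice l (g ⊗ₜ a) = l a • g := by
  simp [slice]

theorem sum_slice_tmul (f : LinFn n V) :
    ∑ i, slice ((Grass.basis n).coord i) f ⊗ₜ[ℝ] Grass.basis n i = f := by
  induction f using TensorProduct.induction_on with
  | zero => simp
  | add x y hx hy =>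
    simp only [map_add, TensorProduct.add_tmul, Finset.sum_add_distrib]
    rw [hx, hy]
  | tmul g a =>
    simp only [slice_tmul, TensorProduct.smul_tmul, ← TensorProduct.tmul_sum]
    congr 1
    exact (Grass.basis n).sum_repr a

theorem slice_add (l l' : Module.Dual ℝ (Grass n)) (f : LinFn n V) :
    slice (l + l') f = slice l f + slice l' f := by
  induction f using TensorProduct.induction_on with
  | zero => simp
  | add x y hx hy => simp only [map_add, hx, hy]; abel
  | tmul g a => simp [add_smul]

theorem slice_smul (r : ℝ) (l : Module.Dual ℝ (Grass n)) (f : LinFn n V) :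
    slice (r • l) f = r • slice l f := by
  induction f using TensorProduct.induction_on with
  | zero => simp
  | add x y hx hy => simp only [map_add, hx, hy, smul_add]
  | tmul g a => simp [mul_smul]

theorem slice_zero (f : LinFn n V) : slice (0 : Module.Dual ℝ (Grass n)) f = 0 := by
  have := slice_smul 0 (0 : Module.Dual ℝ (Grass n)) f
  rwa [zero_smul, zero_smul] at this

theorem slice_tmul_one_mul (l : Module.Dual ℝ (Grass n)) (g : SmoothFn V) (f : LinFn n V) :
    slice l (g ⊗ₜ 1 * f) = g * slice l f := by
  induction f using TensorProduct.induction_on with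
  | zero => simp
  | add x y hx hy => simp only [mul_add, map_add, hx, hy]
  | tmul h a => simp [Algebra.TensorProduct.tmul_mul_tmul]

theorem res_tmul (h : W ≤ V) (g : SmoothFn V) (a : Grass n) :
    LinFn.res n h (g ⊗ₜ a) = SmoothFn.res h g ⊗ₜ a := rfl

theorem slice_res (h : W ≤ V) (l : Module.Dual ℝ (Grass n)) (f : LinFn n V) :
    slice l (LinFn.res n h f) = SmoothFn.res h (slice l f) := by
  induction f using TensorProduct.induction_on with
  | zero => simp
  | add x y hx hy => simp only [map_add, hx, hy]
  | tmul g a => rw [res_tmul, slice_tmul, slice_tmul, map_smul]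

theorem ext_slice {f f' : LinFn n V} (h : ∀ l : Module.Dual ℝ (Grass n), slice l f = slice l f') :
    f = f' := by
  rw [← sum_slice_tmul f, ← sum_slice_tmul f']
  simp only [h]

/-- The body of a superfunction. -/
def body (n : ℕ) (V : Opens (Euc m)) : LinFn n V →ₐ[ℝ] SmoothFn V :=
  (Algebra.TensorProduct.rid ℝ ℝ (SmoothFn V)).toAlgHom.comp
    (Algebra.TensorProduct.map (AlgHom.id ℝ _) (Grass.aug n))

theorem body_tmul (g : SmoothFn V) (a : Grass n) : body n V (g ⊗ₜ a) = Grass.aug n a • g := by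
  simp [body]

theorem body_eq_slice (f : LinFn n V) : body n V f = slice (Grass.aug n).toLinearMap f := by
  induction f using TensorProduct.induction_on with
  | zero => simp
  | add x y hx hy => simp only [map_add, hx, hy]
  | tmul g a => rw [body_tmul, slice_tmul]; rfl

theorem body_res (h : W ≤ V) (f : LinFn n V) :
    body n W (LinFn.res n h f) = SmoothFn.res h (body n V f) := by
  rw [body_eq_slice, body_eq_slice, slice_res]

/-- The parity involution. -/
def inv (n : ℕ) (V : Opens (Euc m)) : LinFn n V →ₐ[ℝ] LinFn n V :=
  Algebra.TensorProduct.map (AlgHom.id ℝ _) (Grass.inv n)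

theorem inv_tmul (g : SmoothFn V) (a : Grass n) : inv n V (g ⊗ₜ a) = g ⊗ₜ Grass.inv n a := rfl

theorem inv_of_mem_zero {f : LinFn n V} (hf : f ∈ LinFn.part n V 0) : inv n V f = f := by
  obtain ⟨t, rfl⟩ := hf
  induction t using TensorProduct.induction_on with
  | zero => simp
  | add x y hx hy => rw [map_add, map_add, hx, hy]
  | tmul g a => exact congrArg (g ⊗ₜ[ℝ] ·) (Grass.inv_of_mem_zero a.2)

theorem inv_of_mem_one {f : LinFn n V} (hf : f ∈ LinFn.part n V 1) : inv n V f = -f := by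
  obtain ⟨t, rfl⟩ := hf
  induction t using TensorProduct.induction_on with
  | zero => simp
  | add x y hx hy => rw [map_add, map_add, hx, hy, neg_add]
  | tmul g a =>
    refine (congrArg (g ⊗ₜ[ℝ] ·) (Grass.inv_of_mem_one a.2)).trans ?_
    rw [TensorProduct.tmul_neg]; rfl

theorem body_inv (f : LinFn n V) : body n V (inv n V f) = body n V f := by
  induction f using TensorProduct.induction_on with
  | zero => simp
  | add x y hx hy => simp only [map_add, hx, hy]
  | tmul g a =>
    rw [inv_tmul, body_tmul, body_tmul]
    congr 1
    induction a using Grass.left_induction with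
    | h0 r => simp
    | h1 x y hx hy => rw [map_add, map_add, map_add, hx, hy]
    | h2 v x hx => rw [map_mul, Grass.inv_ι, map_mul, map_mul, map_neg, Grass.aug_ι]; simp

/-- The parity of a coordinate. -/
def par : Fin m ⊕ Fin n → ZMod 2 := Sum.elim (fun _ => 0) (fun _ => 1)

/-- The partial derivatives with respect to even and odd coordinates. -/
def d : Fin m ⊕ Fin n → (LinFn n V →ₗ[ℝ] LinFn n V)
  | Sum.inl i => TensorProduct.map (SmoothFn.pd i) LinearMap.id
  | Sum.inr j => TensorProduct.map LinearMap.id (Grass.deriv j)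

theorem d_inl_tmul (i : Fin m) (g : SmoothFn V) (a : Grass n) :
    d (Sum.inl i) (g ⊗ₜ[ℝ] a) = SmoothFn.pd i g ⊗ₜ a := rfl

theorem d_inr_tmul (j : Fin n) (g : SmoothFn V) (a : Grass n) :
    d (m := m) (Sum.inr j) (g ⊗ₜ[ℝ] a) = g ⊗ₜ Grass.deriv j a := rfl

theorem d_res (h : W ≤ V) (a : Fin m ⊕ Fin n) (f : LinFn n V) :
    d a (LinFn.res n h f) = LinFn.res n h (d a f) := by
  induction f using TensorProduct.induction_on with
  | zero => simp
  | add x y hx hy => simp only [map_add, hx, hy]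
  | tmul g b =>
    rcases a with i | j
    · rw [d_inl_tmul, res_tmul, res_tmul, d_inl_tmul, SmoothFn.pd_res]
    · rw [d_inr_tmul, res_tmul, res_tmul, d_inr_tmul]

/-- The identity, or the parity involution. -/
def tw (i : ZMod 2) : LinFn n V →ₗ[ℝ] LinFn n V :=
  if i = 0 then LinearMap.id else (inv n V).toLinearMap

theorem tw_zero (f : LinFn n V) : tw 0 f = f := rfl

theorem tw_one (f : LinFn n V) : tw 1 f = inv n V f := by
  simp [tw]

theorem d_mul (a : Fin m ⊕ Fin n) (f g : LinFn n V) :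
    d a (f * g) = d a f * g + tw (par a) f * d a g := by
  induction f using TensorProduct.induction_on with
  | zero => simp
  | add x y hx hy => simp only [map_add, add_mul, hx, hy]; abel
  | tmul p b =>
    induction g using TensorProduct.induction_on with
    | zero => simp
    | add x y hx hy => simp only [map_add, mul_add, hx, hy]; abel
    | tmul q c =>
      rcases a with i | j
      · change _ = _ + tw 0 _ * _
        simp only [Algebra.TensorProduct.tmul_mul_tmul, d_inl_tmul, tw_zero, SmoothFn.pd_mul,
          TensorProduct.add_tmul]
      · change _ = _ + tw 1 _ * _
        simp only [Algebra.TensorProduct.tmul_mul_tmul, d_inr_tmul, tw_one, inv_tmul,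
          Grass.deriv_mul, TensorProduct.tmul_add]

theorem d_inv (a : Fin m ⊕ Fin n) (f : LinFn n V) :
    d a (inv n V f) = (if par a = 0 then 1 else -1 : ℝ) • inv n V (d a f) := by
  induction f using TensorProduct.induction_on with
  | zero => simp
  | add x y hx hy => simp only [map_add, hx, hy, smul_add]
  | tmul g b =>
    rcases a with i | j
    · simp [d_inl_tmul, inv_tmul, par]
    · simp [d_inr_tmul, inv_tmul, par, Grass.deriv_inv, TensorProduct.tmul_neg]

/-- Iterated partial derivatives. -/
def ds (L : List (Fin m ⊕ Fin n)) : LinFn n V →ₗ[ℝ] LinFn n V :=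
  L.foldr (fun a T => d a ∘ₗ T) LinearMap.id

theorem ds_cons (a : Fin m ⊕ Fin n) (L : List (Fin m ⊕ Fin n)) (f : LinFn n V) :
    ds (a :: L) f = d a (ds L f) := rfl

theorem ds_concat (L : List (Fin m ⊕ Fin n)) (a : Fin m ⊕ Fin n) (f : LinFn n V) :
    ds (L ++ [a]) f = ds L (d a f) := by
  induction L with
  | nil => rfl
  | cons b L ih => rw [List.cons_append, ds_cons, ds_cons, ih]

theorem ds_res (h : W ≤ V) (L : List (Fin m ⊕ Fin n)) (f : LinFn n V) :
    ds L (LinFn.res n h f) = LinFn.res n h (ds L f) := by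
  induction L with
  | nil => rfl
  | cons a L ih => rw [ds_cons, ds_cons, ih, d_res]

theorem ds_inv (L : List (Fin m ⊕ Fin n)) :
    ∃ r : ℝ, ∀ f : LinFn n V, ds L (inv n V f) = r • inv n V (ds L f) := by
  induction L with
  | nil => exact ⟨1, fun f => by rw [one_smul]; rfl⟩
  | cons a L ih =>
    obtain ⟨r, hr⟩ := ih
    refine ⟨r * (if par a = 0 then 1 else -1 : ℝ), fun f => ?_⟩
    rw [ds_cons, ds_cons, hr, map_smul, d_inv, smul_smul]

/-- The even entries of a list of coordinates. -/
def lefts : List (Fin m ⊕ Fin n) → List (Fin m)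
  | [] => []
  | Sum.inl i :: L => i :: lefts L
  | Sum.inr _ :: L => lefts L

/-- The odd entries of a list of coordinates. -/
def rights : List (Fin m ⊕ Fin n) → List (Fin n)
  | [] => []
  | Sum.inl _ :: L => rights L
  | Sum.inr j :: L => j :: rights L

theorem exists_lefts_rights (L : List (Fin m)) (L' : List (Fin n)) :
    ∃ K : List (Fin m ⊕ Fin n), lefts K = L ∧ rights K = L' := by
  induction L with
  | nil =>
    induction L' with
    | nil => exact ⟨[], rfl, rfl⟩
    | cons j L' ih =>
      obtain ⟨K, h1, h2⟩ := ih
      exact ⟨Sum.inr j :: K, h1, congrArg (j :: ·) h2⟩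
  | cons i L ih =>
    obtain ⟨K, h1, h2⟩ := ih
    exact ⟨Sum.inl i :: K, congrArg (i :: ·) h1, h2⟩

theorem ds_tmul (L : List (Fin m ⊕ Fin n)) (g : SmoothFn V) (a : Grass n) :
    ds L (g ⊗ₜ[ℝ] a) = SmoothFn.pds (lefts L) g ⊗ₜ Grass.derivs (rights L) a := by
  induction L with
  | nil => rfl
  | cons b L ih =>
    rw [ds_cons, ih]
    rcases b with i | j <;> rfl

/-- Even derivatives act on the smooth factor and odd ones on the Grassmann factor, so the order in
which they alternate is irrelevant. -/
theorem body_ds (L : List (Fin m ⊕ Fin n)) (f : LinFn n V) :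
    body n V (ds L f) = SmoothFn.pds (lefts L)
      (slice ((Grass.aug n).toLinearMap ∘ₗ Grass.derivs (rights L)) f) := by
  induction f using TensorProduct.induction_on with
  | zero => simp
  | add x y hx hy => simp only [map_add, hx, hy]
  | tmul g a => rw [ds_tmul, body_tmul, slice_tmul, map_smul]; rfl

instance (V : Opens (Euc m)) : LocallyCompactSpace V := V.2.locallyCompactSpace

/-- The body, as a continuous function. -/
def bodyC (n : ℕ) (V : Opens (Euc m)) : LinFn n V →ₐ[ℝ] C(V, ℝ) :=
  (SmoothFn.toC V).comp (body n V)

/-- The continuous functions underlying all derivatives of a superfunction. -/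
def jet (n : ℕ) (V : Opens (Euc m)) :
    LinFn n V →ₗ[ℝ] (List (Fin m ⊕ Fin n) → C(V, ℝ)) :=
  LinearMap.pi fun L => (bodyC n V).toLinearMap ∘ₗ ds L

theorem jet_apply (f : LinFn n V) (L : List (Fin m ⊕ Fin n)) : jet n V f L = bodyC n V (ds L f) := rfl

/-- Locally uniform convergence of all derivatives of all components. -/
instance : TopologicalSpace (LinFn n V) := TopologicalSpace.induced (jet n V) inferInstance

theorem isInducing_jet : IsInducing (jet n V) := ⟨rfl⟩

theorem continuous_rng {Z : Type*} [TopologicalSpace Z] {F : Z → LinFn n V} :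
    Continuous F ↔ ∀ L, Continuous fun z => bodyC n V (ds L (F z)) := by
  rw [isInducing_jet.continuous_iff, continuous_pi_iff]
  rfl

theorem continuous_bodyC_ds (L : List (Fin m ⊕ Fin n)) :
    Continuous fun f : LinFn n V => bodyC n V (ds L f) :=
  continuous_rng.1 continuous_id L

theorem continuous_bodyC : Continuous (bodyC n V) := continuous_bodyC_ds []

theorem continuous_d (a : Fin m ⊕ Fin n) : Continuous (d a : LinFn n V → LinFn n V) :=
  continuous_rng.2 fun L => by
    simp only [← ds_concat]
    exact continuous_bodyC_ds _

theorem continuous_inv : Continuous (inv n V) :=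
  continuous_rng.2 fun L => by
    obtain ⟨r, hr⟩ := ds_inv (V := V) L
    have : (fun f => bodyC n V (ds L (inv n V f))) = fun f => r • bodyC n V (ds L f) := by
      funext f
      rw [hr, map_smul]
      congr 1
      exact congrArg (SmoothFn.toC V) (body_inv _)
    rw [this]
    exact (continuous_bodyC_ds L).const_smul r

theorem continuous_tw (i : ZMod 2) : Continuous (tw i : LinFn n V → LinFn n V) := by
  rcases zmod_two_cases i with rfl | rfl
  · exact continuous_id
  · have : (tw 1 : LinFn n V → LinFn n V) = inv n V := funext tw_one
    rw [this]
    exact continuous_inv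

instance : IsTopologicalAddGroup (LinFn n V) := topologicalAddGroup_induced (jet n V)

instance : ContinuousSMul ℝ (LinFn n V) := continuousSMul_induced (jet n V)

/-- The derivative that is applied first meets the product, and the Leibniz rule leaves two products
of continuous maps with a shorter list. For this the list is taken apart at its end and F, G stay
arbitrary in the induction. -/
theorem continuous_mul' (L : List (Fin m ⊕ Fin n)) : ∀ {Z : Type} [TopologicalSpace Z]
    {F G : Z → LinFn n V}, Continuous F → Continuous G →
      Continuous fun z => bodyC n V (ds L (F z * G z)) := by
  induction L using List.reverseRecOn with
  | nil =>
    intro Z _ F G hF hG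
    have : (fun z => bodyC n V (ds [] (F z * G z))) = fun z => bodyC n V (F z) * bodyC n V (G z) :=
      funext fun z => map_mul _ _ _
    rw [this]
    exact (continuous_bodyC.comp hF).mul (continuous_bodyC.comp hG)
  | append_singleton L a ih =>
    intro Z _ F G hF hG
    simp only [ds_concat, d_mul, map_add]
    exact (ih ((continuous_d a).comp hF) hG).add
      (ih ((continuous_tw _).comp hF) ((continuous_d a).comp hG))

instance : ContinuousMul (LinFn n V) :=
  ⟨continuous_rng.2 fun L => continuous_mul' L continuous_fst continuous_snd⟩

theorem continuous_res (h : W ≤ V) : Continuous (LinFn.res n h) :=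
  continuous_rng.2 fun L => by
    have hι : Continuous (Opens.inclusion h) := continuous_inclusion h
    have : (fun f => bodyC n W (ds L (LinFn.res n h f))) =
        fun f => (bodyC n V (ds L f)).comp ⟨_, hι⟩ := by
      funext f
      rw [ds_res]
      exact congrArg (SmoothFn.toC W) (body_res h _)
    rw [this]
    exact (ContinuousMap.continuous_precomp _).comp (continuous_bodyC_ds L)

/-- The topology only sees bodies of derivatives. Since the forms ε∂_{j₁}⋯∂_{j_k} span the dual of
the Grassmann algebra, it controls the derivatives of every component. -/
theorem continuous_pds_slice (L : List (Fin m)) (l : Module.Dual ℝ (Grass n)) :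
    Continuous fun f : LinFn n V => SmoothFn.toC V (SmoothFn.pds L (slice l f)) := by
  have hl : l ∈ Submodule.span ℝ
    (range fun L : List (Fin n) => (Grass.aug n).toLinearMap ∘ₗ Grass.derivs L) := by
    rw [Grass.span_aug_derivs]; trivial
  induction hl using Submodule.span_induction with
  | mem l hl =>
    obtain ⟨L', rfl⟩ := hl
    obtain ⟨K, h1, h2⟩ := exists_lefts_rights L L'
    have := continuous_bodyC_ds (V := V) K
    simpa only [bodyC, AlgHom.comp_apply, body_ds, h1, h2] using this
  | zero =>
    simp only [slice_zero, map_zero]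
    exact continuous_const
  | add x y _ _ hx hy =>
    simp only [slice_add, map_add]
    exact hx.add hy
  | smul r x _ hx =>
    simp only [slice_smul, map_smul]
    exact hx.const_smul r

theorem jet_injective : Function.Injective (jet n V) := by
  rw [← LinearMap.ker_eq_bot, LinearMap.ker_eq_bot']
  intro f hf
  refine ext_slice fun l => ?_
  rw [map_zero]
  have hz : ∀ l : Module.Dual ℝ (Grass n), slice l f = 0 := by
    intro l
    have hl : l ∈ Submodule.span ℝ
      (range fun L : List (Fin n) => (Grass.aug n).toLinearMap ∘ₗ Grass.derivs L) := by
      rw [Grass.span_aug_derivs]; trivial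
    induction hl using Submodule.span_induction with
    | mem l hl =>
      obtain ⟨L', rfl⟩ := hl
      obtain ⟨K, h1, h2⟩ := exists_lefts_rights ([] : List (Fin m)) L'
      have := congrFun hf K
      rw [jet_apply, bodyC, AlgHom.comp_apply, body_ds, h1, h2] at this
      exact SmoothFn.toC_injective (this.trans (map_zero _).symm)
    | zero => exact slice_zero f
    | add x y _ _ hx hy => rw [slice_add, hx, hy, add_zero]
    | smul r x _ hx => rw [slice_smul, hx, smul_zero]
  exact hz l

/-- Each component converges together with all its derivatives, so its limit is smooth; the limits
are reassembled along the monomial basis. -/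
theorem addComplete : AddComplete (LinFn n V) := by
  intro F hF
  have := hF.1
  have hlim : ∀ (I : Finset (Fin n)) (L : List (Fin m)), ∃ c : C(V, ℝ), Tendsto (fun f : LinFn n V =>
      SmoothFn.toC V (SmoothFn.pds L (slice ((Grass.basis n).coord I) f))) F (𝓝 c) := fun I L =>
    addComplete_of_completeSpace C(V, ℝ) _ (hF.map (((SmoothFn.toC V).toLinearMap ∘ₗ
      SmoothFn.pds L ∘ₗ slice ((Grass.basis n).coord I)).toAddMonoidHom)
      (continuous_pds_slice L ((Grass.basis n).coord I)))
  choose c hc using hlim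
  have hg : ∀ I, ∃ g : SmoothFn V, ∀ L, SmoothFn.toC V (SmoothFn.pds L g) = c I L := fun I => by
    have : (F.map (slice ((Grass.basis n).coord I) : LinFn n V → SmoothFn V)).NeBot := inferInstance
    exact SmoothFn.exists_limit (F := F.map (slice ((Grass.basis n).coord I))) fun L =>
      tendsto_map'_iff.2 (hc I L)
  choose g hg using hg
  refine ⟨∑ I, g I ⊗ₜ[ℝ] Grass.basis n I, ?_⟩
  suffices h : Tendsto id F (𝓝 (∑ I, g I ⊗ₜ[ℝ] Grass.basis n I)) from h
  rw [isInducing_jet.tendsto_nhds_iff, tendsto_pi_nhds]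
  intro L
  have key : ∀ f : LinFn n V, jet n V f L = ∑ I, Grass.aug n (Grass.derivs (rights L)
      (Grass.basis n I)) • SmoothFn.toC V (SmoothFn.pds (lefts L)
        (slice ((Grass.basis n).coord I) f)) := by
    intro f
    rw [jet_apply, bodyC, AlgHom.comp_apply]
    conv_lhs => rw [← sum_slice_tmul f]
    simp only [map_sum, ds_tmul, body_tmul, map_smul]
  have hval : jet n V (∑ I, g I ⊗ₜ[ℝ] Grass.basis n I) L = ∑ I, Grass.aug n
      (Grass.derivs (rights L) (Grass.basis n I)) • c I (lefts L) := by
    rw [jet_apply, bodyC, AlgHom.comp_apply]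
    simp only [map_sum, ds_tmul, body_tmul, map_smul, hg]
  rw [hval]
  simp only [Function.comp_def, id, key]
  exact tendsto_finsetSum _ fun I _ => (hc I (lefts L)).const_smul _

theorem frechet : IsFrechetSpace (LinFn n V) := by
  refine .of_addComplete inferInstance inferInstance (.induced (jet n V)) ?_ addComplete
  -- There are countably many lists of coordinates, and each factor C(V, ℝ) is metrizable.
  have : MetrizableSpace (List (Fin m ⊕ Fin n) → C(V, ℝ)) := UniformSpace.metrizableSpace
  exact (IsEmbedding.mk isInducing_jet jet_injective).metrizableSpace

end LinFn

/-! ### Invertible superfunctions and matrices -/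

namespace LinFn

variable {m n : ℕ} {V W : Opens (Euc m)}

/-- The superfunctions whose coefficients are products of at least `k` odd generators. -/
def fil (n k : ℕ) (V : Opens (Euc m)) : Submodule ℝ (LinFn n V) :=
  Submodule.span ℝ {f | ∃ (g : SmoothFn V) (a : Grass n), a ∈ Grass.fil n k ∧ f = g ⊗ₜ[ℝ] a}

theorem fil_eq_bot : fil n (n + 1) V = ⊥ := by
  refine eq_bot_iff.2 (Submodule.span_le.2 ?_)
  rintro _ ⟨g, a, ha, rfl⟩
  rw [Grass.fil_eq_bot, Submodule.mem_bot] at ha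
  simp [ha]

theorem mul_mem_fil {k l : ℕ} {x y : LinFn n V} (hx : x ∈ fil n k V) (hy : y ∈ fil n l V) :
    x * y ∈ fil n (k + l) V := by
  have h : fil n k V * fil n l V ≤ fil n (k + l) V := by
    rw [fil, fil, Submodule.span_mul_span, Submodule.span_le]
    rintro _ ⟨_, ⟨g, a, ha, rfl⟩, _, ⟨h, b, hb, rfl⟩, rfl⟩
    exact Submodule.subset_span ⟨g * h, a * b, Grass.mul_mem_fil ha hb,
      Algebra.TensorProduct.tmul_mul_tmul _ _ _ _⟩
  exact h (Submodule.mul_mem_mul hx hy)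

theorem sub_body_mem_fil (f : LinFn n V) : f - body n V f ⊗ₜ 1 ∈ fil n 1 V := by
  induction f using TensorProduct.induction_on with
  | zero => simp
  | add x y hx hy =>
    rw [map_add, TensorProduct.add_tmul, add_sub_add_comm]
    exact add_mem hx hy
  | tmul g a =>
    refine Submodule.subset_span ⟨g, _, Grass.sub_aug_mem_fil_one a, ?_⟩
    rw [body_tmul, TensorProduct.tmul_sub, TensorProduct.smul_tmul, Algebra.algebraMap_eq_smul_one]

/-- Superfunctions do not commute in general, so determinants are taken of bodies only. N differs
from its invertible body u by a matrix with entries of filtration at least 1; hence N = u(1 +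
nilpotent). -/
theorem isUnit_matrix {ι : Type*} [Fintype ι] [DecidableEq ι] {N : Matrix ι ι (LinFn n V)}
    (h : ∀ x : V, (Matrix.of fun a b => body n V (N a b) x).det ≠ 0) : IsUnit N := by
  let j : SmoothFn V →ₐ[ℝ] LinFn n V := Algebra.TensorProduct.includeLeft
  let N₀ : Matrix ι ι (SmoothFn V) := N.map (body n V)
  have hdet : IsUnit N₀.det := by
    rw [SmoothFn.isUnit_iff]
    intro x
    have hx : N₀.det x = (Matrix.of fun a b => body n V (N a b) x).det := by
      have := RingHom.map_det (((ContinuousMap.evalAlgHom ℝ ℝ x : C(V, ℝ) →ₐ[ℝ] ℝ).comp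
        (SmoothFn.toC V)).toRingHom) N₀
      exact this
    rw [hx]
    exact h x
  have hN₀ : IsUnit (j.mapMatrix N₀) := ((Matrix.isUnit_iff_isUnit_det _).2 hdet).map j.mapMatrix
  obtain ⟨u, hu⟩ := hN₀
  have key : ∀ T : Matrix ι ι (LinFn n V), (∀ a b, T a b ∈ fil n 1 V) → IsNilpotent T := by
    intro T hT
    have hk : ∀ k : ℕ, ∀ a b, (T ^ (k + 1)) a b ∈ fil n (k + 1) V := by
      intro k
      induction k with
      | zero => simpa using hT
      | succ k ih =>
        intro a b
        rw [pow_succ, Matrix.mul_apply]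
        exact Submodule.sum_mem _ fun c _ => mul_mem_fil (ih a c) (hT c b)
    refine ⟨n + 1, ?_⟩
    ext a b
    have := hk n a b
    rwa [fil_eq_bot, Submodule.mem_bot] at this
  have hmul : ∀ T T' : Matrix ι ι (LinFn n V), (∀ a b, T' a b ∈ fil n 1 V) →
      ∀ a b, (T * T') a b ∈ fil n 1 V := by
    intro T T' hT a b
    rw [Matrix.mul_apply]
    refine Submodule.sum_mem _ fun c _ => ?_
    have h0 : T a c ∈ fil n 0 V := by
      induction T a c using TensorProduct.induction_on with
      | zero => exact zero_mem _
      | add x y hx hy => exact add_mem hx hy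
      | tmul g a => exact Submodule.subset_span ⟨g, a, by rw [Grass.fil_zero]; trivial, rfl⟩
    have := mul_mem_fil h0 (hT c b)
    rwa [zero_add] at this
  have hdiff : ∀ a b, (N - j.mapMatrix N₀) a b ∈ fil n 1 V := fun a b => sub_body_mem_fil (N a b)
  have hnil := key _ (hmul (((u⁻¹ : (Matrix ι ι (LinFn n V))ˣ) : Matrix ι ι (LinFn n V))) _ hdiff)
  have hunit := hnil.isUnit_one_add
  have e : N = u * (1 + ((u⁻¹ : (Matrix ι ι (LinFn n V))ˣ) : Matrix ι ι (LinFn n V)) *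
      (N - j.mapMatrix N₀)) := by
    rw [mul_add, mul_one, ← mul_assoc, Units.mul_inv, one_mul, hu, add_sub_cancel]
  rw [e]
  exact u.isUnit.mul hunit

theorem isUnit_iff {f : LinFn n V} : IsUnit f ↔ ∀ x, body n V f x ≠ 0 := by
  refine ⟨fun h => SmoothFn.isUnit_iff.1 (h.map (body n V)), fun h => ?_⟩
  have := isUnit_matrix (ι := Unit) (N := Matrix.of fun _ _ => f) fun x => by simpa using h x
  obtain ⟨u, hu⟩ := this
  have h1 := congrFun (congrFun u.mul_inv ()) ()
  have h2 := congrFun (congrFun u.inv_mul ()) ()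
  rw [hu, Matrix.mul_apply] at h1
  rw [hu, Matrix.mul_apply] at h2
  simp only [Finset.univ_unique, Finset.sum_singleton, Matrix.one_apply_eq] at h1 h2
  exact ⟨⟨f, _, h1, h2⟩, rfl⟩

/-! ### Superderivations that vanish on the coordinates -/

/-- The coordinates of a superdomain. -/
def coord (n : ℕ) (V : Opens (Euc m)) : Fin m ⊕ Fin n → LinFn n V
  | Sum.inl i => SmoothFn.coord V i ⊗ₜ 1
  | Sum.inr j => 1 ⊗ₜ ExteriorAlgebra.ι ℝ (Pi.single j 1)

theorem res_coord (h : W ≤ V) (a : Fin m ⊕ Fin n) : LinFn.res n h (coord n V a) = coord n W a := by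
  rcases a with i | j
  · rfl
  · exact congrArg (· ⊗ₜ[ℝ] _) (map_one (SmoothFn.res h))

theorem d_coord (a b : Fin m ⊕ Fin n) : d a (coord n V b) = if a = b then 1 else 0 := by
  rcases a with i | j <;> rcases b with i' | j'
  · change SmoothFn.pd i (SmoothFn.coord V i') ⊗ₜ 1 = _
    rw [SmoothFn.pd_coord]
    by_cases h : i = i'
    · simp [h, Algebra.TensorProduct.one_def]
    · simp [h]
  · change SmoothFn.pd i 1 ⊗ₜ _ = _
    have : SmoothFn.pd i (1 : SmoothFn V) = 0 := by
      have h := SmoothFn.pd_mul i (1 : SmoothFn V) 1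
      simpa using h
    simp [this]
  · change _ ⊗ₜ Grass.deriv j 1 = _
    have : Grass.deriv j 1 = 0 := by
      have := Grass.deriv_algebraMap j 1
      rwa [map_one] at this
    simp [this]
  · change 1 ⊗ₜ Grass.deriv j (ExteriorAlgebra.ι ℝ _) = _
    rw [Grass.deriv_ι]
    by_cases h : j = j'
    · simp [h, Algebra.TensorProduct.one_def]
    · simp [h]

/-- A smooth function agrees near a point with a globally defined one. -/
theorem exists_global (g : SmoothFn V) (q : V) : ∃ (f : Euc m → ℝ) (W : Opens (Euc m)) (h : W ≤ V),
    ContDiff ℝ ∞ f ∧ (q : Euc m) ∈ W ∧ ∀ x : W, g ⟨x, h x.2⟩ = f x := by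
  obtain ⟨r, hr, hrV⟩ := Metric.isOpen_iff.1 V.2 q q.2
  let χ : ContDiffBump (q : Euc m) := ⟨r / 3, r / 2, by positivity, by linarith⟩
  have hsub : tsupport χ ⊆ V := by
    rw [χ.tsupport_eq]
    exact (Metric.closedBall_subset_ball (by change r / 2 < r; linarith)).trans hrV
  have hW : (⟨Metric.ball q (r / 3), Metric.isOpen_ball⟩ : Opens (Euc m)) ≤ V :=
    (Metric.ball_subset_ball (by linarith)).trans hrV
  refine ⟨fun x => χ x * SmoothFn.extend g x, _, hW, ?_, Metric.mem_ball_self (by positivity), ?_⟩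
  · rw [contDiff_iff_contDiffAt]
    intro x
    by_cases hx : x ∈ V
    · exact χ.contDiff.contDiffAt.mul
        ((SmoothFn.contDiffOn_extend g x hx).contDiffAt (V.2.mem_nhds hx))
    · have hx' : x ∉ tsupport χ := fun h => hx (hsub h)
      have h0 : (fun x => χ x * SmoothFn.extend g x) =ᶠ[𝓝 x] fun _ => 0 := by
        filter_upwards [(isClosed_tsupport _).isOpen_compl.mem_nhds hx'] with y hy
        rw [image_eq_zero_of_notMem_tsupport hy, zero_mul]
      exact contDiffAt_const.congr_of_eventuallyEq h0
  · intro x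
    have : χ (x : Euc m) = 1 := χ.one_of_mem_closedBall (Metric.ball_subset_closedBall x.2)
    change _ = χ (x : Euc m) * SmoothFn.extend g x
    refine Eq.trans ?_ (congrArg (· * _) this).symm
    exact (SmoothFn.extend_apply g ⟨x, hW x.2⟩).symm.trans (one_mul _).symm

/-- Local superderivations that vanish on the coordinates are zero. -/
theorem eq_zero_of_coord (i : ZMod 2) (T : ∀ W : Opens (Euc m), W ≤ V → (LinFn n W →ₗ[ℝ] LinFn n W))
    (hres : ∀ (W W' : Opens (Euc m)) (h : W ≤ V) (h' : W' ≤ W) (f : LinFn n W),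
      LinFn.res n h' (T W h f) = T W' (h'.trans h) (LinFn.res n h' f))
    (hmul : ∀ (W : Opens (Euc m)) (h : W ≤ V) (f g : LinFn n W),
      T W h (f * g) = T W h f * g + tw i f * T W h g)
    (hcoord : ∀ (W : Opens (Euc m)) (h : W ≤ V) a, T W h (coord n W a) = 0)
    (W : Opens (Euc m)) (h : W ≤ V) : T W h = 0 := by
  have htw : ∀ (W : Opens (Euc m)) (g : SmoothFn W), tw i (g ⊗ₜ[ℝ] (1 : Grass n)) = g ⊗ₜ 1 := by
    intro W g
    rcases zmod_two_cases i with rfl | rfl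
    · rfl
    · rw [tw_one, inv_tmul, map_one]
  have hone : ∀ (W : Opens (Euc m)) (h : W ≤ V), T W h 1 = 0 := by
    intro W h
    have h1 := hmul W h 1 1
    rw [mul_one, mul_one, Algebra.TensorProduct.one_def, htw, ← Algebra.TensorProduct.one_def,
      one_mul] at h1
    exact left_eq_add.1 h1
  -- Near q, Hadamard's lemma writes g as a constant plus Σ (xᵢ - qᵢ)Gᵢ. T kills constants and
  -- coordinates, so T g = Σ (xᵢ - qᵢ) T Gᵢ, and every component of this vanishes at q.
  have hsm : ∀ (W : Opens (Euc m)) (h : W ≤ V) (g : SmoothFn W), T W h (g ⊗ₜ 1) = 0 := by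
    intro W h g
    refine ext_slice fun l => ?_
    rw [map_zero]
    ext q
    obtain ⟨f, W', hW', hf, hq, hgf⟩ := exists_global g q
    obtain ⟨G, hG, hfG⟩ := exists_hadamard hf q
    have e : LinFn.res n hW' (g ⊗ₜ 1) = f q • (1 : LinFn n W') +
        ∑ i, (SmoothFn.coord W' i - algebraMap ℝ _ ((q : Euc m) i)) ⊗ₜ[ℝ] (1 : Grass n) *
          (SmoothFn.ofFun (G i) (hG i).contDiffOn ⊗ₜ 1) := by
      rw [res_tmul, Algebra.TensorProduct.one_def, TensorProduct.smul_tmul']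
      simp only [Algebra.TensorProduct.tmul_mul_tmul, mul_one]
      rw [← TensorProduct.sum_tmul, ← TensorProduct.add_tmul]
      congr 1
      ext x
      have hsum : ∀ S : Fin m → SmoothFn W', (∑ i, S i) x = ∑ i, S i x := fun S =>
        map_sum ((ContinuousMap.evalAlgHom ℝ ℝ x : C(W', ℝ) →ₐ[ℝ] ℝ).comp (SmoothFn.toC W')) S _
      change g ⟨x, _⟩ = f q * 1 + (∑ i, _ : SmoothFn W') x
      rw [hsum, hgf x, hfG x, mul_one]
      rfl
    have e2 := congrArg (T W' (hW'.trans h)) e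
    rw [← hres W W' h hW', map_add, map_smul, hone, smul_zero, zero_add, map_sum] at e2
    have hz : ∀ i : Fin m, T W' (hW'.trans h)
        ((SmoothFn.coord W' i - algebraMap ℝ _ ((q : Euc m) i)) ⊗ₜ[ℝ] (1 : Grass n)) = 0 := by
      intro i
      have hc : T W' (hW'.trans h) (SmoothFn.coord W' i ⊗ₜ[ℝ] (1 : Grass n)) = 0 :=
        hcoord W' (hW'.trans h) (Sum.inl i)
      rw [TensorProduct.sub_tmul, map_sub, hc,
        Algebra.algebraMap_eq_smul_one, ← TensorProduct.smul_tmul', map_smul,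
        ← Algebra.TensorProduct.one_def, hone, smul_zero, sub_zero]
    simp only [hmul, hz, htw, zero_mul, zero_add] at e2
    have e3 := congrArg (fun y => slice l y (⟨q, hq⟩ : W')) e2
    simp only [slice_res, map_sum, slice_tmul_one_mul] at e3
    change slice l (T W h (g ⊗ₜ 1)) q = (∑ i, _ : SmoothFn W') _ at e3
    have hsum : ∀ S : Fin m → SmoothFn W', (∑ i, S i) (⟨q, hq⟩ : W') = ∑ i, S i ⟨q, hq⟩ := fun S =>
      map_sum ((ContinuousMap.evalAlgHom ℝ ℝ (⟨q, hq⟩ : W') : C(W', ℝ) →ₐ[ℝ] ℝ).comp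
        (SmoothFn.toC W')) S _
    rw [hsum] at e3
    rw [e3]
    refine Finset.sum_eq_zero fun i _ => ?_
    change ((q : Euc m) i - (q : Euc m) i) * _ = 0
    rw [sub_self, zero_mul]
  refine LinearMap.ext fun f => ?_
  change T W h f = 0
  induction f using TensorProduct.induction_on with
  | zero => simp
  | add x y hx hy => rw [map_add, hx, hy, add_zero]
  | tmul g a =>
    induction a using Grass.left_induction with
    | h0 r =>
      rw [Algebra.algebraMap_eq_smul_one, TensorProduct.tmul_smul, map_smul, hsm, smul_zero]
    | h1 x y hx hy => rw [TensorProduct.tmul_add, map_add, hx, hy, add_zero]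
    -- Odd generators are split off one at a time by the Leibniz rule, T being zero on each of them.
    | h2 v x hx =>
      have e : g ⊗ₜ[ℝ] (ExteriorAlgebra.ι ℝ v * x) =
          ((1 : SmoothFn W) ⊗ₜ[ℝ] (ExteriorAlgebra.ι ℝ v : Grass n)) * g ⊗ₜ[ℝ] x := by
        rw [Algebra.TensorProduct.tmul_mul_tmul, one_mul]
      have hv : T W h ((1 : SmoothFn W) ⊗ₜ[ℝ] (ExteriorAlgebra.ι ℝ v : Grass n)) = 0 := by
        rw [← Grass.sum_smul_ι v, TensorProduct.tmul_sum, map_sum]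
        refine Finset.sum_eq_zero fun j _ => ?_
        have hc : T W h ((1 : SmoothFn W) ⊗ₜ[ℝ] ExteriorAlgebra.ι ℝ (Pi.single j 1)) = 0 :=
          hcoord W h (Sum.inr j)
        rw [TensorProduct.tmul_smul, map_smul, hc, smul_zero]
      rw [e, hmul, hv, hx, zero_mul, mul_zero, add_zero]

end LinFn

/-! ### Charts of a supermanifold -/

namespace LinFn

variable {m n : ℕ} {V : Opens (Euc m)}

theorem inv_of_mem {j : ZMod 2} {f : LinFn n V} (hf : f ∈ LinFn.part n V j) :
    inv n V f = sgn 1 j • f := by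
  rcases zmod_two_cases j with rfl | rfl
  · simp [inv_of_mem_zero hf, sgn]
  · simp [inv_of_mem_one hf, sgn]

theorem tw_of_inv (i : ZMod 2) {j : ZMod 2} {f : LinFn n V} (hf : inv n V f = sgn 1 j • f) :
    tw i f = sgn i j • f := by
  rcases zmod_two_cases i with rfl | rfl
  · rw [tw_zero, sgn_zero_left, one_smul]
  · rw [tw_one, hf]

theorem inv_coord (a : Fin m ⊕ Fin n) : inv n V (coord n V a) = sgn 1 (par a) • coord n V a := by
  rcases a with i | j
  · change inv n V (SmoothFn.coord V i ⊗ₜ 1) = sgn 1 0 • (SmoothFn.coord V i ⊗ₜ 1)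
    rw [inv_tmul, map_one]
    simp [sgn]
  · change inv n V (1 ⊗ₜ ExteriorAlgebra.ι ℝ (Pi.single j 1)) =
      sgn 1 1 • (1 ⊗ₜ ExteriorAlgebra.ι ℝ (Pi.single j 1))
    rw [inv_tmul, Grass.inv_ι, TensorProduct.tmul_neg]
    simp [sgn]

theorem d_inv' (a : Fin m ⊕ Fin n) (f : LinFn n V) :
    inv n V (d a f) = sgn 1 (par a) • d a (inv n V f) := by
  rw [d_inv, smul_smul]
  rcases a with i | j <;> simp [sgn, par]

end LinFn

namespace Supermanifold

variable {m n : ℕ} {X : Type u} [TopologicalSpace X] (M : Supermanifold m n X)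

/-- The map `f ↦ (-1)^{i|f|} f`. -/
def tw {U : Opens X} (i : ZMod 2) : M.O U →ₗ[ℝ] M.O U :=
  parityProj (M.part U) 0 + sgn i 1 • parityProj (M.part U) 1

variable {M} {U W : Opens X}

theorem tw_of_mem (i : ZMod 2) {j : ZMod 2} {f : M.O U} (hf : f ∈ M.part U j) :
    M.tw i f = sgn i j • f := by
  rw [tw, LinearMap.add_apply, LinearMap.smul_apply]
  rcases zmod_two_cases j with rfl | rfl
  · rw [parityProj_of_mem _ hf, parityProj_of_mem_ne _ zero_ne_one hf]
    simp [sgn]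
  · rw [parityProj_of_mem _ hf, parityProj_of_mem_ne _ one_ne_zero hf, zero_add]

/-- An eigenvector of the parity involution has no component of the opposite parity, because 2 is
invertible. -/
theorem mem_part_of_tw {j : ZMod 2} {f : M.O U} (hf : M.tw 1 f = sgn 1 j • f) :
    f ∈ M.part U j := by
  have e := parityProj_add (M.part U) f
  have h0 := tw_of_mem 1 (parityProj_mem (M.part U) 0 f)
  have h1 := tw_of_mem 1 (parityProj_mem (M.part U) 1 f)
  rw [← e, map_add, h0, h1] at hf
  rcases zmod_two_cases j with rfl | rfl
  · have : parityProj (M.part U) 1 f = 0 := by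
      refine eq_zero_of_eq_neg ?_
      simpa [sgn] using hf.symm
    rw [← e, this, add_zero]
    exact parityProj_mem _ _ _
  · have : parityProj (M.part U) 0 f = 0 := by
      refine eq_zero_of_eq_neg ?_
      simpa [sgn] using hf
    rw [← e, this, zero_add]
    exact parityProj_mem _ _ _

/-- Induction over homogeneous superfunctions. -/
theorem part_induction {p : M.O U → Prop} (f : M.O U) (hadd : ∀ f g, p f → p g → p (f + g))
    (hp : ∀ j, ∀ f ∈ M.part U j, p f) : p f := by
  rw [← parityProj_add (M.part U) f]
  exact hadd _ _ (hp _ _ (parityProj_mem _ _ _)) (hp _ _ (parityProj_mem _ _ _))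

theorem res_parityProj (h : W ≤ U) (i : ZMod 2) (f : M.O U) :
    M.res h (parityProj (M.part U) i f) = parityProj (M.part W) i (M.res h f) := by
  induction f using part_induction with
  | hadd f g hf hg => simp only [map_add, hf, hg]
  | hp j f hf =>
    by_cases hij : j = i
    · subst hij
      rw [parityProj_of_mem _ hf, parityProj_of_mem _ (M.res_part h j f hf)]
    · rw [parityProj_of_mem_ne _ hij hf, parityProj_of_mem_ne _ hij (M.res_part h j f hf), map_zero]

/-- Expresses the parity projections by the involution, which commutes with charts; their continuity
is derived from this. -/
theorem parityProj_eq_tw (i : ZMod 2) (f : M.O U) :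
    parityProj (M.part U) i f = (1 / 2 : ℝ) • (f + sgn 1 i • M.tw 1 f) := by
  have e := parityProj_add (M.part U) f
  have h0 := tw_of_mem 1 (parityProj_mem (M.part U) 0 f)
  have h1 := tw_of_mem 1 (parityProj_mem (M.part U) 1 f)
  have ht : M.tw 1 f = parityProj (M.part U) 0 f - parityProj (M.part U) 1 f := by
    conv_lhs => rw [← e]
    rw [map_add, h0, h1]
    simp [sgn, sub_eq_add_neg]
  rw [ht]
  nth_rewrite 2 [← e]
  rcases zmod_two_cases i with rfl | rfl
  · have : sgn 1 0 = 1 := by simp [sgn]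
    rw [this]
    module
  · have : sgn 1 1 = -1 := by simp [sgn]
    rw [this]
    module

/-- The twist absorbs the sign, so `f` need not be homogeneous. -/
theorem mul_leibniz {i : ZMod 2} {D : M.PreVect U} (hD : D ∈ M.vectPart U i) (W : Set.Iic U)
    (f g : M.O W.1) : D W (f * g) = D W f * g + M.tw i f * D W g := by
  induction f using part_induction with
  | hadd f g hf hg => simp only [map_add, add_mul, hf, hg]; abel
  | hp j f hf => rw [hD.2.2 W j f g hf, tw_of_mem i hf, smul_mul_assoc]

/-- Superderivations commute with restrictions. -/
theorem vect_res (D : M.Vect U) (W W' : Set.Iic U) (h : W'.1 ≤ W.1) (f : M.O W.1) :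
    M.res h (D.1 W f) = D.1 W' (M.res h f) := by
  obtain ⟨D, hD⟩ := D
  change M.res h (D W f) = D W' (M.res h f)
  refine Submodule.iSup_induction (M.vectPart U)
    (motive := fun D => M.res h (D W f) = D W' (M.res h f)) hD ?_ ?_ ?_
  · exact fun i D hD => hD.1 W W' h f
  · simp
  · intro D D' hD hD'
    simp only [Pi.add_apply, LinearMap.add_apply, map_add, hD, hD']

theorem applyVect_vectRes (h : W ≤ U) (D : M.Vect U) (f : M.O U) :
    M.applyVect (M.vectRes h D) (M.res h f) = M.res h (M.applyVect D f) :=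
  (vect_res D ⟨U, le_refl U⟩ ⟨W, h⟩ h f).symm

/-! ### Superfunctions and vector fields in a chart -/

variable (M) in
/-- A local isomorphism with a superdomain. -/
structure Chart where
  φ : OpenPartialHomeomorph X (Euc m)
  e : ∀ V : Opens (Euc m), (V : Set (Euc m)) ⊆ φ.target → (M.O (chartPreimage φ V) ≃ₐ[ℝ] LinFn n V)
  e_part : ∀ V hV i a, a ∈ M.part (chartPreimage φ V) i → e V hV a ∈ LinFn.part n V i
  e_res : ∀ (V W : Opens (Euc m)) (hV : (V : Set (Euc m)) ⊆ φ.target) (h : W ≤ V) a,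
    e W (Subset.trans h hV) (M.res (chartPreimage_mono φ h) a) = LinFn.res n h (e V hV a)

namespace Chart

variable (c : M.Chart)

/-- The domain of a chart. -/
def dom : Opens X := ⟨c.φ.source, c.φ.open_source⟩

/-- The image of an open set under a chart. -/
def img (W : Opens X) : Opens (Euc m) :=
  ⟨c.φ.target ∩ c.φ.symm ⁻¹' W, c.φ.symm.isOpen_inter_preimage W.2⟩

theorem img_subset (W : Opens X) : (c.img W : Set (Euc m)) ⊆ c.φ.target := inter_subset_left

theorem img_mono {c : M.Chart} (h : W ≤ U) : c.img W ≤ c.img U := fun _ hx => ⟨hx.1, h hx.2⟩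

theorem pre_img_le (W : Opens X) : chartPreimage c.φ (c.img W) ≤ W := by
  rintro x ⟨hx, _, hx'⟩
  have : c.φ.symm (c.φ x) ∈ W := hx'
  rwa [c.φ.left_inv hx] at this

theorem pre_img_le_dom (W : Opens X) : chartPreimage c.φ (c.img W) ≤ c.dom := fun _ hx => hx.1

theorem le_pre_img {c : M.Chart} (h : W ≤ c.dom) : W ≤ chartPreimage c.φ (c.img W) := by
  intro x hx
  refine ⟨h hx, c.φ.map_source (h hx), ?_⟩
  change c.φ.symm (c.φ x) ∈ W
  rwa [c.φ.left_inv (h hx)]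

theorem apply_mem_img {c : M.Chart} (h : W ≤ c.dom) {x : X} (hx : x ∈ W) : c.φ x ∈ c.img W :=
  (le_pre_img h hx).2

/-- The expression of a superfunction in a chart. -/
def E (W : Opens X) : M.O W →ₐ[ℝ] LinFn n (c.img W) :=
  (c.e (c.img W) (c.img_subset W)).toAlgHom.comp (M.res (c.pre_img_le W))

theorem E_res (h : W ≤ U) (f : M.O U) : c.E W (M.res h f) = LinFn.res n (img_mono h) (c.E U f) := by
  refine Eq.trans ?_ (c.e_res (c.img U) (c.img W) (c.img_subset U) (img_mono h) _)
  change c.e (c.img W) _ (M.res _ (M.res h f)) = c.e (c.img W) _ (M.res _ (M.res _ f))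
  rw [M.res_res, M.res_res]

variable {c}

/-- The superfunction with a given expression in a chart. -/
def ofE (h : W ≤ c.dom) : LinFn n (c.img W) →ₐ[ℝ] M.O W :=
  (M.res (le_pre_img h)).comp (c.e (c.img W) (c.img_subset W)).symm.toAlgHom

theorem E_ofE (h : W ≤ c.dom) (f : LinFn n (c.img W)) : c.E W (ofE h f) = f := by
  change c.e (c.img W) _ (M.res _ (M.res _ ((c.e (c.img W) _).symm f))) = f
  rw [M.res_res]
  refine (congrArg _ (M.res_id _ _)).trans ?_
  exact (c.e (c.img W) (c.img_subset W)).apply_symm_apply f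

theorem ofE_E (h : W ≤ c.dom) (f : M.O W) : ofE h (c.E W f) = f := by
  change M.res _ ((c.e (c.img W) _).symm (c.e (c.img W) _ (M.res _ f))) = f
  rw [AlgEquiv.symm_apply_apply, M.res_res]
  exact M.res_id _ _

theorem E_injective (h : W ≤ c.dom) : Function.Injective (c.E W) := fun f g e => by
  rw [← ofE_E h f, e, ofE_E]

theorem res_ofE (h : U ≤ c.dom) (h' : W ≤ U) (f : LinFn n (c.img U)) :
    M.res h' (ofE h f) = ofE (h'.trans h) (LinFn.res n (img_mono h') f) := by
  refine E_injective (h'.trans h) ?_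
  rw [E_res, E_ofE, E_ofE]

variable (c) in
theorem inv_E {j : ZMod 2} {f : M.O W} (hf : f ∈ M.part W j) :
    LinFn.inv n _ (c.E W f) = sgn 1 j • c.E W f :=
  LinFn.inv_of_mem (c.e_part _ _ _ _ (M.res_part _ _ _ hf))

variable (c) in
theorem E_tw (i : ZMod 2) (f : M.O W) : c.E W (M.tw i f) = LinFn.tw i (c.E W f) := by
  induction f using part_induction with
  | hadd f g hf hg => simp only [map_add, hf, hg]
  | hp j f hf => rw [tw_of_mem i hf, map_smul, LinFn.tw_of_inv i (c.inv_E hf)]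

/-- A chart is only assumed to send homogeneous elements to homogeneous ones. The converse holds
because it is injective on `W` and intertwines the parity involutions. -/
theorem mem_part (h : W ≤ c.dom) {j : ZMod 2} {f : M.O W}
    (hf : LinFn.inv n _ (c.E W f) = sgn 1 j • c.E W f) : f ∈ M.part W j := by
  refine mem_part_of_tw (E_injective h ?_)
  rw [E_tw, LinFn.tw_one, hf, map_smul]

/-- The coordinates of a chart. -/
def z (h : W ≤ c.dom) (a : Fin m ⊕ Fin n) : M.O W := ofE h (LinFn.coord n _ a)

theorem E_z (h : W ≤ c.dom) (a : Fin m ⊕ Fin n) : c.E W (z h a) = LinFn.coord n _ a := E_ofE h _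

theorem res_z (h : U ≤ c.dom) (h' : W ≤ U) (a : Fin m ⊕ Fin n) :
    M.res h' (z h a) = z (h'.trans h) a := by
  rw [z, z, res_ofE, LinFn.res_coord]

theorem z_mem (h : W ≤ c.dom) (a : Fin m ⊕ Fin n) : z h a ∈ M.part W (LinFn.par a) :=
  mem_part h (by rw [E_z, LinFn.inv_coord])

/-- The partial derivatives with respect to the coordinates of a chart. -/
def preD (h : U ≤ c.dom) (a : Fin m ⊕ Fin n) : M.PreVect U := fun W =>
  (ofE (W.2.trans h)).toLinearMap ∘ₗ LinFn.d a ∘ₗ (c.E W.1).toLinearMap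

theorem E_preD (h : U ≤ c.dom) (a : Fin m ⊕ Fin n) (W : Set.Iic U) (f : M.O W.1) :
    c.E W.1 (preD h a W f) = LinFn.d a (c.E W.1 f) := E_ofE (W.2.trans h) _

theorem preD_mem (h : U ≤ c.dom) (a : Fin m ⊕ Fin n) : preD h a ∈ M.vectPart U (LinFn.par a) := by
  refine ⟨fun W W' h' f => ?_, fun W j f hf => ?_, fun W j f g hf => ?_⟩
  · refine E_injective (W'.2.trans h) ?_
    rw [E_res, E_preD, E_preD, E_res, LinFn.d_res]
  · refine mem_part (W.2.trans h) ?_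
    rw [E_preD, LinFn.d_inv', c.inv_E hf, map_smul, smul_smul]
    congr 1
    generalize LinFn.par a = i
    rcases zmod_two_cases i with rfl | rfl <;> rcases zmod_two_cases j with rfl | rfl <;>
      simp [sgn, show (1 + 1 : ZMod 2) = 0 from rfl]
  · refine E_injective (W.2.trans h) ?_
    rw [E_preD, map_mul, LinFn.d_mul, map_add, map_mul, E_preD, map_smul, map_mul, E_preD,
      LinFn.tw_of_inv _ (c.inv_E hf), smul_mul_assoc]

/-- The coordinate vector fields of a chart. -/
def D (h : U ≤ c.dom) (a : Fin m ⊕ Fin n) : M.Vect U :=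
  ⟨preD h a, Submodule.mem_iSup_of_mem _ (preD_mem h a)⟩

theorem vectRes_D (h : U ≤ c.dom) (h' : W ≤ U) (a : Fin m ⊕ Fin n) :
    M.vectRes h' (D h a) = D (h'.trans h) a := rfl

theorem E_applyVect_D (h : U ≤ c.dom) (a : Fin m ⊕ Fin n) (f : M.O U) :
    c.E U (M.applyVect (D h a) f) = LinFn.d a (c.E U f) := E_ofE h _

theorem applyVect_D_z (h : U ≤ c.dom) (a b : Fin m ⊕ Fin n) :
    M.applyVect (D h a) (z h b) = if a = b then 1 else 0 := by
  refine E_injective h ?_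
  rw [E_applyVect_D, E_z, LinFn.d_coord]
  split_ifs <;> simp

/-- The chart turns T into a compatible family of superderivations on the open subsets of a
superdomain that kills the coordinates, so `LinFn.eq_zero_of_coord` applies. -/
theorem eq_zero_of_z (h : U ≤ c.dom) {i : ZMod 2} {T : M.PreVect U} (hT : T ∈ M.vectPart U i)
    (hz : ∀ a, T ⟨U, le_refl U⟩ (z h a) = 0) : T = 0 := by
  have hle : ∀ V : Opens (Euc m), V ≤ c.img U → chartPreimage c.φ V ≤ U := fun V hV =>
    (chartPreimage_mono c.φ hV).trans (c.pre_img_le U)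
  have hV : ∀ V : Opens (Euc m), V ≤ c.img U → (V : Set (Euc m)) ⊆ c.φ.target := fun V hV =>
    Subset.trans hV (c.img_subset U)
  have hzV : ∀ (V : Opens (Euc m)) (hVU : V ≤ c.img U) a,
      c.e V (hV V hVU) (M.res (hle V hVU) (z h a)) = LinFn.coord n V a := by
    intro V hVU a
    have := c.e_res (c.img U) V (c.img_subset U) hVU (M.res (c.pre_img_le U) (z h a))
    rw [M.res_res] at this
    refine this.trans ((congrArg (LinFn.res n hVU) (E_z h a)).trans (LinFn.res_coord hVU a))
  have htw : ∀ (V : Opens (Euc m)) (hV : (V : Set (Euc m)) ⊆ c.φ.target)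
      (f : M.O (chartPreimage c.φ V)), c.e V hV (M.tw i f) = LinFn.tw i (c.e V hV f) := by
    intro V hV f
    induction f using part_induction with
    | hadd f g hf hg => simp only [map_add, hf, hg]
    | hp j f hf => rw [tw_of_mem i hf, map_smul,
        LinFn.tw_of_inv i (LinFn.inv_of_mem (c.e_part _ _ _ _ hf))]
  let S : ∀ V : Opens (Euc m), V ≤ c.img U → Module.End ℝ (M.O (chartPreimage c.φ V)) :=
    fun V hVU => T ⟨chartPreimage c.φ V, hle V hVU⟩
  have hSres : ∀ (V V' : Opens (Euc m)) (hVU : V ≤ c.img U) (hV' : V' ≤ V) f,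
      M.res (chartPreimage_mono c.φ hV') (S V hVU f) =
        S V' (hV'.trans hVU) (M.res (chartPreimage_mono c.φ hV') f) := fun V V' hVU hV' f =>
    hT.1 ⟨_, hle V hVU⟩ ⟨_, hle V' (hV'.trans hVU)⟩ _ f
  have hSmul : ∀ (V : Opens (Euc m)) (hVU : V ≤ c.img U) f g,
      S V hVU (f * g) = S V hVU f * g + M.tw i f * S V hVU g := fun V hVU f g =>
    mul_leibniz hT ⟨_, hle V hVU⟩ f g
  have hSz : ∀ (V : Opens (Euc m)) (hVU : V ≤ c.img U) a,
      S V hVU (M.res (hle V hVU) (z h a)) = 0 := fun V hVU a => by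
    refine (hT.1 ⟨U, le_refl U⟩ ⟨_, hle V hVU⟩ (hle V hVU) (z h a)).symm.trans ?_
    rw [hz, map_zero]
  have key := LinFn.eq_zero_of_coord (V := c.img U) i
    (fun V hVU => (c.e V (hV V hVU)).toLinearMap ∘ₗ S V hVU ∘ₗ
      (c.e V (hV V hVU)).symm.toLinearMap) ?_ ?_ ?_
  · funext W
    refine LinearMap.ext fun f => ?_
    have hW := W.2.trans h
    refine E_injective hW ?_
    have h1 := LinearMap.congr_fun (key (c.img W.1) (img_mono W.2)) (c.E W.1 f)
    have h2 := hT.1 W ⟨chartPreimage c.φ (c.img W.1), hle _ (img_mono W.2)⟩ (c.pre_img_le W.1) f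
    refine (congrArg (c.e _ (c.img_subset W.1)) h2).trans (Eq.trans ?_ (h1.trans ?_))
    · change _ = c.e _ _ (S _ (img_mono W.2) ((c.e _ _).symm (c.e _ _ _)))
      rw [AlgEquiv.symm_apply_apply]
      rfl
    · exact (map_zero (c.E W.1)).symm
  · intro V V' hVU hV' f
    change LinFn.res n hV' (c.e V _ (S V hVU ((c.e V _).symm f))) =
      c.e V' _ (S V' (hV'.trans hVU) ((c.e V' _).symm (LinFn.res n hV' f)))
    rw [← c.e_res, hSres V V' hVU hV']
    congr 2
    rw [AlgEquiv.eq_symm_apply, c.e_res V V' (hV V hVU), AlgEquiv.apply_symm_apply]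
  · intro V hVU f g
    change c.e V _ (S V hVU ((c.e V _).symm (f * g))) = c.e V _ (S V hVU ((c.e V _).symm f)) * g +
      LinFn.tw i f * c.e V _ (S V hVU ((c.e V _).symm g))
    rw [map_mul, hSmul V hVU, map_add, map_mul, map_mul, htw, AlgEquiv.apply_symm_apply,
      AlgEquiv.apply_symm_apply]
  · intro V hVU a
    change c.e V _ (S V hVU ((c.e V _).symm (LinFn.coord n V a))) = 0
    rw [← hzV V hVU a, AlgEquiv.symm_apply_apply, hSz V hVU, map_zero]

theorem applyVect_mulVect (f : M.O U) (T : M.Vect U) (g : M.O U) :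
    M.applyVect (M.mulVect f T) g = f * M.applyVect T g :=
  congrArg (· * M.applyVect T g) (M.res_id U f)

theorem applyVect_add (T T' : M.Vect U) (g : M.O U) :
    M.applyVect (T + T') g = M.applyVect T g + M.applyVect T' g := rfl

theorem applyVect_sum {ι : Type*} (s : Finset ι) (T : ι → M.Vect U) (g : M.O U) :
    M.applyVect (∑ a ∈ s, T a) g = ∑ a ∈ s, M.applyVect (T a) g := by
  classical
  induction s using Finset.induction_on with
  | empty => rfl
  | insert a s ha ih => rw [Finset.sum_insert ha, Finset.sum_insert ha, applyVect_add, ih]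

/-- The expansion of a vector field in terms of the coordinate vector fields. -/
theorem eq_sum_D (h : U ≤ c.dom) (T : M.Vect U) :
    T = ∑ a, M.mulVect (M.applyVect T (z h a)) (D h a) := by
  obtain ⟨T, hT⟩ := T
  refine Submodule.iSup_induction' (M.vectPart U)
    (motive := fun T hT => (⟨T, hT⟩ : M.Vect U) =
      ∑ a, M.mulVect (M.applyVect (⟨T, hT⟩ : M.Vect U) (z h a)) (D h a)) ?_ ?_ ?_ hT
  · intro i T hT
    set T' : M.Vect U := ⟨T, Submodule.mem_iSup_of_mem i hT⟩
    rw [← sub_eq_zero]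
    refine Subtype.ext (eq_zero_of_z h (i := i) ?_ fun b => ?_)
    · refine Submodule.sub_mem _ hT ?_
      rw [Submodule.coe_sum]
      refine Submodule.sum_mem _ fun a _ => ?_
      -- The coefficient T(z_a) has parity i + |a| and ∂_a has parity |a|, so every term of the sum
      -- has the parity i of T, as `eq_zero_of_z` requires.
      have h1 := M.preMulVect_part (i + LinFn.par a) (LinFn.par a) (M.applyVect T' (z h a))
        (hT.2.1 ⟨U, le_refl U⟩ _ _ (z_mem h a)) (preD h a) (preD_mem h a)
      rw [add_assoc, CharTwo.add_self_eq_zero, add_zero] at h1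
      exact h1
    · change M.applyVect (T' - ∑ a, M.mulVect (M.applyVect T' (z h a)) (D h a)) (z h b) = 0
      have hs : ∀ S : M.Vect U, M.applyVect (T' - S) (z h b) =
        M.applyVect T' (z h b) - M.applyVect S (z h b) := fun S => rfl
      rw [hs, applyVect_sum]
      simp only [applyVect_mulVect, applyVect_D_z, mul_ite, mul_one, mul_zero, Finset.sum_ite_eq',
        Finset.mem_univ, if_true, sub_self]
  · refine (Finset.sum_eq_zero fun a _ => ?_).symm
    have : M.applyVect (0 : M.Vect U) (z h a) = 0 := rfl
    refine Subtype.ext (funext fun W => LinearMap.ext fun g => ?_)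
    change M.res W.2 (M.applyVect (0 : M.Vect U) (z h a)) * _ = 0
    rw [this, map_zero, zero_mul]
  · intro T T' hT hT' h1 h2
    refine (congrArg₂ (· + ·) h1 h2).trans ?_
    rw [← Finset.sum_add_distrib]
    refine Finset.sum_congr rfl fun a _ => ?_
    refine Subtype.ext (funext fun W => LinearMap.ext fun g => ?_)
    refine (add_mul _ _ _).symm.trans ?_
    rw [← map_add]
    rfl

theorem E_applyVect (h : U ≤ c.dom) (T : M.Vect U) (f : M.O U) :
    c.E U (M.applyVect T f) = ∑ a, c.E U (M.applyVect T (z h a)) * LinFn.d a (c.E U f) := by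
  conv_lhs => rw [eq_sum_D h T, applyVect_sum, map_sum]
  refine Finset.sum_congr rfl fun a _ => ?_
  rw [applyVect_mulVect, map_mul, E_applyVect_D]

end Chart

theorem exists_chart (M : Supermanifold m n X) (p : X) : ∃ c : M.Chart, p ∈ c.dom := by
  obtain ⟨φ, hp, e, h1, h2⟩ := M.locallyLinear p
  exact ⟨⟨φ, e, h1, h2⟩, hp⟩

end Supermanifold

/-! ### Values of superfunctions and the topology of the structure sheaf -/

theorem LinFn.res_res {m n : ℕ} {V V' V'' : Opens (Euc m)} (h : V' ≤ V) (h' : V'' ≤ V')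
    (f : LinFn n V) : LinFn.res n h' (LinFn.res n h f) = LinFn.res n (h'.trans h) f := by
  induction f using TensorProduct.induction_on with
  | zero => simp
  | add x y hx hy => simp only [map_add, hx, hy]
  | tmul g a => rfl

theorem LinFn.res_self {m n : ℕ} {V : Opens (Euc m)} (f : LinFn n V) :
    LinFn.res n (le_refl V) f = f := by
  induction f using TensorProduct.induction_on with
  | zero => simp
  | add x y hx hy => simp only [map_add, hx, hy]
  | tmul g a => rfl

namespace Supermanifold

variable {m n : ℕ} {X : Type u} [TopologicalSpace X] {M : Supermanifold m n X} {U W : Opens X}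

/-- Being non-invertible on every neighbourhood of a point depends on the germ only. -/
theorem hasValue_res (h : W ≤ U) (f : M.O U) {p : X} (hp : p ∈ W) (r : ℝ) :
    M.HasValue (M.res h f) p r ↔ M.HasValue f p r := by
  refine ⟨fun H V hV hpV hu => H (V ⊓ W) inf_le_right ⟨hpV, hp⟩ ?_, fun H V hV hpV hu => ?_⟩
  · have := hu.map (M.res (inf_le_left : V ⊓ W ≤ V))
    rw [map_sub, AlgHom.commutes, M.res_res] at this
    rwa [M.res_res]
  · rw [M.res_res] at hu
    exact H V (hV.trans h) hpV hu

theorem value_res (h : W ≤ U) (f : M.O U) {p : X} (hp : p ∈ W) :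
    M.value (M.res h f) p = M.value f p := by
  rw [value, value, funext fun r => propext (hasValue_res h f hp r)]

namespace Chart

variable {c : M.Chart}

theorem hasValue_body (h : W ≤ c.dom) (f : M.O W) {p : X} (hp : p ∈ W) :
    M.HasValue f p (LinFn.body n _ (c.E W f) ⟨c.φ p, apply_mem_img h hp⟩) := by
  intro W' h' hp' hu
  have h1 := LinFn.isUnit_iff.1 (hu.map (c.E W')) ⟨c.φ p, apply_mem_img (h'.trans h) hp'⟩
  rw [map_sub, E_res, AlgHom.commutes, map_sub, LinFn.body_res, AlgHom.commutes] at h1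
  exact h1 (sub_self _)

/-- If r differs from the body of f at p, then it does so on a neighbourhood, where f - r is
invertible. So the body at p is the only possible value. -/
theorem value_eq (h : W ≤ c.dom) (f : M.O W) {p : X} (hp : p ∈ W) :
    M.value f p = LinFn.body n _ (c.E W f) ⟨c.φ p, apply_mem_img h hp⟩ := by
  have H : M.HasValue f p (M.value f p) := Classical.epsilon_spec ⟨_, hasValue_body h f hp⟩
  by_contra hne
  set r := M.value f p
  let V' : Opens (Euc m) := ⟨Subtype.val '' {x : c.img W | LinFn.bodyC n _ (c.E W f) x ≠ r},
    (c.img W).2.isOpenMap_subtype_val _ (isOpen_ne_fun (ContinuousMap.continuous _) continuous_const)⟩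
  have hV' : V' ≤ c.img W := by
    rintro _ ⟨x, _, rfl⟩
    exact x.2
  have hle : chartPreimage c.φ V' ≤ W := (chartPreimage_mono c.φ hV').trans (c.pre_img_le W)
  refine H (chartPreimage c.φ V') hle ⟨h hp, ⟨⟨_, apply_mem_img h hp⟩, Ne.symm hne, rfl⟩⟩ ?_
  have hu : IsUnit (c.E (chartPreimage c.φ V') (M.res hle f - algebraMap ℝ _ r)) := by
    rw [LinFn.isUnit_iff]
    rintro ⟨x, hx, hx'⟩
    have hx2 : c.φ (c.φ.symm x) ∈ V' := hx'.2
    rw [c.φ.right_inv hx] at hx2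
    obtain ⟨y, hy, rfl⟩ := hx2
    rw [map_sub, E_res, AlgHom.commutes, map_sub, LinFn.body_res, AlgHom.commutes]
    exact sub_ne_zero.2 hy
  have := hu.map (ofE (hle.trans h))
  rwa [ofE_E] at this

/-- A chart as a continuous map. -/
def fwd (h : W ≤ c.dom) : C(W, c.img W) :=
  ⟨fun p => ⟨c.φ p, apply_mem_img h p.2⟩, by
    refine Continuous.subtype_mk ?_ _
    exact continuousOn_iff_continuous_domRestrict.1 (c.φ.continuousOn.mono h)⟩

variable (c) in
/-- The inverse of a chart as a continuous map. -/
def bwd (W : Opens X) : C(c.img W, W) :=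
  ⟨fun x => ⟨c.φ.symm x, x.2.2⟩, by
    refine Continuous.subtype_mk ?_ _
    exact continuousOn_iff_continuous_domRestrict.1 (c.φ.symm.continuousOn.mono inter_subset_left)⟩

theorem fwd_bwd (h : W ≤ c.dom) : (fwd h).comp (c.bwd W) = ContinuousMap.id _ :=
  ContinuousMap.ext fun x => Subtype.ext (c.φ.right_inv x.2.1)

end Chart

/-- The values of a superfunction, with the topology of uniform convergence on compact sets. -/
def vals (f : M.O U) : UniformOnFun U ℝ {K : Set U | IsCompact K} :=
  UniformOnFun.ofFun {K : Set U | IsCompact K} fun p : U => M.value f p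

namespace Chart

variable {c : M.Chart}

/-- The values are the body read through a homeomorphism of `U` with its image, and uniform
convergence on compact sets is the compact-open topology for continuous functions. -/
theorem continuous_vals_iff (h : U ≤ c.dom) {Z : Type*} [TopologicalSpace Z] {F : Z → M.O U} :
    (Continuous fun z => vals (F z)) ↔ Continuous fun z => LinFn.bodyC n _ (c.E U (F z)) := by
  have e : (fun z => vals (F z)) = fun z => UniformOnFun.ofFun {K : Set U | IsCompact K}
      ((LinFn.bodyC n _ (c.E U (F z))).comp (fwd h)) := by
    funext z
    exact congrArg (UniformOnFun.ofFun _) (funext fun p => value_eq h (F z) p.2)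
  rw [e, ← ContinuousMap.continuous_iff_continuous_uniformOnFun]
  refine ⟨fun H => ?_, fun H => (ContinuousMap.continuous_precomp _).comp H⟩
  have h2 := (ContinuousMap.continuous_precomp (c.bwd U)).comp H
  have e2 : (fun z => LinFn.bodyC n _ (c.E U (F z))) =
      fun z => ((LinFn.bodyC n _ (c.E U (F z))).comp (fwd h)).comp (c.bwd U) := by
    funext z
    rw [ContinuousMap.comp_assoc, fwd_bwd, ContinuousMap.comp_id]
  rw [e2]
  exact h2

/-- On the domain of a chart, convergence of all iterated derivatives along vector fields is
convergence in the chart. -/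
theorem continuous_iff (h : U ≤ c.dom) {Z : Type*} [TopologicalSpace Z] {F : Z → M.O U} :
    (∀ L : List (M.Vect U), Continuous fun z => vals (L.foldr M.applyVect (F z))) ↔
      Continuous fun z => c.E U (F z) := by
  constructor
  · intro H
    rw [LinFn.continuous_rng]
    intro L
    have h1 := (continuous_vals_iff h).1 (H (L.map (D h)))
    have e : ∀ f : M.O U, c.E U ((L.map (D h)).foldr M.applyVect f) = LinFn.ds L (c.E U f) := by
      intro f
      induction L with
      | nil => rfl
      | cons a L ih =>
        rw [List.map_cons, List.foldr_cons, E_applyVect_D, ih ?_, LinFn.ds_cons]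
        exact (continuous_vals_iff h).1 (H (L.map (D h)))
    simpa only [e] using h1
  -- Every vector field is Σ T(z_a)∂_a with coefficients that do not depend on the parameter, and
  -- products and ∂_a are continuous in the chart.
  · intro H L
    rw [continuous_vals_iff h]
    refine LinFn.continuous_bodyC.comp ?_
    induction L with
    | nil => exact H
    | cons T L ih =>
      have e : (fun z => c.E U ((T :: L).foldr M.applyVect (F z))) = fun y => ∑ a,
          c.E U (M.applyVect T (z h a)) * LinFn.d a (c.E U (L.foldr M.applyVect (F y))) :=
        funext fun y => E_applyVect h T _
      rw [e]
      exact continuous_finsetSum _ fun a _ => continuous_const.mul ((LinFn.continuous_d a).comp ih)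

theorem img_le_img_pre (c : M.Chart) (U : Opens X) :
    c.img U ≤ c.img (chartPreimage c.φ (c.img U)) := by
  intro x hx
  refine ⟨hx.1, ?_⟩
  change c.φ.symm x ∈ chartPreimage c.φ (c.img U)
  refine ⟨c.φ.map_target hx.1, ?_⟩
  change c.φ (c.φ.symm x) ∈ c.img U
  rwa [c.φ.right_inv hx.1]

theorem E_eq_res (c : M.Chart) (f : M.O U) :
    c.E U f = LinFn.res n (c.img_le_img_pre U) (c.E _ (M.res (c.pre_img_le U) f)) := by
  rw [E_res, LinFn.res_res, LinFn.res_self]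

-- `U` may stick out of the chart; this reduces to its part inside the domain, where
-- `continuous_iff` is available.
variable (c) in
theorem continuous_E_of_res {Z : Type*} [TopologicalSpace Z] {F : Z → M.O U}
    (H : Continuous fun z => c.E _ (M.res (c.pre_img_le U) (F z))) :
    Continuous fun z => c.E U (F z) := by
  simp_rw [fun z => c.E_eq_res (F z)]
  exact (LinFn.continuous_res (c.img_le_img_pre U)).comp H

theorem exists_core {p : X} (hp : p ∈ c.dom) : ∃ (B : Opens (Euc m)) (K : Set (c.img c.dom)),
    IsCompact K ∧ c.φ p ∈ B ∧ ∀ x ∈ B, ∃ y ∈ K, (y : Euc m) = x := by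
  obtain ⟨K, hK, hx⟩ := exists_compact_mem_nhds (⟨c.φ p, apply_mem_img le_rfl hp⟩ : c.img c.dom)
  refine ⟨⟨Subtype.val '' interior K, (c.img c.dom).2.isOpenMap_subtype_val _ isOpen_interior⟩, K,
    hK, ⟨_, mem_interior_iff_mem_nhds.2 hx, rfl⟩, ?_⟩
  rintro _ ⟨y, hy, rfl⟩
  exact ⟨y, interior_subset hy, rfl⟩

end Chart

/-! ### A finite atlas with relatively compact cores -/

variable (M)

/-- A chart around a point. -/
def chartAt (p : X) : M.Chart := (M.exists_chart p).choose

theorem mem_chartAt (p : X) : p ∈ (M.chartAt p).dom := (M.exists_chart p).choose_spec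

/-- A relatively compact neighbourhood of a point in the image of a chart. -/
def coreImg (p : X) : Opens (Euc m) := (Chart.exists_core (M.mem_chartAt p)).choose

/-- A neighbourhood of a point in the domain of a chart. -/
def core (p : X) : Opens X := chartPreimage (M.chartAt p).φ (M.coreImg p)

theorem core_le (p : X) : M.core p ≤ (M.chartAt p).dom := fun _ hx => hx.1

theorem exists_compact_core (p : X) : ∃ K : Set ((M.chartAt p).img (M.chartAt p).dom),
    IsCompact K ∧ ∀ x ∈ M.coreImg p, ∃ y ∈ K, (y : Euc m) = x := by
  obtain ⟨K, h1, _, h2⟩ := (Chart.exists_core (M.mem_chartAt p)).choose_spec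
  exact ⟨K, h1, h2⟩

theorem mem_core (p : X) : p ∈ M.core p := by
  obtain ⟨K, _, h, _⟩ := (Chart.exists_core (M.mem_chartAt p)).choose_spec
  exact ⟨M.mem_chartAt p, h⟩

theorem exists_atlas [CompactSpace X] : ∃ s : Finset X, ∀ q, ∃ p ∈ s, q ∈ M.core p := by
  obtain ⟨s, _, hs⟩ := isCompact_univ.elim_nhds_subcover (fun p => (M.core p : Set X))
    fun p _ => (M.core p).2.mem_nhds (M.mem_core p)
  refine ⟨s, fun q => ?_⟩
  have := hs (mem_univ q)
  rw [mem_iUnion₂] at this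
  obtain ⟨p, hp, hq⟩ := this
  exact ⟨p, hp, hq⟩

variable [CompactSpace X]

/-- A finite atlas of a compact supermanifold. -/
def atlas : Finset X := M.exists_atlas.choose

theorem le_iSup_core (U : Opens X) : U ≤ ⨆ i : M.atlas, U ⊓ M.core i := by
  intro q hq
  obtain ⟨p, hp, hpq⟩ := M.exists_atlas.choose_spec q
  exact Opens.mem_iSup.2 ⟨⟨p, hp⟩, hq, hpq⟩

/-- The charts of the atlas. -/
def ch (i : M.atlas) : M.Chart := M.chartAt i

theorem le_iSup_pre (U : Opens X) :
    U ≤ ⨆ i : M.atlas, chartPreimage (M.ch i).φ ((M.ch i).img U) := by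
  refine (M.le_iSup_core U).trans (iSup_mono fun i => ?_)
  refine (Chart.le_pre_img (c := M.ch i) (inf_le_right.trans (M.core_le i))).trans ?_
  exact chartPreimage_mono _ (Chart.img_mono inf_le_left)

variable {M}

omit [CompactSpace X] in
theorem ext_of_cover {ι : Type u} {V : ι → Opens X} (hV : ∀ i, V i ≤ W) (hc : W ≤ ⨆ i, V i)
    {t t' : M.O W} (h : ∀ i, M.res (hV i) t = M.res (hV i) t') : t = t' := by
  obtain rfl : W = ⨆ i, V i := le_antisymm hc (iSup_le hV)
  refine (M.glue V (fun i => M.res (hV i) t) ?_).unique (fun _ => rfl) fun i => (h i).symm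
  intro i j
  rw [M.res_res, M.res_res]

omit [CompactSpace X] in
theorem exists_glue {ι : Type u} {V : ι → Opens X} (hV : ∀ i, V i ≤ W) (hc : W ≤ ⨆ i, V i)
    (s : ∀ i, M.O (V i)) (hs : ∀ i j, M.res (inf_le_left : V i ⊓ V j ≤ V i) (s i) =
      M.res inf_le_right (s j)) : ∃ t : M.O W, ∀ i, M.res (hV i) t = s i := by
  obtain rfl : W = ⨆ i, V i := le_antisymm hc (iSup_le hV)
  obtain ⟨t, ht, -⟩ := M.glue V s hs
  exact ⟨t, ht⟩

variable (M) in
/-- The expressions of a superfunction in the charts of the atlas. -/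
def rho (U : Opens X) : M.O U →ₐ[ℝ] (∀ i : M.atlas, LinFn n ((M.ch i).img U)) :=
  AlgHom.pi fun i => (M.ch i).E U

/-- The topology of uniform convergence of all derivatives of all components on compact sets. -/
instance (U : Opens X) : TopologicalSpace (M.O U) :=
  TopologicalSpace.induced (M.rho U) inferInstance

theorem isInducing_rho (U : Opens X) : IsInducing (M.rho U) := ⟨rfl⟩

/-- The chart domains cover, and sections of a sheaf are determined locally. -/
theorem rho_injective (U : Opens X) : Function.Injective (M.rho U) := by
  intro f g e
  refine ext_of_cover (fun i => (M.ch i).pre_img_le U) (M.le_iSup_pre U) fun i => ?_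
  exact ((M.ch i).e _ ((M.ch i).img_subset U)).injective (congrFun e i)

theorem continuous_rng {Z : Type*} [TopologicalSpace Z] {F : Z → M.O U} :
    Continuous F ↔ ∀ i : M.atlas, Continuous fun z => (M.ch i).E U (F z) := by
  rw [(isInducing_rho U).continuous_iff, continuous_pi_iff]
  rfl

theorem continuous_E (i : M.atlas) : Continuous ((M.ch i).E U) :=
  continuous_rng.1 continuous_id i

instance : IsTopologicalAddGroup (M.O U) := topologicalAddGroup_induced (M.rho U)

instance : ContinuousSMul ℝ (M.O U) := continuousSMul_induced (M.rho U).toLinearMap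

instance : ContinuousMul (M.O U) :=
  ⟨continuous_rng.2 fun i => by
    simp only [map_mul]
    exact ((continuous_E i).comp continuous_fst).mul ((continuous_E i).comp continuous_snd)⟩

theorem frechet_pi (U : Opens X) : IsFrechetSpace (∀ i : M.atlas, LinFn n ((M.ch i).img U)) :=
  IsFrechetSpace.pi fun _ => LinFn.frechet

instance : MetrizableSpace (M.O U) :=
  have := (frechet_pi (M := M) U).metrizable
  (IsEmbedding.mk (isInducing_rho U) (rho_injective U)).metrizableSpace

instance : LocallyConvexSpace ℝ (M.O U) :=
  have := (frechet_pi (M := M) U).convex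
  .induced (M.rho U).toLinearMap

theorem continuous_res (h : W ≤ U) : Continuous (M.res h) :=
  continuous_rng.2 fun i => by
    simp only [Chart.E_res]
    exact (LinFn.continuous_res _).comp (continuous_E i)

theorem continuous_tw (i : ZMod 2) : Continuous (M.tw i : M.O U → M.O U) :=
  continuous_rng.2 fun j => by
    simp only [Chart.E_tw]
    exact (LinFn.continuous_tw i).comp (continuous_E j)

theorem continuous_parityProj (i : ZMod 2) : Continuous (parityProj (M.part U) i) := by
  have : (parityProj (M.part U) i : M.O U → M.O U) =
    fun f => (1 / 2 : ℝ) • (f + sgn 1 i • M.tw 1 f) := funext fun f => parityProj_eq_tw i f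
  rw [this]
  exact (continuous_id.add ((continuous_tw 1).const_smul _)).const_smul _

/-- Convergence of all derivatives along vector fields does not mention charts, so it carries
convergence from chart i to the overlap with any chart j. -/
theorem continuous_of_E (i : M.atlas) (h : U ≤ (M.ch i).dom) {Z : Type*} [TopologicalSpace Z]
    {F : Z → M.O U} (H : Continuous fun z => (M.ch i).E U (F z)) : Continuous F := by
  refine continuous_rng.2 fun j => (M.ch j).continuous_E_of_res ?_
  rw [← Chart.continuous_iff ((M.ch j).pre_img_le_dom U),
    Chart.continuous_iff (((M.ch j).pre_img_le U).trans h)]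
  simp only [Chart.E_res]
  exact (LinFn.continuous_res _).comp H

omit [CompactSpace X] in
theorem res_foldr (h : W ≤ U) (L : List (M.Vect U)) (f : M.O U) :
    M.res h (L.foldr M.applyVect f) = (L.map (M.vectRes h)).foldr M.applyVect (M.res h f) := by
  induction L with
  | nil => rfl
  | cons T L ih => rw [List.foldr_cons, List.map_cons, List.foldr_cons, ← ih, applyVect_vectRes]

/-- On a compact set uniform and locally uniform convergence agree, and the latter is checked on
small compact sets inside single charts. -/
theorem continuous_vals [T2Space X] {Z : Type*} [TopologicalSpace Z] {F : Z → M.O U}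
    (hF : Continuous F) (L : List (M.Vect U)) :
    Continuous fun z => vals (L.foldr M.applyVect (F z)) := by
  rw [continuous_iff_continuousAt]
  intro z₀
  refine UniformOnFun.tendsto_iff_tendstoUniformlyOn.2 fun K hK => ?_
  rw [← tendstoLocallyUniformlyOn_iff_tendstoUniformlyOn_of_compact hK]
  intro u hu p _
  obtain ⟨i, hi⟩ := Opens.mem_iSup.1 (M.le_iSup_core U p.2)
  have hWU : U ⊓ M.core i ≤ U := inf_le_left
  set W := U ⊓ M.core i
  have hW : W ≤ (M.ch i).dom := inf_le_right.trans (M.core_le i)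
  have hLC : LocallyCompactSpace W := W.2.locallyCompactSpace
  have h1 : Continuous fun z => vals (M.res hWU (L.foldr M.applyVect (F z))) := by
    simp only [res_foldr]
    exact (Chart.continuous_iff hW).2 ((continuous_E i).comp ((continuous_res hWU).comp hF)) _
  obtain ⟨C, hC, hpC⟩ := exists_compact_mem_nhds (⟨p, hi⟩ : W)
  have h2 := UniformOnFun.tendsto_iff_tendstoUniformlyOn.1 (h1.tendsto z₀) C hC u hu
  have hemb : IsOpenEmbedding (Opens.inclusion hWU) := Opens.isOpenEmbedding_of_le hWU
  refine ⟨Opens.inclusion hWU '' C, mem_nhdsWithin_of_mem_nhds (hemb.image_mem_nhds.2 hpC), ?_⟩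
  filter_upwards [h2] with z hz
  rintro _ ⟨y, hy, rfl⟩
  have h3 : (M.value (M.res hWU (L.foldr M.applyVect (F z₀))) y,
    M.value (M.res hWU (L.foldr M.applyVect (F z))) y) ∈ u := hz y hy
  rw [value_res hWU _ y.2, value_res hWU _ y.2] at h3
  exact h3

end Supermanifold

/-! ### The sections of the endomorphism bundle as a topological algebra -/

theorem sum_zmod_two {G : Type*} [AddCommMonoid G] (g : ZMod 2 → G) : ∑ j, g j = g 0 + g 1 :=
  Fin.sum_univ_two (M := G) g

namespace Supermanifold

variable {m n : ℕ} {X : Type u} [TopologicalSpace X] {M : Supermanifold m n X} {U W : Opens X}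

/-- The superfunction `A(D)f`. -/
def act (A : M.EndT) (T : M.Vect U) (f : M.O U) : M.O U := M.applyVect (EndT.val M A U T) f

theorem act_add (A B : M.EndT) (T : M.Vect U) (f : M.O U) :
    act (A + B) T f = act A T f + act B T f := rfl

theorem act_mul (A B : M.EndT) (T : M.Vect U) (f : M.O U) :
    act (A * B) T f = act A (EndT.val M B U T) f := rfl

theorem act_vect_add (A : M.EndT) (T T' : M.Vect U) (f : M.O U) :
    act A (T + T') f = act A T f + act A T' f := by
  rw [act, map_add]
  rfl

theorem act_vect_smul (A : M.EndT) (r : ℝ) (T : M.Vect U) (f : M.O U) :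
    act A (r • T) f = r • act A T f := by
  rw [act, map_smul]
  rfl

theorem act_fn_add (A : M.EndT) (T : M.Vect U) (f g : M.O U) :
    act A T (f + g) = act A T f + act A T g := map_add _ _ _

theorem act_fn_smul (A : M.EndT) (r : ℝ) (T : M.Vect U) (f : M.O U) :
    act A T (r • f) = r • act A T f := map_smul _ _ _

theorem parityProj_add_EndT (A : M.EndT) :
    parityProj (EndT.part M) 0 A + parityProj (EndT.part M) 1 A = A := parityProj_add _ A

theorem vectRes_val (A : M.EndT) (h : W ≤ U) (T : M.Vect U) :
    M.vectRes h (EndT.val M A U T) = EndT.val M A W (M.vectRes h T) := by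
  have e : ∀ (V : Opens X) (T : M.Vect V), EndT.val M A V T =
      EndT.val M (parityProj (EndT.part M) 0 A) V T +
        EndT.val M (parityProj (EndT.part M) 1 A) V T := by
    intro V T
    conv_lhs => rw [← parityProj_add_EndT A]
    rfl
  have h0 : parityProj (EndT.part M) 0 A ∈ EndT.part M 0 := parityProj_mem _ 0 A
  have h1 : parityProj (EndT.part M) 1 A ∈ EndT.part M 1 := parityProj_mem _ 1 A
  rw [e, e, map_add]
  exact congrArg₂ (· + ·) (h0.1 U W h T) (h1.1 U W h T)

theorem res_act (h : W ≤ U) (A : M.EndT) (T : M.Vect U) (f : M.O U) :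
    M.res h (act A T f) = act A (M.vectRes h T) (M.res h f) := by
  rw [act, act, ← vectRes_val, applyVect_vectRes]

theorem vect_ext {T T' : M.Vect U} (h : ∀ (W : Opens X) (hW : W ≤ U) (f : M.O W),
    M.applyVect (M.vectRes hW T) f = M.applyVect (M.vectRes hW T') f) : T = T' :=
  Subtype.ext (funext fun W => LinearMap.ext fun f => h W.1 W.2 f)

theorem EndT.ext_act {A B : M.EndT} (h : ∀ (U : Opens X) (T : M.Vect U) (f : M.O U),
    act A T f = act B T f) : A = B := by
  refine EndT.ext M (funext fun U => LinearMap.ext fun T => vect_ext fun W hW f => ?_)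
  rw [vectRes_val, vectRes_val]
  exact h W _ f

theorem val_mulVect {j : ZMod 2} {A : M.EndT} (hA : A ∈ EndT.part M j) (g : M.O U) (T : M.Vect U) :
    EndT.val M A U (M.mulVect g T) = M.mulVect (M.tw j g) (EndT.val M A U T) := by
  have hadd : ∀ (g g' : M.O U) (T : M.Vect U),
      M.mulVect (g + g') T = M.mulVect g T + M.mulVect g' T := fun g g' T =>
    Subtype.ext (funext fun W => LinearMap.ext fun f => by
      change M.res W.2 (g + g') * _ = M.res W.2 g * _ + M.res W.2 g' * _
      rw [map_add, add_mul])
  have hsmul : ∀ (r : ℝ) (g : M.O U) (T : M.Vect U),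
      M.mulVect (r • g) T = r • M.mulVect g T := fun r g T =>
    Subtype.ext (funext fun W => LinearMap.ext fun f => by
      change M.res W.2 (r • g) * _ = r • (M.res W.2 g * _)
      rw [map_smul, smul_mul_assoc])
  induction g using part_induction with
  | hadd g g' hg hg' => rw [hadd, map_add, hg, hg', map_add, hadd]
  | hp k g hg =>
    rw [tw_of_mem j hg, hsmul]
    exact hA.2.2 U k g T hg

/-- T is expanded in coordinate fields; pulling the coefficients out of A costs the twist by the
parity of A. -/
theorem act_eq_sum {j : ZMod 2} {A : M.EndT} (hA : A ∈ EndT.part M j) {c : M.Chart}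
    (h : U ≤ c.dom) (T : M.Vect U) (f : M.O U) :
    act A T f = ∑ a, M.tw j (M.applyVect T (Chart.z h a)) * act A (Chart.D h a) f := by
  conv_lhs => rw [act, Chart.eq_sum_D h T, map_sum, Chart.applyVect_sum]
  refine Finset.sum_congr rfl fun a _ => ?_
  rw [val_mulVect hA, Chart.applyVect_mulVect]
  rfl

theorem act_D_mem {j : ZMod 2} {A : M.EndT} (hA : A ∈ EndT.part M j) {c : M.Chart}
    (h : U ≤ c.dom) (a b : Fin m ⊕ Fin n) :
    act A (Chart.D h a) (Chart.z h b) ∈ M.part U (j + LinFn.par a + LinFn.par b) :=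
  (hA.2.1 U (LinFn.par a) (Chart.D h a) (Chart.preD_mem h a)).2.1 ⟨U, le_refl U⟩ _ _
    (Chart.z_mem h b)

theorem act_D_eq_sum (A : M.EndT) {c : M.Chart} (h : U ≤ c.dom) (a : Fin m ⊕ Fin n) (f : M.O U) :
    act A (Chart.D h a) f =
      ∑ b, act A (Chart.D h a) (Chart.z h b) * M.applyVect (Chart.D h b) f := by
  conv_lhs => rw [act, Chart.eq_sum_D h (EndT.val M A U (Chart.D h a)), Chart.applyVect_sum]
  refine Finset.sum_congr rfl fun b _ => ?_
  rw [Chart.applyVect_mulVect]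
  rfl

/-- The components of the homogeneous parts of a section of the endomorphism bundle. -/
theorem act_parityProj (j : ZMod 2) (A : M.EndT) {c : M.Chart} (h : U ≤ c.dom)
    (a b : Fin m ⊕ Fin n) :
    act (parityProj (EndT.part M) j A) (Chart.D h a) (Chart.z h b) =
      parityProj (M.part U) (j + LinFn.par a + LinFn.par b) (act A (Chart.D h a) (Chart.z h b)) := by
  conv_rhs => rw [← parityProj_add_EndT A, act_add, map_add]
  have h0 := act_D_mem (parityProj_mem (EndT.part M) 0 A) h a b
  have h1 := act_D_mem (parityProj_mem (EndT.part M) 1 A) h a b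
  rcases zmod_two_cases j with rfl | rfl
  · rw [parityProj_of_mem _ h0, parityProj_of_mem_ne _ _ h1, add_zero]
    simp
  · rw [parityProj_of_mem _ h1, parityProj_of_mem_ne _ _ h0, zero_add]
    simp

variable [CompactSpace X]

theorem continuous_ofE (i : M.atlas) (h : U ≤ (M.ch i).dom) :
    Continuous (Chart.ofE (c := M.ch i) h) :=
  continuous_of_E i h (by
    simp only [Chart.E_ofE]
    exact continuous_id)

/-- Limits exist in each chart, agree on overlaps by uniqueness of limits, and glue. -/
theorem addComplete (U : Opens X) : AddComplete (M.O U) := by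
  intro F hF
  have := hF.1
  have hle := fun i : M.atlas => (M.ch i).pre_img_le U
  have hdom := fun i : M.atlas => (M.ch i).pre_img_le_dom U
  have hlim : ∀ i : M.atlas, ∃ s, Tendsto (M.res (hle i)) F (𝓝 s) := by
    intro i
    obtain ⟨g, hg⟩ := LinFn.addComplete _ (hF.map
      (((M.ch i).E _).toLinearMap ∘ₗ (M.res (hle i)).toLinearMap).toAddMonoidHom
      ((continuous_E i).comp (continuous_res (hle i))))
    refine ⟨Chart.ofE (hdom i) g, ?_⟩
    have h1 := ((continuous_ofE i (hdom i)).tendsto g).comp hg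
    refine h1.congr fun f => ?_
    exact Chart.ofE_E (hdom i) _
  choose s hs using hlim
  obtain ⟨t, ht⟩ := exists_glue hle (M.le_iSup_pre U) s fun i j => by
    have h1 := ((continuous_res (inf_le_left : chartPreimage (M.ch i).φ ((M.ch i).img U) ⊓
      chartPreimage (M.ch j).φ ((M.ch j).img U) ≤ _)).tendsto _).comp (hs i)
    have h2 := ((continuous_res (inf_le_right : chartPreimage (M.ch i).φ ((M.ch i).img U) ⊓
      chartPreimage (M.ch j).φ ((M.ch j).img U) ≤ _)).tendsto _).comp (hs j)
    refine tendsto_nhds_unique h1 (h2.congr fun f => ?_)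
    rw [Function.comp_apply, Function.comp_apply, M.res_res, M.res_res]
  refine ⟨t, ?_⟩
  suffices h : Tendsto id F (𝓝 t) from h
  rw [(isInducing_rho U).tendsto_nhds_iff, tendsto_pi_nhds]
  intro i
  have h1 := (((LinFn.continuous_res ((M.ch i).img_le_img_pre U)).comp
    (continuous_E i)).tendsto _).comp (hs i)
  rw [← ht i] at h1
  change Tendsto (fun f => (M.ch i).E U f) F (𝓝 ((M.ch i).E U t))
  rw [Chart.E_eq_res (M.ch i) t]
  exact h1.congr fun f => (Chart.E_eq_res (M.ch i) f).symm

variable [T2Space X]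

-- On the part of `U` in a chart domain, the defining topology of E provides exactly the iterated
-- derivatives along vector fields that `Chart.continuous_iff` asks for.
omit [T2Space X] in
theorem continuous_act (T : M.Vect U) (f : M.O U) : Continuous fun A : M.EndT => act A T f := by
  refine continuous_rng.2 fun i => (M.ch i).continuous_E_of_res ?_
  simp only [res_act]
  rw [← Chart.continuous_iff ((M.ch i).pre_img_le_dom U)]
  intro L
  exact continuous_iInf_dom (i := _) (continuous_iInf_dom (i := _) (continuous_iInf_dom (i := _)
    (continuous_iInf_dom (i := L) continuous_induced_dom)))

theorem continuous_EndT_rng {Z : Type*} [TopologicalSpace Z] {F : Z → M.EndT}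
    (H : ∀ (U : Opens X) (T : M.Vect U) (f : M.O U), Continuous fun z => act (F z) T f) :
    Continuous F := by
  refine continuous_iInf_rng.2 fun U => continuous_iInf_rng.2 fun T => continuous_iInf_rng.2 fun f =>
    continuous_iInf_rng.2 fun L => continuous_induced_rng.2 ?_
  exact continuous_vals (H U T f) L

variable (M) in
/-- The components of a section of the endomorphism bundle in the charts of the atlas. -/
def kappa : M.EndT →ₗ[ℝ] (∀ q : M.atlas × (Fin m ⊕ Fin n) × (Fin m ⊕ Fin n), M.O (M.ch q.1).dom) where
  toFun A q := act A (Chart.D le_rfl q.2.1) (Chart.z le_rfl q.2.2)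
  map_add' _ _ := rfl
  map_smul' _ _ := rfl

-- Over a chart, A is recovered from its components by operations that are continuous in them:
-- parity projections, restrictions and products with fixed superfunctions.
omit [T2Space X] in
theorem act_eq_sum_kappa {i : M.atlas} (h : U ≤ (M.ch i).dom) (A : M.EndT) (T : M.Vect U) (f : M.O U) :
    act A T f = ∑ j, ∑ a, M.tw j (M.applyVect T (Chart.z h a)) * ∑ b,
      M.res h (parityProj (M.part _) (j + LinFn.par a + LinFn.par b) (M.kappa A (i, a, b))) *
        M.applyVect (Chart.D h b) f := by
  have hj : ∀ j, act (parityProj (EndT.part M) j A) T f =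
      ∑ a, M.tw j (M.applyVect T (Chart.z h a)) * ∑ b,
      M.res h (parityProj (M.part _) (j + LinFn.par a + LinFn.par b) (M.kappa A (i, a, b))) *
        M.applyVect (Chart.D h b) f := by
    intro j
    rw [act_eq_sum (parityProj_mem _ j A) h]
    refine Finset.sum_congr rfl fun a _ => ?_
    rw [act_D_eq_sum]
    congr 1
    refine Finset.sum_congr rfl fun b _ => ?_
    rw [act_parityProj, res_parityProj]
    congr 2
    refine Eq.trans ?_ (res_act h A _ _).symm
    rw [Chart.vectRes_D, Chart.res_z]
  conv_lhs => rw [← parityProj_add_EndT A, act_add, hj, hj]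
  rw [sum_zmod_two]

/-- Replaces a topology given by all open sets and all vector fields by finitely many matrix
entries. The components are continuous, and conversely they determine every A(T)f continuously. -/
theorem isInducing_kappa : IsInducing (M.kappa) := by
  have hc : Continuous M.kappa := continuous_pi fun q => continuous_act _ _
  refine ⟨le_antisymm hc.le_induced ?_⟩
  refine continuous_id_iff_le.1 (@continuous_EndT_rng m n X _ M _ _ _
    (TopologicalSpace.induced M.kappa inferInstance) _ fun U T f => ?_)
  refine (@continuous_rng m n X _ M U _ _ (TopologicalSpace.induced M.kappa inferInstance) _).2
    fun i => ?_
  refine @Chart.continuous_E_of_res m n X _ M U (M.ch i) _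
    (TopologicalSpace.induced M.kappa inferInstance) _ ?_
  let _ : TopologicalSpace M.EndT := TopologicalSpace.induced M.kappa inferInstance
  have hk : ∀ q, Continuous fun A : M.EndT => M.kappa A q := fun q =>
    (continuous_apply q).comp continuous_induced_dom
  simp only [id, res_act, act_eq_sum_kappa ((M.ch i).pre_img_le_dom U)]
  refine (continuous_E i).comp ?_
  refine continuous_finsetSum _ fun j _ => continuous_finsetSum _ fun a _ => continuous_const.mul
    (continuous_finsetSum _ fun b _ => Continuous.mul ?_ continuous_const)
  exact (continuous_res _).comp ((continuous_parityProj _).comp (hk _))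

/-- Sections with equal components are topologically inseparable, whereas their values A(T)f lie in
Hausdorff spaces. -/
theorem kappa_injective : Function.Injective (M.kappa) := by
  intro A B e
  have h1 : Inseparable A B := isInducing_kappa.inseparable_iff.1 (e ▸ Inseparable.refl _)
  exact EndT.ext_act fun U T f => (h1.map (continuous_act T f)).eq

theorem continuous_kappa_iff {Z : Type*} [TopologicalSpace Z] {F : Z → M.EndT} :
    Continuous F ↔ ∀ q, Continuous fun z => M.kappa (F z) q := by
  rw [isInducing_kappa.continuous_iff, continuous_pi_iff]
  rfl

theorem continuous_kappa (q) : Continuous fun A : M.EndT => M.kappa A q :=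
  continuous_kappa_iff.1 continuous_id q

instance : IsTopologicalAddGroup M.EndT := isInducing_kappa.topologicalAddGroup M.kappa

instance : ContinuousSMul ℝ M.EndT := isInducing_kappa.continuousSMul continuous_id (map_smul _ _ _)

instance : LocallyConvexSpace ℝ M.EndT := by
  have := LocallyConvexSpace.induced M.kappa
  rw [← isInducing_kappa.eq_induced] at this
  exact this

instance : MetrizableSpace M.EndT :=
  have : MetrizableSpace (∀ q : M.atlas × (Fin m ⊕ Fin n) × (Fin m ⊕ Fin n), M.O (M.ch q.1).dom) :=
    inferInstance
  (IsEmbedding.mk isInducing_kappa kappa_injective).metrizableSpace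

theorem continuous_parityProj_EndT (j : ZMod 2) : Continuous (parityProj (EndT.part M) j) :=
  continuous_kappa_iff.2 fun q => by
    have : (fun A : M.EndT => M.kappa (parityProj (EndT.part M) j A) q) =
        fun A => parityProj _ (j + LinFn.par q.2.1 + LinFn.par q.2.2) (M.kappa A q) :=
      funext fun A => act_parityProj j A le_rfl q.2.1 q.2.2
    rw [this]
    exact (continuous_parityProj _).comp (continuous_kappa q)

/-- In components the product is a matrix product with parity twists. -/
instance : ContinuousMul M.EndT := by
  refine ⟨continuous_kappa_iff.2 fun q => ?_⟩
  obtain ⟨i, a, b⟩ := q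
  have e : ∀ p : M.EndT × M.EndT, M.kappa (p.1 * p.2) (i, a, b) =
      ∑ j, ∑ c, M.tw j (M.kappa p.2 (i, a, c)) *
        M.kappa (parityProj (EndT.part M) j p.1) (i, c, b) := by
    intro p
    have hj : ∀ j, act (parityProj (EndT.part M) j p.1)
        (EndT.val M p.2 (M.ch i).dom (Chart.D le_rfl a)) (Chart.z le_rfl b) =
        ∑ c, M.tw j (M.kappa p.2 (i, a, c)) *
          M.kappa (parityProj (EndT.part M) j p.1) (i, c, b) := fun j =>
      act_eq_sum (parityProj_mem _ j p.1) le_rfl _ _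
    refine (act_mul p.1 p.2 _ _).trans ?_
    conv_lhs => rw [← parityProj_add_EndT p.1, act_add]
    refine (congrArg₂ (· + ·) (hj 0) (hj 1)).trans ?_
    rw [sum_zmod_two]
  simp only [e]
  refine continuous_finsetSum _ fun j _ => continuous_finsetSum _ fun c _ => Continuous.mul ?_ ?_
  · exact (continuous_tw j).comp ((continuous_kappa _).comp continuous_snd)
  · exact (continuous_kappa _).comp ((continuous_parityProj_EndT j).comp continuous_fst)

end Supermanifold

/-! ### Completeness of the space of sections -/

namespace Supermanifold

variable {m n : ℕ} {X : Type u} [TopologicalSpace X] {M : Supermanifold m n X} {U W : Opens X}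

theorem exists_vectPart_add (T : M.Vect U) : ∃ T₀ T₁ : M.Vect U, T₀.1 ∈ M.vectPart U 0 ∧
    T₁.1 ∈ M.vectPart U 1 ∧ T = T₀ + T₁ := by
  have hle : M.Vect U ≤ M.vectPart U 0 ⊔ M.vectPart U 1 := by
    refine iSup_le fun j => ?_
    rcases zmod_two_cases j with rfl | rfl
    · exact le_sup_left
    · exact le_sup_right
  obtain ⟨a, ha, b, hb, e⟩ := Submodule.mem_sup.1 (hle T.2)
  exact ⟨⟨a, Submodule.mem_iSup_of_mem 0 ha⟩, ⟨b, Submodule.mem_iSup_of_mem 1 hb⟩, ha, hb,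
    Subtype.ext e.symm⟩

theorem vectRes_mulVect (h : W ≤ U) (f : M.O U) (T : M.Vect U) :
    M.vectRes h (M.mulVect f T) = M.mulVect (M.res h f) (M.vectRes h T) :=
  Subtype.ext (funext fun V => LinearMap.ext fun g =>
    congrArg (· * T.1 ⟨V.1, le_trans V.2 h⟩ g) (M.res_res h V.2 f).symm)

/-- The section of the endomorphism bundle defined by a homogeneous family of maps. -/
def EndT.ofPart {j : ZMod 2} {A : M.PreEnd} (hA : A ∈ M.endPart j) : M.EndT :=
  ⟨A, Submodule.mem_iSup_of_mem j hA⟩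

variable [CompactSpace X]

theorem mem_part_of_tendsto {α : Type*} {F : Filter α} [F.NeBot] {j : ZMod 2} {g : α → M.O U}
    {x : M.O U} (hx : Tendsto g F (𝓝 x)) (hg : ∀ᶠ a in F, g a ∈ M.part U j) : x ∈ M.part U j := by
  have h1 := ((continuous_parityProj j).tendsto x).comp hx
  have h2 : parityProj (M.part U) j x = x :=
    tendsto_nhds_unique_of_eventuallyEq h1 hx (hg.mono fun a ha => parityProj_of_mem _ ha)
  rw [← h2]
  exact parityProj_mem _ _ _

/-- All limits of A(T)f exist because the spaces of superfunctions are complete, and the identities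
that define a section of parity j are preserved by limits. A fixed parity is assumed since the signs
in these identities depend on it. -/
theorem exists_limit_of_homogeneous [T2Space X] {j : ZMod 2} {G : Filter M.EndT} (hG : AddCauchy G)
    (hj : ∀ᶠ A in G, A ∈ EndT.part M j) : ∃ B, G ≤ 𝓝 B := by
  have := hG.1
  have hlim : ∀ (U : Opens X) (T : M.Vect U) (f : M.O U), ∃ x,
      Tendsto (fun A => act A T f) G (𝓝 x) := fun U T f =>
    addComplete U _ (hG.map (⟨⟨fun A => act A T f, rfl⟩, fun _ _ => rfl⟩ : M.EndT →+ M.O U)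
      (continuous_act T f))
  choose l hl using hlim
  have hadd : ∀ U T f g, l U T (f + g) = l U T f + l U T g := fun U T f g =>
    tendsto_nhds_unique (hl U T _) (((hl U T f).add (hl U T g)).congr fun A =>
      (act_fn_add A T f g).symm)
  have hsmul : ∀ U T (r : ℝ) f, l U T (r • f) = r • l U T f := fun U T r f =>
    tendsto_nhds_unique (hl U T _) (((hl U T f).const_smul r).congr fun A =>
      (act_fn_smul A r T f).symm)
  have hadd' : ∀ U T T' f, l U (T + T') f = l U T f + l U T' f := fun U T T' f =>
    tendsto_nhds_unique (hl U _ f) (((hl U T f).add (hl U T' f)).congr fun A =>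
      (act_vect_add A T T' f).symm)
  have hsmul' : ∀ U (r : ℝ) T f, l U (r • T) f = r • l U T f := fun U r T f =>
    tendsto_nhds_unique (hl U _ f) (((hl U T f).const_smul r).congr fun A =>
      (act_vect_smul A r T f).symm)
  let S : ∀ U : Opens X, M.Vect U → M.PreVect U := fun U T W =>
    { toFun := l W.1 (M.vectRes W.2 T)
      map_add' := hadd _ _
      map_smul' := hsmul _ _ }
  have hS : ∀ (U : Opens X) (T : M.Vect U) (i : ZMod 2), T.1 ∈ M.vectPart U i →
      S U T ∈ M.vectPart U (j + i) := by
    intro U T i hT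
    have hAT : ∀ W : Set.Iic U, ∀ A ∈ EndT.part M j,
        (EndT.val M A W.1 (M.vectRes W.2 T)).1 ∈ M.vectPart W.1 (j + i) := fun W A hA =>
      hA.2.1 W.1 i (M.vectRes W.2 T) (M.preVectRes_part W.2 i _ hT)
    refine ⟨fun W W' h f => ?_, fun W k f hf => ?_, fun W k f g hf => ?_⟩
    · refine tendsto_nhds_unique (((continuous_res h).tendsto _).comp (hl W.1 (M.vectRes W.2 T) f))
        ((hl W'.1 (M.vectRes W'.2 T) (M.res h f)).congr fun A => ?_)
      exact (res_act h A (M.vectRes W.2 T) f).symm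
    · exact mem_part_of_tendsto (hl W.1 (M.vectRes W.2 T) f) (hj.mono fun A hA =>
        (hAT W A hA).2.1 ⟨W.1, le_refl W.1⟩ k f hf)
    · refine tendsto_nhds_unique_of_eventuallyEq (hl W.1 (M.vectRes W.2 T) (f * g))
        (((hl W.1 (M.vectRes W.2 T) f).mul_const g).add
          (((hl W.1 (M.vectRes W.2 T) g).const_mul f).const_smul (sgn (j + i) k)))
        (hj.mono fun A hA => (hAT W A hA).2.2 ⟨W.1, le_refl W.1⟩ k f g hf)
  have hSadd : ∀ (U : Opens X) (T T' : M.Vect U), S U (T + T') = S U T + S U T' := fun U T T' =>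
    funext fun W => LinearMap.ext fun f => hadd' W.1 (M.vectRes W.2 T) (M.vectRes W.2 T') f
  have hSmem : ∀ (U : Opens X) (T : M.Vect U), S U T ∈ M.Vect U := by
    intro U T
    obtain ⟨T₀, T₁, h0, h1, rfl⟩ := exists_vectPart_add T
    rw [hSadd]
    exact add_mem (Submodule.mem_iSup_of_mem _ (hS U T₀ 0 h0))
      (Submodule.mem_iSup_of_mem _ (hS U T₁ 1 h1))
  let B : M.PreEnd := fun U =>
    { toFun := fun T => ⟨S U T, hSmem U T⟩
      map_add' := fun T T' => Subtype.ext (hSadd U T T')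
      map_smul' := fun r T => Subtype.ext (funext fun W => LinearMap.ext fun f =>
        hsmul' W.1 r (M.vectRes W.2 T) f) }
  have hB : B ∈ M.endPart j := by
    refine ⟨fun U V h T => rfl, fun U i T hT => hS U T i hT, fun U k f T hf => ?_⟩
    refine Subtype.ext (funext fun W => LinearMap.ext fun g => ?_)
    obtain ⟨W, hW : W ≤ U⟩ := W
    change l W (M.vectRes hW (M.mulVect f T)) g = sgn j k • (M.res hW f * l W (M.vectRes hW T) g)
    rw [vectRes_mulVect]
    refine tendsto_nhds_unique_of_eventuallyEq (hl W _ g)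
      (((hl W (M.vectRes hW T) g).const_mul (M.res hW f)).const_smul (sgn j k))
      (hj.mono fun A hA => ?_)
    change act A (M.mulVect (M.res hW f) (M.vectRes hW T)) g =
      sgn j k • (M.res hW f * act A (M.vectRes hW T) g)
    rw [act, val_mulVect hA, Chart.applyVect_mulVect, tw_of_mem j (M.res_part hW k f hf),
      smul_mul_assoc]
    rfl
  refine ⟨EndT.ofPart hB, ?_⟩
  suffices h : Tendsto id G (𝓝 (EndT.ofPart hB)) from h
  rw [isInducing_kappa.tendsto_nhds_iff, tendsto_pi_nhds]
  exact fun q => hl _ _ _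

/-- The parity projections are continuous, so both homogeneous parts of a Cauchy filter are Cauchy.
-/
theorem addComplete_EndT [T2Space X] : AddComplete M.EndT := by
  intro F hF
  have hj : ∀ j, ∃ B, Tendsto (parityProj (EndT.part M) j) F (𝓝 B) := fun j =>
    exists_limit_of_homogeneous (hF.map (parityProj (EndT.part M) j).toAddMonoidHom
      (continuous_parityProj_EndT j)) (Filter.eventually_map.2
        (.of_forall fun A => parityProj_mem (EndT.part M) j A))
  obtain ⟨B₀, h0⟩ := hj 0
  obtain ⟨B₁, h1⟩ := hj 1
  refine ⟨B₀ + B₁, ?_⟩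
  exact (h0.add h1).congr fun A => parityProj_add_EndT A

theorem frechet_EndT [T2Space X] : IsFrechetSpace M.EndT :=
  .of_addComplete inferInstance inferInstance inferInstance inferInstance addComplete_EndT

end Supermanifold

/-! ### Gluing of vector fields -/

namespace Supermanifold

variable {m n : ℕ} {X : Type u} [TopologicalSpace X] {M : Supermanifold m n X} {U W : Opens X}

theorem le_iSup_inf {ι : Type*} {V : ι → Opens X} (hW : W ≤ U) (hc : U ≤ ⨆ i, V i) :
    W ≤ ⨆ i, W ⊓ V i :=
  (le_inf le_rfl (hW.trans hc)).trans (inf_iSup_eq _ _).le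

theorem vect_ext_of_cover {ι : Type u} {V : ι → Opens X} (hV : ∀ i, V i ≤ U) (hc : U ≤ ⨆ i, V i)
    {T T' : M.Vect U} (h : ∀ i, M.vectRes (hV i) T = M.vectRes (hV i) T') : T = T' := by
  refine vect_ext fun W hW f => ext_of_cover (fun i => (inf_le_left : W ⊓ V i ≤ W))
    (le_iSup_inf hW hc) fun i => ?_
  rw [← applyVect_vectRes, ← applyVect_vectRes]
  have e : ∀ T : M.Vect U, M.vectRes inf_le_left (M.vectRes hW T) =
    M.vectRes (inf_le_right : W ⊓ V i ≤ V i) (M.vectRes (hV i) T) := fun _ => rfl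
  rw [e, e, h i]

/-- For f on W, the value S f is glued from the values T_i f on W ∩ V_i, and each law of a
superderivation is verified on this cover. -/
theorem exists_glue_vectPart {ι : Type u} {V : ι → Opens X} (hV : ∀ i, V i ≤ U)
    (hc : U ≤ ⨆ i, V i) {k : ZMod 2} {T : ∀ i, M.Vect (V i)}
    (hT : ∀ i, (T i).1 ∈ M.vectPart (V i) k)
    (hTT : ∀ i j, M.vectRes (inf_le_left : V i ⊓ V j ≤ V i) (T i) = M.vectRes inf_le_right (T j)) :
    ∃ S : M.Vect U, S.1 ∈ M.vectPart U k ∧ ∀ i, M.vectRes (hV i) S = T i := by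
  let R : ∀ i (Q : Opens X), Q ≤ V i → Module.End ℝ (M.O Q) := fun i Q h => (T i).1 ⟨Q, h⟩
  have hR : ∀ i j (Q : Opens X) (h : Q ≤ V i) (h' : Q ≤ V j), R i Q h = R j Q h' :=
    fun i j Q h h' => congrFun (congrArg Subtype.val (hTT i j)) ⟨Q, le_inf h h'⟩
  have hres : ∀ i (Q Q' : Opens X) (h : Q ≤ V i) (h' : Q' ≤ Q) (f : M.O Q),
      M.res h' (R i Q h f) = R i Q' (h'.trans h) (M.res h' f) := fun i Q Q' h h' f =>
    (hT i).1 ⟨Q, h⟩ ⟨Q', h'.trans h⟩ h' f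
  have hex : ∀ (W : Opens X) (_ : W ≤ U) (f : M.O W), ∃ t : M.O W, ∀ i,
      M.res (inf_le_left : W ⊓ V i ≤ W) t = R i (W ⊓ V i) inf_le_right (M.res inf_le_left f) :=
    fun W hW f => exists_glue (fun _ => inf_le_left) (le_iSup_inf hW hc)
      (fun i => R i (W ⊓ V i) inf_le_right (M.res inf_le_left f)) fun i j => by
        rw [hres, hres, M.res_res, M.res_res]
        exact LinearMap.congr_fun (hR i j _ _ _) _
  choose t ht using hex
  have hext : ∀ (W : Opens X) (_ : W ≤ U) (f g : M.O W),
      (∀ i, M.res (inf_le_left : W ⊓ V i ≤ W) f = M.res inf_le_left g) → f = g :=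
    fun W hW f g h => ext_of_cover _ (le_iSup_inf hW hc) h
  have tadd : ∀ W (hW : W ≤ U) f g, t W hW (f + g) = t W hW f + t W hW g := fun W hW f g =>
    hext W hW _ _ fun i => by rw [map_add, ht, ht, ht, map_add, map_add]
  have tsmul : ∀ W (hW : W ≤ U) (r : ℝ) f, t W hW (r • f) = r • t W hW f := fun W hW r f =>
    hext W hW _ _ fun i => by rw [map_smul, ht, ht, map_smul, map_smul]
  have tres : ∀ W (hW : W ≤ U) W' (h : W' ≤ W) f,
      M.res h (t W hW f) = t W' (h.trans hW) (M.res h f) := fun W hW W' h f =>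
    hext W' (h.trans hW) _ _ fun i => by
      rw [ht, M.res_res, M.res_res]
      have e := M.res_res (inf_le_left : W ⊓ V i ≤ W) (inf_le_inf_right (V i) h) (t W hW f)
      rw [ht, hres, M.res_res] at e
      exact e.symm
  have tpart : ∀ W (hW : W ≤ U) j, ∀ f ∈ M.part W j, t W hW f ∈ M.part W (k + j) := by
    intro W hW j f hf
    have e : parityProj (M.part W) (k + j) (t W hW f) = t W hW f := by
      refine hext W hW _ _ fun i => ?_
      rw [res_parityProj, ht]
      exact parityProj_of_mem _ ((hT i).2.1 ⟨W ⊓ V i, _⟩ j _ (M.res_part _ j f hf))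
    rw [← e]
    exact parityProj_mem _ _ _
  have tmul : ∀ W (hW : W ≤ U) j, ∀ f ∈ M.part W j, ∀ g,
      t W hW (f * g) = t W hW f * g + sgn k j • (f * t W hW g) := fun W hW j f hf g =>
    hext W hW _ _ fun i => by
      rw [map_add, map_smul, map_mul, map_mul, ht, ht, ht, map_mul]
      exact (hT i).2.2 ⟨W ⊓ V i, _⟩ j _ _ (M.res_part _ j f hf)
  let S : M.PreVect U := fun W =>
    { toFun := t W.1 W.2
      map_add' := tadd W.1 W.2
      map_smul' := tsmul W.1 W.2 }
  have hS : S ∈ M.vectPart U k :=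
    ⟨fun W W' h f => tres W.1 W.2 W'.1 h f, fun W j f hf => tpart W.1 W.2 j f hf,
      fun W j f g hf => tmul W.1 W.2 j f hf g⟩
  refine ⟨⟨S, Submodule.mem_iSup_of_mem k hS⟩, hS, fun i => ?_⟩
  refine vect_ext fun W hW f => ?_
  change t W (hW.trans (hV i)) f = R i W hW f
  refine hext W (hW.trans (hV i)) _ _ fun j => ?_
  rw [ht, hres]
  exact LinearMap.congr_fun (hR j i _ _ _) _

/-! ### Invertible sections -/

theorem tw_zero (f : M.O U) : M.tw 0 f = f := by
  induction f using part_induction with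
  | hadd f g hf hg => rw [map_add, hf, hg]
  | hp j f hf => rw [tw_of_mem 0 hf, sgn_zero_left, one_smul]

/-- An even A preserves parities, so the component of S of the wrong parity is sent to 0 and
vanishes by injectivity. -/
theorem mem_vectPart_of_val {A : M.EndT} (hA : A ∈ EndT.part M 0)
    (hinj : Function.Injective (EndT.val M A U)) {k : ZMod 2} {S : M.Vect U}
    (hS : (EndT.val M A U S).1 ∈ M.vectPart U k) : S.1 ∈ M.vectPart U k := by
  obtain ⟨S₀, S₁, h0, h1, rfl⟩ := exists_vectPart_add S
  have a0 : (EndT.val M A U S₀).1 ∈ M.vectPart U 0 := by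
    have := hA.2.1 U 0 S₀ h0
    rwa [add_zero] at this
  have a1 : (EndT.val M A U S₁).1 ∈ M.vectPart U 1 := by
    have := hA.2.1 U 1 S₁ h1
    rwa [zero_add] at this
  rw [map_add] at hS
  rcases zmod_two_cases k with rfl | rfl
  · have h2 : (EndT.val M A U S₁).1 ∈ M.vectPart U 0 := by
      have := Submodule.sub_mem _ hS a0
      rwa [Submodule.coe_add, add_sub_cancel_left] at this
    have h3 : EndT.val M A U S₁ = 0 :=
      Subtype.ext (Submodule.disjoint_def.1 (M.vectPart_disjoint U) _ h2 a1)
    rw [hinj (h3.trans (map_zero _).symm), add_zero]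
    exact h0
  · have h2 : (EndT.val M A U S₀).1 ∈ M.vectPart U 1 := by
      have := Submodule.sub_mem _ hS a1
      rwa [Submodule.coe_add, add_sub_cancel_right] at this
    have h3 : EndT.val M A U S₀ = 0 :=
      Subtype.ext (Submodule.disjoint_def.1 (M.vectPart_disjoint U) _ a0 h2)
    rw [hinj (h3.trans (map_zero _).symm), zero_add]
    exact h1

/-- The inverse maps on sections are compatible with restriction, parity and multiplication, as one
sees by applying the injective maps of A. -/
theorem exists_inverse {A : M.EndT} (hA : A ∈ EndT.part M 0)
    (hbij : ∀ U, Function.Bijective (EndT.val M A U)) :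
    ∃ C ∈ EndT.part M 0, A * C = 1 ∧ C * A = 1 := by
  let e := fun U => LinearEquiv.ofBijective (EndT.val M A U) (hbij U)
  let C : M.PreEnd := fun U => (e U).symm.toLinearMap
  have hAC : ∀ U T, EndT.val M A U (C U T) = T := fun U T => (e U).apply_symm_apply T
  have hCA : ∀ U T, C U (EndT.val M A U T) = T := fun U T => (e U).symm_apply_apply T
  have hC : C ∈ M.endPart 0 := by
    refine ⟨fun U V h T => (hbij V).1 ?_, fun U i T hT => ?_, fun U k f T hf => (hbij U).1 ?_⟩
    · rw [← vectRes_val, hAC, hAC]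
    · rw [zero_add]
      refine mem_vectPart_of_val hA (hbij U).1 ?_
      rwa [hAC]
    · rw [hAC, map_smul, val_mulVect hA, hAC, tw_zero, sgn_zero_left, one_smul]
  refine ⟨EndT.ofPart hC, hC, EndT.ext M ?_, EndT.ext M ?_⟩
  · exact funext fun U => LinearMap.ext fun T => hAC U T
  · exact funext fun U => LinearMap.ext fun T => hCA U T

/-- Local preimages agree on overlaps by injectivity and therefore glue. The two parities are
treated separately because gluing is available for homogeneous fields. -/
theorem bijective_of_local {A : M.EndT} (hA : A ∈ EndT.part M 0) {ι : Type u} {V : ι → Opens X}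
    (hc : ⊤ ≤ ⨆ i, V i) (h : ∀ i, ∀ W ≤ V i, Function.Bijective (EndT.val M A W)) (U : Opens X) :
    Function.Bijective (EndT.val M A U) := by
  have hcov : ∀ U : Opens X, U ≤ ⨆ i, U ⊓ V i := fun U => le_iSup_inf le_top hc
  have hle : ∀ (U : Opens X) i, U ⊓ V i ≤ U := fun U i => inf_le_left
  have hinj : ∀ U, Function.Injective (EndT.val M A U) := by
    intro U T T' e
    refine vect_ext_of_cover (hle U) (hcov U) fun i => (h i _ inf_le_right).1 ?_
    rw [← vectRes_val, ← vectRes_val, e]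
  refine ⟨hinj U, ?_⟩
  have key : ∀ (k : ZMod 2) (T : M.Vect U), T.1 ∈ M.vectPart U k → ∃ S, EndT.val M A U S = T := by
    intro k T hT
    have hex : ∀ i, ∃ S, EndT.val M A (U ⊓ V i) S = M.vectRes (hle U i) T := fun i =>
      (h i _ inf_le_right).2 _
    choose S hS using hex
    obtain ⟨S', -, hS'⟩ := exists_glue_vectPart (k := k) (hle U) (hcov U) (T := S)
      (fun i => mem_vectPart_of_val hA (hinj _) (by
        rw [hS]
        exact M.preVectRes_part (hle U i) k T.1 hT))
      (fun i j => hinj _ (by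
        rw [← vectRes_val, ← vectRes_val, hS, hS]
        rfl))
    refine ⟨S', vect_ext_of_cover (hle U) (hcov U) fun i => ?_⟩
    rw [vectRes_val, hS', hS]
  intro T
  obtain ⟨T₀, T₁, h0, h1, rfl⟩ := exists_vectPart_add T
  obtain ⟨S₀, rfl⟩ := key 0 T₀ h0
  obtain ⟨S₁, rfl⟩ := key 1 T₁ h1
  exact ⟨S₀ + S₁, map_add _ _ _⟩

/-- An even section is invertible over a chart domain if its matrix is. -/
theorem bijective_of_isUnit_matrix {A : M.EndT} (hA : A ∈ EndT.part M 0) {c : M.Chart}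
    (h : W ≤ c.dom)
    (hN : IsUnit (Matrix.of fun a b => c.E W (act A (Chart.D h a) (Chart.z h b)))) :
    Function.Bijective (EndT.val M A W) := by
  obtain ⟨N, hN⟩ := hN
  -- An even A lets coefficients pass without a twist, so on coordinate rows it is right
  -- multiplication by its matrix.
  let co : M.Vect W → (Fin m ⊕ Fin n → LinFn n (c.img W)) := fun T a =>
    c.E W (M.applyVect T (Chart.z h a))
  have hco : ∀ T, co (EndT.val M A W T) = Matrix.vecMul (co T) N.val := by
    intro T
    rw [hN]
    funext b
    change c.E W (act A T (Chart.z h b)) = ∑ a, co T a * _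
    rw [act_eq_sum hA h, map_sum]
    refine Finset.sum_congr rfl fun a _ => ?_
    rw [map_mul, tw_zero]
    rfl
  have hinj : Function.Injective co := by
    intro T T' e
    rw [Chart.eq_sum_D h T, Chart.eq_sum_D h T']
    refine Finset.sum_congr rfl fun a _ => ?_
    rw [Chart.E_injective h (congrFun e a)]
  constructor
  · intro T T' e
    refine hinj ?_
    have h1 := congrArg (fun S => Matrix.vecMul (co S) N⁻¹.val) e
    simpa only [hco, Matrix.vecMul_vecMul, Units.mul_inv, Matrix.vecMul_one] using h1
  · intro T
    let v := Matrix.vecMul (co T) N⁻¹.val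
    refine ⟨∑ a, M.mulVect (Chart.ofE h (v a)) (Chart.D h a), hinj ?_⟩
    have hv : co (∑ a, M.mulVect (Chart.ofE h (v a)) (Chart.D h a)) = v := by
      funext b
      change c.E W (M.applyVect _ _) = _
      rw [Chart.applyVect_sum]
      simp only [Chart.applyVect_mulVect, Chart.applyVect_D_z, mul_ite, mul_one, mul_zero,
        Finset.sum_ite_eq', Finset.mem_univ, if_true]
      exact Chart.E_ofE h _
    rw [hco, hv, Matrix.vecMul_vecMul, Units.inv_mul, Matrix.vecMul_one]

variable [CompactSpace X]

variable (M) in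
/-- The determinant of the body of the matrix of a section of the endomorphism bundle. -/
def bodyDet (i : M.atlas) (A : M.EndT) : C((M.ch i).img (M.ch i).dom, ℝ) :=
  (Matrix.of fun a b => LinFn.bodyC n _ ((M.ch i).E _ (M.kappa A (i, a, b)))).det

theorem bodyDet_one (i : M.atlas) : M.bodyDet i 1 = 1 := by
  rw [bodyDet, ← Matrix.det_one (n := Fin m ⊕ Fin n)]
  congr 1
  ext1 a b
  change LinFn.bodyC n _ ((M.ch i).E _ (M.applyVect (Chart.D le_rfl a) (Chart.z le_rfl b))) = _
  rw [Chart.applyVect_D_z, Matrix.one_apply]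
  split_ifs <;> simp

theorem bodyDet_apply (i : M.atlas) (A : M.EndT) (y : (M.ch i).img (M.ch i).dom) :
    M.bodyDet i A y =
      (Matrix.of fun a b => LinFn.body n _ ((M.ch i).E _ (M.kappa A (i, a, b))) y).det :=
  RingHom.map_det (ContinuousMap.evalAlgHom ℝ ℝ y : C(_, ℝ) →ₐ[ℝ] ℝ).toRingHom _

theorem continuous_bodyDet [T2Space X] (i : M.atlas) : Continuous (M.bodyDet i) := by
  refine Continuous.matrix_det (continuous_matrix fun a b => ?_)
  exact LinFn.continuous_bodyC.comp ((continuous_E i).comp (continuous_kappa _))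

/-- At A = 1 the determinant of the body is 1, and having no zeros on a compact set is an open
condition in the compact-open topology. Finitely many charts suffice, so for A near 1 the matrix of
A is invertible on every core; the cores cover M, and bijectivity is local. -/
theorem eventually_exists_inverse [T2Space X] : ∀ᶠ A in 𝓝 (1 : M.EndT),
    A ∈ EndT.part M 0 → ∃ C ∈ EndT.part M 0, A * C = 1 ∧ C * A = 1 := by
  have hK : ∀ i : M.atlas, ∀ᶠ A in 𝓝 (1 : M.EndT), ∀ y : (M.ch i).img (M.ch i).dom,
      (y : Euc m) ∈ M.coreImg i → M.bodyDet i A y ≠ 0 := by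
    intro i
    obtain ⟨K, hK, hB⟩ := M.exists_compact_core i
    have hopen : IsOpen {g : C((M.ch i).img (M.ch i).dom, ℝ) | MapsTo g K {0}ᶜ} :=
      ContinuousMap.isOpen_setOfPred_mapsTo hK isOpen_compl_singleton
    have hmem : M.bodyDet i 1 ∈ {g : C((M.ch i).img (M.ch i).dom, ℝ) | MapsTo g K {0}ᶜ} := by
      intro y _
      rw [bodyDet_one]
      exact one_ne_zero
    filter_upwards [(continuous_bodyDet i).continuousAt.preimage_mem_nhds (hopen.mem_nhds hmem)]
      with A hAm y hy
    obtain ⟨y', hy', e⟩ := hB y hy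
    obtain rfl : y' = y := Subtype.ext e
    exact hAm hy'
  filter_upwards [Filter.eventually_all.2 hK] with A hAK hA
  refine exists_inverse hA (bijective_of_local hA (V := fun i : M.atlas => M.core i) ?_ ?_)
  · exact (M.le_iSup_core ⊤).trans (iSup_mono fun i => inf_le_right)
  · intro i W hW
    have hWd : W ≤ (M.ch i).dom := hW.trans (M.core_le i)
    refine bijective_of_isUnit_matrix hA hWd (LinFn.isUnit_matrix fun x => ?_)
    have hx : (x : Euc m) ∈ M.coreImg i := by
      have h1 := (hW x.2.2).2
      change (M.ch i).φ ((M.ch i).φ.symm x) ∈ M.coreImg i at h1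
      rwa [(M.ch i).φ.right_inv x.2.1] at h1
    have h2 := hAK i ⟨x, Chart.img_mono hWd x.2⟩ hx
    rw [bodyDet_apply] at h2
    refine fun h0 => h2 (Eq.trans (congrArg Matrix.det (Matrix.ext fun a b => ?_)) h0)
    have e : act A (Chart.D hWd a) (Chart.z hWd b) = M.res hWd (M.kappa A (i, a, b)) := by
      refine Eq.trans ?_ (res_act hWd A _ _).symm
      rw [Chart.vectRes_D, Chart.res_z]
    change _ = LinFn.body n _ ((M.ch i).E W (act A (Chart.D hWd a) (Chart.z hWd b))) x
    rw [e, Chart.E_res, LinFn.body_res]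
    rfl

/-- The sections of the endomorphism bundle form a Fréchet superalgebra whose even units are open. -/
theorem isSuperUnitOpen [T2Space X] (M : Supermanifold m n X) : IsSuperUnitOpen (EndT.part M) where
  frechet := frechet_EndT
  mul := inferInstance
  proj i := continuous_parityProj_EndT i
  units := eventually_exists_inverse

end Supermanifold

end SuperACS
end

/-! ### The theorem -/

theorem mainTheorem2 {X : Type u} [TopologicalSpace X] [T2Space X] [CompactSpace X] {m n : ℕ}
    (M : Supermanifold m n X) :
    (∃ ι : M.acs ⟶ M.sectionsFunctor, ∀ Λ : Gr,
      (∀ J : M.ACS Λ, ι.app Λ J = J.1) ∧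
      IsEmbedding (ι.app Λ) ∧
      range (ι.app Λ) = {S : M.Sections Λ | S * S = -1}) ∧
    (∀ Λ : Gr,
      IsFrechetSpace (M.Sections Λ) ∧
      IsSplitSubmanifold {S : M.Sections Λ | S * S = -1} ∧
      ∀ J₀ : M.ACS Λ,
        (antiSubmodule J₀).ClosedComplemented ∧
        IsSliceChart {S : M.Sections Λ | S * S = -1} (antiSubmodule J₀)
          {H | IsUnit (1 + (H : M.Sections Λ))} (fun H => afVal J₀ H)) ∧
    (∀ Λ : Gr,
      IsHolomorphicAtlas (fun J₀ : M.ACS Λ => afParam J₀) ∧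
      ∀ J₀ : M.ACS Λ,
        (∃ h : (0 : Anti J₀) ∈ afDom J₀, afChart J₀ ⟨0, h⟩ = J₀) ∧
        ∀ H : afDom J₀, ∃ D : Anti J₀ ≃L[ℂ] Anti (afChart J₀ H), ∀ K : Anti J₀,
          HasDirDeriv ℝ (fun K' : Anti J₀ => afVal J₀ K'.val) H.1 K (D K).val) ∧
    (∀ J₀ : M.ACS Gr.real,
      (M.tangent J₀).IsSuperrepresentable ∧ (M.tangent J₀).IsFrechet ∧
      (∀ (Λ : Gr) (H : (M.tangent J₀).obj Λ),
        H ∈ (M.superchart J₀).dom Λ ↔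
          (M.tangent J₀).map (Gr.zeroHom Λ Gr.real) H ∈ (M.superchart J₀).dom Gr.real) ∧
      (∀ (Λ : Gr) (J : M.ACS Λ),
        J ∈ range ((M.superchart J₀).toFun Λ) ↔
          M.acs.map (Gr.zeroHom Λ Gr.real) J ∈ range ((M.superchart J₀).toFun Gr.real)) ∧
      ∀ {Λ Λ' : Gr} (φ : Λ ⟶ Λ') (H : (M.superchart J₀).dom Λ),
        ∃ h : (M.tangent J₀).map φ H.1 ∈ (M.superchart J₀).dom Λ',
          (M.superchart J₀).toFun Λ' ⟨(M.tangent J₀).map φ H.1, h⟩ =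
            M.acs.map φ ((M.superchart J₀).toFun Λ H)) ∧
    IsComplexSuperAtlas M.acs (fun J₀ : M.ACS Gr.real => M.superchart J₀) ∧
    IsComplexFrechetSupermanifold M.acs := by
  -- The geometry of M enters only through this property; the rest holds for any superalgebra that
  -- has it.
  have h := M.isSuperUnitOpen
  refine ⟨⟨⟨fun Λ => TopCat.ofHom ⟨fun J : M.ACS Λ => J.1, continuous_subtype_val⟩, fun _ _ _ => rfl⟩,
    fun Λ => ⟨fun _ => rfl, IsEmbedding.subtypeVal, Subtype.range_coe⟩⟩, fun Λ => ?_, fun Λ => ?_,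
    fun J₀ => ?_, h.isComplexSuperAtlas, ⟨_, _, h.isComplexSuperAtlas⟩⟩
  · have hΛ := h.isUnitOpenAlgebra Λ
    exact ⟨hΛ.frechet, hΛ.isSplitSubmanifold,
      fun J₀ => ⟨hΛ.closedComplemented J₀, hΛ.isSliceChart J₀⟩⟩
  · have hΛ := h.isUnitOpenAlgebra Λ
    exact ⟨hΛ.isHolomorphicAtlas, fun J₀ =>
      ⟨⟨IsUnitOpenAlgebra.zero_mem_afDom J₀, IsUnitOpenAlgebra.afChart_zero J₀⟩,
        fun H => hΛ.exists_derivative J₀ H⟩⟩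
  · exact ⟨h.superrepresentable J₀, h.isFrechet J₀, fun _ H => mem_afDom_constLift_iff J₀ H,
      fun _ J => mem_range_constLift_iff J₀ J, fun φ H => natural_afChart J₀ φ H⟩
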